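/- **Notation.** For modulus $0<\kappa<1$ put $\kappa'=\sqrt{1-\kappa^2}$; $\mathrm K[\kappa],\mathrm E[\kappa],\Pi[n,\kappa]$ are the complete elliptic integrals, $\Pi[n,\kappa]=\int_0^{\pi/2}\frac{d\theta}{(1-n\sin^2\theta)\sqrt{1-\kappa^2\sin^2\theta}}$, and $\mathrm{sn},\mathrm{cn},\mathrm{dn},\mathrm{sd}=\mathrm{sn}/\mathrm{dn},\dots$ are the Jacobi functions of modulus $\kappa$ ($\kappa$ is suppressed). For $\sigma=\pm1$ and $a\in\mathbb R$ the McMillan octupole map is $q'=p,\ p'=-q+\frac{a\,p}{1+\sigma p^2}$, with invariant $\mathcal K[p,q]=p^2-apq+q^2+\sigma p^2q^2$. For a closed curve $C\subset\{\mathcal K=\mathrm{const}\}$ traversed by the flow $\dot q=\partial_p\mathcal K,\ \dot p=-\partial_q\mathcal K$ with period $T$, the canonical action is $J=\frac1{2\pi}\oint_C p\,dq$, and the rotation number is $\nu=T'/T$, where $T'\in[0,T)$ is the time after which the flow realizes one step of the map on $C$. The elliptic Lissajous curve of type $\mathrm{ef}\in\{\mathrm{sn},\mathrm{cn},\mathrm{dn}\}$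 is $x=\mathrm{ef}(t),\ y=\mathrm{ef}(t+\eta)$, with area $S_{\mathrm{ef}}(\kappa,\eta)=\oint y\,dx$ over one period ($4\mathrm K$ for sn, cn; $2\mathrm K$ for dn). **Regimes.** We consider the following closed curves at level $\mathcal K$. * (DO) $\sigma=-1$, $|a|<2$, $0<\mathcal K<(|\tfrac a2|-1)^2$, the part of the level set in the component of $\{\mathcal K[p,q]<(|\tfrac a2|-1)^2\}$ containing the origin; $\mathrm{ef}=\mathrm{sn}$, $h=\sqrt{\kappa}$, $B=\frac{1-(a/2)^2+\mathcal K}{\sqrt{\mathcal K}}$, $\kappa=\frac{B-\sqrt{B^2-4}}2$, $\eta_+\in(0,\mathrm K]$ with $\mathrm{ns}\,\eta_+=\sqrt{\kappa}/\mathcal K^{1/4}$. * (FO) $\sigma=1$, $a\in\mathbb R$, $\mathcal K>0$, the whole level set; $\mathrm{ef}=\mathrm{cn}$, $h=\sqrt{\kappa/\kappa'}$, $B=\frac{(a/2)^2-1+\mathcal K}{\sqrt{\mathcal K}}$, $\kappa=\frac1{\sqrt2}\sqrt{1+\frac B{\sqrt{B^2+4}}}$, $\eta_+\in(0,\mathrm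 K]$ with $\mathrm{ds}\,\eta_+=\sqrt{\kappa\kappa'}/\mathcal K^{1/4}$. * (Df) $\sigma=1$, $|a|>2$, $-(|\tfrac a2|-1)^2<\mathcal K<0$, either of the two pieces $q>0$, $q<0$ of the level set; $\mathrm{ef}=\mathrm{dn}$, $h=\sqrt{1/\kappa'}$, $B=\frac{(a/2)^2-1+\mathcal K}{\sqrt{|\mathcal K|}}$, $\kappa=\frac{\sqrt{B+2}-\sqrt{B-2}}{2(B^2-4)^{-1/4}}$, $\eta_+\in(0,\mathrm K)$ with $\mathrm{cs}\,\eta_+=\sqrt{\kappa'}/|\mathcal K|^{1/4}$. In all cases $\kappa\in(0,1)$. In DO and FO let $\eta=\eta_+$ if $a\ge0$ and $\eta=2\mathrm K-\eta_+$ if $a<0$; in Df let $\eta=\eta_+$. The maps $\mathcal K\mapsto\kappa$ are bijections of the stated range onto $(0,1)$ (for FO when $|a|<2$), and $\kappa\to0^+$ when $\mathcal K$ tends to the lower end of its range. **Theorem.** 1. (Areas.) For all $0<\kappa<1$ and all $\eta$ with $\mathrm{sn}\,\eta\neq0$, writing $\Pi=\Pi[\kappa^2\mathrm{sn}^2\eta,\kappa]$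 (with $1/\mathrm{sc}\,\eta=\mathrm{cn}\,\eta/\mathrm{sn}\,\eta$), $$S_{\mathrm{sn}}=\frac4{\kappa^2}\frac{\mathrm{sd}^2\eta\,\mathrm E-\mathrm K+\mathrm{cn}^2\eta\,\Pi}{\mathrm{sn}\,\eta\,\mathrm{sd}^2\eta},\qquad S_{\mathrm{cn}}=\frac4{\kappa^2}\frac{\mathrm K-\mathrm{sn}^2\eta\,\mathrm E-\mathrm{cn}^2\eta\,\Pi}{\mathrm{sd}\,\eta\,\mathrm{sn}^2\eta},$$ $$S_{\mathrm{dn}}=\frac{2}{\mathrm{sc}\,\eta\,\mathrm{sn}^2\eta}\left\{(\mathrm{sn}^2\eta+\mathrm{dn}^2\eta)\mathrm K-\mathrm{sn}^2\eta\,\mathrm E-\mathrm{dn}^2\eta\,\Pi\right\}.$$ 2. (Action.) In each regime the set described is a single closed orbit of the flow; it is the rescaled Lissajous curve $\{(q,p)=|\mathcal K|^{1/4}h\,(\mathrm{ef}(u),\mathrm{ef}(u+\eta)):u\in\mathbb R\}$ (in Df: with $q$ multiplied by the sign $s=\pm1$ of the piece and $p$ by $s\,a/|a|$), and $$J_{\mathrm{sn}}=\frac{\sqrt{|\mathcal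 K|}}{2\pi}\,\kappa\,S_{\mathrm{sn}}(\kappa,\eta),\quad J_{\mathrm{cn}}=\frac{\sqrt{|\mathcal K|}}{2\pi}\,\frac{\kappa}{\kappa'}\,S_{\mathrm{cn}}(\kappa,\eta),\quad J_{\mathrm{dn}}=\frac{\sqrt{|\mathcal K|}}{2\pi}\,\frac1{\kappa'}\,S_{\mathrm{dn}}(\kappa,\eta).$$ Explicitly, with $\Pi=\Pi[\kappa^2\mathrm{sn}^2\eta_+,\kappa]$, $$J_{\mathrm{sn}}=\frac2\pi\frac{\mathrm{sd}^2\eta_+\mathrm E-\mathrm K+\mathrm{cn}^2\eta_+\Pi}{\mathrm{sd}\,\eta_+\,\mathrm{nd}\,\eta_+},\qquad J_{\mathrm{cn}}=\frac2\pi\frac{\mathrm K-\mathrm{sn}^2\eta_+\mathrm E-\mathrm{cn}^2\eta_+\Pi}{\mathrm{sn}\,\eta_+\,\mathrm{dn}\,\eta_+},$$ $$J_{\mathrm{dn}}=\frac1\pi\frac{(\mathrm{sn}^2\eta_++\mathrm{dn}^2\eta_+)\mathrm K-\mathrm{sn}^2\eta_+\mathrm E-\mathrm{dn}^2\eta_+\Pi}{\mathrm{sn}\,\eta_+\,\mathrm{cn}\,\eta_+}.$$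 The rotation number exists and equals $\nu=\eta/(4\mathrm K)$ in DO and FO, and $\nu=\eta_+/(2\mathrm K)$ in Df with $a>2$. 3. (Series at the origin.) Let $|a|<2$ and $\nu_0=\frac1{2\pi}\arccos\frac a2$. As $\mathcal K\to0^+$ (upper signs: sn/DO, lower signs: cn/FO), $$J_{\mathrm{sn}}=\tfrac{(4-a^2)^{3/2}}{2^4}\Big[\kappa^2+\tfrac{2-7a^2}{2^4}\kappa^4+\tfrac{6-68a^2+33a^4}{2^7}\kappa^6+\tfrac{100-2398a^2+2838a^4-715a^6}{2^{12}}\kappa^8\Big]+O(\kappa^{10}),$$ $$J_{\mathrm{cn}}=\tfrac{(4-a^2)^{3/2}}{2^4}\Big[\kappa^2+7\tfrac{2+a^2}{2^4}\kappa^4+\tfrac{102+44a^2+33a^4}{2^7}\kappa^6+\tfrac{3036+1246a^2+330a^4+715a^6}{2^{12}}\kappa^8\Big]+O(\kappa^{10}),$$ $$J_{\mathrm{sn,cn}}=\tfrac1{\sqrt{4-a^2}}\Big[\mathcal K\pm\tfrac{2+a^2}{(4-a^2)^2}\mathcal K^2+2\tfrac{6+12a^2+a^4}{(4-a^2)^4}\mathcal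 K^3\pm5\tfrac{20+90a^2+30a^4+a^6}{(4-a^2)^6}\mathcal K^4\Big]+O(\mathcal K^5),$$ $$\nu_{\mathrm{sn}}=\nu_0-\tfrac{a\sqrt{4-a^2}}{2^4\,2\pi}\Big[3\kappa^2+\tfrac{86-35a^2}{2^5}\kappa^4+7\tfrac{46-48a^2+11a^4}{2^7}\kappa^6+\tfrac{39340-74926a^2+40722a^4-6435a^6}{2^{14}}\kappa^8\Big]+O(\kappa^{10}),$$ $$\nu_{\mathrm{cn}}=\nu_0+\tfrac{a\sqrt{4-a^2}}{2^4\,2\pi}\Big[3\kappa^2+\tfrac{10+35a^2}{2^5}\kappa^4+\tfrac{18-56a^2+77a^4}{2^7}\kappa^6+\tfrac{1364-13(26+858a^2-495a^4)a^2}{2^{14}}\kappa^8\Big]+O(\kappa^{10}),$$ $$\nu_{\mathrm{sn,cn}}=\nu_0+\tfrac{a}{2\pi(4-a^2)^{3/2}}\Big[\mp3\mathcal K-\tfrac12\tfrac{86+13a^2}{(4-a^2)^2}\mathcal K^2\mp2\tfrac{322+200a^2+9a^4}{(4-a^2)^4}\mathcal K^3-\tfrac14\tfrac{39340+55506a^2+10386a^4+221a^6}{(4-a^2)^6}\mathcal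 K^4\Big]+O(\mathcal K^5),$$ $$\nu_{\mathrm{sn,cn}}=\nu_0+\tfrac a{2\pi}\Big[\mp\tfrac3{4-a^2}J-\tfrac{74+7a^2}{2(4-a^2)^{5/2}}J^2\mp5\tfrac{(2+a^2)(46+a^2)}{(4-a^2)^4}J^3\Big]+O(J^4).$$ 4. (Series in the Duffing regime.) Let $a>2$, $\nu_0=\frac1{2\pi}\arccos(\frac4a-1)$ and $\widetilde{\mathcal K}=\mathcal K+(\frac a2-1)^2$. As $\widetilde{\mathcal K}\to0^+$, $$J_{\mathrm{dn}}=\tfrac{(a-2)^{3/2}}{2^4\sqrt2\,a}\Big[\kappa^4+\kappa^6+\big(\tfrac{119}8-\tfrac{4+3a}{a^2}\big)\tfrac{\kappa^8}{2^4}+\big(\tfrac{55}8-\tfrac{4+3a}{a^2}\big)\tfrac{\kappa^{10}}{2^3}\Big]+O(\kappa^{12}),$$ $$J_{\mathrm{dn}}=\tfrac{2^{-3/2}}{\sqrt{a-2}}\Big[\widetilde{\mathcal K}+\tfrac{8-a}{2^4(a-2)^2}\widetilde{\mathcal K}^2+\tfrac{192-32a+3a^2}{2^8(a-2)^4}\widetilde{\mathcal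 K}^3+\tfrac{12800-5(480-72a+5a^2)a}{2^{13}(a-2)^6}\widetilde{\mathcal K}^4\Big]+O(\widetilde{\mathcal K}^5),$$ $$\nu_{\mathrm{dn}}=\nu_0-\tfrac1{2\pi}\tfrac{\sqrt{a-2}}{2^4\sqrt2\,a^2}\Big[(4+a)(\kappa^4+\kappa^6)-\tfrac{384+96a-964a^2-235a^3}{2^8a^2}\kappa^8-\tfrac{384+96a-452a^2-107a^3}{2^7a^2}\kappa^{10}\Big]+O(\kappa^{12}),$$ $$\nu_{\mathrm{dn}}=\nu_0-\tfrac1{2\pi}\tfrac{2^{-3/2}}{a(a-2)^{3/2}}\Big[(4+a)\widetilde{\mathcal K}-\tfrac{128-224a-68a^2+5a^3}{2^5a(a-2)^2}\widetilde{\mathcal K}^2+\tfrac{4096-11264a+12672a^2+4384a^3-476a^4+33a^5}{3\cdot2^8a^2(a-2)^4}\widetilde{\mathcal K}^3\Big]+O(\widetilde{\mathcal K}^4),$$ $$\nu_{\mathrm{dn}}=\nu_0-\tfrac1{2\pi}\Big[\tfrac1a\tfrac{4+a}{a-2}J-\tfrac1{a^2}\tfrac{128-160a-60a^2+3a^3}{2^{7/2}(a-2)^{5/2}}J^2\Big]+O(J^3).$$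 -/

import Mathlib

open Set Filter Topology Asymptotics

noncomputable section

/-! Legendre elliptic integrals with modulus `k`, and Jacobi elliptic functions. -/

/-- Incomplete elliptic integral of the first kind. -/
def ellF (φ k : ℝ) : ℝ := ∫ θ in (0 : ℝ)..φ, 1 / √(1 - k ^ 2 * Real.sin θ ^ 2)

/-- Complete elliptic integral of the first kind. -/
def ellK (k : ℝ) : ℝ := ellF (Real.pi / 2) k

/-- Complete elliptic integral of the second kind. -/
def ellE (k : ℝ) : ℝ := ∫ θ in (0 : ℝ)..(Real.pi / 2), √(1 - k ^ 2 * Real.sin θ ^ 2)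

/-- Complete elliptic integral of the third kind, with characteristic `n`. -/
def ellPi (n k : ℝ) : ℝ :=
  ∫ θ in (0 : ℝ)..(Real.pi / 2),
    1 / ((1 - n * Real.sin θ ^ 2) * √(1 - k ^ 2 * Real.sin θ ^ 2))

/-- Jacobi amplitude: the inverse of `φ ↦ F(φ, k)`, a bijection of `ℝ` when `|k| < 1`. -/
def jacAm (u k : ℝ) : ℝ := Function.invFun (fun φ => ellF φ k) u

def jacSn (u k : ℝ) : ℝ := Real.sin (jacAm u k)
def jacCn (u k : ℝ) : ℝ := Real.cos (jacAm u k)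
def jacDn (u k : ℝ) : ℝ := √(1 - k ^ 2 * jacSn u k ^ 2)

def jacSd (u k : ℝ) : ℝ := jacSn u k / jacDn u k
def jacNd (u k : ℝ) : ℝ := 1 / jacDn u k
def jacSc (u k : ℝ) : ℝ := jacSn u k / jacCn u k
def jacNs (u k : ℝ) : ℝ := 1 / jacSn u k
def jacDs (u k : ℝ) : ℝ := jacDn u k / jacSn u k
def jacCs (u k : ℝ) : ℝ := jacCn u k / jacSn u k

/-- Inverse functions, with values on the quarter period `(0, K(k)]`. -/
def arcNs (x k : ℝ) : ℝ := Function.invFunOn (fun u => jacNs u k) (Ioc 0 (ellK k)) x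
def arcDs (x k : ℝ) : ℝ := Function.invFunOn (fun u => jacDs u k) (Ioc 0 (ellK k)) x
def arcCs (x k : ℝ) : ℝ := Function.invFunOn (fun u => jacCs u k) (Ioc 0 (ellK k)) x

/-! Elliptic Lissajous curves `x = ef t`, `y = ef (t + η)`. -/

/-- The area `∮ y dx` of the curve `x = f t`, `y = f (t + η)` traversed once, `0 ≤ t ≤ T`. -/
def lissajousArea (f : ℝ → ℝ) (T η : ℝ) : ℝ := ∫ t in (0 : ℝ)..T, f (t + η) * deriv f t

def areaSn (k η : ℝ) : ℝ := lissajousArea (fun t => jacSn t k) (4 * ellK k) η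
def areaCn (k η : ℝ) : ℝ := lissajousArea (fun t => jacCn t k) (4 * ellK k) η
def areaDn (k η : ℝ) : ℝ := lissajousArea (fun t => jacDn t k) (2 * ellK k) η

/-! The canonical McMillan octupole. The sign `σ = ±1` is that of the coefficient `Γ`. -/

/-- The biquadratic invariant `p² - a p q + q² + σ p² q²`. -/
def octInv (σ a q p : ℝ) : ℝ := p ^ 2 - a * p * q + q ^ 2 + σ * (p ^ 2 * q ^ 2)

/-- The map `q' = p`, `p' = -q + f(p)` on points `(q, p)`; the force `f(p) = -2 ε p / (p² + Γ)`
is written with `Γ = σ` and `a = -2 ε / Γ`. -/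
def octMap (σ a : ℝ) (z : ℝ × ℝ) : ℝ × ℝ := (z.2, -z.1 + a * z.2 / (1 + σ * z.2 ^ 2))

/-- `t ↦ (q t, p t)` traverses the closed curve `C` exactly once in each period `T`, as a solution
of Hamilton's equations with the invariant taken as the Hamiltonian. -/
structure IsClosedOrbit (σ a : ℝ) (C : Set (ℝ × ℝ)) (q p : ℝ → ℝ) (T : ℝ) : Prop where
  period_pos : 0 < T
  eq_q : ∀ t, HasDerivAt q (deriv (fun y => octInv σ a (q t) y) (p t)) t
  eq_p : ∀ t, HasDerivAt p (-deriv (fun x => octInv σ a x (p t)) (q t)) t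
  periodic_q : Function.Periodic q T
  periodic_p : Function.Periodic p T
  injOn : InjOn (fun t => (q t, p t)) (Ico 0 T)
  range_eq : range (fun t => (q t, p t)) = C

/-- `J = (1 / 2π) ∮ p dq` over the closed curve `C`. -/
def HasAction (σ a : ℝ) (C : Set (ℝ × ℝ)) (J : ℝ) : Prop :=
  (∃ q p T, IsClosedOrbit σ a C q p T) ∧
  ∀ q p T, IsClosedOrbit σ a C q p T →
    1 / (2 * Real.pi) * ∫ t in (0 : ℝ)..T, p t * deriv q t = J

/-- `ν = T' / T`, where `T` is the period of the Hamiltonian flow on the closed curve `C` and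
`T' ∈ [0, T)` is the time after which the flow realizes one step of the map on `C`. -/
def HasRotationNumber (σ a : ℝ) (C : Set (ℝ × ℝ)) (ν : ℝ) : Prop :=
  (∃ q p T, IsClosedOrbit σ a C q p T) ∧
  ∀ q p T, IsClosedOrbit σ a C q p T →
    ∃ T' ∈ Ico 0 T,
      (∀ t, octMap σ a (q t, p t) = (q (t + T'), p (t + T'))) ∧ ν = T' / T

/-! Closed invariant curves on the level `c` of the invariant in the three regimes. -/

/-- Defocusing octupole: the curve around the origin, inside the separatrix. -/
def curveDO (a c : ℝ) : Set (ℝ × ℝ) :=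
  {z | z ∈ connectedComponentIn {w : ℝ × ℝ | octInv (-1) a w.1 w.2 < (|a / 2| - 1) ^ 2} (0, 0) ∧
    octInv (-1) a z.1 z.2 = c}

/-- Focusing octupole: the curve around the origin. -/
def curveFO (a c : ℝ) : Set (ℝ × ℝ) := {z | octInv 1 a z.1 z.2 = c}

/-- Duffing regime: one of the two closed curves inside the figure-eight separatrix;
the lobe `q > 0` for `s = 1` and the lobe `q < 0` for `s = -1`. -/
def curveDf (a s c : ℝ) : Set (ℝ × ℝ) := {z | octInv 1 a z.1 z.2 = c ∧ 0 < s * z.1}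

/-! Elliptic modulus and phase advance as functions of `a` and the value `c` of the invariant. -/

/-- Complementary modulus. -/
def compModulus (k : ℝ) : ℝ := √(1 - k ^ 2)

def bDO (a c : ℝ) : ℝ := -((a / 2) ^ 2 - 1 - c) / √c
def bFO (a c : ℝ) : ℝ := ((a / 2) ^ 2 - 1 + c) / √c
def bDf (a c : ℝ) : ℝ := ((a / 2) ^ 2 - 1 + c) / √|c|

def modDO (a c : ℝ) : ℝ := (bDO a c - √(bDO a c ^ 2 - 4)) / 2
def modFO (a c : ℝ) : ℝ := 1 / √2 * √(1 + bFO a c / √(bFO a c ^ 2 + 4))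
def modDf (a c : ℝ) : ℝ :=
  (√(bDf a c + 2) - √(bDf a c - 2)) / 2 * (bDf a c ^ 2 - 4) ^ ((1 : ℝ) / 4)

/-- The phase advance `η₊`. -/
def etaDO (a c : ℝ) : ℝ := arcNs (√(modDO a c) / c ^ ((1 : ℝ) / 4)) (modDO a c)
def etaFO (a c : ℝ) : ℝ :=
  arcDs (√(modFO a c * compModulus (modFO a c)) / c ^ ((1 : ℝ) / 4)) (modFO a c)
def etaDf (a c : ℝ) : ℝ := arcCs (√(compModulus (modDf a c)) / |c| ^ ((1 : ℝ) / 4)) (modDf a c)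

/-- The phase advance `η`: it is `η₊` for `a ≥ 0` and `η₋ = 2 K(k) - η₊` for `a < 0`. -/
def phase (a k ηp : ℝ) : ℝ := if 0 ≤ a then ηp else 2 * ellK k - ηp

/-! Truncated power series. In the first group `s = 1` is the `sn` case (DO) and `s = -1` the
`cn` case (FO). -/

/-- Rotation number of the linearization at the origin. -/
def nuZero (a : ℝ) : ℝ := 1 / (2 * Real.pi) * Real.arccos (a / 2)

/-- Rotation number of the linearization at the symmetric fixed points, `a > 2`. -/
def nuZeroDf (a : ℝ) : ℝ := 1 / (2 * Real.pi) * Real.arccos (4 / a - 1)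

def serJSnMod (a k : ℝ) : ℝ :=
  (4 - a ^ 2) ^ ((3 : ℝ) / 2) / 2 ^ 4 *
    (k ^ 2 + (2 - 7 * a ^ 2) / 2 ^ 4 * k ^ 4
      + (6 - 68 * a ^ 2 + 33 * a ^ 4) / 2 ^ 7 * k ^ 6
      + (100 - 2398 * a ^ 2 + 2838 * a ^ 4 - 715 * a ^ 6) / 2 ^ 12 * k ^ 8)

def serJCnMod (a k : ℝ) : ℝ :=
  (4 - a ^ 2) ^ ((3 : ℝ) / 2) / 2 ^ 4 *
    (k ^ 2 + 7 * ((2 + a ^ 2) / 2 ^ 4) * k ^ 4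
      + (102 + 44 * a ^ 2 + 33 * a ^ 4) / 2 ^ 7 * k ^ 6
      + (3036 + 1246 * a ^ 2 + 330 * a ^ 4 + 715 * a ^ 6) / 2 ^ 12 * k ^ 8)

def serJInv (s a c : ℝ) : ℝ :=
  1 / √(4 - a ^ 2) *
    (c + s * ((2 + a ^ 2) / (4 - a ^ 2) ^ 2) * c ^ 2
      + 2 * ((6 + 12 * a ^ 2 + a ^ 4) / (4 - a ^ 2) ^ 4) * c ^ 3
      + s * 5 * ((20 + 90 * a ^ 2 + 30 * a ^ 4 + a ^ 6) / (4 - a ^ 2) ^ 6) * c ^ 4)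

def serNuSnMod (a k : ℝ) : ℝ :=
  nuZero a - a * √(4 - a ^ 2) / (2 ^ 4 * (2 * Real.pi)) *
    (3 * k ^ 2 + (86 - 35 * a ^ 2) / 2 ^ 5 * k ^ 4
      + 7 * ((46 - 48 * a ^ 2 + 11 * a ^ 4) / 2 ^ 7) * k ^ 6
      + (39340 - 74926 * a ^ 2 + 40722 * a ^ 4 - 6435 * a ^ 6) / 2 ^ 14 * k ^ 8)

def serNuCnMod (a k : ℝ) : ℝ :=
  nuZero a + a * √(4 - a ^ 2) / (2 ^ 4 * (2 * Real.pi)) *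
    (3 * k ^ 2 + (10 + 35 * a ^ 2) / 2 ^ 5 * k ^ 4
      + (18 - 56 * a ^ 2 + 77 * a ^ 4) / 2 ^ 7 * k ^ 6
      + (1364 - 13 * (26 + 858 * a ^ 2 - 495 * a ^ 4) * a ^ 2) / 2 ^ 14 * k ^ 8)

def serNuInv (s a c : ℝ) : ℝ :=
  nuZero a + a / (2 * Real.pi * (4 - a ^ 2) ^ ((3 : ℝ) / 2)) *
    (-(s * 3 * c) - 1 / 2 * ((86 + 13 * a ^ 2) / (4 - a ^ 2) ^ 2) * c ^ 2
      - s * 2 * ((322 + 200 * a ^ 2 + 9 * a ^ 4) / (4 - a ^ 2) ^ 4) * c ^ 3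
      - 1 / 4 * ((39340 + 55506 * a ^ 2 + 10386 * a ^ 4 + 221 * a ^ 6) / (4 - a ^ 2) ^ 6) * c ^ 4)

def serNuAct (s a J : ℝ) : ℝ :=
  nuZero a + a / (2 * Real.pi) *
    (-(s * (3 / (4 - a ^ 2)) * J)
      - (74 + 7 * a ^ 2) / (2 * (4 - a ^ 2) ^ ((5 : ℝ) / 2)) * J ^ 2
      - s * 5 * ((2 + a ^ 2) * (46 + a ^ 2) / (4 - a ^ 2) ^ 4) * J ^ 3)

def serJDnMod (a k : ℝ) : ℝ :=
  (a - 2) ^ ((3 : ℝ) / 2) / (2 ^ 4 * √2 * a) *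
    (k ^ 4 + k ^ 6 + (119 / 8 - (4 + 3 * a) / a ^ 2) * (k ^ 8 / 2 ^ 4)
      + (55 / 8 - (4 + 3 * a) / a ^ 2) * (k ^ 10 / 2 ^ 3))

/-- Series in the shifted invariant `x = c + (a / 2 - 1)²`. -/
def serJDnInv (a x : ℝ) : ℝ :=
  (2 : ℝ) ^ (-(3 : ℝ) / 2) / √(a - 2) *
    (x + (8 - a) / (2 ^ 4 * (a - 2) ^ 2) * x ^ 2
      + (192 - 32 * a + 3 * a ^ 2) / (2 ^ 8 * (a - 2) ^ 4) * x ^ 3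
      + (12800 - 5 * (480 - 72 * a + 5 * a ^ 2) * a) / (2 ^ 13 * (a - 2) ^ 6) * x ^ 4)

def serNuDnMod (a k : ℝ) : ℝ :=
  nuZeroDf a - 1 / (2 * Real.pi) * (√(a - 2) / (2 ^ 4 * √2 * a ^ 2)) *
    ((4 + a) * (k ^ 4 + k ^ 6)
      - (384 + 96 * a - 964 * a ^ 2 - 235 * a ^ 3) / (2 ^ 8 * a ^ 2) * k ^ 8
      - (384 + 96 * a - 452 * a ^ 2 - 107 * a ^ 3) / (2 ^ 7 * a ^ 2) * k ^ 10)

def serNuDnInv (a x : ℝ) : ℝ :=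
  nuZeroDf a - 1 / (2 * Real.pi) * ((2 : ℝ) ^ (-(3 : ℝ) / 2) / (a * (a - 2) ^ ((3 : ℝ) / 2))) *
    ((4 + a) * x
      - (128 - 224 * a - 68 * a ^ 2 + 5 * a ^ 3) / (2 ^ 5 * a * (a - 2) ^ 2) * x ^ 2
      + (4096 - 11264 * a + 12672 * a ^ 2 + 4384 * a ^ 3 - 476 * a ^ 4 + 33 * a ^ 5)
          / (3 * 2 ^ 8 * a ^ 2 * (a - 2) ^ 4) * x ^ 3)

def serNuDnAct (a J : ℝ) : ℝ :=
  nuZeroDf a - 1 / (2 * Real.pi) *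
    (1 / a * ((4 + a) / (a - 2)) * J
      - 1 / a ^ 2 * ((128 - 160 * a - 60 * a ^ 2 + 3 * a ^ 3)
          / ((2 : ℝ) ^ ((7 : ℝ) / 2) * (a - 2) ^ ((5 : ℝ) / 2))) * J ^ 2)

end

/-!
The theorem rests on one fact, the addition theorem for `sn`, `cn`, `dn`, and on the resulting
expression of `ef (u + η) ± ef (u - η)` through `ef u` and its derivative.

**Areas.** The addition theorems (`jacSn_add`, `jacCn_add`, `jacDn_add`) split `y x'` on a Lissajous
curve into a function of `sn² t` and an odd function of `t`. The odd part has zero integral over a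
period, and `θ = am t` turns the rest into an integral of a rational function of `sin² θ` over
`√(1 - k² sin² θ)` (`areaSn_eq_integral` and its analogues). Partial fractions
(`integral_eq_of_partial_fractions`) reduce it to `K`, `E` and `Π`.

**Orbits.** The structure `OctupolePhase` collects what is used of `ef` and of the phase `η`. It gives
Hamilton's equations for the rescaled curve, hence conservation of the invariant, and shows that one
step of the map is the shift `u ↦ u + η`. As the Hamiltonian field is locally Lipschitz, all closed
orbits with the same trace differ by a shift of time (`IsClosedOrbit.exists_shift`), so a single
parametrization determines action and rotation number. That the curve is the whole level set follows
by solving a quadratic equation for `p`, whose two roots are the values of `ef` at `u + η` and `u - η`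
(`OctupolePhase.mem_range`); for the defocusing octupole the component of the origin is bounded by
the lines through the saddles. The modulus and the phase are matched to the level through one
algebraic identity in each regime (`modDO_spec`, `modFO_spec`, `modDf_spec`), which also gives the
bijections onto `(0, 1)`.

**Series at the origin.** With `m = k²` for the defocusing and `m = -k² / (1 - k²)` for the focusing
octupole, both regimes are the two sides of one family: action and invariant change sign with `m`,
the rotation number does not (`ellFm_arccos_neg`), and the square `w` of the sine of the amplitude
satisfies `(1 - w) (1 - m w) = (a / 2)²`. So `w` (`octSinSq`) is algebraic in `m`, and so is the
derivative of the amplitude. Expanding under the integral sign uniformly in the characteristic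
(`exists_integral_expansion`) and in the amplitude (`exists_ellFm_expansion`) expresses action and
rotation number through expansions of algebraic functions. These are computed in the calculus of
`TaylorExp`, in which the coefficients of inverses and square roots are verified rather than derived.
The series in the invariant and in the action are checked by substituting the expansions in `m`.

**Series in the Duffing regime.** Landen's transformation (`ellFm_landen`) replaces the modulus `k` by
`t = (1 - k') / (1 + k')`. The square of the sine of the transformed amplitude satisfies, up to a
factor, the quadratic equation of the first family with `m = t²` and `2 / a` in place of `a / 2`
(`phaseDf_landen`), and all quantities are even in `t` (for the action by `isBigO_dfIntegral`, where
the odd powers of `cos` integrate to zero). An expansion in `t²` through two nontrivial orders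
therefore determines the terms of order `k⁴` to `k¹⁰` (`isBigO_landen_series`).
-/

noncomputable section

/-! ### The incomplete integral of the first kind and the amplitude -/

/-- The incomplete elliptic integral of the first kind as a function of the parameter `m = k ^ 2`,
which is also allowed to be negative. -/
def ellFm (φ m : ℝ) : ℝ := ∫ θ in (0 : ℝ)..φ, 1 / √(1 - m * Real.sin θ ^ 2)

theorem ellF_eq_ellFm (φ k : ℝ) : ellF φ k = ellFm φ (k ^ 2) := rfl

theorem one_sub_mul_sq_pos {m s : ℝ} (hm : m < 1) (hs : s ^ 2 ≤ 1) : 0 < 1 - m * s ^ 2 := by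
  rcases le_or_gt m 0 with h | h
  · nlinarith [sq_nonneg s]
  · nlinarith [sq_nonneg s]

theorem one_sub_mul_sin_sq_pos {m : ℝ} (hm : m < 1) (θ : ℝ) : 0 < 1 - m * Real.sin θ ^ 2 :=
  one_sub_mul_sq_pos hm (Real.sin_sq_le_one θ)

theorem continuous_ellFm_integrand {m : ℝ} (hm : m < 1) :
    Continuous fun θ : ℝ => 1 / √(1 - m * Real.sin θ ^ 2) := by
  refine continuous_const.div (by fun_prop) fun θ => ?_
  exact (Real.sqrt_pos.2 (one_sub_mul_sin_sq_pos hm θ)).ne'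

theorem hasDerivAt_ellFm {m : ℝ} (hm : m < 1) (φ : ℝ) :
    HasDerivAt (fun φ => ellFm φ m) (1 / √(1 - m * Real.sin φ ^ 2)) φ :=
  intervalIntegral.integral_hasDerivAt_right
    ((continuous_ellFm_integrand hm).intervalIntegrable _ _)
    (continuous_ellFm_integrand hm).aestronglyMeasurable.stronglyMeasurableAtFilter
    (continuous_ellFm_integrand hm).continuousAt

theorem strictMono_ellFm {m : ℝ} (hm : m < 1) : StrictMono fun φ => ellFm φ m := by
  refine strictMono_of_hasDerivAt_pos (fun φ => hasDerivAt_ellFm hm φ) fun φ => ?_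
  have := Real.sqrt_pos.2 (one_sub_mul_sin_sq_pos hm φ)
  positivity

@[simp] theorem ellFm_zero (m : ℝ) : ellFm 0 m = 0 := by simp [ellFm]

theorem ellFm_neg (φ m : ℝ) : ellFm (-φ) m = -ellFm φ m := by
  have h := intervalIntegral.integral_comp_neg (a := 0) (b := φ)
    (fun θ : ℝ => 1 / √(1 - m * Real.sin θ ^ 2))
  simp only [Real.sin_neg, neg_sq, neg_zero] at h
  rw [ellFm, ellFm, intervalIntegral.integral_symm, ← h]

/-- A function of `θ` that depends on `sin θ ^ 2` only has equal integrals over `[0, π / 2]` and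
`[π / 2, π]`. -/
theorem integral_sin_sq_zero_pi {f : ℝ → ℝ} (hf : Continuous fun θ => f (Real.sin θ ^ 2)) :
    ∫ θ in (0 : ℝ)..Real.pi, f (Real.sin θ ^ 2)
      = 2 * ∫ θ in (0 : ℝ)..(Real.pi / 2), f (Real.sin θ ^ 2) := by
  have h := intervalIntegral.integral_comp_sub_left (a := 0) (b := Real.pi / 2)
    (fun θ : ℝ => f (Real.sin θ ^ 2)) Real.pi
  simp only [Real.sin_pi_sub, sub_zero] at h
  rw [← intervalIntegral.integral_add_adjacent_intervals (b := Real.pi / 2)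
    (hf.intervalIntegrable _ _) (hf.intervalIntegrable _ _), h]
  ring_nf

theorem ellFm_pi {m : ℝ} (hm : m < 1) : ellFm Real.pi m = 2 * ellFm (Real.pi / 2) m :=
  integral_sin_sq_zero_pi (f := fun x => 1 / √(1 - m * x)) (continuous_ellFm_integrand hm)

theorem ellFm_add_pi {m : ℝ} (hm : m < 1) (φ : ℝ) :
    ellFm (φ + Real.pi) m = ellFm φ m + 2 * ellFm (Real.pi / 2) m := by
  have h := intervalIntegral.integral_comp_add_right (a := 0) (b := φ)
    (fun θ : ℝ => 1 / √(1 - m * Real.sin θ ^ 2)) Real.pi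
  simp only [Real.sin_add_pi, neg_sq, zero_add] at h
  rw [← ellFm_pi hm, ellFm, ellFm, ellFm, h, add_comm (∫ θ in Real.pi..φ + Real.pi, _),
    intervalIntegral.integral_add_adjacent_intervals
      ((continuous_ellFm_integrand hm).intervalIntegrable _ _)
      ((continuous_ellFm_integrand hm).intervalIntegrable _ _)]

theorem ellFm_pos {φ m : ℝ} (hm : m < 1) (h : 0 < φ) : 0 < ellFm φ m := by
  have := strictMono_ellFm hm h
  simpa using this

theorem ellK_pos {k : ℝ} (hk : k ^ 2 < 1) : 0 < ellK k :=
  ellFm_pos hk (by positivity)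

theorem ellFm_nat_mul_pi {m : ℝ} (hm : m < 1) (n : ℕ) :
    ellFm (n * Real.pi) m = n * (2 * ellFm (Real.pi / 2) m) := by
  induction n with
  | zero => simp
  | succ n ih => push_cast; rw [add_mul, one_mul, ellFm_add_pi hm, ih]; ring

theorem ellFm_surjective {m : ℝ} (hm : m < 1) : Function.Surjective fun φ => ellFm φ m := by
  have hc : Continuous fun φ => ellFm φ m :=
    continuous_iff_continuousAt.2 fun φ => (hasDerivAt_ellFm hm φ).continuousAt
  have hK : 0 < 2 * ellFm (Real.pi / 2) m := by
    have := ellFm_pos hm (φ := Real.pi / 2) (by positivity)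
    positivity
  have htop : Tendsto (fun φ => ellFm φ m) atTop atTop := by
    refine tendsto_atTop_atTop_of_monotone (strictMono_ellFm hm).monotone fun b => ?_
    obtain ⟨n, hn⟩ := exists_nat_ge (b / (2 * ellFm (Real.pi / 2) m))
    refine ⟨n * Real.pi, ?_⟩
    rw [ellFm_nat_mul_pi hm]
    rwa [div_le_iff₀ hK] at hn
  refine hc.surjective htop ?_
  have h2 : (fun φ => ellFm φ m) = fun φ => -ellFm (-φ) m := by
    funext φ; rw [ellFm_neg, neg_neg]
  rw [h2]
  exact tendsto_neg_atTop_atBot.comp (htop.comp tendsto_neg_atBot_atTop)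

/-- A quotient whose numerator and denominator have proportional logarithmic derivatives is
constant; this is the form in which the three addition theorems are obtained. -/
theorem div_eq_div_of_hasDerivAt {N D N' D' : ℝ → ℝ} (hN : ∀ u, HasDerivAt N (N' u) u)
    (hD : ∀ u, HasDerivAt D (D' u) u) (h0 : ∀ u, D u ≠ 0) (h : ∀ u, N' u * D u = N u * D' u)
    (u v : ℝ) : N u / D u = N v / D v := by
  refine is_const_of_deriv_eq_zero (f := fun u => N u / D u)
    (fun u => ((hN u).div (hD u) (h0 u)).differentiableAt) (fun u => ?_) u v
  refine ((hN u).div (hD u) (h0 u)).deriv.trans ?_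
  rw [h u, sub_self, zero_div]

section Jacobi

variable {k : ℝ} (hk : k ^ 2 < 1)
include hk

theorem ellF_jacAm (u : ℝ) : ellF (jacAm u k) k = u :=
  Function.rightInverse_invFun (ellFm_surjective hk) u

theorem jacAm_ellF (φ : ℝ) : jacAm (ellF φ k) k = φ :=
  (strictMono_ellFm hk).injective (ellF_jacAm hk (ellF φ k))

theorem jacAm_eq_iff {u φ : ℝ} : jacAm u k = φ ↔ u = ellF φ k :=
  ⟨fun h => by rw [← h, ellF_jacAm hk], fun h => by rw [h, jacAm_ellF hk]⟩

theorem jacAm_strictMono : StrictMono fun u => jacAm u k := fun u v huv => by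
  refine (strictMono_ellFm hk).lt_iff_lt.1 ?_
  have h1 := ellF_jacAm hk u
  have h2 := ellF_jacAm hk v
  rw [ellF_eq_ellFm] at h1 h2
  simp only [h1, h2, huv]

theorem jacAm_surjective : Function.Surjective fun u => jacAm u k := fun φ =>
  ⟨ellF φ k, jacAm_ellF hk φ⟩

theorem continuous_jacAm : Continuous fun u => jacAm u k :=
  (jacAm_strictMono hk).monotone.continuous_of_surjective (jacAm_surjective hk)

theorem jacAm_zero : jacAm 0 k = 0 := by
  rw [jacAm_eq_iff hk, ellF_eq_ellFm, ellFm_zero]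

theorem jacAm_neg (u : ℝ) : jacAm (-u) k = -jacAm u k := by
  rw [jacAm_eq_iff hk, ellF_eq_ellFm, ellFm_neg, ← ellF_eq_ellFm, ellF_jacAm hk]

theorem jacAm_ellK : jacAm (ellK k) k = Real.pi / 2 := jacAm_ellF hk _

theorem jacAm_add_two_ellK (u : ℝ) : jacAm (u + 2 * ellK k) k = jacAm u k + Real.pi := by
  rw [jacAm_eq_iff hk, ellF_eq_ellFm, ellFm_add_pi hk, ← ellF_eq_ellFm, ellF_jacAm hk]
  rfl

theorem jacAm_two_ellK_sub (u : ℝ) : jacAm (2 * ellK k - u) k = Real.pi - jacAm u k := by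
  rw [show 2 * ellK k - u = -u + 2 * ellK k by ring, jacAm_add_two_ellK hk, jacAm_neg hk]
  ring

theorem jacDn_sq (u : ℝ) : jacDn u k ^ 2 = 1 - k ^ 2 * jacSn u k ^ 2 :=
  Real.sq_sqrt (one_sub_mul_sin_sq_pos hk _).le

theorem jacDn_pos (u : ℝ) : 0 < jacDn u k := Real.sqrt_pos.2 (one_sub_mul_sin_sq_pos hk _)

theorem hasDerivAt_jacAm (u : ℝ) : HasDerivAt (fun u => jacAm u k) (jacDn u k) u := by
  have h := HasDerivAt.of_local_left_inverse (f := fun φ => ellF φ k) (g := fun u => jacAm u k)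
    (a := u) (continuous_jacAm hk).continuousAt (hasDerivAt_ellFm hk (jacAm u k))
    (one_div_pos.2 (jacDn_pos hk u)).ne' (Eventually.of_forall fun v => ellF_jacAm hk v)
  simpa [jacDn, jacSn] using h

theorem hasDerivAt_jacSn (u : ℝ) :
    HasDerivAt (fun u => jacSn u k) (jacCn u k * jacDn u k) u :=
  (hasDerivAt_jacAm hk u).sin

theorem hasDerivAt_jacCn (u : ℝ) :
    HasDerivAt (fun u => jacCn u k) (-jacSn u k * jacDn u k) u :=
  (hasDerivAt_jacAm hk u).cos

theorem hasDerivAt_jacDn (u : ℝ) :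
    HasDerivAt (fun u => jacDn u k) (-(k ^ 2) * jacSn u k * jacCn u k) u := by
  have h := ((((hasDerivAt_jacSn hk u).pow 2).const_mul (k ^ 2)).const_sub 1).sqrt
    (one_sub_mul_sin_sq_pos hk _).ne'
  refine h.congr_deriv ?_
  have hd := (jacDn_pos hk u).ne'
  have : √(1 - k ^ 2 * jacSn u k ^ 2) = jacDn u k := rfl
  simp only [Nat.cast_ofNat, Pi.pow_apply]
  rw [this]
  field_simp
  norm_num
  ring

omit hk in
theorem jacCn_sq (u : ℝ) : jacCn u k ^ 2 = 1 - jacSn u k ^ 2 := by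
  have := Real.sin_sq_add_cos_sq (jacAm u k)
  simp only [jacCn, jacSn]; linarith

omit hk in
theorem jacSn_sq_le_one (u : ℝ) : jacSn u k ^ 2 ≤ 1 := Real.sin_sq_le_one _

theorem continuous_jacSn : Continuous fun u => jacSn u k :=
  Real.continuous_sin.comp (continuous_jacAm hk)

theorem continuous_jacCn : Continuous fun u => jacCn u k :=
  Real.continuous_cos.comp (continuous_jacAm hk)

theorem continuous_jacDn : Continuous fun u => jacDn u k := by
  have := continuous_jacSn hk
  unfold jacDn
  fun_prop

theorem jacSn_zero : jacSn 0 k = 0 := by simp [jacSn, jacAm_zero hk]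
theorem jacCn_zero : jacCn 0 k = 1 := by simp [jacCn, jacAm_zero hk]
theorem jacDn_zero : jacDn 0 k = 1 := by simp [jacDn, jacSn_zero hk]
theorem jacSn_neg (u : ℝ) : jacSn (-u) k = -jacSn u k := by simp [jacSn, jacAm_neg hk]
theorem jacCn_neg (u : ℝ) : jacCn (-u) k = jacCn u k := by simp [jacCn, jacAm_neg hk]
theorem jacDn_neg (u : ℝ) : jacDn (-u) k = jacDn u k := by simp [jacDn, jacSn_neg hk]
theorem jacCn_ellK : jacCn (ellK k) k = 0 := by simp [jacCn, jacAm_ellK hk]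

theorem jacSn_two_ellK_sub (u : ℝ) : jacSn (2 * ellK k - u) k = jacSn u k := by
  simp [jacSn, jacAm_two_ellK_sub hk]
theorem jacCn_two_ellK_sub (u : ℝ) : jacCn (2 * ellK k - u) k = -jacCn u k := by
  simp [jacCn, jacAm_two_ellK_sub hk]
theorem jacDn_two_ellK_sub (u : ℝ) : jacDn (2 * ellK k - u) k = jacDn u k := by
  simp [jacDn, jacSn_two_ellK_sub hk]

theorem jacSn_add_two_ellK (u : ℝ) : jacSn (u + 2 * ellK k) k = -jacSn u k := by
  simp [jacSn, jacAm_add_two_ellK hk, Real.sin_add_pi]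
theorem jacCn_add_two_ellK (u : ℝ) : jacCn (u + 2 * ellK k) k = -jacCn u k := by
  simp [jacCn, jacAm_add_two_ellK hk, Real.cos_add_pi]
theorem jacDn_periodic : Function.Periodic (fun u => jacDn u k) (2 * ellK k) := fun u => by
  simp [jacDn, jacSn_add_two_ellK hk]
theorem jacSn_periodic : Function.Periodic (fun u => jacSn u k) (4 * ellK k) := fun u => by
  simp only
  rw [show u + 4 * ellK k = u + 2 * ellK k + 2 * ellK k by ring, jacSn_add_two_ellK hk,
    jacSn_add_two_ellK hk, neg_neg]
theorem jacCn_periodic : Function.Periodic (fun u => jacCn u k) (4 * ellK k) := fun u => by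
  simp only
  rw [show u + 4 * ellK k = u + 2 * ellK k + 2 * ellK k by ring, jacCn_add_two_ellK hk,
    jacCn_add_two_ellK hk, neg_neg]

/-- `sn` and `cn` together determine the argument modulo `4 K`. -/
theorem eq_of_jacSn_eq_of_jacCn_eq {u v : ℝ} (hs : jacSn u k = jacSn v k)
    (hc : jacCn u k = jacCn v k) (hu : u ∈ Ico 0 (4 * ellK k)) (hv : v ∈ Ico 0 (4 * ellK k)) :
    u = v := by
  have key : ∀ w ∈ Ico 0 (4 * ellK k), jacAm w k ∈ Ico 0 (2 * Real.pi) := fun w hw => by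
    refine ⟨?_, ?_⟩
    · rw [← jacAm_zero hk]; exact (jacAm_strictMono hk).monotone hw.1
    · have h := jacAm_strictMono hk hw.2
      simp only at h
      rwa [show 4 * ellK k = 0 + 2 * ellK k + 2 * ellK k by ring, jacAm_add_two_ellK hk,
        jacAm_add_two_ellK hk, jacAm_zero hk, show 0 + Real.pi + Real.pi = 2 * Real.pi by ring] at h
  have hang : ((jacAm u k : ℝ) : Real.Angle) = (jacAm v k : ℝ) :=
    Real.Angle.cos_sin_inj (by simpa [jacCn] using hc) (by simpa [jacSn] using hs)
  obtain ⟨n, hn⟩ := Real.Angle.angle_eq_iff_two_pi_dvd_sub.1 hang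
  have h1 := key u hu
  have h2 := key v hv
  have hpi := Real.pi_pos
  have hn0 : n = 0 := by
    have a1 : (n : ℝ) < 1 := by
      by_contra h; push Not at h; nlinarith [h1.1, h1.2, h2.1, h2.2]
    have a2 : (-1 : ℝ) < n := by
      by_contra h; push Not at h; nlinarith [h1.1, h1.2, h2.1, h2.2]
    have b1 : n < 1 := by exact_mod_cast a1
    have b2 : -1 < n := by exact_mod_cast a2
    omega
  rw [hn0] at hn
  exact (jacAm_strictMono hk).injective (by simpa [sub_eq_zero] using hn)

theorem jacAm_mem_Ioc {u : ℝ} (hu : u ∈ Ioc 0 (ellK k)) : jacAm u k ∈ Ioc 0 (Real.pi / 2) := by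
  refine ⟨?_, ?_⟩
  · rw [← jacAm_zero hk]; exact jacAm_strictMono hk hu.1
  · rw [← jacAm_ellK hk]; exact (jacAm_strictMono hk).monotone hu.2

theorem jacSn_pos_of_mem {u : ℝ} (hu : u ∈ Ioc 0 (ellK k)) : 0 < jacSn u k := by
  have h := jacAm_mem_Ioc hk hu
  exact Real.sin_pos_of_pos_of_lt_pi h.1 (by linarith [h.2, Real.pi_pos])

theorem jacCn_nonneg_of_mem {u : ℝ} (hu : u ∈ Ioc 0 (ellK k)) : 0 ≤ jacCn u k := by
  have h := jacAm_mem_Ioc hk hu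
  exact Real.cos_nonneg_of_mem_Icc ⟨by linarith [h.1, Real.pi_pos], h.2⟩

/-- Every value in `(0, 1]` is taken by `sn` on the quarter period `(0, K]`. -/
theorem exists_jacSn_eq {x : ℝ} (hx : x ∈ Ioc 0 1) : ∃ u ∈ Ioc 0 (ellK k), jacSn u k = x := by
  refine ⟨ellF (Real.arcsin x) k, ⟨?_, ?_⟩, ?_⟩
  · exact ellFm_pos hk (Real.arcsin_pos.2 hx.1)
  · exact (strictMono_ellFm hk).monotone (Real.arcsin_le_pi_div_two x)
  · rw [jacSn, jacAm_ellF hk, Real.sin_arcsin (by linarith [hx.1]) hx.2]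

/-! ### Addition theorems -/

theorem add_denom_pos (u v : ℝ) : 0 < 1 - k ^ 2 * jacSn u k ^ 2 * jacSn v k ^ 2 := by
  have h1 := jacSn_sq_le_one (k := k) u
  have h2 := jacSn_sq_le_one (k := k) v
  have : k ^ 2 * jacSn u k ^ 2 * jacSn v k ^ 2 ≤ k ^ 2 * 1 * 1 := by gcongr
  linarith

theorem hasDerivAt_add_denom (c u : ℝ) :
    HasDerivAt (fun u => 1 - k ^ 2 * jacSn u k ^ 2 * jacSn (c - u) k ^ 2)
      (-(2 * k ^ 2 * jacSn u k * jacSn (c - u) k * (jacCn u k * jacDn u k * jacSn (c - u) k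
        - jacSn u k * (jacCn (c - u) k * jacDn (c - u) k)))) u := by
  have hs := hasDerivAt_jacSn hk u
  have hs' := (hasDerivAt_jacSn hk (c - u)).comp_const_sub c u
  exact ((((hs.pow 2).const_mul (k ^ 2)).mul (hs'.pow 2)).const_sub 1).congr_deriv
    (by simp only [Pi.pow_apply]; push_cast; ring)

/-- For fixed `u + v` the quotient of the right-hand side by the factor on the left is constant; its
value at `u = 0` is `sn (u + v)`. The other two addition theorems are obtained in the same way. -/
theorem jacSn_add (u v : ℝ) :
    jacSn (u + v) k * (1 - k ^ 2 * jacSn u k ^ 2 * jacSn v k ^ 2)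
      = jacSn u k * jacCn v k * jacDn v k + jacSn v k * jacCn u k * jacDn u k := by
  have h := div_eq_div_of_hasDerivAt
    (N := fun w => jacSn w k * jacCn (u + v - w) k * jacDn (u + v - w) k
      + jacSn (u + v - w) k * jacCn w k * jacDn w k)
    (hD := fun w => hasDerivAt_add_denom hk (u + v) w)
    (hN := fun w => by
      have hs := hasDerivAt_jacSn hk w
      have hc := hasDerivAt_jacCn hk w
      have hd := hasDerivAt_jacDn hk w
      have hs' := (hasDerivAt_jacSn hk (u + v - w)).comp_const_sub (u + v) w
      have hc' := (hasDerivAt_jacCn hk (u + v - w)).comp_const_sub (u + v) w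
      have hd' := (hasDerivAt_jacDn hk (u + v - w)).comp_const_sub (u + v) w
      exact ((hs.mul hc').mul hd').add ((hs'.mul hc).mul hd))
    (h0 := fun w => (add_denom_pos hk w (u + v - w)).ne')
    (h := fun w => by
      simp only [Pi.mul_apply]
      have c1 := jacCn_sq (k := k) w
      have d1 := jacDn_sq hk w
      have c2 := jacCn_sq (k := k) (u + v - w)
      have d2 := jacDn_sq hk (u + v - w)
      generalize jacSn w k = s1 at *
      generalize jacCn w k = c1' at *
      generalize jacDn w k = d1' at *
      generalize jacSn (u + v - w) k = s2 at *
      generalize jacCn (u + v - w) k = c2' at *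
      generalize jacDn (u + v - w) k = d2' at *
      grind) u 0
  simp only [sub_zero, jacSn_zero hk, jacCn_zero hk, jacDn_zero hk, add_sub_cancel_left] at h
  rw [div_eq_iff (add_denom_pos hk u v).ne'] at h
  rw [h]; ring

theorem jacCn_add (u v : ℝ) :
    jacCn (u + v) k * (1 - k ^ 2 * jacSn u k ^ 2 * jacSn v k ^ 2)
      = jacCn u k * jacCn v k - jacSn u k * jacDn u k * (jacSn v k * jacDn v k) := by
  have h := div_eq_div_of_hasDerivAt
    (N := fun w => jacCn w k * jacCn (u + v - w) k
      - jacSn w k * jacDn w k * (jacSn (u + v - w) k * jacDn (u + v - w) k))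
    (hD := fun w => hasDerivAt_add_denom hk (u + v) w)
    (hN := fun w => by
      have hs := hasDerivAt_jacSn hk w
      have hc := hasDerivAt_jacCn hk w
      have hd := hasDerivAt_jacDn hk w
      have hs' := (hasDerivAt_jacSn hk (u + v - w)).comp_const_sub (u + v) w
      have hc' := (hasDerivAt_jacCn hk (u + v - w)).comp_const_sub (u + v) w
      have hd' := (hasDerivAt_jacDn hk (u + v - w)).comp_const_sub (u + v) w
      exact (hc.mul hc').sub ((hs.mul hd).mul (hs'.mul hd')))
    (h0 := fun w => (add_denom_pos hk w (u + v - w)).ne')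
    (h := fun w => by
      simp only [Pi.mul_apply]
      have c1 := jacCn_sq (k := k) w
      have d1 := jacDn_sq hk w
      have c2 := jacCn_sq (k := k) (u + v - w)
      have d2 := jacDn_sq hk (u + v - w)
      generalize jacSn w k = s1 at *
      generalize jacCn w k = c1' at *
      generalize jacDn w k = d1' at *
      generalize jacSn (u + v - w) k = s2 at *
      generalize jacCn (u + v - w) k = c2' at *
      generalize jacDn (u + v - w) k = d2' at *
      grind) u 0
  simp only [sub_zero, jacSn_zero hk, jacCn_zero hk, jacDn_zero hk, add_sub_cancel_left] at h
  rw [div_eq_iff (add_denom_pos hk u v).ne'] at h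
  rw [h]; ring

theorem jacDn_add (u v : ℝ) :
    jacDn (u + v) k * (1 - k ^ 2 * jacSn u k ^ 2 * jacSn v k ^ 2)
      = jacDn u k * jacDn v k - k ^ 2 * (jacSn u k * jacCn u k * (jacSn v k * jacCn v k)) := by
  have h := div_eq_div_of_hasDerivAt
    (N := fun w => jacDn w k * jacDn (u + v - w) k
      - k ^ 2 * (jacSn w k * jacCn w k * (jacSn (u + v - w) k * jacCn (u + v - w) k)))
    (hD := fun w => hasDerivAt_add_denom hk (u + v) w)
    (hN := fun w => by
      have hs := hasDerivAt_jacSn hk w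
      have hc := hasDerivAt_jacCn hk w
      have hd := hasDerivAt_jacDn hk w
      have hs' := (hasDerivAt_jacSn hk (u + v - w)).comp_const_sub (u + v) w
      have hc' := (hasDerivAt_jacCn hk (u + v - w)).comp_const_sub (u + v) w
      have hd' := (hasDerivAt_jacDn hk (u + v - w)).comp_const_sub (u + v) w
      exact (hd.mul hd').sub (((hs.mul hc).mul (hs'.mul hc')).const_mul (k ^ 2)))
    (h0 := fun w => (add_denom_pos hk w (u + v - w)).ne')
    (h := fun w => by
      simp only [Pi.mul_apply]
      have c1 := jacCn_sq (k := k) w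
      have d1 := jacDn_sq hk w
      have c2 := jacCn_sq (k := k) (u + v - w)
      have d2 := jacDn_sq hk (u + v - w)
      generalize jacSn w k = s1 at *
      generalize jacCn w k = c1' at *
      generalize jacDn w k = d1' at *
      generalize jacSn (u + v - w) k = s2 at *
      generalize jacCn (u + v - w) k = c2' at *
      generalize jacDn (u + v - w) k = d2' at *
      grind) u 0
  simp only [sub_zero, jacSn_zero hk, jacCn_zero hk, jacDn_zero hk, add_sub_cancel_left] at h
  rw [div_eq_iff (add_denom_pos hk u v).ne'] at h
  rw [h]; ring

end Jacobi

/-! ### Areas of the Lissajous curves -/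

/-- An odd periodic function has zero integral over a period. -/
theorem Function.Periodic.integral_eq_zero_of_odd {f : ℝ → ℝ} {T : ℝ} (hf : Function.Periodic f T)
    (hodd : ∀ t, f (-t) = -f t) : ∫ t in (0 : ℝ)..T, f t = 0 := by
  have h := intervalIntegral.integral_comp_sub_left (a := 0) (b := T) f T
  have h2 : ∀ t, f (T - t) = -f t := fun t => by
    rw [← hodd, ← hf (-t)]; ring_nf
  simp only [h2, sub_self, sub_zero, intervalIntegral.integral_neg] at h
  linarith

section
variable {k : ℝ} (hk : k ^ 2 < 1)
include hk

/-- Integrals of functions of `sn ^ 2` over a half period, by the substitution `θ = am t`. -/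
theorem integral_comp_jacSn_sq {g : ℝ → ℝ} (hg : ContinuousOn g (Icc 0 1)) :
    ∫ t in (0 : ℝ)..(2 * ellK k), g (jacSn t k ^ 2)
      = 2 * ∫ θ in (0 : ℝ)..(Real.pi / 2),
          g (Real.sin θ ^ 2) / √(1 - k ^ 2 * Real.sin θ ^ 2) := by
  have hmaps : ∀ x : ℝ, Real.sin x ^ 2 ∈ Icc (0 : ℝ) 1 := fun x =>
    ⟨sq_nonneg _, Real.sin_sq_le_one x⟩
  have hgc : Continuous fun θ : ℝ => g (Real.sin θ ^ 2) :=
    hg.comp_continuous (by fun_prop) hmaps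
  have h := intervalIntegral.integral_comp_mul_deriv (a := 0) (b := Real.pi)
    (f := fun θ => ellF θ k) (g := fun t => g (jacSn t k ^ 2))
    (fun x _ => hasDerivAt_ellFm hk x) (continuous_ellFm_integrand hk).continuousOn
    (hgc.comp (continuous_jacAm hk))
  have h0 : ellF 0 k = 0 := ellFm_zero _
  have hpi : ellF Real.pi k = 2 * ellK k := ellFm_pi hk
  rw [h0, hpi] at h
  rw [← h, ← integral_sin_sq_zero_pi (f := fun x => g x / √(1 - k ^ 2 * x))
    (by
      simp only [div_eq_mul_one_div (g _)]
      exact hgc.mul (continuous_ellFm_integrand hk))]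
  refine intervalIntegral.integral_congr fun θ _ => ?_
  simp only [Function.comp, jacSn, jacAm_ellF hk]
  ring

theorem integral_comp_jacSn_sq_four {g : ℝ → ℝ} (hg : ContinuousOn g (Icc 0 1)) :
    ∫ t in (0 : ℝ)..(4 * ellK k), g (jacSn t k ^ 2)
      = 4 * ∫ θ in (0 : ℝ)..(Real.pi / 2),
          g (Real.sin θ ^ 2) / √(1 - k ^ 2 * Real.sin θ ^ 2) := by
  have hp : Function.Periodic (fun t => g (jacSn t k ^ 2)) (2 * ellK k) := fun t => by
    simp only [jacSn_add_two_ellK hk, neg_sq]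
  have hc : Continuous fun t => g (jacSn t k ^ 2) :=
    hg.comp_continuous ((continuous_jacSn hk).pow 2) fun t => ⟨sq_nonneg _, jacSn_sq_le_one t⟩
  have h := hp.intervalIntegral_add_eq (2 * ellK k) 0
  rw [zero_add] at h
  rw [← intervalIntegral.integral_add_adjacent_intervals (b := 2 * ellK k)
    (hc.intervalIntegrable _ _) (hc.intervalIntegrable _ _),
    show 4 * ellK k = 2 * ellK k + 2 * ellK k by ring, h, integral_comp_jacSn_sq hk hg]
  ring

theorem continuous_add_denom_inv (η : ℝ) :
    Continuous fun t => (1 - k ^ 2 * jacSn t k ^ 2 * jacSn η k ^ 2)⁻¹ := by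
  have := continuous_jacSn hk
  exact Continuous.inv₀ (by fun_prop) fun t => (add_denom_pos hk t η).ne'

theorem continuousOn_inv_denom (η : ℝ) :
    ContinuousOn (fun x => (1 - k ^ 2 * jacSn η k ^ 2 * x)⁻¹) (Icc 0 1) := by
  refine ContinuousOn.inv₀ (by fun_prop) fun x hx => ?_
  have h1 := jacSn_sq_le_one (k := k) η
  have : k ^ 2 * jacSn η k ^ 2 * x ≤ k ^ 2 * 1 * 1 := by
    have := hx.1; have := hx.2; gcongr
  exact (by linarith : 0 < 1 - k ^ 2 * jacSn η k ^ 2 * x).ne'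

/-- By the addition theorem the integrand is a function of `sn² t` plus an odd function of `t`. The odd
part drops out over a period, and the rest is integrated by `θ = am t`. -/
theorem areaSn_eq_integral (η : ℝ) :
    areaSn k η = 4 * jacSn η k * ∫ θ in (0 : ℝ)..(Real.pi / 2),
      (1 - Real.sin θ ^ 2) * (1 - k ^ 2 * Real.sin θ ^ 2)
        * (1 - k ^ 2 * jacSn η k ^ 2 * Real.sin θ ^ 2)⁻¹ / √(1 - k ^ 2 * Real.sin θ ^ 2) := by
  have hcs := continuous_jacSn hk
  have hcc := continuous_jacCn hk
  have hcd := continuous_jacDn hk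
  have hci := continuous_add_denom_inv hk η
  have hsplit : ∀ t, jacSn (t + η) k * deriv (fun t => jacSn t k) t
      = jacCn η k * jacDn η k * (jacSn t k * jacCn t k * jacDn t k
          * (1 - k ^ 2 * jacSn t k ^ 2 * jacSn η k ^ 2)⁻¹)
        + jacSn η k * ((1 - jacSn t k ^ 2) * (1 - k ^ 2 * jacSn t k ^ 2)
          * (1 - k ^ 2 * jacSn η k ^ 2 * jacSn t k ^ 2)⁻¹) := fun t => by
    have hD := (add_denom_pos hk t η).ne'
    have e : 1 - k ^ 2 * jacSn η k ^ 2 * jacSn t k ^ 2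
      = 1 - k ^ 2 * jacSn t k ^ 2 * jacSn η k ^ 2 := by ring
    rw [(hasDerivAt_jacSn hk t).deriv, eq_div_of_mul_eq hD (jacSn_add hk t η), e,
      ← jacCn_sq, ← jacDn_sq hk]
    field_simp
  rw [areaSn, lissajousArea]
  simp only [hsplit]
  rw [intervalIntegral.integral_add (Continuous.intervalIntegrable (by fun_prop) _ _)
    (Continuous.intervalIntegrable ?_ _ _), intervalIntegral.integral_const_mul,
    intervalIntegral.integral_const_mul, Function.Periodic.integral_eq_zero_of_odd,
    integral_comp_jacSn_sq_four hk
      (g := fun x => (1 - x) * (1 - k ^ 2 * x) * (1 - k ^ 2 * jacSn η k ^ 2 * x)⁻¹)]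
  · ring
  · exact ContinuousOn.mul (by fun_prop) (continuousOn_inv_denom hk η)
  · intro t
    have e : jacDn (t + 4 * ellK k) k = jacDn t k := by
      have h := (jacDn_periodic hk).nat_mul 2 t
      norm_num at h
      rw [← h]; ring_nf
    have e1 := jacSn_periodic hk t
    have e2 := jacCn_periodic hk t
    simp only at e1 e2 ⊢
    rw [e, e1, e2]
  · intro t
    simp only [jacSn_neg hk, jacCn_neg hk, jacDn_neg hk, neg_sq]; ring
  · have : ∀ t, (1 - k ^ 2 * jacSn η k ^ 2 * jacSn t k ^ 2)⁻¹
      = (1 - k ^ 2 * jacSn t k ^ 2 * jacSn η k ^ 2)⁻¹ := fun t => by ring_nf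
    simp only [this]
    fun_prop

theorem areaCn_eq_integral (η : ℝ) :
    areaCn k η = 4 * (jacSn η k * jacDn η k) * ∫ θ in (0 : ℝ)..(Real.pi / 2),
      Real.sin θ ^ 2 * (1 - k ^ 2 * Real.sin θ ^ 2)
        * (1 - k ^ 2 * jacSn η k ^ 2 * Real.sin θ ^ 2)⁻¹ / √(1 - k ^ 2 * Real.sin θ ^ 2) := by
  have hcs := continuous_jacSn hk
  have hcc := continuous_jacCn hk
  have hcd := continuous_jacDn hk
  have hci := continuous_add_denom_inv hk η
  have hsplit : ∀ t, jacCn (t + η) k * deriv (fun t => jacCn t k) t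
      = -jacCn η k * (jacSn t k * jacCn t k * jacDn t k
          * (1 - k ^ 2 * jacSn t k ^ 2 * jacSn η k ^ 2)⁻¹)
        + jacSn η k * jacDn η k * (jacSn t k ^ 2 * (1 - k ^ 2 * jacSn t k ^ 2)
          * (1 - k ^ 2 * jacSn η k ^ 2 * jacSn t k ^ 2)⁻¹) := fun t => by
    have hD := (add_denom_pos hk t η).ne'
    have e : 1 - k ^ 2 * jacSn η k ^ 2 * jacSn t k ^ 2
      = 1 - k ^ 2 * jacSn t k ^ 2 * jacSn η k ^ 2 := by ring
    rw [(hasDerivAt_jacCn hk t).deriv, eq_div_of_mul_eq hD (jacCn_add hk t η), e,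
      ← jacDn_sq hk]
    field_simp
    ring
  rw [areaCn, lissajousArea]
  simp only [hsplit]
  rw [intervalIntegral.integral_add (Continuous.intervalIntegrable (by fun_prop) _ _)
    (Continuous.intervalIntegrable ?_ _ _), intervalIntegral.integral_const_mul,
    intervalIntegral.integral_const_mul, Function.Periodic.integral_eq_zero_of_odd,
    integral_comp_jacSn_sq_four hk
      (g := fun x => x * (1 - k ^ 2 * x) * (1 - k ^ 2 * jacSn η k ^ 2 * x)⁻¹)]
  · ring
  · exact ContinuousOn.mul (by fun_prop) (continuousOn_inv_denom hk η)
  · intro t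
    have e : jacDn (t + 4 * ellK k) k = jacDn t k := by
      have h := (jacDn_periodic hk).nat_mul 2 t
      norm_num at h
      rw [← h]; ring_nf
    have e1 := jacSn_periodic hk t
    have e2 := jacCn_periodic hk t
    simp only at e1 e2 ⊢
    rw [e, e1, e2]
  · intro t
    simp only [jacSn_neg hk, jacCn_neg hk, jacDn_neg hk, neg_sq]; ring
  · have : ∀ t, (1 - k ^ 2 * jacSn η k ^ 2 * jacSn t k ^ 2)⁻¹
      = (1 - k ^ 2 * jacSn t k ^ 2 * jacSn η k ^ 2)⁻¹ := fun t => by ring_nf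
    simp only [this]
    fun_prop

theorem areaDn_eq_integral (η : ℝ) :
    areaDn k η = 2 * (k ^ 4 * (jacSn η k * jacCn η k)) * ∫ θ in (0 : ℝ)..(Real.pi / 2),
      Real.sin θ ^ 2 * (1 - Real.sin θ ^ 2)
        * (1 - k ^ 2 * jacSn η k ^ 2 * Real.sin θ ^ 2)⁻¹ / √(1 - k ^ 2 * Real.sin θ ^ 2) := by
  have hcs := continuous_jacSn hk
  have hcc := continuous_jacCn hk
  have hcd := continuous_jacDn hk
  have hci := continuous_add_denom_inv hk η
  have hsplit : ∀ t, jacDn (t + η) k * deriv (fun t => jacDn t k) t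
      = -(k ^ 2) * jacDn η k * (jacSn t k * jacCn t k * jacDn t k
          * (1 - k ^ 2 * jacSn t k ^ 2 * jacSn η k ^ 2)⁻¹)
        + k ^ 4 * (jacSn η k * jacCn η k) * (jacSn t k ^ 2 * (1 - jacSn t k ^ 2)
          * (1 - k ^ 2 * jacSn η k ^ 2 * jacSn t k ^ 2)⁻¹) := fun t => by
    have hD := (add_denom_pos hk t η).ne'
    have e : 1 - k ^ 2 * jacSn η k ^ 2 * jacSn t k ^ 2
      = 1 - k ^ 2 * jacSn t k ^ 2 * jacSn η k ^ 2 := by ring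
    rw [(hasDerivAt_jacDn hk t).deriv, eq_div_of_mul_eq hD (jacDn_add hk t η), e,
      ← jacCn_sq]
    field_simp
    ring
  rw [areaDn, lissajousArea]
  simp only [hsplit]
  rw [intervalIntegral.integral_add (Continuous.intervalIntegrable (by fun_prop) _ _)
    (Continuous.intervalIntegrable ?_ _ _), intervalIntegral.integral_const_mul,
    intervalIntegral.integral_const_mul, Function.Periodic.integral_eq_zero_of_odd,
    integral_comp_jacSn_sq hk
      (g := fun x => x * (1 - x) * (1 - k ^ 2 * jacSn η k ^ 2 * x)⁻¹)]
  · ring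
  · exact ContinuousOn.mul (by fun_prop) (continuousOn_inv_denom hk η)
  · intro t
    have e1 := jacDn_periodic hk t
    simp only at e1 ⊢
    rw [e1, jacSn_add_two_ellK hk, jacCn_add_two_ellK hk]
    ring
  · intro t
    simp only [jacSn_neg hk, jacCn_neg hk, jacDn_neg hk, neg_sq]; ring
  · have : ∀ t, (1 - k ^ 2 * jacSn η k ^ 2 * jacSn t k ^ 2)⁻¹
      = (1 - k ^ 2 * jacSn t k ^ 2 * jacSn η k ^ 2)⁻¹ := fun t => by ring_nf
    simp only [this]
    fun_prop

/-- Partial fractions: an integrand whose numerator is `(1 - n x) (α (1 - k² x) + β) + γ` is a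
combination of the three complete integrals. -/
theorem integral_eq_of_partial_fractions {n : ℝ} (hn : n < 1) {g : ℝ → ℝ} {α β γ : ℝ}
    (hg : ∀ x, g x = (1 - n * x) * (α * (1 - k ^ 2 * x) + β) + γ) :
    ∫ θ in (0 : ℝ)..(Real.pi / 2), g (Real.sin θ ^ 2) * (1 - n * Real.sin θ ^ 2)⁻¹
        / √(1 - k ^ 2 * Real.sin θ ^ 2)
      = α * ellE k + β * ellK k + γ * ellPi n k := by
  have hc := continuous_ellFm_integrand hk
  have hcn : Continuous fun θ : ℝ =>
      1 / ((1 - n * Real.sin θ ^ 2) * √(1 - k ^ 2 * Real.sin θ ^ 2)) := by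
    refine continuous_const.div (by fun_prop) fun θ => ?_
    exact (mul_pos (one_sub_mul_sin_sq_pos hn θ)
      (Real.sqrt_pos.2 (one_sub_mul_sin_sq_pos hk θ))).ne'
  have hE : Continuous fun θ : ℝ => √(1 - k ^ 2 * Real.sin θ ^ 2) := by fun_prop
  rw [ellE, ellK, ellF, ellPi, ← intervalIntegral.integral_const_mul,
    ← intervalIntegral.integral_const_mul, ← intervalIntegral.integral_const_mul,
    ← intervalIntegral.integral_add ((hE.const_mul α).intervalIntegrable _ _)
      ((hc.const_mul β).intervalIntegrable _ _),
    ← intervalIntegral.integral_add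
      (Continuous.intervalIntegrable (by fun_prop) _ _)
      ((hcn.const_mul γ).intervalIntegrable _ _)]
  refine intervalIntegral.integral_congr fun θ _ => ?_
  have h1 := (one_sub_mul_sin_sq_pos hn θ).ne'
  have h2 := (Real.sqrt_pos.2 (one_sub_mul_sin_sq_pos hk θ)).ne'
  have h3 := Real.sq_sqrt (one_sub_mul_sin_sq_pos hk θ).le
  rw [hg]
  generalize √(1 - k ^ 2 * Real.sin θ ^ 2) = D at *
  rw [← h3]
  field_simp

theorem sq_mul_jacSn_sq_lt_one (η : ℝ) : k ^ 2 * jacSn η k ^ 2 < 1 := by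
  nlinarith [jacSn_sq_le_one (k := k) η, sq_nonneg (jacSn η k)]

end

theorem areaSn_formula {k η : ℝ} (hk0 : k ≠ 0) (hk : k ^ 2 < 1) (hs : jacSn η k ≠ 0) :
    areaSn k η = 4 / k ^ 2 *
        ((jacSd η k ^ 2 * ellE k - ellK k + jacCn η k ^ 2 * ellPi (k ^ 2 * jacSn η k ^ 2) k)
          / (jacSn η k * jacSd η k ^ 2)) := by
  have hd := (jacDn_pos hk η).ne'
  have hc2 := jacCn_sq (k := k) η
  have hd2 := jacDn_sq hk η
  rw [areaSn_eq_integral hk,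
    integral_eq_of_partial_fractions hk (sq_mul_jacSn_sq_lt_one hk η)
      (g := fun x => (1 - x) * (1 - k ^ 2 * x))
      (α := 1 / (k ^ 2 * jacSn η k ^ 2)) (β := -(jacDn η k ^ 2 / (k ^ 2 * jacSn η k ^ 4)))
      (γ := jacCn η k ^ 2 * jacDn η k ^ 2 / (k ^ 2 * jacSn η k ^ 4))]
  · rw [jacSd]
    field_simp
    ring
  · intro x
    rw [hc2, hd2]
    field_simp
    ring

theorem areaCn_formula {k η : ℝ} (hk0 : k ≠ 0) (hk : k ^ 2 < 1) (hs : jacSn η k ≠ 0) :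
    areaCn k η = 4 / k ^ 2 *
        ((ellK k - jacSn η k ^ 2 * ellE k - jacCn η k ^ 2 * ellPi (k ^ 2 * jacSn η k ^ 2) k)
          / (jacSd η k * jacSn η k ^ 2)) := by
  have hd := (jacDn_pos hk η).ne'
  have hc2 := jacCn_sq (k := k) η
  rw [areaCn_eq_integral hk,
    integral_eq_of_partial_fractions hk (sq_mul_jacSn_sq_lt_one hk η)
      (g := fun x => x * (1 - k ^ 2 * x))
      (α := -(1 / (k ^ 2 * jacSn η k ^ 2))) (β := 1 / (k ^ 2 * jacSn η k ^ 4))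
      (γ := -(jacCn η k ^ 2 / (k ^ 2 * jacSn η k ^ 4)))]
  · rw [jacSd]
    field_simp
    ring
  · intro x
    rw [hc2]
    field_simp
    ring

theorem areaDn_formula {k η : ℝ} (hk0 : k ≠ 0) (hk : k ^ 2 < 1) (hs : jacSn η k ≠ 0) :
    areaDn k η = 2 / (jacSc η k * jacSn η k ^ 2) *
        ((jacSn η k ^ 2 + jacDn η k ^ 2) * ellK k - jacSn η k ^ 2 * ellE k
          - jacDn η k ^ 2 * ellPi (k ^ 2 * jacSn η k ^ 2) k) := by
  have hd2 := jacDn_sq hk η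
  rw [areaDn_eq_integral hk,
    integral_eq_of_partial_fractions hk (sq_mul_jacSn_sq_lt_one hk η)
      (g := fun x => x * (1 - x))
      (α := -(1 / (k ^ 4 * jacSn η k ^ 2)))
      (β := (jacSn η k ^ 2 + jacDn η k ^ 2) / (k ^ 4 * jacSn η k ^ 4))
      (γ := -(jacDn η k ^ 2 / (k ^ 4 * jacSn η k ^ 4)))]
  · rw [jacSc]
    -- the quotient `sn / cn` vanishes where `cn` does, and so does the area
    rcases eq_or_ne (jacCn η k) 0 with hc | hc
    · simp [hc]
    · field_simp
      ring
  · intro x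
    rw [hd2]
    field_simp
    ring

section

/-! ### Closed orbits of the Hamiltonian flow -/

theorem hasDerivAt_octInv_left (σ a q p : ℝ) :
    HasDerivAt (fun x => octInv σ a x p) (2 * q - a * p + 2 * σ * (q * p ^ 2)) q := by
  have h : HasDerivAt (fun x : ℝ => x) 1 q := hasDerivAt_id q
  have h2 := h.pow 2
  refine ((((h.const_mul (a * p)).const_sub (p ^ 2)).add h2).add
    ((h2.const_mul (p ^ 2)).const_mul σ)).congr_deriv ?_
  push_cast
  ring

theorem octInv_comm (σ a q p : ℝ) : octInv σ a q p = octInv σ a p q := by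
  simp only [octInv]; ring

theorem hasDerivAt_octInv_right (σ a q p : ℝ) :
    HasDerivAt (fun y => octInv σ a q y) (2 * p - a * q + 2 * σ * (p * q ^ 2)) p := by
  have h := hasDerivAt_octInv_left σ a p q
  simpa only [octInv_comm σ a _ q] using h

/-- The Hamiltonian vector field of the invariant. -/
def octField (σ a : ℝ) (z : ℝ × ℝ) : ℝ × ℝ :=
  (2 * z.2 - a * z.1 + 2 * σ * (z.2 * z.1 ^ 2), -(2 * z.1 - a * z.2 + 2 * σ * (z.1 * z.2 ^ 2)))

/-- The Hamiltonian field is polynomial, hence Lipschitz on balls; closed orbits are compact, so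
this gives uniqueness of solutions along them. -/
theorem exists_lipschitzOnWith_octField (σ a R : ℝ) :
    ∃ K, LipschitzOnWith K (octField σ a) (Metric.closedBall 0 R) := by
  have hd : ContDiff ℝ 1 (octField σ a) := by unfold octField; fun_prop
  exact hd.locallyLipschitz.locallyLipschitzOn.exists_lipschitzOnWith_of_compact
    (isCompact_closedBall 0 R)

variable {σ a : ℝ} {C : Set (ℝ × ℝ)} {q p : ℝ → ℝ} {T : ℝ}

theorem IsClosedOrbit.hasDerivAt (h : IsClosedOrbit σ a C q p T) (t : ℝ) :
    HasDerivAt (fun t => (q t, p t)) (octField σ a (q t, p t)) t := by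
  have h1 := h.eq_q t
  have h2 := h.eq_p t
  rw [(hasDerivAt_octInv_right σ a _ _).deriv] at h1
  rw [(hasDerivAt_octInv_left σ a _ _).deriv] at h2
  exact h1.prodMk h2

theorem IsClosedOrbit.isCompact (h : IsClosedOrbit σ a C q p T) : IsCompact C := by
  have hc : Continuous fun t => (q t, p t) :=
    continuous_iff_continuousAt.2 fun t => (h.hasDerivAt t).continuousAt
  have hper : Function.Periodic (fun t => (q t, p t)) T := fun t => by
    simp only [h.periodic_q t, h.periodic_p t]
  rw [← h.range_eq, ← hper.image_Icc h.period_pos 0]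
  exact isCompact_Icc.image hc

/-- Two closed orbits with the same trace differ by a shift of time. -/
theorem IsClosedOrbit.exists_shift (h : IsClosedOrbit σ a C q p T) {q' p' : ℝ → ℝ} {T' : ℝ}
    (h' : IsClosedOrbit σ a C q' p' T') : ∃ τ, ∀ t, q' t = q (t + τ) ∧ p' t = p (t + τ) := by
  have hmem : (q' 0, p' 0) ∈ range fun t => (q t, p t) := by
    rw [h.range_eq, ← h'.range_eq]; exact ⟨0, rfl⟩
  obtain ⟨τ, hτ⟩ := hmem
  obtain ⟨R, hR⟩ := h.isCompact.isBounded.subset_closedBall 0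
  obtain ⟨K, hK⟩ := exists_lipschitzOnWith_octField σ a R
  have huniq := ODE_solution_unique_univ (v := fun _ => octField σ a) (t₀ := 0)
    (s := fun _ => Metric.closedBall 0 R) (f := fun t => (q' t, p' t))
    (g := fun t => (q (t + τ), p (t + τ))) (fun _ => hK)
    (fun t => ⟨h'.hasDerivAt t, hR (h'.range_eq ▸ ⟨t, rfl⟩)⟩)
    (fun t => ⟨(h.hasDerivAt (t + τ)).comp_add_const t τ, hR (h.range_eq ▸ ⟨t + τ, rfl⟩)⟩)
    (by simpa using hτ.symm)
  exact ⟨τ, fun t => by simpa [Prod.ext_iff] using congrFun huniq t⟩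

theorem IsClosedOrbit.period_le (h : IsClosedOrbit σ a C q p T) {q' p' : ℝ → ℝ} {T' : ℝ}
    (h' : IsClosedOrbit σ a C q' p' T') : T ≤ T' := by
  obtain ⟨τ, hτ⟩ := h.exists_shift h'
  by_contra! hlt
  have e : (q T', p T') = (q 0, p 0) := by
    have h1 := hτ (T' - τ)
    have h2 := hτ (0 - τ)
    have h3 := h'.periodic_q (0 - τ)
    have h4 := h'.periodic_p (0 - τ)
    rw [show 0 - τ + T' = T' - τ by ring] at h3 h4
    simp only [sub_add_cancel] at h1 h2
    rw [← h1.1, ← h1.2, ← h2.1, ← h2.2, h3, h4]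
  exact h'.period_pos.ne' (h.injOn ⟨h'.period_pos.le, hlt⟩ ⟨le_rfl, h.period_pos⟩ e)

theorem IsClosedOrbit.period_eq (h : IsClosedOrbit σ a C q p T) {q' p' : ℝ → ℝ} {T' : ℝ}
    (h' : IsClosedOrbit σ a C q' p' T') : T' = T :=
  le_antisymm (h'.period_le h) (h.period_le h')

/-- All closed orbits with the same trace differ by a shift of time, so one of them determines the
action. -/
theorem IsClosedOrbit.hasAction (h : IsClosedOrbit σ a C q p T) :
    HasAction σ a C (1 / (2 * Real.pi) * ∫ t in (0 : ℝ)..T, p t * deriv q t) := by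
  refine ⟨⟨q, p, T, h⟩, fun q' p' T' h' => ?_⟩
  obtain ⟨τ, hτ⟩ := h.exists_shift h'
  have hq : q' = fun t => q (t + τ) := funext fun t => (hτ t).1
  have hp : p' = fun t => p (t + τ) := funext fun t => (hτ t).2
  have hper : Function.Periodic (fun t => p t * deriv q t) T := fun t => by
    have : deriv q (t + T) = deriv q t := by
      rw [← deriv_comp_add_const, funext h.periodic_q]
    simp only [h.periodic_p t, this]
  rw [h.period_eq h', hq, hp]
  simp only [deriv_comp_add_const]
  rw [intervalIntegral.integral_comp_add_right (fun t => p t * deriv q t), zero_add,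
    add_comm T τ, hper.intervalIntegral_add_eq τ 0, zero_add]

/-- One closed orbit on which the map acts as a shift of time determines the rotation number. -/
theorem IsClosedOrbit.hasRotationNumber (h : IsClosedOrbit σ a C q p T) {T' : ℝ}
    (hT' : T' ∈ Ico 0 T) (hmap : ∀ t, octMap σ a (q t, p t) = (q (t + T'), p (t + T'))) :
    HasRotationNumber σ a C (T' / T) := by
  refine ⟨⟨q, p, T, h⟩, fun q₁ p₁ T₁ h₁ => ?_⟩
  obtain ⟨τ, hτ⟩ := h.exists_shift h₁
  rw [h.period_eq h₁]
  refine ⟨T', hT', fun t => ?_, rfl⟩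
  rw [(hτ t).1, (hτ t).2, (hτ _).1, (hτ _).2, hmap, add_right_comm]

/-- Changing the sign of `a` amounts to reflecting `p` and reversing time. -/
theorem IsClosedOrbit.reflect (h : IsClosedOrbit σ a C q p T) :
    IsClosedOrbit σ (-a) ((fun z : ℝ × ℝ => (z.1, -z.2)) '' C) (fun t => q (-t))
      (fun t => -p (-t)) T where
  period_pos := h.period_pos
  eq_q t := by
    have h1 := h.eq_q (-t)
    rw [(hasDerivAt_octInv_right σ _ _ _).deriv] at h1 ⊢
    exact (h1.scomp t (hasDerivAt_neg t)).congr_deriv (by simp only [smul_eq_mul]; ring)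
  eq_p t := by
    have h1 := h.eq_p (-t)
    rw [(hasDerivAt_octInv_left σ _ _ _).deriv] at h1 ⊢
    exact (h1.scomp t (hasDerivAt_neg t)).neg.congr_deriv (by simp only [smul_eq_mul]; ring)
  periodic_q t := by
    simp only [neg_add, ← sub_eq_add_neg, h.periodic_q.sub_eq]
  periodic_p t := by
    simp only [neg_add, ← sub_eq_add_neg, h.periodic_p.sub_eq]
  injOn := by
    intro s hs t ht hst
    simp only [Prod.mk.injEq, neg_inj] at hst
    have hz : ∀ s, (q (T - s), p (T - s)) = (q (-s), p (-s)) := fun s => by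
      rw [sub_eq_neg_add, h.periodic_q, h.periodic_p]
    have h0 : (q (-s), p (-s)) = (q (-t), p (-t)) := by rw [hst.1, hst.2]
    rcases eq_or_lt_of_le hs.1 with rfl | hs0 <;> rcases eq_or_lt_of_le ht.1 with rfl | ht0
    · rfl
    · exfalso
      rw [neg_zero, ← hz t] at h0
      have := h.injOn ⟨le_rfl, h.period_pos⟩ ⟨by linarith [ht.2], by linarith⟩ h0
      linarith [ht.2]
    · exfalso
      rw [neg_zero, ← hz s] at h0
      have := h.injOn ⟨by linarith [hs.2], by linarith⟩ ⟨le_rfl, h.period_pos⟩ h0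
      linarith [hs.2]
    · rw [← hz s, ← hz t] at h0
      have := h.injOn ⟨by linarith [hs.2], by linarith⟩ ⟨by linarith [ht.2], by linarith⟩ h0
      linarith
  range_eq := by
    rw [← h.range_eq, ← range_comp]
    have : (fun t => (q (-t), -p (-t)))
      = ((fun z : ℝ × ℝ => (z.1, -z.2)) ∘ fun t => (q t, p t)) ∘ Neg.neg := rfl
    rw [this]
    exact (Equiv.neg ℝ).surjective.range_comp _

/-- The action integral is the same on the reflected orbit. -/
theorem IsClosedOrbit.integral_reflect (h : IsClosedOrbit σ a C q p T) :
    ∫ t in (0 : ℝ)..T, (-p (-t)) * deriv (fun t => q (-t)) t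
      = ∫ t in (0 : ℝ)..T, p t * deriv q t := by
  have hper : Function.Periodic (fun t => p t * deriv q t) T := fun t => by
    have : deriv q (t + T) = deriv q t := by
      rw [← deriv_comp_add_const, funext h.periodic_q]
    simp only [h.periodic_p t, this]
  have h1 := intervalIntegral.integral_comp_neg (a := 0) (b := T) (fun t => p t * deriv q t)
  have h2 := hper.intervalIntegral_add_eq (-T) 0
  simp only [neg_add_cancel, zero_add] at h2
  rw [neg_zero, h2] at h1
  rw [← h1]
  refine intervalIntegral.integral_congr fun t _ => ?_
  simp only [deriv_comp_neg]
  ring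

end

section

/-! ### Lissajous curves as orbits -/

theorem range_comp_mul_left {α : Type*} {f : ℝ → α} {ω : ℝ} (hω : ω ≠ 0) :
    (range fun t => f (ω * t)) = range f :=
  Function.Surjective.range_comp (fun x => ⟨x / ω, mul_div_cancel₀ x hω⟩) f

/-- What is needed of a function `E` and a phase `η` for the rescaled curve
`(h E u, h E (u + η))` to be an orbit of the octupole with sign `σ` and parameter `2 α`: an
addition theorem for the shifts by `± η`, and a period on which `E` together with its derivative
is injective. -/
structure OctupolePhase (σ h α β η P : ℝ) (E E' : ℝ → ℝ) : Prop where
  hasDerivAt : ∀ u, HasDerivAt E (E' u) u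
  add : ∀ u, E (u + η) * (1 + σ * h ^ 2 * E u ^ 2) = α * E u + β * E' u
  sub : ∀ u, E (u - η) * (1 + σ * h ^ 2 * E u ^ 2) = α * E u - β * E' u
  denom_ne : ∀ u, 1 + σ * h ^ 2 * E u ^ 2 ≠ 0
  periodic : Function.Periodic E P
  inj : ∀ u ∈ Ico 0 P, ∀ v ∈ Ico 0 P, E u = E v → E' u = E' v → u = v
  period_pos : 0 < P
  beta_pos : 0 < β
  scale_ne : h ≠ 0

namespace OctupolePhase

variable {σ h α β η P : ℝ} {E E' : ℝ → ℝ} (H : OctupolePhase σ h α β η P E E')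
include H

theorem hasDerivAt_orbit (t : ℝ) :
    HasDerivAt (fun t => h * E (2 * β * t)) (h * (E' (2 * β * t) * (2 * β))) t := by
  have := ((H.hasDerivAt (2 * β * t)).comp t ((hasDerivAt_id t).const_mul (2 * β))).const_mul h
  exact this.congr_deriv (by ring)

theorem hasDerivAt_orbit_add (t : ℝ) :
    HasDerivAt (fun t => h * E (2 * β * t + η)) (h * (E' (2 * β * t + η) * (2 * β))) t := by
  have := ((H.hasDerivAt (2 * β * t + η)).comp t
    (((hasDerivAt_id t).const_mul (2 * β)).add_const η)).const_mul h
  exact this.congr_deriv (by ring)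

/-- The curve, run at speed `2 β`, solves Hamilton's equations: the equation for `q` is the addition
theorem for `u + η`, and the equation for `p` the one for `u - η`, taken at `u + η`. -/
theorem isClosedOrbit :
    IsClosedOrbit σ (2 * α) (range fun u => (h * E u, h * E (u + η)))
      (fun t => h * E (2 * β * t)) (fun t => h * E (2 * β * t + η)) (P / (2 * β)) where
  period_pos := div_pos H.period_pos (mul_pos two_pos H.beta_pos)
  eq_q t := by
    rw [(hasDerivAt_octInv_right _ _ _ _).deriv]
    refine (H.hasDerivAt_orbit t).congr_deriv ?_
    linear_combination -(2 * h) * H.add (2 * β * t)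
  eq_p t := by
    rw [(hasDerivAt_octInv_left _ _ _ _).deriv]
    refine (H.hasDerivAt_orbit_add t).congr_deriv ?_
    have := H.sub (2 * β * t + η)
    rw [add_sub_cancel_right] at this
    linear_combination (2 * h) * this
  periodic_q t := by
    have hβ := H.beta_pos
    have e : 2 * β * (t + P / (2 * β)) = 2 * β * t + P := by field_simp
    simp only [e, H.periodic (2 * β * t)]
  periodic_p t := by
    have hβ := H.beta_pos
    have e : 2 * β * (t + P / (2 * β)) + η = 2 * β * t + η + P := by field_simp; ring
    simp only [e, H.periodic (2 * β * t + η)]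
  injOn := by
    have hβ := H.beta_pos
    intro t ht t' ht' he
    simp only [Prod.mk.injEq, mul_right_inj' H.scale_ne] at he
    have a1 := H.add (2 * β * t)
    rw [he.1, he.2, H.add (2 * β * t')] at a1
    have hmem : ∀ t ∈ Ico 0 (P / (2 * β)), 2 * β * t ∈ Ico 0 P := fun t ht => by
      refine ⟨mul_nonneg (by positivity) ht.1, ?_⟩
      have := ht.2
      rw [lt_div_iff₀ (by positivity)] at this
      linarith
    have := H.inj _ (hmem t ht) _ (hmem t' ht') he.1
      (mul_left_cancel₀ hβ.ne' (by linarith))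
    exact mul_left_cancel₀ (mul_ne_zero two_ne_zero hβ.ne') this
  range_eq := range_comp_mul_left (f := fun u => (h * E u, h * E (u + η)))
    (mul_ne_zero two_ne_zero H.beta_pos.ne')

/-- The invariant is constant along the curve, by conservation of energy. -/
theorem octInv_eq (u : ℝ) :
    octInv σ (2 * α) (h * E u) (h * E (u + η)) = octInv σ (2 * α) (h * E 0) (h * E η) := by
  have hβ := H.beta_pos
  have hd : ∀ t, HasDerivAt
      (fun t => octInv σ (2 * α) (h * E (2 * β * t)) (h * E (2 * β * t + η))) 0 t := fun t => by
    have h1 := H.isClosedOrbit.eq_q t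
    have h2 := H.isClosedOrbit.eq_p t
    rw [(hasDerivAt_octInv_right _ _ _ _).deriv] at h1
    rw [(hasDerivAt_octInv_left _ _ _ _).deriv] at h2
    refine ((((h2.pow 2).sub ((h2.const_mul (2 * α)).mul h1)).add (h1.pow 2)).add
      (((h2.pow 2).mul (h1.pow 2)).const_mul σ)).congr_deriv ?_
    simp only [Pi.pow_apply]
    push_cast
    ring
  have hconst := is_const_of_deriv_eq_zero (fun t => (hd t).differentiableAt)
    (fun t => (hd t).deriv) (u / (2 * β)) 0
  simp only [mul_zero, zero_add] at hconst
  rwa [mul_div_cancel₀ _ (by positivity)] at hconst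

/-- Adding the two addition theorems, one step of the map is the shift `u ↦ u + η`. -/
theorem octMap_eq (u : ℝ) :
    octMap σ (2 * α) (h * E u, h * E (u + η)) = (h * E (u + η), h * E (u + η + η)) := by
  have hD := H.denom_ne (u + η)
  have h1 := H.add (u + η)
  have h2 := H.sub (u + η)
  rw [add_sub_cancel_right] at h2
  have e : 1 + σ * (h * E (u + η)) ^ 2 = 1 + σ * h ^ 2 * E (u + η) ^ 2 := by ring
  simp only [octMap, Prod.mk.injEq, true_and]
  rw [e]
  refine mul_right_cancel₀ hD ?_
  rw [add_mul, div_mul_cancel₀ _ hD]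
  linear_combination -h * h1 - h * h2

theorem hasRotationNumber (hη : η ∈ Ico 0 P) :
    HasRotationNumber σ (2 * α) (range fun u => (h * E u, h * E (u + η))) (η / P) := by
  have hβ := H.beta_pos
  have h := H.isClosedOrbit.hasRotationNumber (T' := η / (2 * β))
    ⟨div_nonneg hη.1 (by positivity), div_lt_div_of_pos_right hη.2 (by positivity)⟩
    fun t => by rw [H.octMap_eq, mul_add, mul_div_cancel₀ _ (by positivity)]
  rwa [div_div_div_cancel_right₀ (by positivity)] at h

theorem integral_eq :
    1 / (2 * Real.pi) * ∫ t in (0 : ℝ)..(P / (2 * β)),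
        h * E (2 * β * t + η) * deriv (fun t => h * E (2 * β * t)) t
      = h ^ 2 / (2 * Real.pi) * lissajousArea E P η := by
  have hβ := H.beta_pos
  have hsub := intervalIntegral.integral_comp_mul_left (a := 0)
    (b := P / (2 * β)) (c := 2 * β) (fun t => E (t + η) * deriv E t) (by positivity)
  rw [mul_zero, mul_div_cancel₀ _ (by positivity), smul_eq_mul] at hsub
  have hI : ∫ t in (0 : ℝ)..(P / (2 * β)),
      h * E (2 * β * t + η) * deriv (fun t => h * E (2 * β * t)) t
      = h ^ 2 * (2 * β) * ∫ t in (0 : ℝ)..(P / (2 * β)),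
          E (2 * β * t + η) * deriv E (2 * β * t) := by
    rw [← intervalIntegral.integral_const_mul]
    refine intervalIntegral.integral_congr fun t _ => ?_
    simp only [(H.hasDerivAt_orbit t).deriv, (H.hasDerivAt _).deriv]
    ring
  rw [lissajousArea, hI, hsub]
  field_simp

/-- Substituting `u = 2 β t` in the action integral gives the area of the Lissajous curve. -/
theorem hasAction :
    HasAction σ (2 * α) (range fun u => (h * E u, h * E (u + η)))
      (h ^ 2 / (2 * Real.pi) * lissajousArea E P η) :=
  H.integral_eq ▸ H.isClosedOrbit.hasAction

end OctupolePhase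

section
variable {k η : ℝ} (hk : k ^ 2 < 1)
include hk

/-- The defocusing octupole: here `√c = k sn² η` and `a / 2 = cn η dn η`. -/
theorem octupolePhase_jacSn (hk0 : k ≠ 0) (hs : 0 < jacSn η k) :
    OctupolePhase (-1) (k * jacSn η k) (jacCn η k * jacDn η k) (jacSn η k) η (4 * ellK k)
      (fun u => jacSn u k) (fun u => jacCn u k * jacDn u k) where
  hasDerivAt := hasDerivAt_jacSn hk
  add u := by linear_combination jacSn_add hk u η
  sub u := by
    have h := jacSn_add hk u (-η)
    rw [jacSn_neg hk, jacCn_neg hk, jacDn_neg hk] at h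
    rw [sub_eq_add_neg]
    linear_combination h
  denom_ne u := by
    have := (add_denom_pos hk u η).ne'
    contrapose! this
    linear_combination this
  periodic := jacSn_periodic hk
  inj u hu v hv h1 h2 := by
    have hd : jacDn u k = jacDn v k := by rw [jacDn, jacDn, h1]
    rw [hd, mul_left_inj' (jacDn_pos hk v).ne'] at h2
    exact eq_of_jacSn_eq_of_jacCn_eq hk h1 h2 hu hv
  period_pos := mul_pos four_pos (ellK_pos hk)
  beta_pos := hs
  scale_ne := mul_ne_zero hk0 hs.ne'

theorem one_add_sq_mul_jacCn_sq (u : ℝ) :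
    (1 + 1 * (k * jacSn η k / jacDn η k) ^ 2 * jacCn u k ^ 2) * jacDn η k ^ 2
      = 1 - k ^ 2 * jacSn u k ^ 2 * jacSn η k ^ 2 := by
  have hd := (jacDn_pos hk η).ne'
  have hd2 := jacDn_sq hk η
  rw [jacCn_sq]
  field_simp
  linear_combination hd2

/-- The focusing octupole: here `a / 2 = cn η / dn² η`. -/
theorem octupolePhase_jacCn (hk0 : k ≠ 0) (hs : 0 < jacSn η k) :
    OctupolePhase 1 (k * jacSn η k / jacDn η k) (jacCn η k / jacDn η k ^ 2)
      (jacSn η k / jacDn η k) η (4 * ellK k)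
      (fun u => jacCn u k) (fun u => -jacSn u k * jacDn u k) where
  hasDerivAt := hasDerivAt_jacCn hk
  add u := by
    have hd := (jacDn_pos hk η).ne'
    refine mul_right_cancel₀ (pow_ne_zero 2 hd) ?_
    rw [mul_assoc, one_add_sq_mul_jacCn_sq hk, jacCn_add hk]
    field_simp
    ring
  sub u := by
    have hd := (jacDn_pos hk η).ne'
    have h := jacCn_add hk u (-η)
    rw [jacSn_neg hk, jacCn_neg hk, jacDn_neg hk, neg_sq] at h
    refine mul_right_cancel₀ (pow_ne_zero 2 hd) ?_
    rw [mul_assoc, one_add_sq_mul_jacCn_sq hk, sub_eq_add_neg, h]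
    field_simp
  denom_ne u := by positivity
  periodic := jacCn_periodic hk
  inj u hu v hv h1 h2 := by
    have hsq : jacSn u k ^ 2 = jacSn v k ^ 2 := by
      have e1 := jacCn_sq (k := k) u
      have e2 := jacCn_sq (k := k) v
      rw [h1] at e1
      linarith
    have hd : jacDn u k = jacDn v k := by rw [jacDn, jacDn, hsq]
    rw [hd, mul_left_inj' (jacDn_pos hk v).ne', neg_inj] at h2
    exact eq_of_jacSn_eq_of_jacCn_eq hk h2 h1 hu hv
  period_pos := mul_pos four_pos (ellK_pos hk)
  beta_pos := div_pos hs (jacDn_pos hk η)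
  scale_ne := div_ne_zero (mul_ne_zero hk0 hs.ne') (jacDn_pos hk η).ne'

theorem one_add_sq_mul_jacDn_sq (hc : jacCn η k ≠ 0) (u : ℝ) :
    (1 + 1 * (jacSn η k / jacCn η k) ^ 2 * jacDn u k ^ 2) * jacCn η k ^ 2
      = 1 - k ^ 2 * jacSn u k ^ 2 * jacSn η k ^ 2 := by
  have hc2 := jacCn_sq (k := k) η
  rw [jacDn_sq hk]
  field_simp
  linear_combination hc2

/-- The Duffing regime: here `a / 2 = dn η / cn² η`. -/
theorem octupolePhase_jacDn (hk0 : k ≠ 0) (hs : 0 < jacSn η k) (hc : 0 < jacCn η k) :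
    OctupolePhase 1 (jacSn η k / jacCn η k) (jacDn η k / jacCn η k ^ 2)
      (jacSn η k / jacCn η k) η (2 * ellK k)
      (fun u => jacDn u k) (fun u => -(k ^ 2) * jacSn u k * jacCn u k) where
  hasDerivAt := hasDerivAt_jacDn hk
  add u := by
    refine mul_right_cancel₀ (pow_ne_zero 2 hc.ne') ?_
    rw [mul_assoc, one_add_sq_mul_jacDn_sq hk hc.ne', jacDn_add hk]
    field_simp
    ring
  sub u := by
    have h := jacDn_add hk u (-η)
    rw [jacSn_neg hk, jacCn_neg hk, jacDn_neg hk, neg_sq] at h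
    refine mul_right_cancel₀ (pow_ne_zero 2 hc.ne') ?_
    rw [mul_assoc, one_add_sq_mul_jacDn_sq hk hc.ne', sub_eq_add_neg, h]
    field_simp
  denom_ne u := by positivity
  periodic := jacDn_periodic hk
  inj u hu v hv h1 h2 := by
    have hsq : jacSn u k ^ 2 = jacSn v k ^ 2 := by
      have e1 := jacDn_sq hk u
      have e2 := jacDn_sq hk v
      rw [h1] at e1
      exact mul_left_cancel₀ (pow_ne_zero 2 hk0) (by linarith)
    have hsc : jacSn u k * jacCn u k = jacSn v k * jacCn v k :=
      mul_left_cancel₀ (neg_ne_zero.2 (pow_ne_zero 2 hk0)) (by linarith)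
    have hK := ellK_pos hk
    -- Up to the common shift by `2 K` the pair `(sn, cn)` is determined up to its sign.
    have hcsq : jacCn u k ^ 2 = jacCn v k ^ 2 := by rw [jacCn_sq, jacCn_sq, hsq]
    have key : (jacSn u k = jacSn v k ∧ jacCn u k = jacCn v k) ∨
        (jacSn u k = -jacSn v k ∧ jacCn u k = -jacCn v k) := by
      rcases sq_eq_sq_iff_eq_or_eq_neg.1 hsq with e1 | e1 <;>
      rcases sq_eq_sq_iff_eq_or_eq_neg.1 hcsq with e2 | e2
      · exact Or.inl ⟨e1, e2⟩
      · rw [e1, e2] at hsc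
        rcases mul_eq_zero.1 (show jacSn v k * jacCn v k = 0 by linarith) with e3 | e3
        · exact Or.inr ⟨by rw [e1, e3, neg_zero], e2⟩
        · exact Or.inl ⟨e1, by rw [e2, e3, neg_zero]⟩
      · rw [e1, e2] at hsc
        rcases mul_eq_zero.1 (show jacSn v k * jacCn v k = 0 by linarith) with e3 | e3
        · exact Or.inl ⟨by rw [e1, e3, neg_zero], e2⟩
        · exact Or.inr ⟨e1, by rw [e2, e3, neg_zero]⟩
      · exact Or.inr ⟨e1, e2⟩
    rcases key with ⟨e1, e2⟩ | ⟨e1, e2⟩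
    · exact eq_of_jacSn_eq_of_jacCn_eq hk e1 e2 ⟨hu.1, by linarith [hu.2]⟩
        ⟨hv.1, by linarith [hv.2]⟩
    · rw [← jacSn_add_two_ellK hk] at e1
      rw [← jacCn_add_two_ellK hk] at e2
      have := eq_of_jacSn_eq_of_jacCn_eq hk e1 e2 ⟨hu.1, by linarith [hu.2]⟩
        ⟨by linarith [hv.1], by linarith [hv.2]⟩
      linarith [hu.2, hv.1]
  period_pos := mul_pos two_pos (ellK_pos hk)
  beta_pos := div_pos hs hc
  scale_ne := div_ne_zero hs.ne' hc.ne'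

end

end

/-! ### Level sets of the invariant -/

/-- Completing the square in `p`. -/
theorem octInv_eq_iff_sq (σ α q p c : ℝ) (hD : 1 + σ * q ^ 2 ≠ 0) :
    octInv σ (2 * α) q p = c ↔
      ((1 + σ * q ^ 2) * p - α * q) ^ 2 = α ^ 2 * q ^ 2 - (1 + σ * q ^ 2) * (q ^ 2 - c) := by
  have e : ((1 + σ * q ^ 2) * p - α * q) ^ 2 - (α ^ 2 * q ^ 2 - (1 + σ * q ^ 2) * (q ^ 2 - c))
      = (1 + σ * q ^ 2) * (octInv σ (2 * α) q p - c) := by rw [octInv]; ring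
  rw [← sub_eq_zero (b := c), ← sub_eq_zero (b := α ^ 2 * q ^ 2 - _), e, mul_eq_zero]
  simp [hD]

/-- A point of the level set whose abscissa is attained by the curve lies on the curve: its
ordinate is one of the two roots `h E (u ± η)` of a quadratic equation. -/
theorem OctupolePhase.mem_range {σ h α β η P : ℝ} {E E' : ℝ → ℝ}
    (H : OctupolePhase σ h α β η P E E') {u₀ : ℝ} (hrefl : ∀ u, E (u₀ - u) = E u) {q p : ℝ}
    (hq : ∃ u, q = h * E u)
    (hz : octInv σ (2 * α) q p = octInv σ (2 * α) (h * E 0) (h * E η)) :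
    (q, p) ∈ range fun u => (h * E u, h * E (u + η)) := by
  obtain ⟨u, rfl⟩ := hq
  have h1 := H.octInv_eq u
  rw [← hz] at h1
  have hD := H.denom_ne u
  have ha := H.add u
  have hs := H.sub u
  have hprod : (1 + σ * h ^ 2 * E u ^ 2) * ((p - h * E (u + η)) * (p - h * E (u - η))) = 0 := by
    simp only [octInv] at h1
    linear_combination -h1 + (-h * p + h ^ 2 * E (u + η)) * (ha + hs)
  rcases mul_eq_zero.1 ((mul_eq_zero.1 hprod).resolve_left hD) with h2 | h2
  · exact ⟨u, by rw [sub_eq_zero] at h2; rw [h2]⟩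
  · refine ⟨u₀ - u, ?_⟩
    rw [sub_eq_zero] at h2
    simp only [hrefl, h2, show u₀ - u + η = u₀ - (u - η) by ring]

theorem OctupolePhase.octInv_of_mem_range {σ h α β η P : ℝ} {E E' : ℝ → ℝ}
    (H : OctupolePhase σ h α β η P E E') {z : ℝ × ℝ}
    (hz : z ∈ range fun u => (h * E u, h * E (u + η))) :
    octInv σ (2 * α) z.1 z.2 = octInv σ (2 * α) (h * E 0) (h * E η) := by
  obtain ⟨u, rfl⟩ := hz
  exact H.octInv_eq u

/-- On the lines through the saddles the invariant is at least its value at the saddles. -/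
theorem sq_le_octInv_of_sq_eq {α q p : ℝ} (hq : q ^ 2 = 1 - |α|) :
    (|α| - 1) ^ 2 ≤ octInv (-1) (2 * α) q p := by
  have h1 : α ^ 2 = |α| ^ 2 := (sq_abs α).symm
  have e : octInv (-1) (2 * α) q p = |α| * p ^ 2 - 2 * α * (p * q) + (1 - |α|) := by
    rw [octInv]
    linear_combination (1 - p ^ 2) * hq
  rw [e]
  rcases abs_cases α with ⟨h2, h3⟩ | ⟨h2, h3⟩
  · rw [h2] at hq ⊢
    nlinarith [mul_nonneg h3 (sq_nonneg (p - q))]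
  · rw [h2] at hq ⊢
    nlinarith [mul_nonneg (neg_pos.2 h3).le (sq_nonneg (p + q))]

/-- The component of the origin lies between the vertical lines through the saddles. -/
theorem sq_lt_of_mem_connectedComponentIn {α : ℝ} (hα : |α| < 1) {z : ℝ × ℝ}
    (hz : z ∈ connectedComponentIn
      {w : ℝ × ℝ | octInv (-1) (2 * α) w.1 w.2 < (|α| - 1) ^ 2} (0, 0)) :
    z.1 ^ 2 < 1 - |α| := by
  set S := {w : ℝ × ℝ | octInv (-1) (2 * α) w.1 w.2 < (|α| - 1) ^ 2} with hS
  have h0 : ((0, 0) : ℝ × ℝ) ∈ S := by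
    simp only [hS, mem_ofPred_eq, octInv]
    have : 0 < (|α| - 1) ^ 2 := by
      have : |α| - 1 ≠ 0 := by linarith
      positivity
    simpa using this
  have hpre := (isPreconnected_connectedComponentIn (F := S) (x := (0, 0))).image
    (fun w : ℝ × ℝ => w.1 ^ 2) (by fun_prop)
  by_contra! hge
  have hmem := hpre.ordConnected.out ⟨(0, 0), mem_connectedComponentIn h0, rfl⟩ ⟨z, hz, rfl⟩
    (show 1 - |α| ∈ _ from ⟨by simp; linarith, hge⟩)
  obtain ⟨w, hw, hw2⟩ := hmem
  have hwS := connectedComponentIn_subset _ _ hw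
  exact absurd hwS (not_lt.2 (sq_le_octInv_of_sq_eq hw2))

/-- Inside the square cut out by the saddles the invariant increases along rays. -/
theorem mem_connectedComponentIn_of_sq_le {α q p : ℝ}
    (hq : q ^ 2 ≤ 1 - |α|) (hp : p ^ 2 ≤ 1 - |α|)
    (hz : octInv (-1) (2 * α) q p < (|α| - 1) ^ 2) :
    (q, p) ∈ connectedComponentIn
      {w : ℝ × ℝ | octInv (-1) (2 * α) w.1 w.2 < (|α| - 1) ^ 2} (0, 0) := by
  have hsub : segment ℝ ((0, 0) : ℝ × ℝ) (q, p)
      ⊆ {w : ℝ × ℝ | octInv (-1) (2 * α) w.1 w.2 < (|α| - 1) ^ 2} := by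
    rw [segment_eq_image]
    rintro _ ⟨t, ht, rfl⟩
    simp only [mem_ofPred_eq, Prod.smul_mk, smul_eq_mul, mul_zero, Prod.mk_add_mk, zero_add]
    refine lt_of_le_of_lt ?_ hz
    have hX : (1 - |α|) * (q ^ 2 + p ^ 2) ≤ q ^ 2 + p ^ 2 - 2 * α * (p * q) := by
      rcases abs_cases α with ⟨h2, h3⟩ | ⟨h2, h3⟩
      · rw [h2]; nlinarith [mul_nonneg h3 (sq_nonneg (p - q))]
      · rw [h2]; nlinarith [mul_nonneg (neg_pos.2 h3).le (sq_nonneg (p + q))]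
    have hY : 2 * (q ^ 2 * p ^ 2) ≤ (1 - |α|) * (q ^ 2 + p ^ 2) := by
      nlinarith [mul_nonneg (sq_nonneg q) (sub_nonneg.2 hp),
        mul_nonneg (sq_nonneg p) (sub_nonneg.2 hq)]
    have hs0 : 0 ≤ 1 - t ^ 2 := by nlinarith [ht.1, ht.2]
    have hYn : 0 ≤ q ^ 2 * p ^ 2 := by positivity
    have e : octInv (-1) (2 * α) q p - octInv (-1) (2 * α) (t * q) (t * p)
        = (1 - t ^ 2) * ((q ^ 2 + p ^ 2 - 2 * α * (p * q)) - 2 * (q ^ 2 * p ^ 2)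
          + (1 - t ^ 2) * (q ^ 2 * p ^ 2)) := by
      simp only [octInv]; ring
    have : 0 ≤ (1 - t ^ 2) * ((q ^ 2 + p ^ 2 - 2 * α * (p * q)) - 2 * (q ^ 2 * p ^ 2)
          + (1 - t ^ 2) * (q ^ 2 * p ^ 2)) :=
      mul_nonneg hs0 (add_nonneg (by linarith) (mul_nonneg hs0 hYn))
    linarith
  exact (convex_segment _ _).isPreconnected.subset_connectedComponentIn
    (left_mem_segment ℝ _ _) hsub (right_mem_segment ℝ _ _)

section
variable {k η : ℝ} (hk : k ^ 2 < 1)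
include hk

theorem jacSn_surjOn {x : ℝ} (hx : x ^ 2 ≤ 1) : ∃ u, jacSn u k = x :=
  ⟨ellF (Real.arcsin x) k, by
    have := abs_le.1 (sq_le_one_iff_abs_le_one x |>.1 hx)
    rw [jacSn, jacAm_ellF hk, Real.sin_arcsin this.1 this.2]⟩

theorem jacCn_surjOn {x : ℝ} (hx : x ^ 2 ≤ 1) : ∃ u, jacCn u k = x :=
  ⟨ellF (Real.arccos x) k, by
    have := abs_le.1 (sq_le_one_iff_abs_le_one x |>.1 hx)
    rw [jacCn, jacAm_ellF hk, Real.cos_arccos this.1 this.2]⟩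

theorem jacDn_surjOn (hk0 : k ≠ 0) {x : ℝ} (hx : 1 - k ^ 2 ≤ x ^ 2) (hx1 : x ^ 2 ≤ 1)
    (hx0 : 0 < x) : ∃ u, jacDn u k = x := by
  have hkk : 0 < k ^ 2 := by positivity
  obtain ⟨u, hu⟩ := jacSn_surjOn hk (x := √((1 - x ^ 2) / k ^ 2)) (by
    rw [Real.sq_sqrt (div_nonneg (by linarith) hkk.le), div_le_one hkk]; linarith)
  refine ⟨u, ?_⟩
  rw [jacDn, hu, Real.sq_sqrt (div_nonneg (by linarith) hkk.le), mul_div_cancel₀ _ hkk.ne',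
    sub_sub_cancel, Real.sqrt_sq hx0.le]

/-- The curve around the origin of the defocusing octupole is the elliptic sine curve. -/
theorem curveDO_eq_range (hk0 : 0 < k) (hs : 0 < jacSn η k) {α c : ℝ}
    (hα : jacCn η k * jacDn η k = α) (hα1 : |α| < 1) (hc : c = k ^ 2 * jacSn η k ^ 4)
    (hc1 : c < (|α| - 1) ^ 2) :
    curveDO (2 * α) c
      = range fun u => (k * jacSn η k * jacSn u k, k * jacSn η k * jacSn (u + η) k) := by
  have H := octupolePhase_jacSn hk hk0.ne' hs
  have hE : octInv (-1) (2 * α) (k * jacSn η k * jacSn 0 k) (k * jacSn η k * jacSn η k) = c := by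
    rw [hc, octInv, jacSn_zero hk]; ring
  have hA : α ^ 2 = (1 - jacSn η k ^ 2) * (1 - k ^ 2 * jacSn η k ^ 2) := by
    rw [← hα, mul_pow, jacCn_sq, jacDn_sq hk]
  have hs1 := jacSn_sq_le_one (k := k) η
  rw [hα] at H
  have hmem := fun q p h1 h2 => H.mem_range (jacSn_two_ellK_sub hk) (q := q) (p := p) h1
    (Eq.trans h2 hE.symm)
  have hinv := fun z hz => (H.octInv_of_mem_range (z := z) hz).trans hE
  clear hE H hα
  generalize jacSn η k = s at *
  have ha2 : α ^ 2 = |α| ^ 2 := (sq_abs α).symm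
  have hks : 0 < k ^ 2 * s ^ 2 := by positivity
  -- the discriminant has the roots `k ^ 2 * s ^ 2` and `s ^ 2`, which the saddles separate
  have hroot : (1 - |α| - k ^ 2 * s ^ 2) * (s ^ 2 - (1 - |α|)) = |α| * ((1 - |α|) ^ 2 - c) := by
    rw [hc]
    have : |α| ^ 2 = (1 - s ^ 2) * (1 - k ^ 2 * s ^ 2) := by rw [← ha2, hA]
    linear_combination (1 - |α|) * this
  have hkk : k ^ 2 * s ^ 2 < s ^ 2 := by nlinarith [pow_pos hs 2]
  have hbox : k ^ 2 * s ^ 2 ≤ 1 - |α| ∧ 1 - |α| ≤ s ^ 2 := by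
    have hpos : 0 ≤ (1 - |α| - k ^ 2 * s ^ 2) * (s ^ 2 - (1 - |α|)) := by
      rw [hroot]; exact mul_nonneg (abs_nonneg _) (by nlinarith)
    constructor
    · by_contra! h
      have := mul_neg_of_neg_of_pos (sub_neg.2 h) (show 0 < s ^ 2 - (1 - |α|) by linarith)
      linarith
    · by_contra! h
      have := mul_neg_of_pos_of_neg (show 0 < 1 - |α| - k ^ 2 * s ^ 2 by linarith) (sub_neg.2 h)
      linarith
  ext ⟨q, p⟩
  have e2 : 2 * α / 2 = α := by ring
  simp only [curveDO, mem_ofPred_eq, e2]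
  constructor
  · rintro ⟨hcomp, hz⟩
    have hq := sq_lt_of_mem_connectedComponentIn hα1 hcomp
    simp only at hq
    refine hmem q p ?_ hz
    have hD : 1 + -1 * q ^ 2 ≠ 0 := by have := abs_nonneg α; nlinarith
    have hsq := (octInv_eq_iff_sq (-1) α q p c hD).1 hz
    have hdisc : 0 ≤ (q ^ 2 - k ^ 2 * s ^ 2) * (q ^ 2 - s ^ 2) := by
      have h1 : (q ^ 2 - k ^ 2 * s ^ 2) * (q ^ 2 - s ^ 2)
          = α ^ 2 * q ^ 2 - (1 + -1 * q ^ 2) * (q ^ 2 - c) := by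
        rw [hc, hA]; ring
      rw [h1, ← hsq]; positivity
    have hq2 : q ^ 2 ≤ k ^ 2 * s ^ 2 := by
      by_contra! h
      have := mul_neg_of_pos_of_neg (sub_pos.2 h) (show q ^ 2 - s ^ 2 < 0 by linarith [hbox.2])
      linarith
    obtain ⟨u, hu⟩ := jacSn_surjOn hk (x := q / (k * s)) (by
      rw [div_pow, mul_pow, div_le_one hks]; exact hq2)
    exact ⟨u, by rw [hu]; field_simp⟩
  · intro hz
    have hi := hinv _ hz
    refine ⟨?_, hi⟩
    obtain ⟨u, hu⟩ := hz
    simp only [Prod.mk.injEq] at hu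
    have hle : ∀ v, (k * s * jacSn v k) ^ 2 ≤ 1 - |α| := fun v => by
      have := jacSn_sq_le_one (k := k) v
      have e : (k * s * jacSn v k) ^ 2 = k ^ 2 * s ^ 2 * jacSn v k ^ 2 := by ring
      rw [e]
      nlinarith [hbox.1]
    refine mem_connectedComponentIn_of_sq_le (hu.1 ▸ hle _) (hu.2 ▸ hle _) ?_
    simp only at hi
    rw [hi]; exact hc1

/-- The curve around the origin of the focusing octupole is the elliptic cosine curve. -/
theorem curveFO_eq_range (hk0 : 0 < k) (hs : 0 < jacSn η k) {α c : ℝ}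
    (hα : jacCn η k / jacDn η k ^ 2 = α)
    (hc : c = k ^ 2 * (1 - k ^ 2) * jacSn η k ^ 4 / jacDn η k ^ 4) :
    curveFO (2 * α) c = range fun u =>
      (k * jacSn η k / jacDn η k * jacCn u k, k * jacSn η k / jacDn η k * jacCn (u + η) k) := by
  have H := octupolePhase_jacCn hk hk0.ne' hs
  have hd := jacDn_pos hk η
  have hd2 := jacDn_sq hk η
  have hc2 := jacCn_sq (k := k) η
  have hA : α ^ 2 * jacDn η k ^ 4 = 1 - jacSn η k ^ 2 := by
    rw [← hα, ← hc2]; field_simp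
  have hc0 : c * jacDn η k ^ 4 = k ^ 2 * (1 - k ^ 2) * jacSn η k ^ 4 := by
    rw [hc]; field_simp
  have hE : octInv 1 (2 * α) (k * jacSn η k / jacDn η k * jacCn 0 k)
      (k * jacSn η k / jacDn η k * jacCn η k) = c := by
    rw [hc, octInv, jacCn_zero hk, ← hα]
    field_simp
    generalize jacSn η k = s at *
    generalize jacCn η k = x at *
    generalize jacDn η k = d at *
    clear H hα hA hc0 hc
    grind
  rw [hα] at H
  have hmem := fun q p h1 h2 => H.mem_range (u₀ := 0) (fun u => by rw [zero_sub, jacCn_neg hk])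
    (q := q) (p := p) h1 (Eq.trans h2 hE.symm)
  have hinv := fun z hz => (H.octInv_of_mem_range (z := z) hz).trans hE
  clear hE H hα hc hc2
  generalize jacSn η k = s at *
  generalize jacDn η k = d at *
  ext ⟨q, p⟩
  simp only [curveFO, mem_ofPred_eq]
  refine ⟨fun hz => hmem q p ?_ hz, fun hz => hinv _ hz⟩
  have hsq := (octInv_eq_iff_sq 1 α q p c (by positivity)).1 hz
  have h1 : (d ^ 2 * q ^ 2 - k ^ 2 * s ^ 2) * (d ^ 2 * q ^ 2 + (1 - k ^ 2) * s ^ 2)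
      = -(d ^ 4 * (α ^ 2 * q ^ 2 - (1 + 1 * q ^ 2) * (q ^ 2 - c))) := by
    linear_combination q ^ 2 * hA + (1 + q ^ 2) * hc0
      - q ^ 2 * (d ^ 2 + 1 - s ^ 2 + k ^ 2 * s ^ 2) * hd2
  have h2 : (d ^ 2 * q ^ 2 - k ^ 2 * s ^ 2) * (d ^ 2 * q ^ 2 + (1 - k ^ 2) * s ^ 2) ≤ 0 := by
    rw [h1, ← hsq, neg_nonpos]; positivity
  have h3 : 0 < d ^ 2 * q ^ 2 + (1 - k ^ 2) * s ^ 2 := by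
    have : 0 < 1 - k ^ 2 := by linarith
    positivity
  have hq2 : d ^ 2 * q ^ 2 ≤ k ^ 2 * s ^ 2 := by
    have := nonpos_of_mul_nonpos_left h2 h3
    linarith
  obtain ⟨u, hu⟩ := jacCn_surjOn hk (x := q * d / (k * s)) (by
    rw [div_pow, mul_pow, mul_pow, div_le_one (by positivity)]; linarith)
  exact ⟨u, by rw [hu]; field_simp⟩

/-- The lobe `q > 0` of the figure-eight in the Duffing regime is the delta amplitude curve. -/
theorem curveDf_one_eq_range (hk0 : 0 < k) (hs : 0 < jacSn η k) (hx : 0 < jacCn η k) {α c : ℝ}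
    (hα : jacDn η k / jacCn η k ^ 2 = α)
    (hc : c = -((1 - k ^ 2) * jacSn η k ^ 4 / jacCn η k ^ 4)) :
    curveDf (2 * α) 1 c = range fun u =>
      (jacSn η k / jacCn η k * jacDn u k, jacSn η k / jacCn η k * jacDn (u + η) k) := by
  have H := octupolePhase_jacDn hk hk0.ne' hs hx
  have hd2 := jacDn_sq hk η
  have hc2 := jacCn_sq (k := k) η
  have hA : α ^ 2 * jacCn η k ^ 4 = 1 - k ^ 2 * jacSn η k ^ 2 := by
    rw [← hα, ← hd2]; field_simp
  have hc0 : c * jacCn η k ^ 4 = -((1 - k ^ 2) * jacSn η k ^ 4) := by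
    rw [hc]; field_simp
  have hE : octInv 1 (2 * α) (jacSn η k / jacCn η k * jacDn 0 k)
      (jacSn η k / jacCn η k * jacDn η k) = c := by
    rw [hc, octInv, jacDn_zero hk, ← hα]
    field_simp
    generalize jacSn η k = s at *
    generalize jacCn η k = x at *
    generalize jacDn η k = d at *
    clear H hα hA hc0 hc
    grind
  rw [hα] at H
  have hpos : ∀ z ∈ range fun u => (jacSn η k / jacCn η k * jacDn u k,
      jacSn η k / jacCn η k * jacDn (u + η) k), 0 < z.1 := by
    rintro _ ⟨u, rfl⟩
    exact mul_pos (div_pos hs hx) (jacDn_pos hk u)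
  have hmem := fun q p h1 h2 => H.mem_range (u₀ := 0) (fun u => by rw [zero_sub, jacDn_neg hk])
    (q := q) (p := p) h1 (Eq.trans h2 hE.symm)
  have hinv := fun z hz => (H.octInv_of_mem_range (z := z) hz).trans hE
  clear hE H hα hc hd2
  generalize jacSn η k = s at *
  generalize jacCn η k = x at *
  ext ⟨q, p⟩
  simp only [curveDf, mem_ofPred_eq, one_mul]
  refine ⟨fun ⟨hz, hq⟩ => hmem q p ?_ hz, fun hz => ⟨hinv _ hz, hpos _ hz⟩⟩
  have hsq := (octInv_eq_iff_sq 1 α q p c (by positivity)).1 hz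
  have h1 : (x ^ 2 * q ^ 2 - s ^ 2) * (x ^ 2 * q ^ 2 - (1 - k ^ 2) * s ^ 2)
      = -(x ^ 4 * (α ^ 2 * q ^ 2 - (1 + 1 * q ^ 2) * (q ^ 2 - c))) := by
    linear_combination q ^ 2 * hA + (1 + q ^ 2) * hc0
      - q ^ 2 * (x ^ 2 + 1 + (1 - k ^ 2) * s ^ 2) * hc2
  have h2 : (x ^ 2 * q ^ 2 - s ^ 2) * (x ^ 2 * q ^ 2 - (1 - k ^ 2) * s ^ 2) ≤ 0 := by
    rw [h1, ← hsq, neg_nonpos]; positivity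
  have h3 : (1 - k ^ 2) * s ^ 2 < s ^ 2 := by nlinarith [pow_pos hk0 2, pow_pos hs 2]
  have h4 : x ^ 2 * q ^ 2 ≤ s ^ 2 := by
    by_contra! h
    have := mul_pos (sub_pos.2 h)
      (show 0 < x ^ 2 * q ^ 2 - (1 - k ^ 2) * s ^ 2 by linarith)
    linarith
  have h5 : (1 - k ^ 2) * s ^ 2 ≤ x ^ 2 * q ^ 2 := by
    by_contra! h
    have := mul_pos_of_neg_of_neg (show x ^ 2 * q ^ 2 - s ^ 2 < 0 by linarith) (sub_neg.2 h)
    linarith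
  have e : (q * x / s) ^ 2 = x ^ 2 * q ^ 2 / s ^ 2 := by ring
  obtain ⟨u, hu⟩ := jacDn_surjOn hk hk0.ne' (x := q * x / s)
    (by rw [e, le_div_iff₀ (by positivity)]; exact h5)
    (by rw [e, div_le_one (by positivity)]; exact h4) (by positivity)
  exact ⟨u, by rw [hu]; field_simp⟩

end

/-! ### Modulus and phase from the value of the invariant -/

theorem arcNs_spec {k x : ℝ} (hk : k ^ 2 < 1) (hx : 1 ≤ x) :
    arcNs x k ∈ Ioc 0 (ellK k) ∧ jacNs (arcNs x k) k = x := by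
  obtain ⟨u, hu, hux⟩ := exists_jacSn_eq hk (x := 1 / x)
    ⟨by positivity, by rw [div_le_one (by linarith)]; exact hx⟩
  have h : ∃ u ∈ Ioc 0 (ellK k), jacNs u k = x := ⟨u, hu, by rw [jacNs, hux, one_div_one_div]⟩
  exact ⟨Function.invFunOn_mem h, Function.invFunOn_eq h⟩

theorem arcDs_spec {k x : ℝ} (hk : k ^ 2 < 1) (hx0 : 0 < x) (hx : 1 - k ^ 2 ≤ x ^ 2) :
    arcDs x k ∈ Ioc 0 (ellK k) ∧ jacDs (arcDs x k) k = x := by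
  have hkx : 1 ≤ k ^ 2 + x ^ 2 := by linarith
  have hsq : √(1 / (k ^ 2 + x ^ 2)) ^ 2 = 1 / (k ^ 2 + x ^ 2) := Real.sq_sqrt (by positivity)
  obtain ⟨u, hu, hux⟩ := exists_jacSn_eq hk (x := √(1 / (k ^ 2 + x ^ 2)))
    ⟨by positivity, Real.sqrt_le_one.2 ((div_le_one (by positivity)).2 hkx)⟩
  have h : ∃ u ∈ Ioc 0 (ellK k), jacDs u k = x := by
    refine ⟨u, hu, ?_⟩
    have hs := jacSn_pos_of_mem hk hu
    have hd := jacDn_pos hk u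
    refine (sq_eq_sq₀ (div_nonneg hd.le hs.le) hx0.le).1 ?_
    rw [div_pow, jacDn_sq hk, hux, hsq]
    field_simp
    ring
  exact ⟨Function.invFunOn_mem h, Function.invFunOn_eq h⟩

theorem arcCs_spec {k x : ℝ} (hk : k ^ 2 < 1) (hx0 : 0 < x) :
    arcCs x k ∈ Ioo 0 (ellK k) ∧ jacCs (arcCs x k) k = x := by
  have hsq : √(1 / (1 + x ^ 2)) ^ 2 = 1 / (1 + x ^ 2) := Real.sq_sqrt (by positivity)
  obtain ⟨u, hu, hux⟩ := exists_jacSn_eq hk (x := √(1 / (1 + x ^ 2)))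
    ⟨by positivity, Real.sqrt_le_one.2 ((div_le_one (by positivity)).2 (by nlinarith))⟩
  have h : ∃ u ∈ Ioc 0 (ellK k), jacCs u k = x := by
    refine ⟨u, hu, ?_⟩
    have hs := jacSn_pos_of_mem hk hu
    have hd := jacCn_nonneg_of_mem hk hu
    refine (sq_eq_sq₀ (div_nonneg hd hs.le) hx0.le).1 ?_
    rw [div_pow, jacCn_sq, hux, hsq]
    field_simp
    ring
  have h1 : arcCs x k ∈ Ioc 0 (ellK k) := Function.invFunOn_mem h
  have h2 : jacCs (arcCs x k) k = x := Function.invFunOn_eq h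
  refine ⟨⟨h1.1, lt_of_le_of_ne h1.2 fun he => ?_⟩, h2⟩
  rw [he, jacCs, jacCn_ellK hk, zero_div] at h2
  exact hx0.ne h2

theorem rpow_quarter_sq {c : ℝ} (hc : 0 ≤ c) : (c ^ ((1 : ℝ) / 4)) ^ 2 = √c := by
  rw [← Real.rpow_natCast, ← Real.rpow_mul hc, Real.sqrt_eq_rpow]
  norm_num

/-- The phase `η` has the same `sn` as `η₊`, and the sign of its `cn` is that of `a`. -/
theorem phase_spec {k ηp : ℝ} (hk : k ^ 2 < 1) (h : ηp ∈ Ioc 0 (ellK k)) (a : ℝ) :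
    jacSn (phase a k ηp) k = jacSn ηp k ∧ jacDn (phase a k ηp) k = jacDn ηp k ∧
      jacCn (phase a k ηp) k = (if 0 ≤ a then 1 else -1) * jacCn ηp k ∧
      phase a k ηp ∈ Ioo 0 (2 * ellK k) := by
  have hK := ellK_pos hk
  rw [phase]
  split_ifs
  · exact ⟨rfl, rfl, (one_mul _).symm, h.1, by linarith [h.2]⟩
  · exact ⟨jacSn_two_ellK_sub hk _, jacDn_two_ellK_sub hk _,
      by rw [jacCn_two_ellK_sub hk, neg_one_mul], by linarith [h.2], by linarith [h.1]⟩

theorem eq_of_sign_mul {a α x : ℝ} (hα : α = a / 2) (hx : 0 ≤ x) (h : x ^ 2 = α ^ 2) :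
    (if 0 ≤ a then 1 else -1) * x = α := by
  split_ifs with h0
  · rw [one_mul]
    exact (sq_eq_sq₀ hx (by rw [hα]; linarith)).1 h
  · rw [neg_one_mul, neg_eq_iff_eq_neg]
    exact (sq_eq_sq₀ hx (by rw [hα]; linarith)).1 (by rw [h, neg_sq])

/-! #### Defocusing octupole -/

/-- The smaller root of `X + 1 / X = b` for `b > 2`. -/
theorem smaller_root_spec {b : ℝ} (hb : 2 < b) :
    (b - √(b ^ 2 - 4)) / 2 ∈ Ioo 0 1 ∧
      ((b - √(b ^ 2 - 4)) / 2) ^ 2 + 1 = b * ((b - √(b ^ 2 - 4)) / 2) := by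
  have h0 : 0 < b ^ 2 - 4 := by nlinarith
  have hs := Real.sq_sqrt h0.le
  have hp := Real.sqrt_pos.2 h0
  refine ⟨⟨?_, ?_⟩, ?_⟩
  · nlinarith
  · by_contra! h
    nlinarith
  · linear_combination hs / 4

/-- If `X + 1 / X = b` with `0 < X < 1`, then `X` is the smaller root. -/
theorem smaller_root_eq {b x : ℝ} (hx : x ∈ Ioo 0 1) (h : x ^ 2 + 1 = b * x) :
    (b - √(b ^ 2 - 4)) / 2 = x := by
  have hb : b = x + 1 / x := by have := hx.1.ne'; field_simp; linarith
  have h1 : 1 < 1 / x := by rw [lt_div_iff₀ hx.1, one_mul]; exact hx.2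
  have e : b ^ 2 - 4 = (1 / x - x) ^ 2 := by
    have := hx.1.ne'
    rw [hb]; field_simp; ring
  rw [e, Real.sqrt_sq (by linarith [hx.2]), hb]
  ring

theorem two_lt_bDO {a c : ℝ} (ha : |a| < 2) (hc : c ∈ Ioo 0 ((|a / 2| - 1) ^ 2)) :
    2 < bDO a c ∧ √c < 1 - |a / 2| ∧ 0 < √c := by
  have h2 : |a / 2| < 1 := by rw [abs_div, abs_two]; linarith
  have hr := Real.sqrt_pos.2 hc.1
  have hr1 : √c < 1 - |a / 2| := by
    rw [Real.sqrt_lt' (by linarith)]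
    calc c < _ := hc.2
      _ = _ := by ring
  refine ⟨?_, hr1, hr⟩
  rw [bDO, lt_div_iff₀ hr]
  have h3 := Real.sq_sqrt hc.1.le
  have h4 : (a / 2) ^ 2 = |a / 2| ^ 2 := (sq_abs _).symm
  nlinarith [abs_nonneg (a / 2)]

/-- Modulus and phase of the defocusing octupole, with `w = sn ^ 2 η = √c / k`. -/
theorem modDO_spec {a c : ℝ} (ha : |a| < 2) (hc : c ∈ Ioo 0 ((|a / 2| - 1) ^ 2)) :
    modDO a c ∈ Ioo 0 1 ∧ √c ≤ modDO a c ∧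
      (1 - √c / modDO a c) * (1 - modDO a c * √c) = (a / 2) ^ 2 := by
  obtain ⟨hb, hr1, hr⟩ := two_lt_bDO ha hc
  obtain ⟨hk, hk2⟩ := smaller_root_spec hb
  rw [modDO]
  generalize (bDO a c - √(bDO a c ^ 2 - 4)) / 2 = k at *
  have hk0 := hk.1.ne'
  have hb2 : bDO a c * √c = 1 - (a / 2) ^ 2 + √c ^ 2 := by
    rw [bDO, Real.sq_sqrt hc.1.le]; field_simp; ring
  have e : (1 - √c / k) * (1 - k * √c) = (a / 2) ^ 2 := by
    have e0 : (k - √c) * (1 - k * √c) = (a / 2) ^ 2 * k := by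
      linear_combination -√c * hk2 - k * hb2
    rw [one_sub_div hk0, div_mul_eq_mul_div, div_eq_iff hk0, e0]
  refine ⟨hk, ?_, e⟩
  by_contra! h
  have h1 : 1 < √c / k := by rwa [lt_div_iff₀ hk.1, one_mul]
  have h2 : k * √c < 1 := by nlinarith [hk.1, hk.2, abs_nonneg (a / 2)]
  nlinarith [sq_nonneg (a / 2)]

/-- The defining equation of `η₊`, squared: `sn² η₊ = √c / k`. -/
theorem etaDO_spec {a c : ℝ} (ha : |a| < 2) (hc : c ∈ Ioo 0 ((|a / 2| - 1) ^ 2)) :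
    etaDO a c ∈ Ioc 0 (ellK (modDO a c)) ∧
      jacNs (etaDO a c) (modDO a c) = √(modDO a c) / c ^ ((1 : ℝ) / 4) ∧
      jacSn (etaDO a c) (modDO a c) ^ 2 = √c / modDO a c := by
  obtain ⟨hk, hrk, -⟩ := modDO_spec ha hc
  have hk2 : modDO a c ^ 2 < 1 := by nlinarith [hk.1, hk.2]
  have hq : 0 < c ^ ((1 : ℝ) / 4) := Real.rpow_pos_of_pos hc.1 _
  have hq2 := rpow_quarter_sq hc.1.le
  have hx : 1 ≤ √(modDO a c) / c ^ ((1 : ℝ) / 4) := by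
    rw [le_div_iff₀ hq, one_mul]
    refine Real.le_sqrt_of_sq_le ?_
    rw [hq2]; exact hrk
  obtain ⟨h1, h2⟩ := arcNs_spec hk2 hx
  refine ⟨h1, h2, ?_⟩
  rw [etaDO]
  rw [jacNs, one_div] at h2
  rw [← inv_inj, ← inv_pow, h2, div_pow, hq2, Real.sq_sqrt hk.1.le, inv_div]

theorem modDO_injOn {a : ℝ} (ha : |a| < 2) : InjOn (modDO a) (Ioo 0 ((|a / 2| - 1) ^ 2)) := by
  intro c hc c' hc' h
  obtain ⟨hk, hrk, e⟩ := modDO_spec ha hc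
  obtain ⟨-, hrk', e'⟩ := modDO_spec ha hc'
  rw [← h] at hrk' e'
  generalize modDO a c = k at *
  have hk0 := hk.1.ne'
  have key : (√c - √c') * (k ^ 2 + 1 - k * √c - k * √c') = 0 := by
    have := e.trans e'.symm
    field_simp at this
    linear_combination -this
  rcases mul_eq_zero.1 key with h1 | h1
  · have h2 : √c = √c' := by linarith
    rwa [Real.sqrt_inj hc.1.le hc'.1.le] at h2
  · nlinarith [hk.1, hk.2]

theorem modDO_surjOn {a : ℝ} (ha : |a| < 2) :
    SurjOn (modDO a) (Ioo 0 ((|a / 2| - 1) ^ 2)) (Ioo 0 1) := by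
  intro k hk
  have h2 : |a / 2| < 1 := by rw [abs_div, abs_two]; linarith
  have hA : (a / 2) ^ 2 < 1 := by rw [← sq_abs]; nlinarith [abs_nonneg (a / 2)]
  -- intermediate value theorem for `w ↦ (1 - w) * (1 - k ^ 2 * w)` on `[0, 1]`
  have hivt : ∃ w ∈ Icc (0 : ℝ) 1, (1 - w) * (1 - k ^ 2 * w) = (a / 2) ^ 2 := by
    have := intermediate_value_Icc' (zero_le_one (α := ℝ))
      (f := fun w : ℝ => (1 - w) * (1 - k ^ 2 * w)) (by fun_prop)
    exact this ⟨by simpa using sq_nonneg (a / 2), by simpa using hA.le⟩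
  obtain ⟨w, hw, hwA⟩ := hivt
  have hw0 : 0 < w := by
    rcases hw.1.eq_or_lt with h | h
    · rw [← h] at hwA; norm_num at hwA; linarith
    · exact h
  have hkw : 0 < k * w := mul_pos hk.1 hw0
  have hr : √((k * w) ^ 2) = k * w := Real.sqrt_sq hkw.le
  have hkw1 : k * w < 1 := by nlinarith [hk.1, hk.2, hw.2]
  have hb : bDO a ((k * w) ^ 2) * k = k ^ 2 + 1 := by
    rw [bDO, hr, ← hwA]
    have := hk.1.ne'
    field_simp
    ring
  refine ⟨(k * w) ^ 2, ⟨by positivity, ?_⟩, smaller_root_eq hk (by linarith)⟩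
  have h3 : |a / 2| < 1 - k * w := by
    refine abs_lt_of_sq_lt_sq ?_ (by linarith)
    rw [← hwA]
    nlinarith [hk.1, hk.2, mul_pos hw0 (pow_pos (sub_pos.2 hk.2) 2)]
  nlinarith

theorem modDO_bijOn {a : ℝ} (ha : |a| < 2) :
    BijOn (modDO a) (Ioo 0 ((|a / 2| - 1) ^ 2)) (Ioo 0 1) :=
  ⟨fun _ hc => (modDO_spec ha hc).1, modDO_injOn ha, modDO_surjOn ha⟩

theorem eventually_mem_range_DO {a : ℝ} (ha : |a| < 2) :
    ∀ᶠ c in 𝓝[>] (0 : ℝ), c ∈ Ioo 0 ((|a / 2| - 1) ^ 2) := by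
  have h2 : |a / 2| < 1 := by rw [abs_div, abs_two]; linarith
  exact Ioo_mem_nhdsGT (by have : |a / 2| - 1 ≠ 0 := by linarith
                           positivity)

theorem tendsto_sqrt_zero : Tendsto (fun c : ℝ => √c) (𝓝[>] 0) (𝓝 0) := by
  have := Real.continuous_sqrt.tendsto 0
  rw [Real.sqrt_zero] at this
  exact this.mono_left nhdsWithin_le_nhds

theorem modDO_tendsto {a : ℝ} (ha : |a| < 2) : Tendsto (modDO a) (𝓝[>] 0) (𝓝[>] 0) := by
  have hev := eventually_mem_range_DO ha
  refine tendsto_nhdsWithin_iff.2 ⟨?_, hev.mono fun c hc => (modDO_spec ha hc).1.1⟩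
  have hA : 0 < 1 - (a / 2) ^ 2 := by
    have h2 : |a / 2| < 1 := by rw [abs_div, abs_two]; linarith
    rw [← sq_abs]; nlinarith [abs_nonneg (a / 2)]
  -- `k * b = k ^ 2 + 1 ≤ 2`, and `b` is at least a multiple of `1 / √c`
  have hlim := tendsto_sqrt_zero.const_mul (2 / (1 - (a / 2) ^ 2))
  rw [mul_zero] at hlim
  refine squeeze_zero' (hev.mono fun c hc => (modDO_spec ha hc).1.1.le)
    (hev.mono fun c hc => ?_) hlim
  obtain ⟨hk, hrk, e⟩ := modDO_spec ha hc
  have hr := Real.sqrt_pos.2 hc.1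
  rw [div_mul_eq_mul_div, le_div_iff₀ hA, ← e]
  have hk0 := hk.1.ne'
  have e2 : modDO a c * (1 - (1 - √c / modDO a c) * (1 - modDO a c * √c))
      = √c * (1 + modDO a c ^ 2) - modDO a c * √c ^ 2 := by field_simp; ring
  rw [e2]
  nlinarith [hk.1, hk.2, mul_pos hk.1 (pow_pos hr 2)]

theorem compModulus_spec {k : ℝ} (hk : k ∈ Ioo 0 1) :
    0 < compModulus k ∧ compModulus k ^ 2 = 1 - k ^ 2 ∧ compModulus k < 1 := by
  have h : 0 < 1 - k ^ 2 := by nlinarith [hk.1, hk.2]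
  have h1 : 0 < compModulus k := Real.sqrt_pos.2 h
  have h2 : compModulus k ^ 2 = 1 - k ^ 2 := Real.sq_sqrt h.le
  exact ⟨h1, h2, by nlinarith [hk.1, hk.2]⟩

theorem abs_half_lt_one {a : ℝ} (ha : |a| < 2) : |a / 2| < 1 := by
  rw [abs_div, abs_two]; linarith

theorem half_sq_lt_one {a : ℝ} (ha : |a| < 2) : (a / 2) ^ 2 < 1 := by
  rw [← sq_abs]; nlinarith [abs_nonneg (a / 2), abs_half_lt_one ha]

/-! #### Focusing octupole -/

theorem modFO_eq {a c k : ℝ} (hk : k ∈ Ioo 0 1)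
    (h : k ^ 2 - compModulus k ^ 2 = bFO a c * (k * compModulus k)) : modFO a c = k := by
  obtain ⟨h1, h2, -⟩ := compModulus_spec hk
  have hk0 := hk.1
  have hb : bFO a c = (k ^ 2 - compModulus k ^ 2) / (k * compModulus k) := by
    rw [h]; field_simp
  have e : bFO a c ^ 2 + 4 = (1 / (k * compModulus k)) ^ 2 := by
    rw [hb]
    field_simp
    linear_combination (k ^ 2 + compModulus k ^ 2 + 1) * h2
  rw [modFO, e, Real.sqrt_sq (by positivity), hb]
  have e2 : 1 + (k ^ 2 - compModulus k ^ 2) / (k * compModulus k) / (1 / (k * compModulus k))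
      = 2 * k ^ 2 := by
    field_simp
    linear_combination -h2
  rw [e2, Real.sqrt_mul two_pos.le, Real.sqrt_sq hk0.le]
  field_simp

/-- The equation `X / √(1 - X ^ 2) - √(1 - X ^ 2) / X = b` is solved by `modFO`. -/
theorem modFO_mem (a c : ℝ) :
    modFO a c ∈ Ioo 0 1 ∧ modFO a c ^ 2 - compModulus (modFO a c) ^ 2
      = bFO a c * (modFO a c * compModulus (modFO a c)) := by
  set b := bFO a c with hb
  have hpos : 0 < b ^ 2 + 4 := by positivity
  have hs := Real.sq_sqrt hpos.le
  have hsp := Real.sqrt_pos.2 hpos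
  have hlt : b / √(b ^ 2 + 4) < 1 := by rw [div_lt_one hsp]; nlinarith
  have hgt : -1 < b / √(b ^ 2 + 4) := by rw [lt_div_iff₀ hsp]; nlinarith
  have hsq : modFO a c ^ 2 = (1 + b / √(b ^ 2 + 4)) / 2 := by
    rw [modFO, mul_pow, Real.sq_sqrt (by linarith), div_pow, Real.sq_sqrt two_pos.le]
    ring
  have h0 : 0 < modFO a c := by
    rw [modFO]
    have : 0 < √(1 + b / √(b ^ 2 + 4)) := Real.sqrt_pos.2 (by linarith)
    positivity
  have hmem : modFO a c ∈ Ioo 0 1 := ⟨h0, by nlinarith⟩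
  refine ⟨hmem, ?_⟩
  obtain ⟨h1, h2, -⟩ := compModulus_spec hmem
  have hkk : modFO a c * compModulus (modFO a c) = 1 / √(b ^ 2 + 4) := by
    refine (sq_eq_sq₀ (by positivity) (by positivity)).1 ?_
    have hβ : (b / √(b ^ 2 + 4)) ^ 2 = b ^ 2 / (b ^ 2 + 4) := by rw [div_pow, hs]
    have e : (1 + b / √(b ^ 2 + 4)) / 2 * (1 - (1 + b / √(b ^ 2 + 4)) / 2)
        = (1 - (b / √(b ^ 2 + 4)) ^ 2) / 4 := by ring
    rw [mul_pow, h2, hsq, div_pow, hs, e, hβ]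
    field_simp
    ring
  rw [hkk, h2, hsq]
  ring

/-- Modulus of the focusing octupole; with `v = (sn η / dn η)² = √c / (k k')` the last identity is
`(1 + k² v) (1 - k'² v) = (a / 2)²`. -/
theorem modFO_spec {a c : ℝ} (hc : 0 < c) :
    modFO a c ∈ Ioo 0 1 ∧ √c * compModulus (modFO a c) ≤ modFO a c ∧
      (1 + modFO a c * √c / compModulus (modFO a c))
        * (1 - compModulus (modFO a c) * √c / modFO a c) = (a / 2) ^ 2 := by
  obtain ⟨hk, hk2⟩ := modFO_mem a c
  obtain ⟨h1, -, -⟩ := compModulus_spec hk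
  have hr := Real.sqrt_pos.2 hc
  have hb : bFO a c * √c = (a / 2) ^ 2 - 1 + √c ^ 2 := by
    rw [bFO, Real.sq_sqrt hc.le]; field_simp
  have hk0 := hk.1
  generalize compModulus (modFO a c) = k' at *
  generalize modFO a c = k at *
  have e : (1 + k * √c / k') * (1 - k' * √c / k) = (a / 2) ^ 2 := by
    have e0 : (k' + k * √c) * (k - k' * √c) = (a / 2) ^ 2 * (k' * k) := by
      linear_combination √c * hk2 + k * k' * hb
    rw [one_add_div h1.ne', one_sub_div hk0.ne', div_mul_div_comm, e0,
      mul_div_cancel_right₀ _ (by positivity)]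
  refine ⟨hk, ?_, e⟩
  by_contra! h
  have h3 : 1 < k' * √c / k := by rw [lt_div_iff₀ hk0]; linarith
  have h4 : 0 < 1 + k * √c / k' := by positivity
  nlinarith [sq_nonneg (a / 2)]

/-- The defining equation of `η₊`, squared: `k k' sn² η₊ = √c dn² η₊`. -/
theorem etaFO_spec {a c : ℝ} (hc : 0 < c) :
    etaFO a c ∈ Ioc 0 (ellK (modFO a c)) ∧
      jacDs (etaFO a c) (modFO a c)
        = √(modFO a c * compModulus (modFO a c)) / c ^ ((1 : ℝ) / 4) ∧
      (1 - modFO a c ^ 2 * jacSn (etaFO a c) (modFO a c) ^ 2) * √c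
        = modFO a c * compModulus (modFO a c) * jacSn (etaFO a c) (modFO a c) ^ 2 := by
  obtain ⟨hk, hrk, -⟩ := modFO_spec (a := a) hc
  obtain ⟨h1, h2, -⟩ := compModulus_spec hk
  have hk2 : modFO a c ^ 2 < 1 := by nlinarith [hk.1, hk.2]
  have hkk : 0 < modFO a c * compModulus (modFO a c) := mul_pos hk.1 h1
  have hq : 0 < c ^ ((1 : ℝ) / 4) := Real.rpow_pos_of_pos hc _
  have hq2 := rpow_quarter_sq hc.le
  have hr := Real.sqrt_pos.2 hc
  have hx2 : (√(modFO a c * compModulus (modFO a c)) / c ^ ((1 : ℝ) / 4)) ^ 2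
      = modFO a c * compModulus (modFO a c) / √c := by
    rw [div_pow, hq2, Real.sq_sqrt hkk.le]
  obtain ⟨h3, h4⟩ := arcDs_spec hk2
    (x := √(modFO a c * compModulus (modFO a c)) / c ^ ((1 : ℝ) / 4)) (by positivity) (by
      rw [hx2, ← h2, le_div_iff₀ hr]
      nlinarith)
  refine ⟨h3, h4, ?_⟩
  have hs := jacSn_pos_of_mem hk2 h3
  rw [etaFO, ← jacDn_sq hk2]
  rw [jacDs, div_eq_iff hs.ne'] at h4
  rw [h4, mul_pow, hx2]
  field_simp

theorem modFO_bijOn {a : ℝ} (ha : |a| < 2) : BijOn (modFO a) (Ioi 0) (Ioo 0 1) := by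
  have hA := half_sq_lt_one ha
  refine ⟨fun c hc => (modFO_spec hc).1, fun c hc c' hc' h => ?_, fun k hk => ?_⟩
  · obtain ⟨hk, -, e⟩ := modFO_spec (a := a) hc
    obtain ⟨-, -, e'⟩ := modFO_spec (a := a) hc'
    rw [← h] at e'
    have hr := Real.sqrt_pos.2 hc
    have hr' := Real.sqrt_pos.2 hc'
    obtain ⟨h1, -, -⟩ := compModulus_spec hk
    have hk0 := hk.1
    generalize compModulus (modFO a c) = k' at *
    generalize modFO a c = k at *
    have f1 : 1 + √c * (k / k' - k' / k) - √c ^ 2 = (a / 2) ^ 2 := by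
      rw [← e]; field_simp; ring
    have f2 : 1 + √c' * (k / k' - k' / k) - √c' ^ 2 = (a / 2) ^ 2 := by
      rw [← e']; field_simp; ring
    have key : (√c - √c') * (k / k' - k' / k - √c - √c') = 0 := by
      linear_combination f1 - f2
    rcases mul_eq_zero.1 key with h3 | h3
    · have h4 : √c = √c' := by linarith
      rwa [Real.sqrt_inj (le_of_lt hc) (le_of_lt hc')] at h4
    · have h5 : k / k' - k' / k = √c + √c' := by linarith
      rw [h5] at f1
      nlinarith [mul_pos hr hr']
  · obtain ⟨h1, -, -⟩ := compModulus_spec hk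
    have hk0 := hk.1
    set B := k / compModulus k - compModulus k / k with hB
    -- the positive root of `r ^ 2 - B r - (1 - (a / 2) ^ 2)`
    have hD : B ^ 2 < B ^ 2 + 4 * (1 - (a / 2) ^ 2) := by linarith
    have hDp : 0 ≤ B ^ 2 + 4 * (1 - (a / 2) ^ 2) := by nlinarith [sq_nonneg B]
    have hs := Real.sq_sqrt hDp
    have habs : |B| < √(B ^ 2 + 4 * (1 - (a / 2) ^ 2)) := abs_lt_of_sq_lt_sq (by rw [hs]; exact hD) (Real.sqrt_nonneg _)
    set r := (B + √(B ^ 2 + 4 * (1 - (a / 2) ^ 2))) / 2 with hr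
    have hr0 : 0 < r := by linarith [(abs_lt.1 habs).1]
    have hreq : r ^ 2 = B * r + (1 - (a / 2) ^ 2) := by
      rw [hr]; linear_combination hs / 4
    refine ⟨r ^ 2, pow_pos hr0 2, modFO_eq hk ?_⟩
    have hb : bFO a (r ^ 2) = B := by
      rw [bFO, Real.sqrt_sq hr0.le, div_eq_iff hr0.ne']
      linarith
    rw [hb, hB]
    field_simp

theorem modFO_tendsto {a : ℝ} (ha : |a| < 2) : Tendsto (modFO a) (𝓝[>] 0) (𝓝[>] 0) := by
  have hA := half_sq_lt_one ha
  have hev : ∀ᶠ c in 𝓝[>] (0 : ℝ), 0 < c := self_mem_nhdsWithin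
  refine tendsto_nhdsWithin_iff.2 ⟨?_, hev.mono fun c hc => (modFO_spec hc).1.1⟩
  have hlim := tendsto_sqrt_zero.const_mul (2 / (1 - (a / 2) ^ 2))
  rw [mul_zero] at hlim
  have hev2 : ∀ᶠ c in 𝓝[>] (0 : ℝ), c < (1 - (a / 2) ^ 2) / 2 :=
    (eventually_lt_nhds (by linarith)).filter_mono nhdsWithin_le_nhds
  refine squeeze_zero' (hev.mono fun c hc => (modFO_spec hc).1.1.le)
    ((hev.and hev2).mono fun c ⟨hc, hc2⟩ => ?_) hlim
  obtain ⟨hk, -, e⟩ := modFO_spec (a := a) hc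
  obtain ⟨h1, -, h1'⟩ := compModulus_spec hk
  have hk0 := hk.1
  have hr := Real.sqrt_pos.2 hc
  have hc3 := Real.sq_sqrt hc.le
  generalize compModulus (modFO a c) = k' at *
  generalize modFO a c = k at *
  rw [div_mul_eq_mul_div, le_div_iff₀ (by linarith)]
  have e2 : k * (1 - (1 + k * √c / k') * (1 - k' * √c / k))
      = k' * √c - k ^ 2 * √c / k' + k * √c ^ 2 := by field_simp; ring
  have e3 : 0 ≤ k ^ 2 * √c / k' := by positivity
  rw [e, hc3] at e2
  nlinarith

/-! #### Duffing regime -/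

theorem two_lt_bDf {a c : ℝ} (ha : 2 < |a|) (hc : c ∈ Ioo (-(|a / 2| - 1) ^ 2) 0) :
    2 < bDf a c ∧ √|c| < |a / 2| - 1 ∧ 0 < √|c| := by
  have h2 : 1 < |a / 2| := by rw [abs_div, abs_two]; linarith
  have hcabs : |c| = -c := abs_of_neg hc.2
  have hr := Real.sqrt_pos.2 (abs_pos.2 hc.2.ne)
  have hr1 : √|c| < |a / 2| - 1 := by
    rw [Real.sqrt_lt' (by linarith), hcabs]
    linarith [hc.1]
  refine ⟨?_, hr1, hr⟩
  rw [bDf, lt_div_iff₀ hr]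
  have h3 := Real.sq_sqrt (abs_nonneg c)
  rw [hcabs] at h3 hr1 hr ⊢
  have h4 : (a / 2) ^ 2 = |a / 2| ^ 2 := (sq_abs _).symm
  nlinarith [abs_nonneg (a / 2)]

/-- The closed form of the modulus is `√(1 - y²)` for the root `y = k'` of `y + 1 / y = B`. -/
theorem modDf_eq_sqrt {a c y : ℝ} (hy : y ∈ Ioo 0 1) (h : y ^ 2 + 1 = bDf a c * y) :
    modDf a c = √(1 - y ^ 2) := by
  have hy0 := hy.1
  have hy1 : 0 < 1 - y ^ 2 := by nlinarith [hy.2]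
  have hb : bDf a c = (y ^ 2 + 1) / y := by rw [h]; field_simp
  have e1 : √(bDf a c + 2) = (1 + y) / √y := by
    rw [Real.sqrt_eq_iff_mul_self_eq (by rw [hb]; positivity) (by positivity), hb,
      div_mul_div_comm, Real.mul_self_sqrt hy0.le]
    field_simp
    ring
  have e2 : √(bDf a c - 2) = (1 - y) / √y := by
    have e : bDf a c - 2 = (1 - y) ^ 2 / y := by rw [hb]; field_simp; ring
    rw [Real.sqrt_eq_iff_mul_self_eq (by rw [e]; positivity)
      (div_nonneg (by linarith [hy.2]) (Real.sqrt_nonneg _)), e,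
      div_mul_div_comm, Real.mul_self_sqrt hy0.le]
    ring
  have e3 : bDf a c ^ 2 - 4 = ((1 - y ^ 2) / y) ^ 2 := by
    rw [hb]; field_simp; ring
  have e4 : (bDf a c ^ 2 - 4) ^ ((1 : ℝ) / 4) = √((1 - y ^ 2) / y) := by
    refine (sq_eq_sq₀ (Real.rpow_nonneg (by rw [e3]; positivity) _) (Real.sqrt_nonneg _)).1 ?_
    rw [rpow_quarter_sq (by rw [e3]; positivity), Real.sq_sqrt (div_nonneg hy1.le hy0.le), e3,
      Real.sqrt_sq (div_nonneg hy1.le hy0.le)]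
  have hsy := Real.sqrt_pos.2 hy0
  rw [modDf, e1, e2, e4, Real.sqrt_div hy1.le]
  have := Real.sq_sqrt hy0.le
  field_simp
  rw [this]
  ring

/-- Modulus of the Duffing regime; with `v = (sn η / cn η)² = √|c| / k'` the last identity is `(1 +
k'² v) (1 + v) = (a / 2)²`. -/
theorem modDf_spec {a c : ℝ} (ha : 2 < |a|) (hc : c ∈ Ioo (-(|a / 2| - 1) ^ 2) 0) :
    modDf a c ∈ Ioo 0 1 ∧
      (1 + √|c| * compModulus (modDf a c)) * (1 + √|c| / compModulus (modDf a c))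
        = (a / 2) ^ 2 := by
  obtain ⟨hb, -, hr⟩ := two_lt_bDf ha hc
  obtain ⟨hy, hy2⟩ := smaller_root_spec hb
  have hk := modDf_eq_sqrt hy hy2
  generalize (bDf a c - √(bDf a c ^ 2 - 4)) / 2 = y at *
  have hy0 := hy.1
  have hy1 : 0 < 1 - y ^ 2 := by nlinarith [hy.2]
  have hcomp : compModulus (modDf a c) = y := by
    rw [compModulus, hk, Real.sq_sqrt hy1.le, sub_sub_cancel, Real.sqrt_sq hy0.le]
  have hbr : bDf a c * √|c| = (a / 2) ^ 2 - 1 - √|c| ^ 2 := by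
    rw [bDf, Real.sq_sqrt (abs_nonneg c), abs_of_neg hc.2] at *
    field_simp
    ring
  refine ⟨⟨?_, ?_⟩, ?_⟩
  · rw [hk]; exact Real.sqrt_pos.2 hy1
  · rw [hk, Real.sqrt_lt' one_pos]; nlinarith
  · rw [hcomp]
    have e0 : (1 + √|c| * y) * (y + √|c|) = (a / 2) ^ 2 * y := by
      linear_combination √|c| * hy2 + y * hbr
    rw [one_add_div hy0.ne', mul_div_assoc', e0, mul_div_cancel_right₀ _ hy0.ne']

/-- The defining equation of `η₊`, squared: `k' sn² η₊ = √|c| cn² η₊`. -/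
theorem etaDf_spec {a c : ℝ} (ha : 2 < |a|) (hc : c ∈ Ioo (-(|a / 2| - 1) ^ 2) 0) :
    etaDf a c ∈ Ioo 0 (ellK (modDf a c)) ∧
      jacCs (etaDf a c) (modDf a c) = √(compModulus (modDf a c)) / |c| ^ ((1 : ℝ) / 4) ∧
      jacCn (etaDf a c) (modDf a c) ^ 2 * √|c|
        = compModulus (modDf a c) * jacSn (etaDf a c) (modDf a c) ^ 2 := by
  obtain ⟨hk, -⟩ := modDf_spec ha hc
  obtain ⟨h1, h2, -⟩ := compModulus_spec hk
  have hk2 : modDf a c ^ 2 < 1 := by nlinarith [hk.1, hk.2]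
  have hc0 := abs_pos.2 hc.2.ne
  have hq : 0 < |c| ^ ((1 : ℝ) / 4) := Real.rpow_pos_of_pos hc0 _
  have hq2 := rpow_quarter_sq hc0.le
  have hr := Real.sqrt_pos.2 hc0
  obtain ⟨h3, h4⟩ := arcCs_spec hk2
    (x := √(compModulus (modDf a c)) / |c| ^ ((1 : ℝ) / 4)) (by positivity)
  refine ⟨h3, h4, ?_⟩
  have hs := jacSn_pos_of_mem hk2 (Ioo_subset_Ioc_self h3)
  rw [etaDf]
  rw [jacCs, div_eq_iff hs.ne'] at h4
  rw [h4, mul_pow, div_pow, hq2, Real.sq_sqrt h1.le]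
  field_simp

theorem modDf_bijOn {a : ℝ} (ha : 2 < |a|) :
    BijOn (modDf a) (Ioo (-(|a / 2| - 1) ^ 2) 0) (Ioo 0 1) := by
  have h2 : 1 < |a / 2| := by rw [abs_div, abs_two]; linarith
  refine ⟨fun c hc => (modDf_spec ha hc).1, fun c hc c' hc' h => ?_, fun k hk => ?_⟩
  · obtain ⟨hk, e⟩ := modDf_spec ha hc
    obtain ⟨-, e'⟩ := modDf_spec ha hc'
    rw [← h] at e'
    have hr := Real.sqrt_pos.2 (abs_pos.2 hc.2.ne)
    have hr' := Real.sqrt_pos.2 (abs_pos.2 hc'.2.ne)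
    obtain ⟨h1, -, -⟩ := compModulus_spec hk
    generalize compModulus (modDf a c) = y at *
    have key : (√|c| - √|c'|) * (y + 1 / y + √|c| + √|c'|) = 0 := by
      have := e.trans e'.symm
      field_simp at this ⊢
      linear_combination this
    have hne : y + 1 / y + √|c| + √|c'| ≠ 0 := by positivity
    have h4 : √|c| = √|c'| := by linarith [(mul_eq_zero.1 key).resolve_right hne]
    rw [Real.sqrt_inj (abs_nonneg _) (abs_nonneg _), abs_of_neg hc.2, abs_of_neg hc'.2] at h4
    linarith
  · obtain ⟨h1, h3, h1'⟩ := compModulus_spec hk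
    set y := compModulus k with hy
    set α := |a / 2| with hα
    have hivt : ∃ r ∈ Icc 0 (α ^ 2), (1 + r * y) * (1 + r / y) = α ^ 2 := by
      have := intermediate_value_Icc (show (0 : ℝ) ≤ α ^ 2 by positivity)
        (f := fun r : ℝ => (1 + r * y) * (1 + r / y)) (by fun_prop)
      refine this ⟨by rw [zero_mul, zero_div, add_zero, mul_one]; nlinarith, ?_⟩
      have h5 : α ^ 2 ≤ α ^ 2 / y := by
        rw [le_div_iff₀ h1]; nlinarith [sq_nonneg α]
      have h6 : 0 ≤ α ^ 2 * y := by positivity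
      nlinarith
    obtain ⟨r, hr, hrA⟩ := hivt
    have hr0 : 0 < r := by
      rcases hr.1.eq_or_lt with h | h
      · rw [← h] at hrA; norm_num at hrA; nlinarith
      · exact h
    have hyr : (1 + r) ^ 2 < α ^ 2 := by
      rw [← hrA]
      have : (1 + r * y) * (1 + r / y) - (1 + r) ^ 2 = r * (1 - y) ^ 2 / y := by
        field_simp; ring
      have h7 : 0 < r * (1 - y) ^ 2 / y := by
        have : 0 < 1 - y := by linarith
        positivity
      linarith
    have hlt : 1 + r < α := lt_of_pow_lt_pow_left₀ 2 (by linarith) hyr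
    have habs : |(-(r ^ 2))| = r ^ 2 := by rw [abs_neg, abs_of_nonneg (sq_nonneg r)]
    refine ⟨-(r ^ 2), ⟨by nlinarith, by have := pow_pos hr0 2; linarith⟩, ?_⟩
    have hb : y ^ 2 + 1 = bDf a (-(r ^ 2)) * y := by
      rw [bDf, habs, Real.sqrt_sq hr0.le, ← sq_abs (a / 2), ← hα, ← hrA]
      field_simp
      ring
    rw [modDf_eq_sqrt ⟨h1, h1'⟩ hb, h3, sub_sub_cancel, Real.sqrt_sq hk.1.le]

theorem eventually_mem_range_Df {a : ℝ} (ha : 2 < |a|) :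
    ∀ᶠ c in 𝓝[>] (-(|a / 2| - 1) ^ 2), c ∈ Ioo (-(|a / 2| - 1) ^ 2) 0 := by
  have h2 : 1 < |a / 2| := by rw [abs_div, abs_two]; linarith
  exact Ioo_mem_nhdsGT (by nlinarith)

theorem modDf_tendsto {a : ℝ} (ha : 2 < |a|) :
    Tendsto (modDf a) (𝓝[>] (-(|a / 2| - 1) ^ 2)) (𝓝[>] 0) := by
  have h2 : 1 < |a / 2| := by rw [abs_div, abs_two]; linarith
  refine tendsto_nhdsWithin_iff.2
    ⟨?_, (eventually_mem_range_Df ha).mono fun c hc => (modDf_spec ha hc).1.1⟩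
  have hne : √|(-(|a / 2| - 1) ^ 2)| = |a / 2| - 1 := by
    rw [abs_neg, abs_of_nonneg (sq_nonneg _), Real.sqrt_sq (by linarith)]
  have hbc : ContinuousAt (bDf a) (-(|a / 2| - 1) ^ 2) := by
    unfold bDf
    refine ContinuousAt.div (by fun_prop) (by fun_prop) ?_
    rw [hne]; linarith
  have hb : bDf a (-(|a / 2| - 1) ^ 2) = 2 := by
    rw [bDf, hne, div_eq_iff (by linarith), ← sq_abs (a / 2)]; ring
  have hcont : ContinuousAt (modDf a) (-(|a / 2| - 1) ^ 2) := by
    unfold modDf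
    refine ContinuousAt.mul (by fun_prop) ?_
    exact ContinuousAt.rpow_const (by fun_prop) (Or.inr (by norm_num))
  have hval : modDf a (-(|a / 2| - 1) ^ 2) = 0 := by
    rw [modDf, hb]; norm_num
  have := hcont.tendsto
  rw [hval] at this
  exact this.mono_left nhdsWithin_le_nhds

/-! ### Action and rotation number in the three regimes -/

/-- The action of the defocusing octupole as a function of the invariant. -/
def actionDO (a c : ℝ) : ℝ :=
  √|c| / (2 * Real.pi)
    * (modDO a c * areaSn (modDO a c) (phase a (modDO a c) (etaDO a c)))

/-- The rotation number of the defocusing octupole as a function of the invariant. -/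
def rotationDO (a c : ℝ) : ℝ := phase a (modDO a c) (etaDO a c) / (4 * ellK (modDO a c))

/-- The action of the focusing octupole as a function of the invariant. -/
def actionFO (a c : ℝ) : ℝ :=
  √|c| / (2 * Real.pi) * (modFO a c / compModulus (modFO a c)
    * areaCn (modFO a c) (phase a (modFO a c) (etaFO a c)))

/-- The rotation number of the focusing octupole as a function of the invariant. -/
def rotationFO (a c : ℝ) : ℝ := phase a (modFO a c) (etaFO a c) / (4 * ellK (modFO a c))

/-- The action in the Duffing regime as a function of the invariant. -/
def actionDf (a c : ℝ) : ℝ :=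
  √|c| / (2 * Real.pi) * (1 / compModulus (modDf a c) * areaDn (modDf a c) (etaDf a c))

/-- The rotation number in the Duffing regime as a function of the invariant. -/
def rotationDf (a c : ℝ) : ℝ := etaDf a c / (2 * ellK (modDf a c))

theorem sq_lt_one_of_mem {k : ℝ} (hk : k ∈ Ioo 0 1) : k ^ 2 < 1 := by nlinarith [hk.1, hk.2]

/-- The data of the phase advance in the defocusing case. -/
theorem phaseDO_spec {a c : ℝ} (ha : |a| < 2) (hc : c ∈ Ioo 0 ((|a / 2| - 1) ^ 2)) {k ηp η : ℝ}
    (hk' : k = modDO a c) (hηp' : ηp = etaDO a c) (hη' : η = phase a k ηp) :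
    k ∈ Ioo 0 1 ∧ k ^ 2 < 1 ∧ jacSn η k = jacSn ηp k ∧ jacDn η k = jacDn ηp k ∧
      η ∈ Ioo 0 (2 * ellK k) ∧ 0 < jacSn ηp k ∧ √c = k * jacSn ηp k ^ 2 ∧
      jacCn η k * jacDn η k = a / 2 := by
  obtain ⟨hk, -, hA⟩ := modDO_spec ha hc
  obtain ⟨hηp, -, hs2⟩ := etaDO_spec ha hc
  rw [← hk'] at hk hA
  rw [← hk', ← hηp'] at hηp hs2
  have hk2 := sq_lt_one_of_mem hk
  have hk0 := hk.1
  obtain ⟨es, ed, ec, hmem⟩ := phase_spec hk2 hηp a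
  rw [← hη'] at es ed ec hmem
  have hs := jacSn_pos_of_mem hk2 hηp
  have hd := jacDn_pos hk2 ηp
  have hr : √c = k * jacSn ηp k ^ 2 := by rw [hs2]; field_simp
  have hα : jacCn η k * jacDn η k = a / 2 := by
    rw [ec, ed, mul_assoc]
    refine eq_of_sign_mul rfl (mul_nonneg (jacCn_nonneg_of_mem hk2 hηp) hd.le) ?_
    rw [mul_pow, jacCn_sq, jacDn_sq hk2, ← hA, ← hs2, hr]
    ring
  exact ⟨hk, hk2, es, ed, hmem, hs, hr, hα⟩

/-- Action, rotation number, parametrization of the curve and closed form of the action for the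
defocusing octupole. -/
theorem curve_DO {a c : ℝ} (ha : |a| < 2) (hc : c ∈ Ioo 0 ((|a / 2| - 1) ^ 2)) {k ηp η : ℝ}
    (hk' : k = modDO a c) (hηp' : ηp = etaDO a c) (hη' : η = phase a k ηp) :
    HasAction (-1) a (curveDO a c) (actionDO a c) ∧
      HasRotationNumber (-1) a (curveDO a c) (rotationDO a c) ∧
      curveDO a c = range (fun u =>
        (c ^ ((1 : ℝ) / 4) * √k * jacSn u k, c ^ ((1 : ℝ) / 4) * √k * jacSn (u + η) k)) ∧
      actionDO a c = 2 / Real.pi *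
        ((jacSd ηp k ^ 2 * ellE k - ellK k + jacCn ηp k ^ 2 * ellPi (k ^ 2 * jacSn ηp k ^ 2) k)
          / (jacSd ηp k * jacNd ηp k)) := by
  obtain ⟨hk, hk2, es, ed, hmem, hs, hr, hα⟩ := phaseDO_spec ha hc hk' hηp' hη'
  have hk0 := hk.1
  have hd := jacDn_pos hk2 ηp
  have hscale : c ^ ((1 : ℝ) / 4) * √k = k * jacSn η k := by
    rw [es]
    refine (sq_eq_sq₀ (mul_nonneg (Real.rpow_nonneg hc.1.le _) (Real.sqrt_nonneg _))
      (by positivity)).1 ?_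
    rw [mul_pow, rpow_quarter_sq hc.1.le, Real.sq_sqrt hk0.le, hr]
    ring
  have hc4 : c = k ^ 2 * jacSn η k ^ 4 := by
    rw [← Real.sq_sqrt hc.1.le, hr, es]; ring
  have hrange := curveDO_eq_range hk2 hk0 (es ▸ hs) hα (abs_half_lt_one ha) hc4 hc.2
  rw [mul_div_cancel₀ a two_ne_zero] at hrange
  have H := octupolePhase_jacSn hk2 hk0.ne' (es ▸ hs : 0 < jacSn η k)
  rw [hα] at H
  have hact : actionDO a c = (k * jacSn η k) ^ 2 / (2 * Real.pi) * areaSn k η := by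
    rw [actionDO, ← hk', ← hηp', ← hη', abs_of_pos hc.1, hr, es]; ring
  have h1 := H.hasAction
  have h2 := H.hasRotationNumber ⟨hmem.1.le, by linarith [hmem.2, ellK_pos hk2]⟩
  rw [mul_div_cancel₀ a two_ne_zero, ← hrange] at h1 h2
  refine ⟨?_, ?_, by rw [hrange, hscale], ?_⟩
  · rw [hact]; exact h1
  · rw [rotationDO, ← hk', ← hηp', ← hη']; exact h2
  · rw [hact, areaSn_formula hk0.ne' hk2 (es ▸ hs.ne')]
    have ec2 : jacCn η k ^ 2 = jacCn ηp k ^ 2 := by rw [jacCn_sq, jacCn_sq, es]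
    simp only [jacSd, jacNd, es, ed, ec2]
    field_simp
    ring

/-- The data of the phase advance in the focusing case. -/
theorem phaseFO_spec {a c : ℝ} (hc : 0 < c) {k ηp η : ℝ}
    (hk' : k = modFO a c) (hηp' : ηp = etaFO a c) (hη' : η = phase a k ηp) :
    k ∈ Ioo 0 1 ∧ k ^ 2 < 1 ∧ jacSn η k = jacSn ηp k ∧ jacDn η k = jacDn ηp k ∧
      η ∈ Ioo 0 (2 * ellK k) ∧ 0 < jacSn ηp k ∧
      √c = k * compModulus k * jacSn ηp k ^ 2 / jacDn ηp k ^ 2 ∧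
      jacCn η k / jacDn η k ^ 2 = a / 2 := by
  obtain ⟨hk, -, hA⟩ := modFO_spec (a := a) hc
  obtain ⟨hηp, -, hs2⟩ := etaFO_spec (a := a) hc
  rw [← hk'] at hk hA
  rw [← hk', ← hηp'] at hηp hs2
  have hk2 := sq_lt_one_of_mem hk
  have hk0 := hk.1
  obtain ⟨hy, hy2, -⟩ := compModulus_spec hk
  obtain ⟨es, ed, ec, hmem⟩ := phase_spec hk2 hηp a
  rw [← hη'] at es ed ec hmem
  have hs := jacSn_pos_of_mem hk2 hηp
  have hd := jacDn_pos hk2 ηp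
  rw [← jacDn_sq hk2] at hs2
  have hr : √c = k * compModulus k * jacSn ηp k ^ 2 / jacDn ηp k ^ 2 := by
    rw [← hs2]; field_simp
  have hα : jacCn η k / jacDn η k ^ 2 = a / 2 := by
    rw [ec, ed, mul_div_assoc]
    refine eq_of_sign_mul rfl (div_nonneg (jacCn_nonneg_of_mem hk2 hηp) (sq_nonneg _)) ?_
    rw [div_pow, jacCn_sq, ← hA, hr]
    have hd2 := jacDn_sq hk2 ηp
    field_simp
    rw [hd2, hy2]
    ring
  exact ⟨hk, hk2, es, ed, hmem, hs, hr, hα⟩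

/-- Action, rotation number, parametrization of the curve and closed form of the action for the
focusing octupole. -/
theorem curve_FO {a c : ℝ} (hc : 0 < c) {k ηp η : ℝ}
    (hk' : k = modFO a c) (hηp' : ηp = etaFO a c) (hη' : η = phase a k ηp) :
    HasAction 1 a (curveFO a c) (actionFO a c) ∧
      HasRotationNumber 1 a (curveFO a c) (rotationFO a c) ∧
      curveFO a c = range (fun u =>
        (c ^ ((1 : ℝ) / 4) * √(k / compModulus k) * jacCn u k,
          c ^ ((1 : ℝ) / 4) * √(k / compModulus k) * jacCn (u + η) k)) ∧
      actionFO a c = 2 / Real.pi *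
        ((ellK k - jacSn ηp k ^ 2 * ellE k - jacCn ηp k ^ 2 * ellPi (k ^ 2 * jacSn ηp k ^ 2) k)
          / (jacSn ηp k * jacDn ηp k)) := by
  obtain ⟨hk, hk2, es, ed, hmem, hs, hr, hα⟩ := phaseFO_spec hc hk' hηp' hη'
  have hk0 := hk.1
  have hd := jacDn_pos hk2 ηp
  obtain ⟨hy, hy2, -⟩ := compModulus_spec hk
  have hscale : c ^ ((1 : ℝ) / 4) * √(k / compModulus k) = k * jacSn η k / jacDn η k := by
    rw [es, ed]
    refine (sq_eq_sq₀ (mul_nonneg (Real.rpow_nonneg hc.le _) (Real.sqrt_nonneg _))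
      (by positivity)).1 ?_
    rw [mul_pow, rpow_quarter_sq hc.le, Real.sq_sqrt (by positivity), hr]
    field_simp
  have hc4 : c = k ^ 2 * (1 - k ^ 2) * jacSn η k ^ 4 / jacDn η k ^ 4 := by
    rw [← Real.sq_sqrt hc.le, hr, es, ed, ← hy2]; ring
  have hrange := curveFO_eq_range hk2 hk0 (es ▸ hs) hα hc4
  rw [mul_div_cancel₀ a two_ne_zero] at hrange
  have H := octupolePhase_jacCn hk2 hk0.ne' (es ▸ hs : 0 < jacSn η k)
  rw [hα] at H
  have hact : actionFO a c = (k * jacSn η k / jacDn η k) ^ 2 / (2 * Real.pi) * areaCn k η := by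
    rw [actionFO, ← hk', ← hηp', ← hη', abs_of_pos hc, hr, es, ed]
    field_simp
  have h1 := H.hasAction
  have h2 := H.hasRotationNumber ⟨hmem.1.le, by linarith [hmem.2, ellK_pos hk2]⟩
  rw [mul_div_cancel₀ a two_ne_zero, ← hrange] at h1 h2
  refine ⟨?_, ?_, by rw [hrange, hscale], ?_⟩
  · rw [hact]; exact h1
  · rw [rotationFO, ← hk', ← hηp', ← hη']; exact h2
  · rw [hact, areaCn_formula hk0.ne' hk2 (es ▸ hs.ne')]
    have ec2 : jacCn η k ^ 2 = jacCn ηp k ^ 2 := by rw [jacCn_sq, jacCn_sq, es]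
    simp only [jacSd, es, ed, ec2]
    field_simp
    ring

theorem curveDf_eq_image_smul {a s c : ℝ} (hs : s = 1 ∨ s = -1) :
    curveDf a s c = (fun z : ℝ × ℝ => (s * z.1, s * z.2)) '' curveDf a 1 c := by
  have hs2 : s * s = 1 := by rcases hs with rfl | rfl <;> norm_num
  have hinv : ∀ q p, octInv 1 a (s * q) (s * p) = octInv 1 a q p := fun q p => by
    rcases hs with rfl | rfl <;> simp only [octInv] <;> ring
  ext ⟨q, p⟩
  constructor
  · rintro ⟨h1, h2⟩
    refine ⟨(s * q, s * p), ⟨(hinv q p).trans h1, by simpa using h2⟩, ?_⟩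
    simp only [← mul_assoc, hs2, one_mul]
  · rintro ⟨⟨q', p'⟩, ⟨h1, h2⟩, he⟩
    simp only [Prod.mk.injEq] at he h1 h2
    refine ⟨?_, ?_⟩
    · simp only [← he.1, ← he.2, hinv, h1]
    · simp only [← he.1, ← mul_assoc, hs2]; exact h2

theorem curveDf_neg (a s c : ℝ) :
    curveDf (-a) s c = (fun z : ℝ × ℝ => (z.1, -z.2)) '' curveDf a s c := by
  have hinv : ∀ q p, octInv 1 (-a) q p = octInv 1 a q (-p) := fun q p => by
    simp only [octInv]; ring
  ext ⟨q, p⟩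
  constructor
  · rintro ⟨h1, h2⟩
    exact ⟨(q, -p), ⟨(hinv q p).symm.trans h1, h2⟩, by simp⟩
  · rintro ⟨⟨q', p'⟩, ⟨h1, h2⟩, he⟩
    simp only [Prod.mk.injEq] at he h1 h2
    refine ⟨?_, ?_⟩
    · simp only [← he.1, ← he.2, hinv, neg_neg, h1]
    · simpa only [← he.1] using h2

/-- Reflecting the curve in the origin only changes the sign of the scale. -/
theorem OctupolePhase.smul_scale {σ h α β η P : ℝ} {E E' : ℝ → ℝ}
    (H : OctupolePhase σ h α β η P E E') {s : ℝ} (hs : s ^ 2 = 1) :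
    OctupolePhase σ (s * h) α β η P E E' where
  hasDerivAt := H.hasDerivAt
  add u := by rw [mul_pow, hs, one_mul]; exact H.add u
  sub u := by rw [mul_pow, hs, one_mul]; exact H.sub u
  denom_ne u := by rw [mul_pow, hs, one_mul]; exact H.denom_ne u
  periodic := H.periodic
  inj := H.inj
  period_pos := H.period_pos
  beta_pos := H.beta_pos
  scale_ne := mul_ne_zero (by rintro rfl; norm_num at hs) H.scale_ne

/-- Action, rotation number, parametrization of the curves and closed form of the action in the
Duffing regime. The lobe `q < 0` is the image of the lobe `q > 0` under reflection in the origin,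
and negative `a` is reduced to positive `a` by reflecting `p`. -/
theorem curve_Df {a c : ℝ} (ha : 2 < |a|) (hc : c ∈ Ioo (-(|a / 2| - 1) ^ 2) 0) {k ηp : ℝ}
    (hk' : k = modDf a c) (hηp' : ηp = etaDf a c) :
    (∀ s : ℝ, s = 1 ∨ s = -1 →
      HasAction 1 a (curveDf a s c) (actionDf a c) ∧
      (2 < a → HasRotationNumber 1 a (curveDf a s c) (rotationDf a c)) ∧
      curveDf a s c = range (fun u =>
        (s * (|c| ^ ((1 : ℝ) / 4) * √(1 / compModulus k) * jacDn u k),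
          s * (a / |a|) *
            (|c| ^ ((1 : ℝ) / 4) * √(1 / compModulus k) * jacDn (u + ηp) k)))) ∧
    actionDf a c = 1 / Real.pi *
      (((jacSn ηp k ^ 2 + jacDn ηp k ^ 2) * ellK k - jacSn ηp k ^ 2 * ellE k
        - jacDn ηp k ^ 2 * ellPi (k ^ 2 * jacSn ηp k ^ 2) k)
        / (jacSn ηp k * jacCn ηp k)) := by
  obtain ⟨hk, hA⟩ := modDf_spec ha hc
  obtain ⟨hηp, -, hs2⟩ := etaDf_spec ha hc
  rw [← hk'] at hk hA
  rw [← hk', ← hηp'] at hηp hs2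
  have hk2 := sq_lt_one_of_mem hk
  have hk0 := hk.1
  obtain ⟨hy, hy2, -⟩ := compModulus_spec hk
  have hs := jacSn_pos_of_mem hk2 (Ioo_subset_Ioc_self hηp)
  have hd := jacDn_pos hk2 ηp
  have hc0 : 0 < |c| := abs_pos.2 hc.2.ne
  have hx : 0 < jacCn ηp k := by
    refine (jacCn_nonneg_of_mem hk2 (Ioo_subset_Ioc_self hηp)).lt_of_ne fun h => ?_
    rw [← h] at hs2
    have : 0 < compModulus k * jacSn ηp k ^ 2 := by positivity
    norm_num at hs2
    rcases hs2 with h1 | h1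
    · exact hy.ne' h1
    · exact hs.ne' h1
  have hr : √|c| = compModulus k * jacSn ηp k ^ 2 / jacCn ηp k ^ 2 := by
    rw [← hs2]; field_simp
  have hα : jacDn ηp k / jacCn ηp k ^ 2 = |a| / 2 := by
    refine (sq_eq_sq₀ (by positivity) (by positivity)).1 ?_
    have hA' : (|a| / 2) ^ 2 = (a / 2) ^ 2 := by rw [div_pow, sq_abs, div_pow]
    rw [hA', ← hA, hr, div_pow, jacDn_sq hk2]
    have hc2 := jacCn_sq (k := k) ηp
    field_simp
    rw [hc2, hy2]
    ring
  have hscale : |c| ^ ((1 : ℝ) / 4) * √(1 / compModulus k) = jacSn ηp k / jacCn ηp k := by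
    refine (sq_eq_sq₀ (mul_nonneg (Real.rpow_nonneg hc0.le _) (Real.sqrt_nonneg _))
      (by positivity)).1 ?_
    rw [mul_pow, rpow_quarter_sq hc0.le, Real.sq_sqrt (by positivity), hr]
    field_simp
  have hc4 : c = -((1 - k ^ 2) * jacSn ηp k ^ 4 / jacCn ηp k ^ 4) := by
    have : |c| = (1 - k ^ 2) * jacSn ηp k ^ 4 / jacCn ηp k ^ 4 := by
      rw [← Real.sq_sqrt hc0.le, hr, ← hy2]; ring
    rw [← this, abs_of_neg hc.2, neg_neg]
  have hrange1 := curveDf_one_eq_range hk2 hk0 hs hx hα hc4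
  rw [mul_div_cancel₀ |a| two_ne_zero] at hrange1
  have H := octupolePhase_jacDn hk2 hk0.ne' hs hx
  rw [hα] at H
  have hact : actionDf a c
      = (jacSn ηp k / jacCn ηp k) ^ 2 / (2 * Real.pi) * areaDn k ηp := by
    rw [actionDf, ← hk', ← hηp', hr]
    field_simp
  refine ⟨fun s hs1 => ?_, ?_⟩
  · have hsq : s ^ 2 = 1 := by rcases hs1 with rfl | rfl <;> norm_num
    have Hs := H.smul_scale hsq
    have hrange : curveDf |a| s c = range fun u => (s * (jacSn ηp k / jacCn ηp k) * jacDn u k,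
        s * (jacSn ηp k / jacCn ηp k) * jacDn (u + ηp) k) := by
      rw [curveDf_eq_image_smul hs1, hrange1, ← range_comp]
      congr 1
      funext u
      simp only [Function.comp, mul_assoc]
    have h1 := Hs.isClosedOrbit
    have h2 := Hs.hasRotationNumber (⟨hηp.1.le, by linarith [hηp.2, ellK_pos hk2]⟩)
    rw [mul_div_cancel₀ |a| two_ne_zero, ← hrange] at h1 h2
    have hJ : actionDf a c
        = (s * (jacSn ηp k / jacCn ηp k)) ^ 2 / (2 * Real.pi) * areaDn k ηp := by
      rw [hact, mul_pow, hsq, one_mul]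
    rw [hJ, areaDn, ← Hs.integral_eq, hscale]
    rcases lt_or_ge a 0 with h0 | h0
    · have h3 := h1.reflect
      have h4 := h3.hasAction
      rw [h1.integral_reflect] at h4
      rw [← curveDf_neg, abs_of_neg h0, neg_neg] at h4
      refine ⟨h4, fun h => absurd h (by linarith), ?_⟩
      have e : a = -|a| := by rw [abs_of_neg h0, neg_neg]
      have e2 : a / |a| = -1 := by rw [abs_of_neg h0, div_neg, div_self h0.ne]
      rw [e2]
      conv_lhs => rw [e, curveDf_neg, hrange, ← range_comp]
      congr 1
      funext u
      simp only [Function.comp, Prod.mk.injEq]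
      exact ⟨by ring, by ring⟩
    · have h0' : 0 < a := by
        rcases h0.eq_or_lt with h | h
        · rw [← h, abs_zero] at ha; linarith
        · exact h
      rw [abs_of_pos h0'] at h1 h2 hrange ⊢
      refine ⟨h1.hasAction, fun _ => ?_, ?_⟩
      · rw [rotationDf, ← hk', ← hηp']; exact h2
      · rw [hrange, div_self h0'.ne', mul_one]
        simp only [mul_assoc]
  · rw [hact, areaDn_formula hk0.ne' hk2 hs.ne']
    simp only [jacSc]
    field_simp

/-! ### Truncated Taylor expansions -/

section TaylorExp

variable {ι : Type*} {l : Filter ι} {u f g : ι → ℝ}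

/-- Along the filter `l`, the function `f` agrees with the quartic polynomial in the small quantity
`u` with the given coefficients, up to `O(u ^ 5)`. -/
def TaylorExp (l : Filter ι) (u f : ι → ℝ) (c₀ c₁ c₂ c₃ c₄ : ℝ) : Prop :=
  (fun t => f t - (c₀ + c₁ * u t + c₂ * u t ^ 2 + c₃ * u t ^ 3 + c₄ * u t ^ 4)) =O[l]
    fun t => u t ^ 5

namespace TaylorExp

variable {c₀ c₁ c₂ c₃ c₄ d₀ d₁ d₂ d₃ d₄ : ℝ}

theorem of_eq (h : ∀ t, f t = c₀ + c₁ * u t + c₂ * u t ^ 2 + c₃ * u t ^ 3 + c₄ * u t ^ 4) :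
    TaylorExp l u f c₀ c₁ c₂ c₃ c₄ := by
  refine (isBigO_zero _ _).congr_left fun t => ?_
  rw [h, sub_self]

theorem congr_coeff (hf : TaylorExp l u f c₀ c₁ c₂ c₃ c₄) (h₀ : c₀ = d₀) (h₁ : c₁ = d₁)
    (h₂ : c₂ = d₂) (h₃ : c₃ = d₃) (h₄ : c₄ = d₄) : TaylorExp l u f d₀ d₁ d₂ d₃ d₄ := by
  subst h₀ h₁ h₂ h₃ h₄; exact hf

theorem add_isBigO (hf : TaylorExp l u f c₀ c₁ c₂ c₃ c₄)
    (h : (fun t => g t - f t) =O[l] fun t => u t ^ 5) : TaylorExp l u g c₀ c₁ c₂ c₃ c₄ := by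
  refine (h.add hf).congr_left fun t => ?_
  ring

theorem congr' (hf : TaylorExp l u f c₀ c₁ c₂ c₃ c₄) (h : g =ᶠ[l] f) :
    TaylorExp l u g c₀ c₁ c₂ c₃ c₄ := by
  refine IsBigO.congr' hf ?_ EventuallyEq.rfl
  filter_upwards [h] with t ht
  rw [ht]

theorem add (hf : TaylorExp l u f c₀ c₁ c₂ c₃ c₄) (hg : TaylorExp l u g d₀ d₁ d₂ d₃ d₄) :
    TaylorExp l u (fun t => f t + g t) (c₀ + d₀) (c₁ + d₁) (c₂ + d₂) (c₃ + d₃) (c₄ + d₄) := by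
  refine (IsBigO.add hf hg).congr_left fun t => ?_
  ring

theorem const_mul (hf : TaylorExp l u f c₀ c₁ c₂ c₃ c₄) (r : ℝ) :
    TaylorExp l u (fun t => r * f t) (r * c₀) (r * c₁) (r * c₂) (r * c₃) (r * c₄) := by
  refine (IsBigO.const_mul_left hf r).congr_left fun t => ?_
  ring

theorem sub (hf : TaylorExp l u f c₀ c₁ c₂ c₃ c₄) (hg : TaylorExp l u g d₀ d₁ d₂ d₃ d₄) :
    TaylorExp l u (fun t => f t - g t) (c₀ - d₀) (c₁ - d₁) (c₂ - d₂) (c₃ - d₃) (c₄ - d₄) := by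
  refine (IsBigO.sub hf hg).congr_left fun t => ?_
  ring

theorem tendsto (hf : TaylorExp l u f c₀ c₁ c₂ c₃ c₄) (hu : Tendsto u l (𝓝 0)) :
    Tendsto f l (𝓝 c₀) := by
  have h1 : Tendsto (fun t => f t - (c₀ + c₁ * u t + c₂ * u t ^ 2 + c₃ * u t ^ 3 + c₄ * u t ^ 4))
      l (𝓝 0) := IsBigO.trans_tendsto hf (by simpa using hu.pow 5)
  have h2 : Tendsto (fun t => c₀ + c₁ * u t + c₂ * u t ^ 2 + c₃ * u t ^ 3 + c₄ * u t ^ 4)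
      l (𝓝 (c₀ + c₁ * 0 + c₂ * 0 ^ 2 + c₃ * 0 ^ 3 + c₄ * 0 ^ 4)) := by
    exact ((((tendsto_const_nhds.add (hu.const_mul _)).add ((hu.pow 2).const_mul _)).add
      ((hu.pow 3).const_mul _)).add ((hu.pow 4).const_mul _))
  have h3 := h1.add h2
  simpa using h3

theorem mul (hu : Tendsto u l (𝓝 0)) (hf : TaylorExp l u f c₀ c₁ c₂ c₃ c₄)
    (hg : TaylorExp l u g d₀ d₁ d₂ d₃ d₄) :
    TaylorExp l u (fun t => f t * g t) (c₀ * d₀) (c₀ * d₁ + c₁ * d₀)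
      (c₀ * d₂ + c₁ * d₁ + c₂ * d₀) (c₀ * d₃ + c₁ * d₂ + c₂ * d₁ + c₃ * d₀)
      (c₀ * d₄ + c₁ * d₃ + c₂ * d₂ + c₃ * d₁ + c₄ * d₀) := by
  have hq := (of_eq (l := l) (u := u) (c₀ := d₀) (c₁ := d₁) (c₂ := d₂) (c₃ := d₃) (c₄ := d₄)
    fun t => rfl).tendsto hu
  have h1 := IsBigO.mul ((hf.tendsto hu).isBigO_one ℝ) hg
  have h2 := IsBigO.mul hf (hq.isBigO_one ℝ)
  have h3 : (fun t => u t ^ 5 * ((c₁ * d₄ + c₂ * d₃ + c₃ * d₂ + c₄ * d₁)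
      + (c₂ * d₄ + c₃ * d₃ + c₄ * d₂) * u t + (c₃ * d₄ + c₄ * d₃) * u t ^ 2
      + (c₄ * d₄) * u t ^ 3 + 0 * u t ^ 4)) =O[l] fun t => u t ^ 5 * 1 :=
    (isBigO_refl _ _).mul (((of_eq (l := l) (u := u) fun t => rfl).tendsto hu).isBigO_one ℝ)
  simp only [one_mul, mul_one] at h1 h2 h3
  refine ((h1.add h2).add h3).congr_left fun t => ?_
  ring

theorem sq (hu : Tendsto u l (𝓝 0)) (hf : TaylorExp l u f c₀ c₁ c₂ c₃ c₄) :
    TaylorExp l u (fun t => f t ^ 2) (c₀ ^ 2) (2 * c₀ * c₁)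
      (2 * c₀ * c₂ + c₁ ^ 2) (2 * c₀ * c₃ + 2 * c₁ * c₂)
      (2 * c₀ * c₄ + 2 * c₁ * c₃ + c₂ ^ 2) := by
  have := (hf.mul hu hf).congr_coeff (by ring) (by ring) (by ring) (by ring) (by ring)
    (d₀ := c₀ ^ 2) (d₁ := 2 * c₀ * c₁) (d₂ := 2 * c₀ * c₂ + c₁ ^ 2)
    (d₃ := 2 * c₀ * c₃ + 2 * c₁ * c₂) (d₄ := 2 * c₀ * c₄ + 2 * c₁ * c₃ + c₂ ^ 2)
  simpa only [← pow_two] using this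

/-- Multiplication by the expansion variable shifts the coefficients. -/
theorem var_mul (hu : Tendsto u l (𝓝 0)) (hf : TaylorExp l u f c₀ c₁ c₂ c₃ c₄) :
    TaylorExp l u (fun t => u t * f t) 0 c₀ c₁ c₂ c₃ :=
  ((of_eq (c₀ := 0) (c₁ := 1) (c₂ := 0) (c₃ := 0) (c₄ := 0) fun t => by ring).mul hu
    hf).congr_coeff (by ring) (by ring) (by ring) (by ring) (by ring)

/-- The coefficients of the reciprocal are characterized by the Cauchy product. -/
theorem inv (hu : Tendsto u l (𝓝 0)) (hf : TaylorExp l u f c₀ c₁ c₂ c₃ c₄)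
    (h₀ : c₀ * d₀ = 1) (h₁ : c₀ * d₁ + c₁ * d₀ = 0) (h₂ : c₀ * d₂ + c₁ * d₁ + c₂ * d₀ = 0)
    (h₃ : c₀ * d₃ + c₁ * d₂ + c₂ * d₁ + c₃ * d₀ = 0)
    (h₄ : c₀ * d₄ + c₁ * d₃ + c₂ * d₂ + c₃ * d₁ + c₄ * d₀ = 0) :
    TaylorExp l u (fun t => (f t)⁻¹) d₀ d₁ d₂ d₃ d₄ := by
  have hc : c₀ ≠ 0 := left_ne_zero_of_mul_eq_one h₀
  have ht := hf.tendsto hu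
  have hp := (hf.mul hu (of_eq
    (u := u) (c₀ := d₀) (c₁ := d₁) (c₂ := d₂) (c₃ := d₃) (c₄ := d₄) fun t => rfl)).congr_coeff
    h₀ h₁ h₂ h₃ h₄
  have h1 := (((ht.inv₀ hc).isBigO_one ℝ).neg_left).mul hp
  simp only [one_mul] at h1
  refine h1.congr' ?_ EventuallyEq.rfl
  filter_upwards [ht.eventually_ne hc] with t h
  field_simp
  ring

/-- The coefficients of the square root are characterized by the Cauchy product. -/
theorem sqrt (hu : Tendsto u l (𝓝 0)) (hf : TaylorExp l u f c₀ c₁ c₂ c₃ c₄) (hd : 0 < d₀)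
    (h₀ : d₀ ^ 2 = c₀) (h₁ : 2 * d₀ * d₁ = c₁) (h₂ : 2 * d₀ * d₂ + d₁ ^ 2 = c₂)
    (h₃ : 2 * d₀ * d₃ + 2 * d₁ * d₂ = c₃)
    (h₄ : 2 * d₀ * d₄ + 2 * d₁ * d₃ + d₂ ^ 2 = c₄) :
    TaylorExp l u (fun t => √(f t)) d₀ d₁ d₂ d₃ d₄ := by
  have hq : TaylorExp l u (fun t => d₀ + d₁ * u t + d₂ * u t ^ 2 + d₃ * u t ^ 3 + d₄ * u t ^ 4)
    d₀ d₁ d₂ d₃ d₄ := of_eq fun t => rfl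
  have hqt := hq.tendsto hu
  have ht := hf.tendsto hu
  have hp := hf.sub ((hq.sq hu).congr_coeff h₀ h₁ h₂ h₃ h₄)
  have hpos : ∀ᶠ t in l, 0 < f t := ht.eventually_const_lt (by rw [← h₀]; positivity)
  have hsum : Tendsto (fun t => √(f t) + (d₀ + d₁ * u t + d₂ * u t ^ 2 + d₃ * u t ^ 3
      + d₄ * u t ^ 4)) l (𝓝 (√c₀ + d₀)) := (ht.sqrt).add hqt
  have hne : √c₀ + d₀ ≠ 0 := by positivity
  have h1 := ((hsum.inv₀ hne).isBigO_one ℝ).mul hp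
  simp only [one_mul] at h1
  refine h1.congr' ?_ EventuallyEq.rfl
  filter_upwards [hsum.eventually_ne hne, hpos] with t h h'
  rw [inv_mul_eq_div, div_eq_iff h]
  nlinarith [Real.sq_sqrt h'.le]

theorem comp_tendsto {κ : Type*} {l' : Filter κ} {v : κ → ι}
    (hf : TaylorExp l u f c₀ c₁ c₂ c₃ c₄) (hv : Tendsto v l' l) :
    TaylorExp l' (u ∘ v) (f ∘ v) c₀ c₁ c₂ c₃ c₄ := IsBigO.comp_tendsto hf hv

theorem isBigO_of_zero (hu : Tendsto u l (𝓝 0)) (hf : TaylorExp l u f 0 c₁ c₂ c₃ c₄) :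
    f =O[l] u := by
  have h1 : (fun t => u t ^ 5) =O[l] u := by
    have := (isBigO_refl u l).mul ((hu.pow 4).isBigO_one ℝ)
    simp only [mul_one] at this
    exact this.congr_left fun t => by ring
  have h2 : (fun t => u t * (c₁ + c₂ * u t + c₃ * u t ^ 2 + c₄ * u t ^ 3 + 0 * u t ^ 4)) =O[l]
      fun t => u t * 1 :=
    (isBigO_refl _ _).mul (((of_eq (l := l) (u := u) fun t => rfl).tendsto hu).isBigO_one ℝ)
  simp only [mul_one] at h2
  refine ((IsBigO.trans hf h1).add h2).congr_left fun t => ?_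
  ring

/-- If the linear coefficient does not vanish, the expansion variable is controlled by the
function. -/
theorem var_isBigO (hu : Tendsto u l (𝓝 0)) (hf : TaylorExp l u f 0 c₁ c₂ c₃ c₄) (hc : c₁ ≠ 0) :
    u =O[l] f := by
  have h1 : (fun t => f t - c₁ * u t) =o[l] u := by
    have h2 : (fun t => u t ^ 5) =o[l] u := by
      have := (isBigO_refl u l).mul_isLittleO
        ((isLittleO_one_iff ℝ).2 (by simpa using hu.pow 4 : Tendsto (fun t => u t ^ 4) l (𝓝 0)))
      simp only [mul_one] at this
      exact this.congr_left fun t => by ring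
    have h3 : (fun t => u t * (0 + c₂ * u t + c₃ * u t ^ 2 + c₄ * u t ^ 3 + 0 * u t ^ 4)) =o[l]
        fun t => u t * 1 :=
      (isBigO_refl _ _).mul_isLittleO ((isLittleO_one_iff ℝ).2
        ((of_eq (l := l) (u := u) fun t => rfl).tendsto hu))
    simp only [mul_one] at h3
    refine ((IsBigO.trans_isLittleO hf h2).add h3).congr_left fun t => ?_
    ring
  have h2 : (fun t => f t - c₁ * u t) =o[l] fun t => c₁ * u t := h1.const_mul_right hc
  have h3 := h2.right_isBigO_add
  simp only [sub_add_cancel] at h3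
  exact (isBigO_const_mul_self c₁⁻¹ _ _ |>.congr_left fun t => by
    rw [← mul_assoc, inv_mul_cancel₀ hc, one_mul] : u =O[l] fun t => c₁ * u t).trans h3

/-- Composition: the expansion variable of `f` is itself expanded in a smaller quantity. -/
theorem subst {v : ι → ℝ} (hu : Tendsto u l (𝓝 0)) (hv : TaylorExp l u v 0 d₁ d₂ d₃ d₄)
    (hf : TaylorExp l v f c₀ c₁ c₂ c₃ c₄) :
    TaylorExp l u f c₀ (c₁ * d₁) (c₁ * d₂ + c₂ * d₁ ^ 2)
      (c₁ * d₃ + c₂ * (2 * d₁ * d₂) + c₃ * d₁ ^ 3)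
      (c₁ * d₄ + c₂ * (2 * d₁ * d₃ + d₂ ^ 2) + c₃ * (3 * d₁ ^ 2 * d₂) + c₄ * d₁ ^ 4) := by
  have hO := (hv.isBigO_of_zero hu).pow 5
  have h2 := hv.sq hu
  have h3 := h2.mul hu hv
  have h4 := h2.sq hu
  have h := ((((of_eq (l := l) (u := u) (f := fun _ => c₀) (c₀ := c₀) (c₁ := 0) (c₂ := 0)
    (c₃ := 0) (c₄ := 0) fun t => by ring).add (hv.const_mul c₁)).add (h2.const_mul c₂)).add
    (h3.const_mul c₃)).add (h4.const_mul c₄)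
  refine (add_isBigO h (g := f) ((IsBigO.trans hf hO).congr_left fun t => ?_)).congr_coeff
    ?_ ?_ ?_ ?_ ?_ <;> ring

end TaylorExp

/-- Termwise integration of an expansion of the derivative. -/
theorem TaylorExp.integrate {φ φ' : ℝ → ℝ} {d₀ d₁ d₂ d₃ d₄ : ℝ}
    (hφ : ∀ᶠ t in 𝓝 0, HasDerivAt φ (φ' t) t)
    (h : TaylorExp (𝓝 0) id φ' d₀ d₁ d₂ d₃ d₄) :
    TaylorExp (𝓝 0) id φ (φ 0) d₀ (d₁ / 2) (d₂ / 3) (d₃ / 4) := by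
  have h' : (fun t => φ' t - (d₀ + d₁ * t + d₂ * t ^ 2 + d₃ * t ^ 3)) =O[𝓝 0] fun t => t ^ 4 := by
    have h1 := (isBigO_refl (fun t : ℝ => t ^ 4) (𝓝 0)).mul ((tendsto_id (α := ℝ)
      (x := 𝓝 0)).isBigO_one ℝ)
    have h2 := (isBigO_refl (fun t : ℝ => t ^ 4) (𝓝 0)).const_mul_left d₄
    simp only [mul_one, id] at h1
    refine ((IsBigO.trans h (h1.congr_left fun t => ?_)).add h2).congr_left fun t => ?_
    · simp only [id]; ring
    · simp only [id]; ring
  obtain ⟨C, hC⟩ := h'.bound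
  obtain ⟨ε, hε, H⟩ := Metric.eventually_nhds_iff_ball.1 (hφ.and hC)
  refine IsBigO.of_bound C ?_
  filter_upwards [Metric.ball_mem_nhds 0 hε] with t ht
  have hsub : ∀ x ∈ segment ℝ 0 t, x ∈ Metric.ball (0 : ℝ) ε ∧ ‖x‖ ≤ ‖t‖ := by
    intro x hx
    refine ⟨(convex_ball 0 ε).segment_subset (Metric.mem_ball_self hε) ht hx, ?_⟩
    obtain ⟨b, hb, rfl⟩ := (segment_eq_image ℝ 0 t ▸ hx : x ∈ (fun θ : ℝ => _) '' _)
    simp only [smul_eq_mul, mul_zero, zero_add, Real.norm_eq_abs, abs_mul, abs_of_nonneg hb.1]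
    exact mul_le_of_le_one_left (abs_nonneg _) hb.2
  have hderiv : ∀ x ∈ segment ℝ 0 t, HasDerivWithinAt (fun t => φ t
      - (φ 0 + d₀ * t + d₁ / 2 * t ^ 2 + d₂ / 3 * t ^ 3 + d₃ / 4 * t ^ 4))
      (φ' x - (d₀ + d₁ * x + d₂ * x ^ 2 + d₃ * x ^ 3)) (segment ℝ 0 t) x := by
    intro x hx
    refine HasDerivAt.hasDerivWithinAt ?_
    have h0 := hasDerivAt_id x
    have h1 := ((((h0.const_mul d₀).const_add (φ 0)).add ((h0.pow 2).const_mul (d₁ / 2))).add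
      ((h0.pow 3).const_mul (d₂ / 3))).add ((h0.pow 4).const_mul (d₃ / 4))
    refine ((H x (hsub x hx).1).1.sub h1).congr_deriv ?_
    simp only [id]
    push_cast
    ring
  have hC0 : 0 ≤ C * ‖t‖ ^ 4 := by
    have := (norm_nonneg _).trans (H t ht).2
    rwa [norm_pow] at this
  have hb := (convex_segment (0 : ℝ) t).norm_image_sub_le_of_norm_hasDerivWithin_le
    (C := C * ‖t‖ ^ 4) hderiv (fun x hx => ?_) (left_mem_segment ℝ 0 t) (right_mem_segment ℝ 0 t)
  · simp only [id, norm_pow, sub_zero] at hb ⊢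
    convert hb using 1
    · congr 1; ring
    · ring
  · have h1 := (H x (hsub x hx).1).2
    rw [norm_pow] at h1
    rcases eq_or_ne t 0 with rfl | h0
    · have : x = 0 := by simpa using (hsub x hx).2
      subst this
      simpa using h1
    · have : 0 ≤ C := nonneg_of_mul_nonneg_left hC0 (by positivity)
      refine h1.trans ?_
      gcongr
      exact (hsub x hx).2

end TaylorExp

/-! ### Expansions under the integral sign -/

/-- The coefficients `(2n - 1)!! / (2n)!!` of `(1 - x) ^ (-1 / 2)`. -/
def wallis : ℕ → ℝ
  | 0 => 1
  | n + 1 => (2 * n + 1) / (2 * n + 2) * wallis n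

theorem choose_neg_half (n : ℕ) : Ring.choose (-1 / 2 : ℝ) n = (-1) ^ n * wallis n := by
  induction n with
  | zero => simp [wallis]
  | succ n ih =>
    rw [Ring.choose_eq_smul] at ih ⊢
    rw [descPochhammer_succ_right, Polynomial.smeval_mul, Polynomial.smeval_sub, wallis,
      pow_succ, mul_comm ((-1 : ℝ) ^ n) (-1), mul_assoc, mul_left_comm ((-1 : ℝ) ^ n), ← ih,
      Nat.factorial_succ]
    simp only [smul_eq_mul, Polynomial.smeval_X, pow_one, Polynomial.smeval_natCast, pow_zero,
      Nat.cast_mul, Nat.cast_succ]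
    field_simp
    simp
    ring

/-- The binomial expansion of `(1 - x) ^ (-1 / 2)` with a remainder bound on an interval. -/
theorem exists_inv_sqrt_expansion (N : ℕ) : ∃ C r : ℝ, 0 ≤ C ∧ 0 < r ∧ r ≤ 1 / 2 ∧ ∀ x, |x| ≤ r →
    |1 / √(1 - x) - ∑ n ∈ Finset.range N, wallis n * x ^ n| ≤ C * |x| ^ N := by
  have h := (Real.one_add_rpow_hasFPowerSeriesAt_zero (a := -1 / 2)).isBigO_sub_partialSum_pow N
  have h2 := h.comp_tendsto (k := fun x : ℝ => -x) (l' := 𝓝 0) (by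
    simpa using (continuous_neg (G := ℝ)).tendsto 0)
  obtain ⟨C, hC0, hC⟩ := h2.exists_nonneg
  obtain ⟨ε, hε, H⟩ := Metric.eventually_nhds_iff_ball.1 hC.bound
  refine ⟨C, min (ε / 2) (1 / 2), hC0, by positivity, min_le_right _ _, fun x hx => ?_⟩
  have hx1 : |x| < ε := by linarith [hx.trans (min_le_left _ _)]
  have hx2 : |x| ≤ 1 / 2 := hx.trans (min_le_right _ _)
  have h3 := H x (by simpa using hx1)
  have hpos : 0 ≤ 1 - x := by linarith [le_abs_self x]
  simp only [Function.comp, zero_add, norm_pow, norm_neg, Real.norm_eq_abs] at h3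
  convert h3 using 2
  congr 1
  · rw [← sub_eq_add_neg, show (-1 / 2 : ℝ) = -(1 / 2) by norm_num, Real.rpow_neg hpos,
      Real.sqrt_eq_rpow, one_div]
  · rw [FormalMultilinearSeries.partialSum]
    refine Finset.sum_congr rfl fun n _ => ?_
    simp only [binomialSeries, FormalMultilinearSeries.ofScalars_apply_eq, choose_neg_half,
      smul_eq_mul]
    have h4 : (-1 : ℝ) ^ n * (-1) ^ n = 1 := by rw [← mul_pow]; norm_num
    rw [neg_pow x]
    linear_combination -(wallis n * x ^ n) * h4
  · rw [abs_abs]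

/-- The coefficients of `1 / ((1 - g x) √(1 - x))` as a power series in `x`. -/
def thirdCoeff (g : ℝ) : ℕ → ℝ
  | 0 => 1
  | n + 1 => wallis (n + 1) + g * thirdCoeff g n

/-- The recursion for `thirdCoeff` telescopes: multiplication by `1 - g x` leaves the binomial sum
and a single term of the next order. -/
theorem one_sub_mul_sum_thirdCoeff (g x : ℝ) (N : ℕ) :
    (1 - g * x) * ∑ n ∈ Finset.range (N + 1), thirdCoeff g n * x ^ n
      = ∑ n ∈ Finset.range (N + 1), wallis n * x ^ n - g * thirdCoeff g N * x ^ (N + 1) := by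
  induction N with
  | zero => simp [thirdCoeff, wallis]
  | succ N ih =>
    rw [Finset.sum_range_succ, mul_add, ih, Finset.sum_range_succ _ (N + 1)]
    simp only [thirdCoeff]
    ring

theorem wallis_mem (n : ℕ) : wallis n ∈ Icc 0 1 := by
  induction n with
  | zero => simp [wallis]
  | succ n ih =>
    refine ⟨by rw [wallis]; have := ih.1; positivity, ?_⟩
    rw [wallis]
    refine mul_le_one₀ ?_ ih.1 ih.2
    rw [div_le_one (by positivity)]
    linarith

theorem thirdCoeff_mem {g : ℝ} (hg : g ∈ Icc 0 1) (n : ℕ) : thirdCoeff g n ∈ Icc 0 (n + 1 : ℝ) := by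
  induction n with
  | zero => simp [thirdCoeff]
  | succ n ih =>
    have h := wallis_mem (n + 1)
    simp only [thirdCoeff, mem_Icc, Nat.cast_add, Nat.cast_one]
    have h1 := mul_nonneg hg.1 ih.1
    have h2 := mul_le_of_le_one_left ih.1 hg.2
    exact ⟨by linarith [h.1], by linarith [h.2, ih.2]⟩

theorem thirdCoeff_zero_left (n : ℕ) : thirdCoeff 0 n = wallis n := by
  cases n <;> simp [thirdCoeff, wallis]

theorem exists_third_expansion (N : ℕ) : ∃ C r : ℝ, 0 ≤ C ∧ 0 < r ∧ r ≤ 1 / 2 ∧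
    ∀ x, |x| ≤ r → ∀ g ∈ Icc (0 : ℝ) 1,
    |1 / ((1 - g * x) * √(1 - x)) - ∑ n ∈ Finset.range (N + 1), thirdCoeff g n * x ^ n|
      ≤ C * |x| ^ (N + 1) := by
  obtain ⟨C, r, hC, hr, hr2, H⟩ := exists_inv_sqrt_expansion (N + 1)
  refine ⟨2 * (C + (N + 1)), r, by positivity, hr, hr2, fun x hx g hg => ?_⟩
  have hgx : 1 / 2 ≤ 1 - g * x := by
    have : |g * x| ≤ 1 / 2 := by
      rw [abs_mul, abs_of_nonneg hg.1]
      nlinarith [hg.1, hg.2, abs_nonneg x]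
    linarith [le_abs_self (g * x)]
  have hpos : 0 < 1 - g * x := by linarith
  have e : 1 / ((1 - g * x) * √(1 - x)) - ∑ n ∈ Finset.range (N + 1), thirdCoeff g n * x ^ n
      = ((1 / √(1 - x) - ∑ n ∈ Finset.range (N + 1), wallis n * x ^ n)
        + g * thirdCoeff g N * x ^ (N + 1)) / (1 - g * x) := by
    rw [eq_div_iff hpos.ne', sub_mul, mul_comm _ (1 - g * x), mul_comm _ (1 - g * x),
      one_sub_mul_sum_thirdCoeff, ← one_div_mul_one_div, ← mul_assoc, mul_one_div_cancel hpos.ne']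
    ring
  have h1 := H x hx
  have h2 : |g * thirdCoeff g N * x ^ (N + 1)| ≤ (N + 1) * |x| ^ (N + 1) := by
    have h3 := thirdCoeff_mem hg N
    rw [abs_mul, abs_pow, abs_mul, abs_of_nonneg hg.1, abs_of_nonneg h3.1]
    gcongr
    exact (mul_le_of_le_one_left h3.1 hg.2).trans h3.2
  rw [e, abs_div, abs_of_pos hpos, div_le_iff₀ hpos]
  have h4 := abs_add_le (1 / √(1 - x) - ∑ n ∈ Finset.range (N + 1), wallis n * x ^ n)
    (g * thirdCoeff g N * x ^ (N + 1))
  have h5 : 0 ≤ (C + (N + 1)) * |x| ^ (N + 1) := by positivity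
  nlinarith

/-- Expansion of an integral of the third kind in the modulus, uniformly in the characteristic
and in the weight. -/
theorem exists_integral_expansion (N : ℕ) : ∃ C r : ℝ, 0 ≤ C ∧ 0 < r ∧ r ≤ 1 / 2 ∧
    ∀ W h : ℝ → ℝ, Continuous W → Continuous h → (∀ θ, |W θ| ≤ 1) → (∀ θ, |h θ| ≤ 1) →
    ∀ m, |m| ≤ r → ∀ g ∈ Icc (0 : ℝ) 1, ∀ b, 0 ≤ b →
    |(∫ θ in (0 : ℝ)..b, W θ * (1 / ((1 - g * (m * h θ)) * √(1 - m * h θ))))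
      - ∑ n ∈ Finset.range (N + 1), thirdCoeff g n * m ^ n * ∫ θ in (0 : ℝ)..b, W θ * h θ ^ n|
      ≤ C * |m| ^ (N + 1) * b := by
  obtain ⟨C, r, hC, hr, hr2, H⟩ := exists_third_expansion N
  refine ⟨C, r, hC, hr, hr2, fun W h hW hh hW1 hh1 m hm g hg b hb => ?_⟩
  have hx : ∀ θ, |m * h θ| ≤ |m| := fun θ => by
    rw [abs_mul]; exact mul_le_of_le_one_right (abs_nonneg _) (hh1 θ)
  have hx2 : ∀ θ, |m * h θ| ≤ 1 / 2 := fun θ => (hx θ).trans (hm.trans hr2)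
  have hpos : ∀ θ, 0 < 1 - m * h θ := fun θ => by linarith [le_abs_self (m * h θ), hx2 θ]
  have hpos' : ∀ θ, 0 < 1 - g * (m * h θ) := fun θ => by
    have h1 : |g * (m * h θ)| ≤ 1 / 2 := by
      rw [abs_mul, abs_of_nonneg hg.1]
      nlinarith [hg.1, hg.2, abs_nonneg (m * h θ), hx2 θ]
    linarith [le_abs_self (g * (m * h θ))]
  have hcont : Continuous fun θ => W θ * (1 / ((1 - g * (m * h θ)) * √(1 - m * h θ))) := by
    refine hW.mul (continuous_const.div (by fun_prop) fun θ => ?_)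
    exact (mul_pos (hpos' θ) (Real.sqrt_pos.2 (hpos θ))).ne'
  have e : ∑ n ∈ Finset.range (N + 1), thirdCoeff g n * m ^ n * ∫ θ in (0 : ℝ)..b, W θ * h θ ^ n
      = ∫ θ in (0 : ℝ)..b, W θ * ∑ n ∈ Finset.range (N + 1), thirdCoeff g n * (m * h θ) ^ n := by
    simp only [Finset.mul_sum]
    rw [intervalIntegral.integral_finsetSum fun n _ => by
      apply Continuous.intervalIntegrable; fun_prop]
    refine Finset.sum_congr rfl fun n _ => ?_
    rw [← intervalIntegral.integral_const_mul]
    congr 1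
    funext θ
    ring
  rw [e, ← intervalIntegral.integral_sub (hcont.intervalIntegrable _ _)
    (by apply Continuous.intervalIntegrable; fun_prop)]
  have hb' := intervalIntegral.norm_integral_le_of_norm_le_const (a := 0) (b := b)
    (C := C * |m| ^ (N + 1)) (f := fun θ => W θ * (1 / ((1 - g * (m * h θ)) * √(1 - m * h θ)))
      - W θ * ∑ n ∈ Finset.range (N + 1), thirdCoeff g n * (m * h θ) ^ n) fun θ _ => ?_
  · rwa [sub_zero, abs_of_nonneg hb] at hb'
  · rw [← mul_sub, norm_mul]
    have h1 := H (m * h θ) ((hx θ).trans hm) g hg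
    refine (mul_le_of_le_one_left (norm_nonneg _) (hW1 θ)).trans (h1.trans ?_)
    exact mul_le_mul_of_nonneg_left (pow_le_pow_left₀ (abs_nonneg _) (hx θ) _) hC

/-- The polynomial part of `∫ sin ^ (2 n)`. -/
def wallisRem (w : ℝ) : ℕ → ℝ
  | 0 => 0
  | n + 1 => (2 * n + 1) / (2 * n + 2) * wallisRem w n - w ^ n / (2 * n + 2)

theorem integral_sin_pow_eq_wallis (φ : ℝ) (n : ℕ) :
    ∫ θ in (0 : ℝ)..φ, (Real.sin θ ^ 2) ^ n
      = wallis n * φ + Real.sin φ * Real.cos φ * wallisRem (Real.sin φ ^ 2) n := by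
  induction n with
  | zero => simp [wallis, wallisRem]
  | succ n ih =>
    simp only [← pow_mul] at ih ⊢
    rw [show 2 * (n + 1) = 2 * n + 2 by ring, integral_sin_pow, ih]
    simp only [Real.sin_zero, wallis, wallisRem]
    push_cast
    field_simp
    ring

theorem integral_sin_sq_pow_half_pi (n : ℕ) :
    ∫ θ in (0 : ℝ)..(Real.pi / 2), (Real.sin θ ^ 2) ^ n = wallis n * (Real.pi / 2) := by
  rw [integral_sin_pow_eq_wallis]; simp

/-- Up to terms of order five in the parameter, the incomplete integral is the proportional part of
the complete one plus a trigonometric polynomial of the amplitude. -/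
theorem exists_ellFm_expansion : ∃ C r : ℝ, 0 < r ∧ r ≤ 1 / 2 ∧ ∀ m, |m| ≤ r →
    ∀ φ ∈ Icc 0 Real.pi,
    |ellFm φ m - φ / (Real.pi / 2) * ellFm (Real.pi / 2) m
      - Real.sin φ * Real.cos φ * ∑ n ∈ Finset.range 5,
        wallis n * m ^ n * wallisRem (Real.sin φ ^ 2) n| ≤ C * |m| ^ 5 := by
  obtain ⟨C, r, hC, hr, hr2, H⟩ := exists_integral_expansion 4
  refine ⟨2 * C * Real.pi, r, hr, hr2, fun m hm φ hφ => ?_⟩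
  have key := fun b hb => H (fun _ => 1) (fun θ => Real.sin θ ^ 2) continuous_const (by fun_prop)
    (by simp) (fun θ => by rw [abs_of_nonneg (sq_nonneg _)]; exact Real.sin_sq_le_one θ) m hm 0
    ⟨le_rfl, zero_le_one⟩ b hb
  simp only [thirdCoeff_zero_left, zero_mul, sub_zero, one_mul, integral_sin_pow_eq_wallis] at key
  have h1 := key φ hφ.1
  have h2 := key (Real.pi / 2) (by positivity)
  change |ellFm φ m - _| ≤ _ at h1
  change |ellFm (Real.pi / 2) m - _| ≤ _ at h2
  simp only [Real.cos_pi_div_two, mul_zero, zero_mul, add_zero, mul_add,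
    Finset.sum_add_distrib] at h1 h2
  have e : ellFm φ m - φ / (Real.pi / 2) * ellFm (Real.pi / 2) m
      - Real.sin φ * Real.cos φ * ∑ n ∈ Finset.range 5,
        wallis n * m ^ n * wallisRem (Real.sin φ ^ 2) n
      = (ellFm φ m - (∑ n ∈ Finset.range (4 + 1), wallis n * m ^ n * (wallis n * φ)
        + ∑ n ∈ Finset.range (4 + 1), wallis n * m ^ n *
          (Real.sin φ * Real.cos φ * wallisRem (Real.sin φ ^ 2) n)))
        - φ / (Real.pi / 2) * (ellFm (Real.pi / 2) m
          - ∑ n ∈ Finset.range (4 + 1), wallis n * m ^ n * (wallis n * (Real.pi / 2))) := by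
    rw [mul_sub, Finset.mul_sum, Finset.mul_sum]
    have e1 : ∀ n, φ / (Real.pi / 2) * (wallis n * m ^ n * (wallis n * (Real.pi / 2)))
        = wallis n * m ^ n * (wallis n * φ) := fun n => by field_simp
    have e2 : ∀ n, Real.sin φ * Real.cos φ * (wallis n * m ^ n * wallisRem (Real.sin φ ^ 2) n)
        = wallis n * m ^ n * (Real.sin φ * Real.cos φ * wallisRem (Real.sin φ ^ 2) n) :=
      fun n => by ring
    simp only [e1, e2]
    ring
  rw [e]
  refine (abs_sub _ _).trans ?_
  rw [abs_mul, abs_of_nonneg (div_nonneg hφ.1 (by positivity))]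
  have h3 : φ / (Real.pi / 2) ≤ 2 := by
    rw [div_le_iff₀ (by positivity)]; linarith [hφ.2]
  have h4 : 0 ≤ C * |m| ^ 5 := by positivity
  have h5 := mul_le_mul h3 h2 (abs_nonneg _) zero_le_two
  have h6 := mul_le_mul_of_nonneg_left hφ.2 h4
  norm_num at h1 h5 ⊢
  linarith

/-! ### Expansions of the integral of the first kind -/

theorem tendsto_id_zero : Tendsto (id : ℝ → ℝ) (𝓝 0) (𝓝 0) := tendsto_id

theorem taylorExp_var {ι : Type*} {l : Filter ι} {u : ι → ℝ} : TaylorExp l u u 0 1 0 0 0 :=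
  .of_eq fun t => by ring

theorem taylorExp_const {ι : Type*} {l : Filter ι} {u : ι → ℝ} (c : ℝ) :
    TaylorExp l u (fun _ => c) c 0 0 0 0 := .of_eq fun t => by ring

theorem abs_le_eventually {r : ℝ} (hr : 0 < r) : ∀ᶠ m : ℝ in 𝓝 0, |m| ≤ r := by
  filter_upwards [Metric.ball_mem_nhds (0 : ℝ) hr] with m hm
  simpa using (mem_ball_zero_iff.1 hm).le

/-- A bound of fifth order valid for small parameters, as an asymptotic statement. -/
theorem isBigO_pow_five {f : ℝ → ℝ} {C r : ℝ} (hr : 0 < r) {p : ℝ → Prop}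
    (hp : ∀ᶠ m in 𝓝 0, p m) (h : ∀ m, |m| ≤ r → p m → |f m| ≤ C * |m| ^ 5) :
    f =O[𝓝 0] fun m => id m ^ 5 := by
  refine IsBigO.of_bound C ?_
  filter_upwards [abs_le_eventually hr, hp] with m hm hpm
  simpa only [id, norm_pow, Real.norm_eq_abs] using h m hm hpm

theorem taylorExp_ellFm_half_pi : TaylorExp (𝓝 0) id (fun m => ellFm (Real.pi / 2) m)
    (Real.pi / 2 * 1) (Real.pi / 2 * (1 / 4)) (Real.pi / 2 * (9 / 64)) (Real.pi / 2 * (25 / 256))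
    (Real.pi / 2 * (1225 / 16384)) := by
  obtain ⟨C, r, hC, hr, hr2, H⟩ := exists_integral_expansion 4
  refine isBigO_pow_five (C := C * (Real.pi / 2)) hr (p := fun _ => True) (by simp)
    fun m hm _ => ?_
  have h := H (fun _ => 1) (fun θ => Real.sin θ ^ 2) continuous_const (by fun_prop)
    (by simp) (fun θ => by rw [abs_of_nonneg (sq_nonneg _)]; exact Real.sin_sq_le_one θ) m hm 0
    ⟨le_rfl, zero_le_one⟩ (Real.pi / 2) (by positivity)
  simp only [thirdCoeff_zero_left, zero_mul, sub_zero, one_mul, integral_sin_sq_pow_half_pi] at h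
  change |ellFm (Real.pi / 2) m - _| ≤ _ at h
  simp only [Finset.sum_range_succ, Finset.sum_range_zero, wallis] at h
  convert h using 1
  · congr 2
    simp only [id]
    push_cast
    ring
  · ring

/-- Expansion of the ratio of an incomplete to the complete integral of the first kind, relative to
its value at vanishing modulus, in terms of the expansions of `sin φ cos φ` and of `sin² φ`. -/
theorem taylorExp_ellFm_ratio {φ : ℝ → ℝ} (hφ : ∀ᶠ m in 𝓝 0, φ m ∈ Icc 0 Real.pi)
    {z₀ z₁ z₂ z₃ z₄ w₀ w₁ w₂ w₃ w₄ r₁ r₂ r₃ r₄ : ℝ}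
    (hz : TaylorExp (𝓝 0) id (fun m => Real.sin (φ m) * Real.cos (φ m)) z₀ z₁ z₂ z₃ z₄)
    (hw : TaylorExp (𝓝 0) id (fun m => Real.sin (φ m) ^ 2) w₀ w₁ w₂ w₃ w₄)
    (hr₁ : r₁ = -1 / 4) (hr₂ : r₂ = -5 / 64 - 3 / 32 * w₀)
    (hr₃ : r₃ = -11 / 256 - 1 / 24 * w₀ - 5 / 96 * w₀ ^ 2 - 3 / 32 * w₁)
    (hr₄ : r₄ = -469 / 16384 - 215 / 8192 * w₀ - 55 / 2048 * w₀ ^ 2 - 35 / 1024 * w₀ ^ 3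
      - 1 / 24 * w₁ - 5 / 48 * w₀ * w₁ - 3 / 32 * w₂) :
    TaylorExp (𝓝 0) id (fun m => ellFm (φ m) m / ellFm (Real.pi / 2) m - φ m / (Real.pi / 2))
      0 (2 / Real.pi * (z₀ * r₁)) (2 / Real.pi * (z₀ * r₂ + z₁ * r₁))
      (2 / Real.pi * (z₀ * r₃ + z₁ * r₂ + z₂ * r₁))
      (2 / Real.pi * (z₀ * r₄ + z₁ * r₃ + z₂ * r₂ + z₃ * r₁)) := by
  have h0 := tendsto_id_zero
  obtain ⟨C, r, hr, hr2, H⟩ := exists_ellFm_expansion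
  have hO := isBigO_pow_five hr hφ fun m hm hp => H m hm (φ m) hp
  have hw2 := hw.sq h0
  have hw3 := hw2.mul h0 hw
  have q2 := (taylorExp_const (-3 / 8)).add (hw.const_mul (-1 / 4))
  have q3 := ((taylorExp_const (-5 / 16)).add (hw.const_mul (-5 / 24))).add
    (hw2.const_mul (-1 / 6))
  have q4 := (((taylorExp_const (-35 / 128)).add (hw.const_mul (-35 / 192))).add
    (hw2.const_mul (-7 / 48))).add (hw3.const_mul (-1 / 8))
  have Q := ((taylorExp_const (-1 / 4)).add (((q2.const_mul (3 / 8)).add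
    (((q3.const_mul (5 / 16)).add ((q4.const_mul (35 / 128)).var_mul h0)).var_mul h0)).var_mul
      h0)).var_mul h0
  have hK := taylorExp_ellFm_half_pi.inv h0 (d₀ := 2 / Real.pi * 1)
    (d₁ := 2 / Real.pi * (-1 / 4)) (d₂ := 2 / Real.pi * (-5 / 64))
    (d₃ := 2 / Real.pi * (-11 / 256)) (d₄ := 2 / Real.pi * (-469 / 16384))
    (by field_simp) (by field_simp; norm_num) (by field_simp; norm_num) (by field_simp; norm_num)
    (by field_simp; norm_num)
  have main := (hz.mul h0 Q).mul h0 hK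
  have hO2 := hO.mul ((hK.tendsto h0).isBigO_one ℝ)
  simp only [mul_one] at hO2
  refine (main.add_isBigO (hO2.congr' ?_ EventuallyEq.rfl)).congr_coeff ?_ ?_ ?_ ?_ ?_
  · have hne := taylorExp_ellFm_half_pi.tendsto h0 |>.eventually_ne
      (by positivity : Real.pi / 2 * 1 ≠ 0)
    filter_upwards [hne] with m hm
    simp only [Finset.sum_range_succ, Finset.sum_range_zero, wallis, wallisRem, id]
    field_simp
    push_cast
    ring
  · ring
  · rw [hr₁]; ring
  · rw [hr₁, hr₂]; ring
  · rw [hr₁, hr₂, hr₃]; ring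
  · rw [hr₁, hr₂, hr₃, hr₄]; ring

/-! ### The octupole near the origin in terms of one parameter -/

/-- The square root of the discriminant of `(1 - w) (1 - m w) = A` as an equation for `m w`. -/
def octRoot (A m : ℝ) : ℝ := √((1 - m) ^ 2 + 4 * m * A)

/-- The root `w` of `(1 - w) (1 - m w) = A` that is regular at `m = 0`, with the square root in the
denominator, so that `m = 0` is not exceptional. The parameter `m` is `k ^ 2` in the defocusing case
and `-k ^ 2 / (1 - k ^ 2)` in the focusing case. -/
def octSinSq (A m : ℝ) : ℝ := 2 * (1 - A) / (1 + m + octRoot A m)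

/-- The amplitude `φ` of the phase advance; `sin² φ` is `octSinSq`. -/
def octAmp (a m : ℝ) : ℝ :=
  Real.arccos (a / 2 / √(1 - m * octSinSq ((a / 2) ^ 2) m))

/-- The rotation number as a function of the parameter. -/
def octNu (a m : ℝ) : ℝ := ellFm (octAmp a m) m / (4 * ellFm (Real.pi / 2) m)

/-- The action as a function of the parameter `m` and of `w = sin² φ`. -/
def octActAux (m w : ℝ) : ℝ :=
  2 / Real.pi * m * (w * √w) * ∫ θ in (0 : ℝ)..(Real.pi / 2),
    (1 - Real.sin θ ^ 2) * √(1 - m * Real.sin θ ^ 2) / (1 - m * w * Real.sin θ ^ 2)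

/-- The action as a function of the parameter, with the opposite sign in the focusing case. -/
def octAct (a m : ℝ) : ℝ := octActAux m (octSinSq ((a / 2) ^ 2) m)

/-- The invariant as a function of the parameter, with the opposite sign in the focusing case. -/
def octLevel (a m : ℝ) : ℝ := m * octSinSq ((a / 2) ^ 2) m ^ 2

/-- The sign condition `0 ≤ 1 + m - 2 m w` selects the regular one of the two roots. -/
theorem octSinSq_eq {A m w : ℝ} (hm : 0 < 2 * (1 + m) - 2 * m * w)
    (hd : 0 ≤ 1 + m - 2 * m * w) (h : (1 - w) * (1 - m * w) = A) : octSinSq A m = w := by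
  have hS : octRoot A m = 1 + m - 2 * m * w := by
    rw [octRoot, ← Real.sqrt_sq hd]
    congr 1
    rw [← h]; ring
  rw [octSinSq, hS, div_eq_iff (by linarith), ← h]
  ring

theorem octRoot_spec {A : ℝ} (hA : A ∈ Ico 0 1) : ∀ᶠ m in 𝓝 0, |m| < 1 / 8 ∧
    1 / 2 < octRoot A m ∧ octRoot A m ^ 2 = (1 - m) ^ 2 + 4 * m * A := by
  filter_upwards [Metric.ball_mem_nhds (0 : ℝ) (by norm_num : (0 : ℝ) < 1 / 8)] with m hm
  rw [mem_ball_zero_iff, Real.norm_eq_abs] at hm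
  obtain ⟨h1, h2⟩ := abs_lt.1 hm
  have h3 : 1 / 4 < (1 - m) ^ 2 + 4 * m * A := by nlinarith [hA.1, hA.2]
  refine ⟨hm, ?_, Real.sq_sqrt (by linarith)⟩
  rw [octRoot]
  refine Real.lt_sqrt_of_sq_lt ?_
  norm_num
  linarith

theorem octSinSq_spec {A m : ℝ} (hA : A ∈ Ico 0 1) (hm : |m| < 1 / 8) (hS : 1 / 2 < octRoot A m)
    (hS2 : octRoot A m ^ 2 = (1 - m) ^ 2 + 4 * m * A) :
    octSinSq A m ∈ Ioc 0 1 ∧ m * octSinSq A m = (1 + m - octRoot A m) / 2 ∧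
      (1 - octSinSq A m) * (1 - m * octSinSq A m) = A := by
  obtain ⟨h1, h2⟩ := abs_lt.1 hm
  have hden : 0 < 1 + m + octRoot A m := by linarith
  have hw : octSinSq A m * (1 + m + octRoot A m) = 2 * (1 - A) := div_mul_cancel₀ _ hden.ne'
  have hden' : 0 < 1 - m + octRoot A m := by linarith
  have hw1 : (1 - octSinSq A m) * (1 - m + octRoot A m) = 2 * A := by
    refine mul_right_cancel₀ hden.ne' ?_
    linear_combination (1 : ℝ) * hS2 - (1 - m + octRoot A m) * hw
  have hmw : m * octSinSq A m = (1 + m - octRoot A m) / 2 := by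
    refine mul_right_cancel₀ hden.ne' ?_
    linear_combination (1 / 2 : ℝ) * hS2 + m * hw
  refine ⟨⟨div_pos (by linarith [hA.2]) hden, ?_⟩, hmw, ?_⟩
  · have : 0 ≤ 1 - octSinSq A m :=
      nonneg_of_mul_nonneg_left (by rw [hw1]; linarith [hA.1]) hden'
    linarith
  · rw [hmw]
    linear_combination (1 / 2 : ℝ) * hw1

section

variable {a : ℝ} (ha : (a / 2) ^ 2 < 1)
include ha

theorem half_sq_mem : (a / 2) ^ 2 ∈ Ico 0 1 := ⟨sq_nonneg _, ha⟩

/-- `octSinSq` is `sin² φ` for the amplitude `φ`, so `sin² φ` is algebraic in `m`. -/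
theorem octAmp_spec : ∀ᶠ m in 𝓝 0, octAmp a m ∈ Icc 0 Real.pi ∧
    Real.cos (octAmp a m) = a / 2 / √(1 - m * octSinSq ((a / 2) ^ 2) m) ∧
    Real.sin (octAmp a m) = √(octSinSq ((a / 2) ^ 2) m) ∧
    a / 2 / √(1 - m * octSinSq ((a / 2) ^ 2) m) ∈ Ioo (-1) 1 ∧
    1 / 2 < 1 - m * octSinSq ((a / 2) ^ 2) m := by
  filter_upwards [octRoot_spec (half_sq_mem ha)] with m ⟨hm, hS, hS2⟩
  obtain ⟨hw, -, hrel⟩ := octSinSq_spec (half_sq_mem ha) hm hS hS2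
  set w := octSinSq ((a / 2) ^ 2) m
  have hmw : 1 / 2 < 1 - m * w := by
    have : |m * w| ≤ 1 / 8 := by
      rw [abs_mul, abs_of_pos hw.1]
      nlinarith [hw.1, hw.2, abs_nonneg m]
    linarith [le_abs_self (m * w)]
  have hx : (a / 2 / √(1 - m * w)) ^ 2 = 1 - w := by
    rw [div_pow, Real.sq_sqrt (by linarith), ← hrel, mul_div_assoc, div_self (by linarith), mul_one]
  have hx1 : |a / 2 / √(1 - m * w)| < 1 := by
    rw [← sq_lt_one_iff_abs_lt_one, hx]
    linarith [hw.1]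
  obtain ⟨h1, h2⟩ := abs_lt.1 hx1
  refine ⟨⟨Real.arccos_nonneg _, Real.arccos_le_pi _⟩, Real.cos_arccos h1.le h2.le, ?_,
    ⟨h1, h2⟩, hmw⟩
  rw [octAmp, Real.sin_arccos, hx]
  congr 1
  ring

/-- `D = (1 - m + 2 m A + S) / 2`, for which `w / (1 - m w) = (1 - A) / D`. -/
def octDenom (A m : ℝ) : ℝ := (1 - m + 2 * m * A + octRoot A m) / 2

omit ha in
theorem octDenom_pos {A m : ℝ} (hA : A ∈ Ico 0 1) (hm : |m| < 1 / 8) (hS : 1 / 2 < octRoot A m) :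
    0 < octDenom A m := by
  obtain ⟨h1, h2⟩ := abs_lt.1 hm
  rw [octDenom]
  nlinarith [hA.1, hA.2]

theorem sin_mul_cos_octAmp : ∀ᶠ m in 𝓝 0, Real.sin (octAmp a m) * Real.cos (octAmp a m)
    = a / 2 * √(1 - (a / 2) ^ 2) * (√(octDenom ((a / 2) ^ 2) m))⁻¹ := by
  filter_upwards [octRoot_spec (half_sq_mem ha), octAmp_spec ha]
    with m ⟨hm, hS, hS2⟩ ⟨_, hc, hs, _, hpos⟩
  obtain ⟨hw, hmw, hrel⟩ := octSinSq_spec (half_sq_mem ha) hm hS hS2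
  have hD := octDenom_pos (half_sq_mem ha) hm hS
  rw [hc, hs, mul_assoc, ← Real.sqrt_inv, ← Real.sqrt_mul (by linarith), mul_div_left_comm,
    ← Real.sqrt_div hw.1.le]
  congr 2
  rw [← div_eq_mul_inv, div_eq_div_iff (by linarith) hD.ne', octDenom]
  linear_combination -hrel + octSinSq ((a / 2) ^ 2) m * hmw

/-- The derivative of the amplitude is algebraic in `m`, so its expansion can be integrated
termwise. -/
theorem hasDerivAt_octAmp : ∀ᶠ m in 𝓝 0, HasDerivAt (octAmp a)
    (-(a / 2 * √(1 - (a / 2) ^ 2)) / 2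
      * ((√(octDenom ((a / 2) ^ 2) m))⁻¹ * (octRoot ((a / 2) ^ 2) m)⁻¹)) m := by
  filter_upwards [(octRoot_spec (half_sq_mem ha)).eventually_nhds, octAmp_spec ha,
    sin_mul_cos_octAmp ha] with m h ⟨_, hc, hs, hx, hpos⟩ hsc
  obtain ⟨hm, hS, hS2⟩ := h.self_of_nhds
  obtain ⟨hw, hmw, hrel⟩ := octSinSq_spec (half_sq_mem ha) hm hS hS2
  have hroot : HasDerivAt (octRoot ((a / 2) ^ 2))
      ((m - 1 + 2 * (a / 2) ^ 2) / octRoot ((a / 2) ^ 2) m) m := by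
    have h0 := hasDerivAt_id m
    have h1 := (((h0.const_sub 1).pow 2).add ((h0.const_mul 4).mul_const ((a / 2) ^ 2))).sqrt
      (by simp only [id, Pi.add_apply, Pi.pow_apply]
          have := hS2 ▸ (by positivity : octRoot ((a / 2) ^ 2) m ^ 2 ≠ 0)
          exact this)
    refine h1.congr_deriv ?_
    simp only [id, Pi.add_apply, Pi.pow_apply]
    rw [← octRoot]
    field_simp
    push_cast
    ring
  have hmwd : HasDerivAt (fun m => m * octSinSq ((a / 2) ^ 2) m)
      ((1 - (m - 1 + 2 * (a / 2) ^ 2) / octRoot ((a / 2) ^ 2) m) / 2) m := by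
    refine HasDerivAt.congr_of_eventuallyEq
      (((hasDerivAt_id m).const_add 1).sub hroot |>.div_const 2) ?_
    filter_upwards [h] with t ⟨h1, h2, h3⟩
    exact (octSinSq_spec (half_sq_mem ha) h1 h2 h3).2.1
  have hq := (hmwd.const_sub 1).sqrt (by linarith)
  have hx' := (hasDerivAt_const m (a / 2)).div hq (Real.sqrt_pos.2 (by linarith)).ne'
  have harc := (Real.hasDerivAt_arccos hx.1.ne' hx.2.ne).comp m hx'
  refine harc.congr_deriv ?_
  have hsw : √(1 - (a / 2 / √(1 - m * octSinSq ((a / 2) ^ 2) m)) ^ 2)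
      = √(octSinSq ((a / 2) ^ 2) m) := by
    rw [← Real.sin_arccos]; exact hs
  rw [hsw]
  have hw0 := Real.sqrt_pos.2 hw.1
  have hw2 := Real.sq_sqrt hw.1.le
  have hp0 : 0 < √(1 - m * octSinSq ((a / 2) ^ 2) m) := Real.sqrt_pos.2 (by linarith)
  have hp2 := Real.sq_sqrt (by linarith : 0 ≤ 1 - m * octSinSq ((a / 2) ^ 2) m)
  have key : -(a / 2 * √(1 - (a / 2) ^ 2)) / 2
      * ((√(octDenom ((a / 2) ^ 2) m))⁻¹ * (octRoot ((a / 2) ^ 2) m)⁻¹)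
      = -(√(octSinSq ((a / 2) ^ 2) m) * (a / 2 / √(1 - m * octSinSq ((a / 2) ^ 2) m)))
        / (2 * octRoot ((a / 2) ^ 2) m) := by
    rw [← hc, ← hs, hsc]; field_simp
  rw [key]
  have hS0 : 0 < octRoot ((a / 2) ^ 2) m := by linarith
  -- the derivative of `m w` divided by `1 - m w` is `w / S`
  have hrel' : octRoot ((a / 2) ^ 2) m - (m - 1 + 2 * (a / 2) ^ 2)
      = 2 * (√(octSinSq ((a / 2) ^ 2) m)) ^ 2 * (√(1 - m * octSinSq ((a / 2) ^ 2) m)) ^ 2 := by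
    rw [hw2, hp2]
    linear_combination (2 : ℝ) * hrel + 2 * hmw
  generalize √(octSinSq ((a / 2) ^ 2) m) = W at *
  generalize √(1 - m * octSinSq ((a / 2) ^ 2) m) = Q at *
  have e : (1 - (m - 1 + 2 * (a / 2) ^ 2) / octRoot ((a / 2) ^ 2) m) / 2
      = W ^ 2 * Q ^ 2 / octRoot ((a / 2) ^ 2) m := by
    rw [eq_div_iff hS0.ne', div_mul_eq_mul_div, sub_mul, div_mul_cancel₀ _ hS0.ne', one_mul, hrel']
    ring
  rw [e]
  field_simp
  ring

end

/-! ### Coefficients of the expansions at the origin -/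

theorem taylorExp_octRoot (A : ℝ) : TaylorExp (𝓝 0) id (octRoot A) 1 (-1 + 2 * A)
    (2 * A - 2 * A ^ 2) (2 * A - 6 * A ^ 2 + 4 * A ^ 3)
    (2 * A - 12 * A ^ 2 + 20 * A ^ 3 - 10 * A ^ 4) := by
  have h : TaylorExp (𝓝 0) id (fun m : ℝ => (1 - m) ^ 2 + 4 * m * A) 1 (-2 + 4 * A) 1 0 0 :=
    .of_eq fun m => by simp only [id]; ring
  exact h.sqrt tendsto_id_zero one_pos (by ring) (by ring) (by ring) (by ring) (by ring)

theorem taylorExp_inv_octRoot (A : ℝ) : TaylorExp (𝓝 0) id (fun m => (octRoot A m)⁻¹) 1 (1 - 2 * A)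
    (1 - 6 * A + 6 * A ^ 2) (1 - 12 * A + 30 * A ^ 2 - 20 * A ^ 3)
    (1 - 20 * A + 90 * A ^ 2 - 140 * A ^ 3 + 70 * A ^ 4) :=
  (taylorExp_octRoot A).inv tendsto_id_zero (by ring) (by ring) (by ring) (by ring) (by ring)

theorem taylorExp_inv_sqrt_octDenom (A : ℝ) : TaylorExp (𝓝 0) id (fun m => (√(octDenom A m))⁻¹)
    1 (1 / 2 - A) (3 / 8 - 2 * A + 2 * A ^ 2) (5 / 16 - 25 / 8 * A + 15 / 2 * A ^ 2 - 5 * A ^ 3)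
    (35 / 128 - 35 / 8 * A + 147 / 8 * A ^ 2 - 28 * A ^ 3 + 14 * A ^ 4) := by
  have h1 : TaylorExp (𝓝 0) id (fun m : ℝ => 1 - m + 2 * m * A) 1 (-1 + 2 * A) 0 0 0 :=
    .of_eq fun m => by simp only [id]; ring
  have hD : TaylorExp (𝓝 0) id (octDenom A) 1 (-1 + 2 * A) (A - A ^ 2)
      (A - 3 * A ^ 2 + 2 * A ^ 3) (A - 6 * A ^ 2 + 10 * A ^ 3 - 5 * A ^ 4) :=
    (((h1.add (taylorExp_octRoot A)).const_mul (1 / 2)).congr' (.of_forall fun m => by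
      rw [octDenom]; ring)).congr_coeff (by ring) (by ring) (by ring) (by ring) (by ring)
  have hi := hD.inv tendsto_id_zero (d₀ := 1) (d₁ := 1 - 2 * A) (d₂ := 1 - 5 * A + 5 * A ^ 2)
    (d₃ := 1 - 9 * A + 21 * A ^ 2 - 14 * A ^ 3)
    (d₄ := 1 - 14 * A + 56 * A ^ 2 - 84 * A ^ 3 + 42 * A ^ 4)
    (by ring) (by ring) (by ring) (by ring) (by ring)
  exact (hi.sqrt tendsto_id_zero one_pos (by ring) (by ring) (by ring) (by ring) (by ring)).congr'
    (.of_forall fun m => (Real.sqrt_inv _).symm)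

/-- The factor `w / (1 - A)`. -/
theorem taylorExp_octFactor (A : ℝ) : TaylorExp (𝓝 0) id (fun m => 2 / (1 + m + octRoot A m))
    1 (-A) (-A + 2 * A ^ 2) (-A + 5 * A ^ 2 - 5 * A ^ 3)
    (-A + 9 * A ^ 2 - 21 * A ^ 3 + 14 * A ^ 4) := by
  have h1 : TaylorExp (𝓝 0) id (fun m : ℝ => 1 + m) 1 1 0 0 0 :=
    .of_eq fun m => by simp only [id]; ring
  refine ((((h1.add (taylorExp_octRoot A)).const_mul (1 / 2)).inv tendsto_id_zero ?_ ?_ ?_ ?_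
    ?_).congr' (.of_forall fun m => by
      simp only [mul_inv, one_div, inv_inv, ← div_eq_mul_inv])) <;> ring

theorem taylorExp_octSinSq (A : ℝ) : TaylorExp (𝓝 0) id (octSinSq A) (1 - A) (-A + A ^ 2)
    (-A + 3 * A ^ 2 - 2 * A ^ 3) (-A + 6 * A ^ 2 - 10 * A ^ 3 + 5 * A ^ 4)
    (-A + 10 * A ^ 2 - 30 * A ^ 3 + 35 * A ^ 4 - 14 * A ^ 5) :=
  (((taylorExp_octFactor A).const_mul (1 - A)).congr' (.of_forall fun m => by
    rw [octSinSq]; ring)).congr_coeff (by ring) (by ring) (by ring) (by ring) (by ring)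

/-- The rotation number is `φ / (2 π)`, expanded by integrating the derivative of `φ`, plus a
quarter of the deviation of the ratio of the integrals from `φ / (π / 2)`. -/
theorem taylorExp_octNu {a : ℝ} (ha : (a / 2) ^ 2 < 1) {A s : ℝ} (hA : A = (a / 2) ^ 2)
    (hs : s = 2 / Real.pi * (a / 2 * √(1 - (a / 2) ^ 2))) :
    TaylorExp (𝓝 0) id (octNu a) (nuZero a) (s * (-3 / 16)) (s * (-43 / 256 + 35 / 128 * A))
      (s * (-161 / 1024 + 21 / 32 * A - 77 / 128 * A ^ 2))
      (s * (-9835 / 65536 + 37463 / 32768 * A - 20361 / 8192 * A ^ 2 + 6435 / 4096 * A ^ 3)) := by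
  have h0 := tendsto_id_zero
  subst hA
  have hz := taylorExp_inv_sqrt_octDenom ((a / 2) ^ 2)
  have hφ := TaylorExp.integrate (hasDerivAt_octAmp ha)
    ((hz.mul h0 (taylorExp_inv_octRoot ((a / 2) ^ 2))).const_mul _)
  have hsc := (hz.const_mul (a / 2 * √(1 - (a / 2) ^ 2))).congr' (sin_mul_cos_octAmp ha)
  have hw := (taylorExp_octSinSq ((a / 2) ^ 2)).congr'
    (g := fun m => Real.sin (octAmp a m) ^ 2) (by
      filter_upwards [octAmp_spec ha, octRoot_spec (half_sq_mem ha)] with m ⟨_, _, h, _⟩ ⟨h1, h2, h3⟩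
      rw [h, Real.sq_sqrt (octSinSq_spec (half_sq_mem ha) h1 h2 h3).1.1.le])
  generalize √(1 - (a / 2) ^ 2) = q at *
  have hr := taylorExp_ellFm_ratio ((octAmp_spec ha).mono fun m h => h.1) hsc hw rfl rfl rfl rfl
  have main := (hr.add (hφ.const_mul (2 / Real.pi))).const_mul (1 / 4)
  refine (main.congr' (.of_forall fun m => ?_)).congr_coeff ?_ ?_ ?_ ?_ ?_
  · rw [octNu]; field_simp; ring
  · rw [nuZero]; simp [octAmp]; field_simp; ring
  all_goals rw [hs]; ring

theorem taylorExp_thirdCoeff {w : ℝ → ℝ} {w₀ w₁ w₂ w₃ w₄ : ℝ}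
    (hw : TaylorExp (𝓝 0) id w w₀ w₁ w₂ w₃ w₄) :
    (TaylorExp (𝓝 0) id (fun m => thirdCoeff (w m) 1) (1 / 2 + w₀) w₁ w₂ w₃ w₄) ∧
    (∃ e₃ e₄, TaylorExp (𝓝 0) id (fun m => thirdCoeff (w m) 2) (3 / 8 + w₀ / 2 + w₀ ^ 2)
      (w₁ / 2 + 2 * w₀ * w₁) (w₂ / 2 + 2 * w₀ * w₂ + w₁ ^ 2) e₃ e₄) ∧
    (∃ e₁ e₂ e₃ e₄, TaylorExp (𝓝 0) id (fun m => thirdCoeff (w m) 3)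
      (5 / 16 + 3 / 8 * w₀ + w₀ ^ 2 / 2 + w₀ ^ 3) e₁ e₂ e₃ e₄) := by
  have h0 := tendsto_id_zero
  have h1 : TaylorExp (𝓝 0) id (fun m => thirdCoeff (w m) 1) (1 / 2 + w₀) w₁ w₂ w₃ w₄ :=
    (((taylorExp_const (1 / 2)).add hw).congr' (.of_forall fun m => by
      simp [thirdCoeff, wallis])).congr_coeff rfl (by ring) (by ring) (by ring) (by ring)
  have h2 := ((taylorExp_const (3 / 8)).add (hw.mul h0 h1)).congr'
    (g := fun m => thirdCoeff (w m) 2) (.of_forall fun m => by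
      simp only [thirdCoeff, wallis]; norm_num)
  have h3 := ((taylorExp_const (5 / 16)).add (hw.mul h0 h2)).congr'
    (g := fun m => thirdCoeff (w m) 3) (.of_forall fun m => by
      change wallis 3 + w m * thirdCoeff (w m) 2 = _
      simp only [wallis]; norm_num)
  exact ⟨h1, ⟨_, _, h2.congr_coeff (by ring) (by ring) (by ring) rfl rfl⟩,
    ⟨_, _, _, _, h3.congr_coeff (by ring) rfl rfl rfl rfl⟩⟩

theorem integral_one_sub_mul_sin_pow (n : ℕ) :
    ∫ θ in (0 : ℝ)..(Real.pi / 2), (1 - Real.sin θ ^ 2) * (Real.sin θ ^ 2) ^ n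
      = (wallis n - wallis (n + 1)) * (Real.pi / 2) := by
  rw [sub_mul, ← integral_sin_sq_pow_half_pi, ← integral_sin_sq_pow_half_pi,
    ← intervalIntegral.integral_sub (by apply Continuous.intervalIntegrable; fun_prop)
      (by apply Continuous.intervalIntegrable; fun_prop)]
  congr 1; funext θ; ring

/-- Expansion of the action integral without its prefactor. -/
theorem taylorExp_octActAux {w : ℝ → ℝ} (hw1 : ∀ᶠ m in 𝓝 0, w m ∈ Icc 0 1) {w₀ w₁ w₂ w₃ w₄ : ℝ}
    (hw : TaylorExp (𝓝 0) id w w₀ w₁ w₂ w₃ w₄) :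
    TaylorExp (𝓝 0) id (fun m => 2 / Real.pi * m * ∫ θ in (0 : ℝ)..(Real.pi / 2),
      (1 - Real.sin θ ^ 2) * √(1 - m * Real.sin θ ^ 2) / (1 - m * w m * Real.sin θ ^ 2))
      0 (1 / 2) (-1 / 16 + w₀ / 8) (-1 / 128 - w₀ / 32 + w₀ ^ 2 / 16 + w₁ / 8)
      (5 / 128 * (-1 / 16 - w₀ / 8 - w₀ ^ 2 / 2 + w₀ ^ 3) - w₁ / 32 + w₀ * w₁ / 8 + w₂ / 8) := by
  have h0 := tendsto_id_zero
  obtain ⟨C, r, hC, hr, hr2, H⟩ := exists_integral_expansion 3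
  obtain ⟨e1, ⟨_, _, e2⟩, ⟨_, _, _, _, e3⟩⟩ := taylorExp_thirdCoeff hw
  have hb : ∀ θ : ℝ, |1 - Real.sin θ ^ 2| ≤ 1 := fun θ => by
    rw [abs_of_nonneg (sub_nonneg.2 (Real.sin_sq_le_one θ))]; linarith [sq_nonneg (Real.sin θ)]
  have hs : ∀ θ : ℝ, |Real.sin θ ^ 2| ≤ 1 := fun θ => by
    rw [abs_of_nonneg (sq_nonneg _)]; exact Real.sin_sq_le_one θ
  have key : (fun m => 2 / Real.pi * m * (∫ θ in (0 : ℝ)..(Real.pi / 2),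
      (1 - Real.sin θ ^ 2) * √(1 - m * Real.sin θ ^ 2) / (1 - m * w m * Real.sin θ ^ 2))
      - m * ((∑ n ∈ Finset.range 4, thirdCoeff (w m) n * m ^ n * (wallis n - wallis (n + 1)))
        - m * ∑ n ∈ Finset.range 4, thirdCoeff (w m) n * m ^ n
          * (wallis (n + 1) - wallis (n + 2)))) =O[𝓝 0] fun m => id m ^ 5 := by
    refine isBigO_pow_five (C := 2 * C) hr hw1 fun m hm hwm => ?_
    have k1 := H (fun θ => 1 - Real.sin θ ^ 2) (fun θ => Real.sin θ ^ 2) (by fun_prop)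
      (by fun_prop) hb hs m hm (w m) hwm (Real.pi / 2) (by positivity)
    have k2 := H (fun θ => (1 - Real.sin θ ^ 2) * Real.sin θ ^ 2) (fun θ => Real.sin θ ^ 2)
      (by fun_prop) (by fun_prop) (fun θ => by
        rw [abs_mul]; exact mul_le_one₀ (hb θ) (abs_nonneg _) (hs θ))
      hs m hm (w m) hwm (Real.pi / 2) (by positivity)
    have ep : ∀ n : ℕ, ∀ θ : ℝ, (1 - Real.sin θ ^ 2) * Real.sin θ ^ 2 * (Real.sin θ ^ 2) ^ n
        = (1 - Real.sin θ ^ 2) * (Real.sin θ ^ 2) ^ (n + 1) := fun n θ => by ring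
    simp only [ep, integral_one_sub_mul_sin_pow] at k1 k2
    norm_num only at k1 k2
    have hm1 : ∀ θ : ℝ, |m * Real.sin θ ^ 2| ≤ 1 / 2 := fun θ => by
      rw [abs_mul]; exact (mul_le_of_le_one_right (abs_nonneg _) (hs θ)).trans (hm.trans hr2)
    have hpos : ∀ θ : ℝ, 0 < 1 - m * Real.sin θ ^ 2 := fun θ => by
      linarith [hm1 θ, le_abs_self (m * Real.sin θ ^ 2)]
    have hpos' : ∀ θ : ℝ, 0 < 1 - w m * (m * Real.sin θ ^ 2) := fun θ => by
      have h1 : |w m * (m * Real.sin θ ^ 2)| ≤ 1 / 2 := by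
        rw [abs_mul, abs_of_nonneg hwm.1]
        nlinarith [hwm.1, hwm.2, abs_nonneg (m * Real.sin θ ^ 2), hm1 θ]
      linarith [le_abs_self (w m * (m * Real.sin θ ^ 2))]
    have hcont : Continuous fun θ =>
        1 / ((1 - w m * (m * Real.sin θ ^ 2)) * √(1 - m * Real.sin θ ^ 2)) :=
      continuous_const.div (by fun_prop) fun θ =>
        (mul_pos (hpos' θ) (Real.sqrt_pos.2 (hpos θ))).ne'
    have hint : (∫ θ in (0 : ℝ)..(Real.pi / 2), (1 - Real.sin θ ^ 2) * √(1 - m * Real.sin θ ^ 2)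
        / (1 - m * w m * Real.sin θ ^ 2))
        = (∫ θ in (0 : ℝ)..(Real.pi / 2), (1 - Real.sin θ ^ 2)
          * (1 / ((1 - w m * (m * Real.sin θ ^ 2)) * √(1 - m * Real.sin θ ^ 2))))
        - m * ∫ θ in (0 : ℝ)..(Real.pi / 2), (1 - Real.sin θ ^ 2) * Real.sin θ ^ 2
          * (1 / ((1 - w m * (m * Real.sin θ ^ 2)) * √(1 - m * Real.sin θ ^ 2))) := by
      rw [← intervalIntegral.integral_const_mul, ← intervalIntegral.integral_sub]
      · congr 1
        funext θ
        have e := Real.sq_sqrt (hpos θ).le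
        have e1 := Real.sqrt_pos.2 (hpos θ)
        have e2 := hpos' θ
        have e3 : 1 - m * w m * Real.sin θ ^ 2 = 1 - w m * (m * Real.sin θ ^ 2) := by ring
        rw [e3]
        generalize 1 - w m * (m * Real.sin θ ^ 2) = d at *
        generalize √(1 - m * Real.sin θ ^ 2) = q at *
        field_simp
        rw [e]
        ring
      · exact (Continuous.mul (by fun_prop) hcont).intervalIntegrable _ _
      · exact (continuous_const.mul (Continuous.mul (by fun_prop) hcont)).intervalIntegrable _ _
    rw [hint]
    have e1 : ∀ κ : ℕ → ℝ, ∑ n ∈ Finset.range 4, thirdCoeff (w m) n * m ^ n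
        * (κ n * (Real.pi / 2)) = Real.pi / 2 * ∑ n ∈ Finset.range 4,
          thirdCoeff (w m) n * m ^ n * κ n := fun κ => by
      rw [Finset.mul_sum]; exact Finset.sum_congr rfl fun n _ => by ring
    rw [e1 fun n => wallis n - wallis (n + 1)] at k1
    rw [e1 fun n => wallis (n + 1) - wallis (n + 1 + 1)] at k2
    change |_ - Real.pi / 2 * ∑ n ∈ Finset.range 4, thirdCoeff (w m) n * m ^ n
      * (wallis (n + 1) - wallis (n + 2))| ≤ _ at k2
    generalize (∫ θ in (0 : ℝ)..(Real.pi / 2), (1 - Real.sin θ ^ 2)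
          * (1 / ((1 - w m * (m * Real.sin θ ^ 2)) * √(1 - m * Real.sin θ ^ 2)))) = I1 at *
    generalize (∫ θ in (0 : ℝ)..(Real.pi / 2), (1 - Real.sin θ ^ 2) * Real.sin θ ^ 2
          * (1 / ((1 - w m * (m * Real.sin θ ^ 2)) * √(1 - m * Real.sin θ ^ 2)))) = I2 at *
    generalize ∑ n ∈ Finset.range 4, thirdCoeff (w m) n * m ^ n * (wallis n - wallis (n + 1))
      = S1 at *
    generalize ∑ n ∈ Finset.range 4, thirdCoeff (w m) n * m ^ n
      * (wallis (n + 1) - wallis (n + 2)) = S2 at *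
    have e2 : 2 / Real.pi * m * (I1 - m * I2) - m * (S1 - m * S2)
        = 2 / Real.pi * m * ((I1 - Real.pi / 2 * S1) - m * (I2 - Real.pi / 2 * S2)) := by
      field_simp
      ring
    have hp := Real.pi_pos
    rw [e2, abs_mul, abs_mul, abs_of_pos (by positivity : 0 < 2 / Real.pi)]
    have h3 := abs_sub (I1 - Real.pi / 2 * S1) (m * (I2 - Real.pi / 2 * S2))
    rw [abs_mul] at h3
    have h4 : |m| ≤ 1 := by linarith
    have h5 : |m| * |I2 - Real.pi / 2 * S2| ≤ |I2 - Real.pi / 2 * S2| :=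
      mul_le_of_le_one_left (abs_nonneg _) h4
    calc 2 / Real.pi * |m| * |I1 - Real.pi / 2 * S1 - m * (I2 - Real.pi / 2 * S2)|
        ≤ 2 / Real.pi * |m| * (2 * (C * |m| ^ 4 * (Real.pi / 2))) := by
          gcongr; linarith
      _ = 2 * C * |m| ^ 5 := by field_simp
  have t := ((taylorExp_const (1 / 2)).add (((e1.const_mul (1 / 8)).sub
    (taylorExp_const (1 / 8))).add ((((e2.const_mul (1 / 16)).sub (e1.const_mul (1 / 16))).add
    (((e3.const_mul (5 / 128)).sub (e2.const_mul (5 / 128))).sub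
      ((e3.const_mul (7 / 256)).var_mul h0) |>.var_mul h0)).var_mul h0) |>.var_mul h0)).var_mul h0
  refine (t.add_isBigO (key.congr_left fun m => ?_)).congr_coeff ?_ ?_ ?_ ?_ ?_
  · simp only [Finset.sum_range_succ, Finset.sum_range_zero, id]
    have : thirdCoeff (w m) 0 = 1 := rfl
    rw [this]
    simp only [wallis]
    push_cast
    ring
  all_goals ring

/-! ### The series at the origin in terms of one parameter -/

theorem rpow_three_halves {x : ℝ} (hx : 0 ≤ x) : x ^ ((3 : ℝ) / 2) = √x ^ 3 := by
  rw [Real.sqrt_eq_rpow, ← Real.rpow_natCast, ← Real.rpow_mul hx]; norm_num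

theorem rpow_five_halves {x : ℝ} (hx : 0 ≤ x) : x ^ ((5 : ℝ) / 2) = √x ^ 5 := by
  rw [Real.sqrt_eq_rpow, ← Real.rpow_natCast, ← Real.rpow_mul hx]; norm_num

/-- An expansion starting in degree four, with the term of that degree absorbed in the error. -/
theorem TaylorExp.isBigO_four {ι : Type*} {l : Filter ι} {u f : ι → ℝ} {e : ℝ}
    (hu : Tendsto u l (𝓝 0)) (h : TaylorExp l u f 0 0 0 0 e) : f =O[l] fun t => u t ^ 4 := by
  have h1 := (isBigO_refl (fun t => u t ^ 4) l).mul (hu.isBigO_one ℝ)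
  simp only [mul_one] at h1
  have h2 := (IsBigO.trans h (h1.congr_left fun t => by ring)).add
    ((isBigO_refl (fun t => u t ^ 4) l).const_mul_left e)
  exact h2.congr_left fun t => by ring

/-- An expansion starting in degree three, with the terms from that degree on absorbed in the error.
-/
theorem TaylorExp.isBigO_three {ι : Type*} {l : Filter ι} {u f : ι → ℝ} {e e' : ℝ}
    (hu : Tendsto u l (𝓝 0)) (h : TaylorExp l u f 0 0 0 e e') : f =O[l] fun t => u t ^ 3 := by
  have h1 := ((h.sub (g := fun t => e * u t ^ 3) (d₀ := 0) (d₁ := 0) (d₂ := 0) (d₃ := e) (d₄ := 0)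
    (.of_eq fun t => by ring)).congr_coeff (sub_zero 0) (sub_zero 0) (sub_zero 0) (sub_self e)
    (sub_zero e')).isBigO_four hu
  have h2 := (isBigO_refl (fun t => u t ^ 3) l).mul (hu.isBigO_one ℝ)
  simp only [mul_one] at h2
  have h3 := (h1.trans (h2.congr_left fun t => by ring)).add
    ((isBigO_refl (fun t => u t ^ 3) l).const_mul_left e)
  exact h3.congr_left fun t => by ring

/-- Two functions with the same expansion agree to fifth order. -/
theorem TaylorExp.isBigO_sub {ι : Type*} {l : Filter ι} {u f g : ι → ℝ} {c₀ c₁ c₂ c₃ c₄ : ℝ}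
    (hf : TaylorExp l u f c₀ c₁ c₂ c₃ c₄) (hg : TaylorExp l u g c₀ c₁ c₂ c₃ c₄) :
    (fun t => f t - g t) =O[l] fun t => u t ^ 5 :=
  (IsBigO.sub hf hg).congr_left fun t => by ring

section

variable {a q : ℝ} (ha : (a / 2) ^ 2 < 1) (hq : q = √(1 - (a / 2) ^ 2))
include ha hq

/-- In terms of `q = √(1 - (a / 2)²)` the coefficients of the series are polynomials in `q` and
`q⁻¹`, up to a factor `a`. -/
theorem oct_sqrt_spec : 0 < q ∧ (a / 2) ^ 2 = 1 - q ^ 2 ∧ √(4 - a ^ 2) = 2 * q := by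
  have h : 0 < 1 - (a / 2) ^ 2 := sub_pos.2 ha
  have hq2 : q ^ 2 = 1 - (a / 2) ^ 2 := by rw [hq, Real.sq_sqrt h.le]
  have hq0 : 0 < q := hq ▸ Real.sqrt_pos.2 h
  refine ⟨hq0, by linarith, ?_⟩
  rw [show 4 - a ^ 2 = (2 * q) ^ 2 by rw [mul_pow, hq2]; ring, Real.sqrt_sq (by positivity)]

theorem oct_rpow_spec : (4 - a ^ 2) ^ ((3 : ℝ) / 2) = 8 * q ^ 3 ∧
    (4 - a ^ 2) ^ ((5 : ℝ) / 2) = 32 * q ^ 5 := by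
  have h : 0 ≤ 4 - a ^ 2 := by linarith [show (a / 2) ^ 2 = a ^ 2 / 4 by ring]
  rw [rpow_three_halves h, rpow_five_halves h, (oct_sqrt_spec ha hq).2.2]
  exact ⟨by ring, by ring⟩

theorem oct_even_pow : a ^ 2 = 4 * (1 - q ^ 2) ∧ a ^ 4 = 16 * (1 - q ^ 2) ^ 2 ∧
    a ^ 6 = 64 * (1 - q ^ 2) ^ 3 := by
  have h : a ^ 2 = 4 * (1 - q ^ 2) := by linarith [(oct_sqrt_spec ha hq).2.1]
  refine ⟨h, ?_, ?_⟩
  · rw [show a ^ 4 = (a ^ 2) ^ 2 by ring, h]; ring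
  · rw [show a ^ 6 = (a ^ 2) ^ 3 by ring, h]; ring

theorem taylorExp_octAct {A : ℝ} (hA : A = (a / 2) ^ 2) :
    TaylorExp (𝓝 0) id (octAct a) 0 (q ^ 3 / 2) (q ^ 3 / 2 * (1 / 8 - 7 / 4 * A))
      (q ^ 3 / 2 * (3 / 64 - 17 / 8 * A + 33 / 8 * A ^ 2))
      (q ^ 3 / 2 * (25 / 1024 - 1199 / 512 * A + 1419 / 128 * A ^ 2 - 715 / 64 * A ^ 3)) := by
  have h0 := tendsto_id_zero
  have hA' := half_sq_mem ha
  have hf := taylorExp_octFactor A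
  have hsf := hf.sqrt h0 one_pos (d₁ := -1 / 2 * A) (d₂ := -1 / 2 * A + 7 / 8 * A ^ 2)
    (d₃ := -1 / 2 * A + 9 / 4 * A ^ 2 - 33 / 16 * A ^ 3)
    (d₄ := -1 / 2 * A + 33 / 8 * A ^ 2 - 143 / 16 * A ^ 3 + 715 / 128 * A ^ 4)
    (by ring) (by ring) (by ring) (by ring) (by ring)
  have hI := taylorExp_octActAux (w := octSinSq A) (by
    filter_upwards [octRoot_spec hA'] with m ⟨h1, h2, h3⟩
    rw [hA]
    exact Ioc_subset_Icc_self (octSinSq_spec hA' h1 h2 h3).1) (taylorExp_octSinSq A)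
  have main := ((hf.mul h0 hsf).mul h0 hI).const_mul (q ^ 3)
  refine (main.congr' ?_).congr_coeff ?_ ?_ ?_ ?_ ?_
  · filter_upwards [octRoot_spec hA'] with m ⟨h1, h2, h3⟩
    have hpos : 0 ≤ 1 - A := by rw [hA]; exact (sub_pos.2 ha).le
    have e : octSinSq A m = (1 - A) * (2 / (1 + m + octRoot A m)) := by rw [octSinSq]; ring
    have hsq : √(octSinSq A m) = q * √(2 / (1 + m + octRoot A m)) := by
      rw [e, Real.sqrt_mul hpos, hq, hA]
    have hq2 : 1 - A = q ^ 2 := by rw [hA, (oct_sqrt_spec ha hq).2.1]; ring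
    rw [octAct, octActAux, ← hA, hsq]
    nth_rewrite 1 [e]
    rw [hq2]
    ring
  all_goals ring

theorem octAct_sub_modulus_series : (fun m => octAct a m
    - (4 - a ^ 2) ^ ((3 : ℝ) / 2) / 2 ^ 4 * (m + (2 - 7 * a ^ 2) / 2 ^ 4 * m ^ 2
      + (6 - 68 * a ^ 2 + 33 * a ^ 4) / 2 ^ 7 * m ^ 3
      + (100 - 2398 * a ^ 2 + 2838 * a ^ 4 - 715 * a ^ 6) / 2 ^ 12 * m ^ 4)) =O[𝓝 0]
    fun m => m ^ 5 := by
  refine IsBigO.congr_left (taylorExp_octAct ha hq rfl) fun m => ?_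
  rw [(oct_rpow_spec ha hq).1]
  simp only [id]
  ring

theorem octNu_sub_modulus_series : (fun m => octNu a m
    - (nuZero a - a * √(4 - a ^ 2) / (2 ^ 4 * (2 * Real.pi)) *
    (3 * m + (86 - 35 * a ^ 2) / 2 ^ 5 * m ^ 2
      + 7 * ((46 - 48 * a ^ 2 + 11 * a ^ 4) / 2 ^ 7) * m ^ 3
      + (39340 - 74926 * a ^ 2 + 40722 * a ^ 4 - 6435 * a ^ 6) / 2 ^ 14 * m ^ 4))) =O[𝓝 0]
    fun m => m ^ 5 := by
  refine IsBigO.congr_left (taylorExp_octNu ha rfl rfl) fun m => ?_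
  rw [(oct_sqrt_spec ha hq).2.2, ← hq]
  simp only [id]
  ring

omit ha hq in
theorem taylorExp_octLevel {A : ℝ} (hA : A = (a / 2) ^ 2) :
    TaylorExp (𝓝 0) id (octLevel a) 0 (1 - 2 * A + A ^ 2)
      (-2 * A + 4 * A ^ 2 - 2 * A ^ 3) (-2 * A + 9 * A ^ 2 - 12 * A ^ 3 + 5 * A ^ 4)
      (-2 * A + 16 * A ^ 2 - 40 * A ^ 3 + 40 * A ^ 4 - 14 * A ^ 5) := by
  refine (((taylorExp_octSinSq A).sq tendsto_id_zero).var_mul tendsto_id_zero |>.congr'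
    (.of_forall fun m => by rw [octLevel, hA]; rfl)).congr_coeff ?_ ?_ ?_ ?_ ?_ <;> ring

theorem id_isBigO_octLevel : (id : ℝ → ℝ) =O[𝓝 0] octLevel a :=
  (taylorExp_octLevel rfl).var_isBigO tendsto_id_zero (by
    rw [(oct_sqrt_spec ha hq).2.1]
    have := (oct_sqrt_spec ha hq).1
    ring_nf
    positivity)

theorem id_isBigO_octAct : (id : ℝ → ℝ) =O[𝓝 0] octAct a :=
  (taylorExp_octAct ha hq rfl).var_isBigO tendsto_id_zero (by
    have := (oct_sqrt_spec ha hq).1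
    positivity)

theorem octAct_sub_invariant_series : (fun m => octAct a m - serJInv 1 a (octLevel a m)) =O[𝓝 0]
    fun m => octLevel a m ^ 5 := by
  obtain ⟨hq0, hA, hs⟩ := oct_sqrt_spec ha hq
  obtain ⟨h2, h4, h6⟩ := oct_even_pow ha hq
  refine IsBigO.trans ?_ ((id_isBigO_octLevel ha hq).pow 5)
  have hC := taylorExp_octLevel (a := a) rfl
  have hser : TaylorExp (𝓝 0) (octLevel a) (fun m => serJInv 1 a (octLevel a m)) 0
      (1 / (2 * q)) (1 / (2 * q) * ((2 + a ^ 2) / (4 - a ^ 2) ^ 2))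
      (1 / (2 * q) * (2 * ((6 + 12 * a ^ 2 + a ^ 4) / (4 - a ^ 2) ^ 4)))
      (1 / (2 * q) * (5 * ((20 + 90 * a ^ 2 + 30 * a ^ 4 + a ^ 6) / (4 - a ^ 2) ^ 6))) :=
    .of_eq fun m => by rw [serJInv, hs]; ring
  refine (taylorExp_octAct ha hq rfl).isBigO_sub
    ((hC.subst tendsto_id_zero hser).congr_coeff rfl ?_ ?_ ?_ ?_)
  all_goals
    rw [hA]
    try simp only [h2, h4, h6, show 4 - 4 * (1 - q ^ 2) = 4 * q ^ 2 by ring]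
    field_simp
    try ring

theorem octNu_sub_invariant_series : (fun m => octNu a m - serNuInv 1 a (octLevel a m)) =O[𝓝 0]
    fun m => octLevel a m ^ 5 := by
  obtain ⟨hq0, hA, hs⟩ := oct_sqrt_spec ha hq
  obtain ⟨h2, h4, h6⟩ := oct_even_pow ha hq
  refine IsBigO.trans ?_ ((id_isBigO_octLevel ha hq).pow 5)
  have hC := taylorExp_octLevel (a := a) rfl
  have hser : TaylorExp (𝓝 0) (octLevel a) (fun m => serNuInv 1 a (octLevel a m)) (nuZero a)
      (a / (2 * Real.pi * (8 * q ^ 3)) * (-3))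
      (a / (2 * Real.pi * (8 * q ^ 3)) * (-(1 / 2 * ((86 + 13 * a ^ 2) / (4 - a ^ 2) ^ 2))))
      (a / (2 * Real.pi * (8 * q ^ 3)) *
        (-(2 * ((322 + 200 * a ^ 2 + 9 * a ^ 4) / (4 - a ^ 2) ^ 4))))
      (a / (2 * Real.pi * (8 * q ^ 3)) * (-(1 / 4 *
        ((39340 + 55506 * a ^ 2 + 10386 * a ^ 4 + 221 * a ^ 6) / (4 - a ^ 2) ^ 6)))) :=
    .of_eq fun m => by rw [serNuInv, (oct_rpow_spec ha hq).1]; ring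
  refine (taylorExp_octNu ha rfl rfl).isBigO_sub
    ((hC.subst tendsto_id_zero hser).congr_coeff rfl ?_ ?_ ?_ ?_)
  all_goals
    rw [← hq, hA]
    try simp only [h2, h4, h6, show 4 - 4 * (1 - q ^ 2) = 4 * q ^ 2 by ring]
    field_simp
    try ring

theorem octNu_sub_action_series : (fun m => octNu a m - serNuAct 1 a (octAct a m)) =O[𝓝 0]
    fun m => octAct a m ^ 4 := by
  obtain ⟨hq0, hA, hs⟩ := oct_sqrt_spec ha hq
  obtain ⟨h2, h4, h6⟩ := oct_even_pow ha hq
  refine IsBigO.trans ?_ ((id_isBigO_octAct ha hq).pow 4)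
  have hC := taylorExp_octAct ha hq rfl
  have hser : TaylorExp (𝓝 0) (octAct a) (fun m => serNuAct 1 a (octAct a m)) (nuZero a)
      (a / (2 * Real.pi) * (-(3 / (4 - a ^ 2))))
      (a / (2 * Real.pi) * (-((74 + 7 * a ^ 2) / (2 * (32 * q ^ 5)))))
      (a / (2 * Real.pi) * (-(5 * ((2 + a ^ 2) * (46 + a ^ 2) / (4 - a ^ 2) ^ 4)))) 0 :=
    .of_eq fun m => by rw [serNuAct, (oct_rpow_spec ha hq).2]; ring
  refine ((taylorExp_octNu ha rfl rfl).sub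
    (hC.subst tendsto_id_zero hser) |>.congr_coeff (sub_self _) ?_ ?_ ?_
      rfl).isBigO_four tendsto_id_zero
  all_goals
    rw [← hq]
    try rw [hA]
    simp only [h2, show 4 - 4 * (1 - q ^ 2) = 4 * q ^ 2 by ring]
    field_simp
    try ring

end

/-- The parameter of the focusing case as a function of `x = k ^ 2`. -/
theorem taylorExp_neg_div_one_sub :
    TaylorExp (𝓝 0) id (fun x : ℝ => -x / (1 - x)) 0 (-1) (-1) (-1) (-1) := by
  have h : TaylorExp (𝓝 0) id (fun x : ℝ => 1 - x) 1 (-1) 0 0 0 :=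
    .of_eq fun x => by simp only [id]; ring
  have h1 := h.inv tendsto_id_zero (d₀ := 1) (d₁ := 1) (d₂ := 1) (d₃ := 1) (d₄ := 1) (by norm_num)
    (by norm_num) (by norm_num) (by norm_num) (by norm_num)
  exact (((h1.var_mul tendsto_id_zero).const_mul (-1)).congr' (.of_forall fun x => by
    simp only [id, div_eq_mul_inv]; ring)).congr_coeff (by ring) (by ring) (by ring) (by ring)
    (by ring)

theorem tendsto_neg_div_one_sub : Tendsto (fun x : ℝ => -x / (1 - x)) (𝓝 0) (𝓝 0) :=
  taylorExp_neg_div_one_sub.tendsto tendsto_id_zero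

section

variable {a q : ℝ} (ha : (a / 2) ^ 2 < 1) (hq : q = √(1 - (a / 2) ^ 2))
include ha hq

/-- The focusing series in `x = k²`, obtained by substituting `m = -x / (1 - x)`; the action is
`-octAct`. -/
theorem octAct_focusing_series : (fun x => -octAct a (-x / (1 - x))
    - (4 - a ^ 2) ^ ((3 : ℝ) / 2) / 2 ^ 4 * (x + 7 * ((2 + a ^ 2) / 2 ^ 4) * x ^ 2
      + (102 + 44 * a ^ 2 + 33 * a ^ 4) / 2 ^ 7 * x ^ 3
      + (3036 + 1246 * a ^ 2 + 330 * a ^ 4 + 715 * a ^ 6) / 2 ^ 12 * x ^ 4)) =O[𝓝 0]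
    fun x => x ^ 5 := by
  have h := (taylorExp_neg_div_one_sub.subst tendsto_id_zero
    ((taylorExp_octAct ha hq rfl).comp_tendsto tendsto_neg_div_one_sub)).const_mul (-1)
  refine IsBigO.congr_left h fun m => ?_
  rw [(oct_rpow_spec ha hq).1]
  simp only [id, Function.comp]
  ring

theorem octNu_focusing_series : (fun x => octNu a (-x / (1 - x))
    - (nuZero a + a * √(4 - a ^ 2) / (2 ^ 4 * (2 * Real.pi)) *
    (3 * x + (10 + 35 * a ^ 2) / 2 ^ 5 * x ^ 2
      + (18 - 56 * a ^ 2 + 77 * a ^ 4) / 2 ^ 7 * x ^ 3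
      + (1364 - 13 * (26 + 858 * a ^ 2 - 495 * a ^ 4) * a ^ 2) / 2 ^ 14 * x ^ 4))) =O[𝓝 0]
    fun x => x ^ 5 := by
  have h := taylorExp_neg_div_one_sub.subst tendsto_id_zero
    ((taylorExp_octNu ha rfl rfl).comp_tendsto tendsto_neg_div_one_sub)
  refine IsBigO.congr_left h fun m => ?_
  rw [(oct_sqrt_spec ha hq).2.2, ← hq]
  simp only [id, Function.comp]
  ring

end

/-! ### Transfer of the expansions to the two octupole regimes -/

section

variable {a c : ℝ} (ha : |a| < 2) (hc : c ∈ Ioo 0 ((|a / 2| - 1) ^ 2))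
include ha hc

/-- In the defocusing case the parameter is `m = k²`, and the amplitude `φ` is `am η`. -/
theorem octSinSq_modDO :
    octSinSq ((a / 2) ^ 2) (modDO a c ^ 2) = jacSn (etaDO a c) (modDO a c) ^ 2 := by
  obtain ⟨hk, hrk, hA⟩ := modDO_spec ha hc
  obtain ⟨-, -, hs2⟩ := etaDO_spec ha hc
  have hk0 := hk.1
  have hw1 : jacSn (etaDO a c) (modDO a c) ^ 2 ≤ 1 := jacSn_sq_le_one _
  have hk2 := sq_lt_one_of_mem hk
  refine octSinSq_eq (by nlinarith [sq_nonneg (modDO a c)])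
    (by nlinarith [sq_nonneg (modDO a c)]) ?_
  rw [hs2, ← hA]
  field_simp

theorem octLevel_modDO : octLevel a (modDO a c ^ 2) = c := by
  have hk := (modDO_spec ha hc).1.1
  rw [octLevel, octSinSq_modDO ha hc, (etaDO_spec ha hc).2.2, div_pow, Real.sq_sqrt hc.1.le]
  field_simp

theorem actionDO_eq_octAct : actionDO a c = octAct a (modDO a c ^ 2) := by
  obtain ⟨hk, hk2, es, -, -, hs, hr, -⟩ := phaseDO_spec ha hc rfl rfl rfl
  rw [octAct, octActAux, octSinSq_modDO ha hc, Real.sqrt_sq hs.le, actionDO,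
    areaSn_eq_integral hk2, es, abs_of_pos hc.1, hr]
  have e : ∀ θ : ℝ, (1 - Real.sin θ ^ 2) * (1 - modDO a c ^ 2 * Real.sin θ ^ 2)
        * (1 - modDO a c ^ 2 * jacSn (etaDO a c) (modDO a c) ^ 2 * Real.sin θ ^ 2)⁻¹
        / √(1 - modDO a c ^ 2 * Real.sin θ ^ 2)
      = (1 - Real.sin θ ^ 2) * √(1 - modDO a c ^ 2 * Real.sin θ ^ 2)
        / (1 - modDO a c ^ 2 * jacSn (etaDO a c) (modDO a c) ^ 2 * Real.sin θ ^ 2) := fun θ => by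
    rw [mul_right_comm, mul_div_assoc, Real.div_sqrt, mul_right_comm, ← div_eq_mul_inv]
  simp only [e]
  field_simp
  ring

theorem rotationDO_eq_octNu : rotationDO a c = octNu a (modDO a c ^ 2) := by
  obtain ⟨hk, hk2, es, ed, hη, hs, hr, hα⟩ := phaseDO_spec ha hc rfl rfl rfl
  set η := phase a (modDO a c) (etaDO a c)
  have hd := jacDn_pos hk2 η
  have hφ : octAmp a (modDO a c ^ 2) = jacAm η (modDO a c) := by
    have h1 : 1 - modDO a c ^ 2 * jacSn (etaDO a c) (modDO a c) ^ 2 = jacDn η (modDO a c) ^ 2 := by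
      rw [jacDn_sq hk2, es]
    rw [octAmp, octSinSq_modDO ha hc, h1, Real.sqrt_sq hd.le, ← hα, mul_div_cancel_right₀ _ hd.ne',
      jacCn]
    refine Real.arccos_cos ?_ ?_
    · rw [← jacAm_zero hk2]; exact (jacAm_strictMono hk2).monotone hη.1.le
    · have := jacAm_add_two_ellK hk2 0
      rw [zero_add, jacAm_zero hk2, zero_add] at this
      rw [← this]; exact (jacAm_strictMono hk2).monotone hη.2.le
  rw [rotationDO, octNu, hφ, ← ellF_eq_ellFm, ellF_jacAm hk2, ← ellF_eq_ellFm]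
  rfl

end

/-- The transformation of the first integral to a negative parameter. -/
theorem ellFm_arccos_neg {m : ℝ} (hm : m < 1) {φ : ℝ} (hφ : φ ∈ Icc 0 Real.pi) :
    ellFm (Real.arccos (Real.cos φ / √(1 - m * Real.sin φ ^ 2))) (-m / (1 - m))
      = √(1 - m) * ellFm φ m := by
  have hm1 : 0 < 1 - m := sub_pos.2 hm
  have hmm : -m / (1 - m) < 1 := by rw [div_lt_one hm1]; linarith
  have hΔ : ∀ θ : ℝ, 0 < 1 - m * Real.sin θ ^ 2 := one_sub_mul_sin_sq_pos hm
  have hcd : Continuous fun θ : ℝ => Real.cos θ / √(1 - m * Real.sin θ ^ 2) :=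
    Continuous.div (by fun_prop) (by fun_prop) fun θ => (Real.sqrt_pos.2 (hΔ θ)).ne'
  have hder : ∀ θ ∈ Ioo 0 Real.pi, HasDerivAt (fun θ =>
      ellFm (Real.arccos (Real.cos θ / √(1 - m * Real.sin θ ^ 2))) (-m / (1 - m))
        - √(1 - m) * ellFm θ m) 0 θ := by
    intro θ hθ
    have hs := Real.sin_pos_of_mem_Ioo hθ
    have hD0 := Real.sqrt_pos.2 (hΔ θ)
    have hD2 := Real.sq_sqrt (hΔ θ).le
    have hy0 := Real.sqrt_pos.2 hm1
    have hy2 := Real.sq_sqrt hm1.le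
    have hc2 := Real.sin_sq_add_cos_sq θ
    have hx2 : 1 - (Real.cos θ / √(1 - m * Real.sin θ ^ 2)) ^ 2
        = (√(1 - m) * Real.sin θ / √(1 - m * Real.sin θ ^ 2)) ^ 2 := by
      field_simp
      rw [hD2, hy2]
      linear_combination (-1 : ℝ) * hc2
    have hpos : 0 < √(1 - m) * Real.sin θ / √(1 - m * Real.sin θ ^ 2) := by positivity
    have hx1 : |Real.cos θ / √(1 - m * Real.sin θ ^ 2)| < 1 := by
      rw [← sq_lt_one_iff_abs_lt_one]
      nlinarith
    obtain ⟨h1, h2⟩ := abs_lt.1 hx1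
    have hq : HasDerivAt (fun θ => √(1 - m * Real.sin θ ^ 2))
        (-(m * (2 * Real.sin θ * Real.cos θ)) / (2 * √(1 - m * Real.sin θ ^ 2))) θ := by
      have h0 : HasDerivAt (fun θ => 1 - m * Real.sin θ ^ 2)
          (-(m * (2 * Real.sin θ * Real.cos θ))) θ := by
        simpa using ((Real.hasDerivAt_sin θ).pow 2).const_mul m |>.const_sub 1
      exact h0.sqrt (hΔ θ).ne'
    have hx : HasDerivAt (fun θ => Real.cos θ / √(1 - m * Real.sin θ ^ 2)) _ θ :=
      (Real.hasDerivAt_cos θ).div hq hD0.ne'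
    have harc : HasDerivAt (fun θ => Real.arccos (Real.cos θ / √(1 - m * Real.sin θ ^ 2))) _ θ :=
      HasDerivAt.comp (h := fun θ => Real.cos θ / √(1 - m * Real.sin θ ^ 2)) θ
        (Real.hasDerivAt_arccos h1.ne' h2.ne) hx
    have hF := HasDerivAt.comp (h₂ := fun φ => ellFm φ (-m / (1 - m)))
      (h := fun θ => Real.arccos (Real.cos θ / √(1 - m * Real.sin θ ^ 2))) θ
      (hasDerivAt_ellFm hmm _) harc
    refine (hF.sub ((hasDerivAt_ellFm hm θ).const_mul √(1 - m))).congr_deriv ?_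
    rw [Real.sin_arccos, Real.sq_sqrt (by rw [hx2]; positivity), hx2, Real.sqrt_sq hpos.le]
    have e1 : 1 - -m / (1 - m) * (√(1 - m) * Real.sin θ / √(1 - m * Real.sin θ ^ 2)) ^ 2
        = (1 / √(1 - m * Real.sin θ ^ 2)) ^ 2 := by
      field_simp
      rw [hD2, hy2]
      field_simp
      ring
    rw [e1, Real.sqrt_sq (by positivity)]
    generalize √(1 - m * Real.sin θ ^ 2) = D at *
    generalize √(1 - m) = y at *
    field_simp
    rw [hD2, hy2]
    linear_combination (-m : ℝ) * hc2
  have hcont : Continuous fun θ =>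
      ellFm (Real.arccos (Real.cos θ / √(1 - m * Real.sin θ ^ 2))) (-m / (1 - m))
        - √(1 - m) * ellFm θ m := by
    have hF : ∀ {m : ℝ}, m < 1 → Continuous fun φ => ellFm φ m := fun hm =>
      continuous_iff_continuousAt.2 fun φ => (hasDerivAt_ellFm hm φ).continuousAt
    exact ((hF hmm).comp (Real.continuous_arccos.comp hcd)).sub (continuous_const.mul (hF hm))
  have hz : ellFm (Real.arccos (Real.cos 0 / √(1 - m * Real.sin 0 ^ 2))) (-m / (1 - m))
        - √(1 - m) * ellFm 0 m = 0 := by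
    simp [ellFm]
  rcases hφ.1.eq_or_lt with rfl | h0
  · exact sub_eq_zero.1 hz
  · obtain ⟨θ, hθ, h⟩ := exists_hasDerivAt_eq_slope _ (fun _ => 0) h0 hcont.continuousOn
      fun θ hθ => hder θ ⟨hθ.1, hθ.2.trans_le hφ.2⟩
    rw [hz, eq_comm, div_eq_zero_iff] at h
    rcases h with h | h
    · linarith
    · linarith

theorem integral_sin_sq_reflect (f : ℝ → ℝ) :
    ∫ θ in (0 : ℝ)..(Real.pi / 2), f (Real.sin θ ^ 2)
      = ∫ θ in (0 : ℝ)..(Real.pi / 2), f (1 - Real.sin θ ^ 2) := by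
  have h := intervalIntegral.integral_comp_sub_left (fun θ => f (Real.sin θ ^ 2)) (Real.pi / 2)
    (a := 0) (b := Real.pi / 2)
  simp only [Real.sin_pi_div_two_sub, Real.cos_sq', sub_self, sub_zero] at h
  exact h.symm

section

variable {a c : ℝ} (hc : 0 < c)
include hc

/-- In the focusing case the parameter is `m = -k² / (1 - k²)`, and `cos φ = cn η / dn η`. -/
theorem octSinSq_modFO (hk : modFO a c ^ 2 ≤ 1 / 2) :
    octSinSq ((a / 2) ^ 2) (-modFO a c ^ 2 / (1 - modFO a c ^ 2))
      = ((compModulus (modFO a c)) * jacSn (etaFO a c) (modFO a c)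
        / jacDn (etaFO a c) (modFO a c)) ^ 2 := by
  obtain ⟨hk1, hk2, es, ed, -, hs, hr, hα⟩ := phaseFO_spec (a := a) hc rfl rfl rfl
  obtain ⟨hy, hy2, -⟩ := compModulus_spec hk1
  have hd := jacDn_pos hk2 (etaFO a c)
  have hd2 := jacDn_sq hk2 (etaFO a c)
  have hc2 : jacCn (phase a (modFO a c) (etaFO a c)) (modFO a c) ^ 2
      = 1 - jacSn (etaFO a c) (modFO a c) ^ 2 := by rw [jacCn_sq, es]
  have hα2 := congrArg (· ^ 2) hα
  simp only [div_pow _ (jacDn _ _ ^ 2), hc2, ed] at hα2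
  have hk0 := hk1.1
  generalize jacDn (etaFO a c) (modFO a c) = d at *
  generalize jacSn (etaFO a c) (modFO a c) = s at *
  generalize compModulus (modFO a c) = y at *
  generalize modFO a c = k at *
  have e : -k ^ 2 / (1 - k ^ 2) * (y * s / d) ^ 2 = -(k ^ 2 * s ^ 2 / d ^ 2) := by
    rw [← hy2]; field_simp
  have hp : 0 < k ^ 2 * s ^ 2 / d ^ 2 := by positivity
  have h1 : 0 ≤ 1 + -k ^ 2 / (1 - k ^ 2) := by
    rw [← hy2]
    have : 0 ≤ (y ^ 2 - k ^ 2) / y ^ 2 := div_nonneg (by linarith) (by positivity)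
    refine this.trans_eq ?_
    field_simp
    ring
  refine octSinSq_eq ?_ ?_ ?_
  · rw [mul_assoc, e]; linarith
  · rw [mul_assoc, e]; linarith
  · rw [e, ← hα2]
    field_simp
    rw [hy2]
    linear_combination (d ^ 2 + k ^ 2 * s ^ 2 + 1 - s ^ 2) * hd2

theorem octLevel_modFO (hk : modFO a c ^ 2 ≤ 1 / 2) :
    octLevel a (-modFO a c ^ 2 / (1 - modFO a c ^ 2)) = -c := by
  obtain ⟨hk1, hk2, es, ed, -, hs, hr, hα⟩ := phaseFO_spec (a := a) hc rfl rfl rfl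
  obtain ⟨hy, hy2, -⟩ := compModulus_spec hk1
  have hd := jacDn_pos hk2 (etaFO a c)
  rw [octLevel, octSinSq_modFO hc hk, ← hy2]
  have hcc := Real.sq_sqrt hc.le
  rw [hr] at hcc
  have hk0 := hk1.1
  generalize jacDn (etaFO a c) (modFO a c) = d at *
  generalize jacSn (etaFO a c) (modFO a c) = s at *
  generalize compModulus (modFO a c) = y at *
  generalize modFO a c = k at *
  rw [← hcc]
  field_simp

/-- The substitution `sin² θ ↦ 1 - sin² θ` turns the focusing integral into the one with negative
parameter; the factor `m` in `octAct` accounts for the sign. -/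
theorem actionFO_eq_octAct (hk : modFO a c ^ 2 ≤ 1 / 2) :
    actionFO a c = -octAct a (-modFO a c ^ 2 / (1 - modFO a c ^ 2)) := by
  obtain ⟨hk1, hk2, es, ed, -, hs, hr, hα⟩ := phaseFO_spec (a := a) hc rfl rfl rfl
  obtain ⟨hy, hy2, -⟩ := compModulus_spec hk1
  have hd := jacDn_pos hk2 (etaFO a c)
  have hd2 := jacDn_sq hk2 (etaFO a c)
  rw [octAct, octActAux, octSinSq_modFO hc hk, Real.sqrt_sq (by positivity), actionFO,
    areaCn_eq_integral hk2, es, ed, abs_of_pos hc, hr, integral_sin_sq_reflect fun X =>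
      (1 - X) * √(1 - -modFO a c ^ 2 / (1 - modFO a c ^ 2) * X) / (1 - -modFO a c ^ 2
        / (1 - modFO a c ^ 2) * (compModulus (modFO a c) * jacSn (etaFO a c) (modFO a c)
        / jacDn (etaFO a c) (modFO a c)) ^ 2 * X)]
  have hk0 := hk1.1
  have hn : ∀ θ : ℝ, 0 < 1 - modFO a c ^ 2 * jacSn (etaFO a c) (modFO a c) ^ 2
      * Real.sin θ ^ 2 := fun θ => by
    have h1 := Real.sin_sq_le_one θ
    have h2 : 0 < 1 - modFO a c ^ 2 * jacSn (etaFO a c) (modFO a c) ^ 2 := by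
      rw [← hd2]; positivity
    nlinarith [sq_nonneg (Real.sin θ), mul_nonneg (sq_nonneg (modFO a c))
      (sq_nonneg (jacSn (etaFO a c) (modFO a c)))]
  have hm := one_sub_mul_sin_sq_pos hk2
  generalize jacDn (etaFO a c) (modFO a c) = d at *
  generalize jacSn (etaFO a c) (modFO a c) = s at *
  generalize compModulus (modFO a c) = y at *
  generalize modFO a c = k at *
  have e : ∀ θ : ℝ, (1 - (1 - Real.sin θ ^ 2)) * √(1 - -k ^ 2 / (1 - k ^ 2) * (1 - Real.sin θ ^ 2))
        / (1 - -k ^ 2 / (1 - k ^ 2) * (y * s / d) ^ 2 * (1 - Real.sin θ ^ 2))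
      = d ^ 2 / y * (Real.sin θ ^ 2 * (1 - k ^ 2 * Real.sin θ ^ 2)
        * (1 - k ^ 2 * s ^ 2 * Real.sin θ ^ 2)⁻¹ / √(1 - k ^ 2 * Real.sin θ ^ 2)) := fun θ => by
    have e1 : 1 - -k ^ 2 / (1 - k ^ 2) * (1 - Real.sin θ ^ 2)
        = (1 - k ^ 2 * Real.sin θ ^ 2) / y ^ 2 := by
      rw [← hy2]; field_simp; rw [hy2]; ring
    have e2 : 1 - -k ^ 2 / (1 - k ^ 2) * (y * s / d) ^ 2 * (1 - Real.sin θ ^ 2)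
        = (1 - k ^ 2 * s ^ 2 * Real.sin θ ^ 2) / d ^ 2 := by
      rw [← hy2]; field_simp; rw [hd2]; ring
    rw [e1, e2, Real.sqrt_div (hm θ).le, Real.sqrt_sq hy.le]
    have h1 := hn θ
    have h2 := Real.sqrt_pos.2 (hm θ)
    have h3 := Real.sq_sqrt (hm θ).le
    generalize √(1 - k ^ 2 * Real.sin θ ^ 2) = q at *
    rw [← h3]
    field_simp
    ring
  simp only [e, intervalIntegral.integral_const_mul]
  rw [← hy2]
  field_simp
  ring

/-- Numerator and denominator acquire the same factor from `ellFm_arccos_neg`, which cancels in the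
ratio. -/
theorem rotationFO_eq_octNu (hk : modFO a c ^ 2 ≤ 1 / 2) :
    rotationFO a c = octNu a (-modFO a c ^ 2 / (1 - modFO a c ^ 2)) := by
  obtain ⟨hk1, hk2, es, ed, hη, hs, hr, hα⟩ := phaseFO_spec (a := a) hc rfl rfl rfl
  obtain ⟨hy, hy2, -⟩ := compModulus_spec hk1
  set η := phase a (modFO a c) (etaFO a c)
  have hd := jacDn_pos hk2 η
  have hd2 := jacDn_sq hk2 η
  have hpi : jacAm η (modFO a c) ∈ Icc 0 Real.pi := by
    constructor
    · rw [← jacAm_zero hk2]; exact (jacAm_strictMono hk2).monotone hη.1.le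
    · have := jacAm_add_two_ellK hk2 0
      rw [zero_add, jacAm_zero hk2, zero_add] at this
      rw [← this]; exact (jacAm_strictMono hk2).monotone hη.2.le
  have hφ : octAmp a (-modFO a c ^ 2 / (1 - modFO a c ^ 2))
      = Real.arccos (Real.cos (jacAm η (modFO a c))
        / √(1 - modFO a c ^ 2 * Real.sin (jacAm η (modFO a c)) ^ 2)) := by
    have h1 : 1 - -modFO a c ^ 2 / (1 - modFO a c ^ 2) * (compModulus (modFO a c)
        * jacSn η (modFO a c) / jacDn η (modFO a c)) ^ 2 = (1 / jacDn η (modFO a c)) ^ 2 := by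
      rw [← hy2]; field_simp; rw [hd2]; ring
    rw [octAmp, octSinSq_modFO hc hk, ← es, ← ed, h1, Real.sqrt_sq (by positivity), ← hα]
    change _ = Real.arccos (jacCn η (modFO a c) / jacDn η (modFO a c))
    congr 1
    field_simp
  have h2 := ellFm_arccos_neg hk2
    (φ := Real.pi / 2) ⟨by positivity, by linarith [Real.pi_pos]⟩
  rw [Real.cos_pi_div_two, zero_div, Real.arccos_zero] at h2
  rw [rotationFO, octNu, hφ, ellFm_arccos_neg hk2 hpi, h2,
    ← ellF_eq_ellFm, ellF_jacAm hk2, ← ellF_eq_ellFm, ← compModulus]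
  change η / (4 * ellK (modFO a c)) = compModulus (modFO a c) * η
    / (4 * (compModulus (modFO a c) * ellK (modFO a c)))
  field_simp

end

/-! ### The series of the two octupole regimes -/

/-- The expansions in `m = k²`, restricted to `m > 0`; the expansions in the invariant and in the
action are relations between functions of `m`, and become expansions in `c` because `octLevel` takes
the value `c`. -/
theorem series_DO {a : ℝ} (ha : |a| < 2) :
    (fun c => actionDO a c - serJSnMod a (modDO a c)) =O[𝓝[>] 0] (fun c => modDO a c ^ 10) ∧
    (fun c => actionDO a c - serJInv 1 a c) =O[𝓝[>] 0] (fun c => c ^ 5) ∧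
    (fun c => rotationDO a c - serNuSnMod a (modDO a c)) =O[𝓝[>] 0] (fun c => modDO a c ^ 10) ∧
    (fun c => rotationDO a c - serNuInv 1 a c) =O[𝓝[>] 0] (fun c => c ^ 5) ∧
    (fun c => rotationDO a c - serNuAct 1 a (actionDO a c)) =O[𝓝[>] 0]
      (fun c => actionDO a c ^ 4) := by
  have ha' := half_sq_lt_one ha
  have T : Tendsto (fun c => modDO a c ^ 2) (𝓝[>] 0) (𝓝 0) := by
    simpa using ((modDO_tendsto ha).mono_right nhdsWithin_le_nhds).pow 2
  have hev := eventually_mem_range_DO ha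
  have hJ : ∀ᶠ c in 𝓝[>] 0, octAct a (modDO a c ^ 2) = actionDO a c :=
    hev.mono fun c hc => (actionDO_eq_octAct ha hc).symm
  have hν : ∀ᶠ c in 𝓝[>] 0, octNu a (modDO a c ^ 2) = rotationDO a c :=
    hev.mono fun c hc => (rotationDO_eq_octNu ha hc).symm
  have hC : ∀ᶠ c in 𝓝[>] 0, octLevel a (modDO a c ^ 2) = c :=
    hev.mono fun c hc => octLevel_modDO ha hc
  refine ⟨?_, ?_, ?_, ?_, ?_⟩
  · refine ((octAct_sub_modulus_series ha' rfl).comp_tendsto T).congr' ?_ (.of_forall fun c => ?_)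
    · filter_upwards [hJ] with c h1
      simp only [Function.comp, h1, serJSnMod]; ring
    · simp only [Function.comp]; ring
  · refine ((octAct_sub_invariant_series ha' rfl).comp_tendsto T).congr' ?_ ?_
    · filter_upwards [hJ, hC] with c h1 h2
      simp only [Function.comp, h1, h2]
    · filter_upwards [hC] with c h2
      simp only [Function.comp, h2]
  · refine ((octNu_sub_modulus_series ha' rfl).comp_tendsto T).congr' ?_ (.of_forall fun c => ?_)
    · filter_upwards [hν] with c h1
      simp only [Function.comp, h1, serNuSnMod]; ring
    · simp only [Function.comp]; ring
  · refine ((octNu_sub_invariant_series ha' rfl).comp_tendsto T).congr' ?_ ?_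
    · filter_upwards [hν, hC] with c h1 h2
      simp only [Function.comp, h1, h2]
    · filter_upwards [hC] with c h2
      simp only [Function.comp, h2]
  · refine ((octNu_sub_action_series ha' rfl).comp_tendsto T).congr' ?_ ?_
    · filter_upwards [hν, hJ] with c h1 h2
      simp only [Function.comp, h1, h2]
    · filter_upwards [hJ] with c h2
      simp only [Function.comp, h2]

/-- The expansions restricted to `m < 0`, where the invariant is `-octLevel` and the action is
`-octAct`. This is what reverses the signs of alternate terms. -/
theorem series_FO {a : ℝ} (ha : |a| < 2) :
    (fun c => actionFO a c - serJCnMod a (modFO a c)) =O[𝓝[>] 0] (fun c => modFO a c ^ 10) ∧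
    (fun c => actionFO a c - serJInv (-1) a c) =O[𝓝[>] 0] (fun c => c ^ 5) ∧
    (fun c => rotationFO a c - serNuCnMod a (modFO a c)) =O[𝓝[>] 0] (fun c => modFO a c ^ 10) ∧
    (fun c => rotationFO a c - serNuInv (-1) a c) =O[𝓝[>] 0] (fun c => c ^ 5) ∧
    (fun c => rotationFO a c - serNuAct (-1) a (actionFO a c)) =O[𝓝[>] 0]
      (fun c => actionFO a c ^ 4) := by
  have ha' := half_sq_lt_one ha
  have T : Tendsto (fun c => modFO a c ^ 2) (𝓝[>] 0) (𝓝 0) := by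
    simpa using ((modFO_tendsto ha).mono_right nhdsWithin_le_nhds).pow 2
  have T2 := tendsto_neg_div_one_sub.comp T
  have hev : ∀ᶠ c in 𝓝[>] 0, 0 < c ∧ modFO a c ^ 2 ≤ 1 / 2 :=
    eventually_mem_nhdsWithin.and (T.eventually_le_const (by norm_num))
  have hJ : ∀ᶠ c in 𝓝[>] 0, octAct a (-modFO a c ^ 2 / (1 - modFO a c ^ 2)) = -actionFO a c :=
    hev.mono fun c hc => by rw [actionFO_eq_octAct hc.1 hc.2, neg_neg]
  have hν : ∀ᶠ c in 𝓝[>] 0, octNu a (-modFO a c ^ 2 / (1 - modFO a c ^ 2)) = rotationFO a c :=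
    hev.mono fun c hc => (rotationFO_eq_octNu hc.1 hc.2).symm
  have hC : ∀ᶠ c in 𝓝[>] 0, octLevel a (-modFO a c ^ 2 / (1 - modFO a c ^ 2)) = -c :=
    hev.mono fun c hc => octLevel_modFO hc.1 hc.2
  refine ⟨?_, ?_, ?_, ?_, ?_⟩
  · refine ((octAct_focusing_series ha' rfl).comp_tendsto T).congr' ?_ (.of_forall fun c => ?_)
    · filter_upwards [hJ] with c h1
      simp only [Function.comp, h1, serJCnMod]; ring
    · simp only [Function.comp]; ring
  · refine (((octAct_sub_invariant_series ha' rfl).comp_tendsto T2).neg_left.congr' ?_ ?_).trans (isBigO_refl _ _).neg_left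
    · filter_upwards [hJ, hC] with c h1 h2
      simp only [Function.comp, h1, h2, serJInv]; ring
    · filter_upwards [hC] with c h2
      simp only [Function.comp, h2]; ring
  · refine ((octNu_focusing_series ha' rfl).comp_tendsto T).congr' ?_ (.of_forall fun c => ?_)
    · filter_upwards [hν] with c h1
      simp only [Function.comp, h1, serNuCnMod]; ring
    · simp only [Function.comp]; ring
  · refine (((octNu_sub_invariant_series ha' rfl).comp_tendsto T2).congr' ?_ ?_).trans (isBigO_refl _ _).neg_left
    · filter_upwards [hν, hC] with c h1 h2
      simp only [Function.comp, h1, h2, serNuInv]; ring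
    · filter_upwards [hC] with c h2
      simp only [Function.comp, h2]; ring
  · refine ((octNu_sub_action_series ha' rfl).comp_tendsto T2).congr' ?_ ?_
    · filter_upwards [hν, hJ] with c h1 h2
      simp only [Function.comp, h1, h2, serNuAct]; ring
    · filter_upwards [hJ] with c h2
      simp only [Function.comp, h2]; ring

/-! ### The Duffing regime near the symmetric fixed points -/

/-- The square of the sine of the amplitude of the phase advance after Landen's transformation, as a
function of `b = 2 / a` and of the parameter. -/
def dfSinSq (b m : ℝ) : ℝ := octSinSq (b ^ 2) m / (1 + b)

/-- The amplitude of the phase advance after Landen's transformation. -/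
def dfAmp (b m : ℝ) : ℝ := Real.arcsin √(dfSinSq b m)

/-- The rotation number as a function of the transformed parameter. -/
def dfNu (b m : ℝ) : ℝ := ellFm (dfAmp b m) m / (2 * ellFm (Real.pi / 2) m)

/-- `dfSinSq b m / (1 - b)`, which is `1` at `m = 0`. -/
def dfFactor (b m : ℝ) : ℝ := 2 / (1 + m + octRoot (b ^ 2) m)

/-- `(1 - dfSinSq b m) / b`, which is `1` at `m = 0`. -/
def dfCosFactor (b m : ℝ) : ℝ := (1 - dfSinSq b m) / b

section

variable {b : ℝ} (hb : b ∈ Ioo 0 1)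
include hb

theorem sq_mem_Ico_of_mem : b ^ 2 ∈ Ico 0 1 := ⟨sq_nonneg _, sq_lt_one_of_mem hb⟩

theorem dfSinSq_eq_mul (m : ℝ) : dfSinSq b m = (1 - b) * dfFactor b m := by
  have h := hb.1
  rw [dfSinSq, octSinSq, dfFactor]
  field_simp
  ring

/-- The relations satisfied by `dfSinSq`, inherited from `octSinSq` with `A = b²`. -/
theorem dfSinSq_mem : ∀ᶠ m in 𝓝 0, |m| < 1 / 8 ∧ dfSinSq b m ∈ Ioo 0 1 ∧
    (1 - (1 + b) * dfSinSq b m) * (1 - m * ((1 + b) * dfSinSq b m)) = b ^ 2 ∧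
    m * ((1 + b) * dfSinSq b m) = (1 + m - octRoot (b ^ 2) m) / 2 ∧
    1 / 2 < octRoot (b ^ 2) m ∧ 0 < dfFactor b m ∧ 0 < dfCosFactor b m := by
  have hb0 := hb.1
  filter_upwards [octRoot_spec (sq_mem_Ico_of_mem hb)] with m ⟨hm, hS, hS2⟩
  obtain ⟨hw, hmw, hrel⟩ := octSinSq_spec (sq_mem_Ico_of_mem hb) hm hS hS2
  have e : (1 + b) * dfSinSq b m = octSinSq (b ^ 2) m := by rw [dfSinSq]; field_simp
  have h1 : dfSinSq b m < 1 := by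
    rw [dfSinSq, div_lt_one (by linarith)]; linarith [hw.2]
  refine ⟨hm, ⟨div_pos hw.1 (by linarith), h1⟩, by rw [e, hrel], by rw [e, hmw], hS, ?_,
    div_pos (sub_pos.2 h1) hb0⟩
  exact div_pos two_pos (by linarith [(abs_lt.1 hm).1])

theorem sqrt_dfSinSq_div : ∀ᶠ m in 𝓝 0, √(dfSinSq b m) / √(1 - dfSinSq b m)
    = √((1 - b) / b) * √(dfFactor b m / dfCosFactor b m) := by
  have hb0 := hb.1
  have hb1 : 0 < 1 - b := sub_pos.2 hb.2
  filter_upwards [dfSinSq_mem hb] with m ⟨_, hw, _, _, _, _, hθ⟩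
  rw [← Real.sqrt_div hw.1.le, ← Real.sqrt_mul (by positivity)]
  congr 1
  have e : 1 - dfSinSq b m = b * dfCosFactor b m := by rw [dfCosFactor]; field_simp
  rw [e, dfSinSq_eq_mul hb]
  field_simp

theorem sin_mul_cos_dfAmp : ∀ᶠ m in 𝓝 0, Real.sin (dfAmp b m) * Real.cos (dfAmp b m)
    = √((1 - b) / b) * b * (dfCosFactor b m * √(dfFactor b m / dfCosFactor b m)) := by
  have hb0 := hb.1
  filter_upwards [dfSinSq_mem hb, sqrt_dfSinSq_div hb] with m ⟨_, hw, _⟩ hq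
  have h1 : √(dfSinSq b m) ≤ 1 := Real.sqrt_le_one.2 hw.2.le
  have h0 := Real.sqrt_nonneg (dfSinSq b m)
  have hc := Real.sqrt_pos.2 (sub_pos.2 hw.2)
  rw [dfAmp, Real.sin_arcsin (by linarith) h1, Real.cos_arcsin, Real.sq_sqrt hw.1.le]
  have e : 1 - dfSinSq b m = b * dfCosFactor b m := by rw [dfCosFactor]; field_simp
  calc √(dfSinSq b m) * √(1 - dfSinSq b m)
      = √(dfSinSq b m) / √(1 - dfSinSq b m) * √(1 - dfSinSq b m) ^ 2 := by field_simp
    _ = _ := by rw [Real.sq_sqrt (sub_pos.2 hw.2).le, hq, e]; ring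

/-- As for the octupole, the derivative of the amplitude is algebraic in `m`. -/
theorem hasDerivAt_dfAmp : ∀ᶠ m in 𝓝 0, HasDerivAt (dfAmp b)
    (√((1 - b) / b) / 2 * (((1 + b) * dfSinSq b m - 1) * √(dfFactor b m / dfCosFactor b m)
      * (octRoot (b ^ 2) m)⁻¹)) m := by
  have hb0 := hb.1
  filter_upwards [octRoot_spec (sq_mem_Ico_of_mem hb), dfSinSq_mem hb, sqrt_dfSinSq_div hb]
    with m ⟨hm, hS, hS2⟩ ⟨_, hw, hrel, hmw, _⟩ hq
  have hroot : HasDerivAt (octRoot (b ^ 2)) ((m - 1 + 2 * b ^ 2) / octRoot (b ^ 2) m) m := by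
    have h0 := hasDerivAt_id m
    have h1 := (((h0.const_sub 1).pow 2).add ((h0.const_mul 4).mul_const (b ^ 2))).sqrt
      (by simp only [id, Pi.add_apply, Pi.pow_apply]
          have := hS2 ▸ (by positivity : octRoot (b ^ 2) m ^ 2 ≠ 0)
          exact this)
    refine h1.congr_deriv ?_
    simp only [id, Pi.add_apply, Pi.pow_apply]
    rw [← octRoot]
    field_simp
    push_cast
    ring
  have hden : 0 < 1 + m + octRoot (b ^ 2) m := by linarith [(abs_lt.1 hm).1]
  have hwd : HasDerivAt (dfSinSq b)
      (dfSinSq b m * ((1 + b) * dfSinSq b m - 1) / octRoot (b ^ 2) m) m := by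
    have h1 := ((((hasDerivAt_id m).const_add 1).add hroot).inv hden.ne').const_mul
      (2 * (1 - b ^ 2) / (1 + b))
    refine (h1.congr_of_eventuallyEq (.of_forall fun t => ?_)).congr_deriv ?_
    · simp only [Pi.inv_apply, Pi.add_apply, id, dfSinSq, octSinSq]
      field_simp
    · have hwe : dfSinSq b m * (1 + m + octRoot (b ^ 2) m) = 2 * (1 - b ^ 2) / (1 + b) := by
        rw [dfSinSq, octSinSq]; field_simp
      rw [← hwe]
      simp only [id, Pi.add_apply]
      have hS0 : octRoot (b ^ 2) m ≠ 0 := by linarith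
      have hwe' : dfSinSq b m * (1 + m + octRoot (b ^ 2) m) * (1 + b) = 2 * (1 - b ^ 2) := by
        rw [hwe]; field_simp
      generalize octRoot (b ^ 2) m = S at *
      generalize dfSinSq b m = w at *
      have hd := hden.ne'
      field_simp
      linear_combination (-w) * hwe'
  have hsq := Real.sqrt_pos.2 hw.1
  have hcq := Real.sqrt_pos.2 (sub_pos.2 hw.2)
  have h1 : √(dfSinSq b m) < 1 := (Real.sqrt_lt' one_pos).2 (by linarith [hw.2])
  have harc : HasDerivAt (dfAmp b) _ m :=
    HasDerivAt.comp (h₂ := Real.arcsin) (h := fun m => √(dfSinSq b m)) m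
      (Real.hasDerivAt_arcsin (by linarith) h1.ne) (hwd.sqrt hw.1.ne')
  refine harc.congr_deriv ?_
  rw [Real.sq_sqrt hw.1.le]
  have e : √((1 - b) / b) / 2 * (((1 + b) * dfSinSq b m - 1) * √(dfFactor b m / dfCosFactor b m)
      * (octRoot (b ^ 2) m)⁻¹) = (√((1 - b) / b) * √(dfFactor b m / dfCosFactor b m))
      * ((1 + b) * dfSinSq b m - 1) / (2 * octRoot (b ^ 2) m) := by
    field_simp
  have hS0 : octRoot (b ^ 2) m ≠ 0 := by linarith
  rw [e, ← hq]
  have hw2 := Real.sq_sqrt hw.1.le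
  generalize √(dfSinSq b m) = x at *
  rw [← hw2]
  field_simp

end

theorem taylorExp_dfFactor (b : ℝ) : TaylorExp (𝓝 0) id (dfFactor b) 1 (-b ^ 2)
    (-b ^ 2 + 2 * b ^ 4) (-b ^ 2 + 5 * b ^ 4 - 5 * b ^ 6)
    (-b ^ 2 + 9 * b ^ 4 - 21 * b ^ 6 + 14 * b ^ 8) :=
  (taylorExp_octFactor (b ^ 2)).congr_coeff rfl rfl (by ring) (by ring) (by ring)

section

variable {b : ℝ} (hb : b ∈ Ioo 0 1)
include hb

theorem taylorExp_dfSinSq : TaylorExp (𝓝 0) id (dfSinSq b) (1 - b) (-b ^ 2 + b ^ 3)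
    (-b ^ 2 + b ^ 3 + 2 * b ^ 4 - 2 * b ^ 5)
    (-b ^ 2 + b ^ 3 + 5 * b ^ 4 - 5 * b ^ 5 - 5 * b ^ 6 + 5 * b ^ 7)
    (-b ^ 2 + b ^ 3 + 9 * b ^ 4 - 9 * b ^ 5 - 21 * b ^ 6 + 21 * b ^ 7 + 14 * b ^ 8 - 14 * b ^ 9) :=
  (((taylorExp_dfFactor b).const_mul (1 - b)).congr' (.of_forall (dfSinSq_eq_mul hb))).congr_coeff
    (by ring) (by ring) (by ring) (by ring) (by ring)

theorem taylorExp_dfCosFactor : TaylorExp (𝓝 0) id (dfCosFactor b) 1 (b - b ^ 2)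
    (b - b ^ 2 - 2 * b ^ 3 + 2 * b ^ 4) (b - b ^ 2 - 5 * b ^ 3 + 5 * b ^ 4 + 5 * b ^ 5 - 5 * b ^ 6)
    (b - b ^ 2 - 9 * b ^ 3 + 9 * b ^ 4 + 21 * b ^ 5 - 21 * b ^ 6 - 14 * b ^ 7 + 14 * b ^ 8) := by
  have hb0 := hb.1.ne'
  refine ((((taylorExp_const 1).sub (taylorExp_dfSinSq hb)).const_mul b⁻¹).congr'
    (.of_forall fun m => by rw [dfCosFactor]; ring)).congr_coeff ?_ ?_ ?_ ?_ ?_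
  all_goals field_simp; try ring

theorem taylorExp_dfFactor_div : TaylorExp (𝓝 0) id (fun m => dfFactor b m / dfCosFactor b m)
    1 (-b) (-b + b ^ 2 + b ^ 3) (-b + 2 * b ^ 2 + 2 * b ^ 3 - 2 * b ^ 4 - 2 * b ^ 5)
    (-b + 3 * b ^ 2 + 3 * b ^ 3 - 7 * b ^ 4 - 7 * b ^ 5 + 5 * b ^ 6 + 5 * b ^ 7) := by
  have hi := (taylorExp_dfCosFactor hb).inv tendsto_id_zero (d₀ := 1) (d₁ := -b + b ^ 2)
    (d₂ := -b + 2 * b ^ 2 - b ^ 4) (d₃ := -b + 3 * b ^ 2 - 4 * b ^ 4 + 2 * b ^ 6)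
    (d₄ := -b + 4 * b ^ 2 - 10 * b ^ 4 + 12 * b ^ 6 - 5 * b ^ 8)
    (by ring) (by ring) (by ring) (by ring) (by ring)
  exact (((taylorExp_dfFactor b).mul tendsto_id_zero hi).congr' (.of_forall fun m =>
    div_eq_mul_inv _ _)).congr_coeff (by ring) (by ring) (by ring) (by ring) (by ring)

/-- The factor `tan φ` of the amplitude `φ`, relative to its value at `m = 0`. -/
theorem taylorExp_dfTan :
    TaylorExp (𝓝 0) id (fun m => √(dfFactor b m / dfCosFactor b m)) 1 (-1 / 2 * b)
    (-1 / 2 * b + 3 / 8 * b ^ 2 + 1 / 2 * b ^ 3)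
    (-1 / 2 * b + 3 / 4 * b ^ 2 + 19 / 16 * b ^ 3 - 3 / 4 * b ^ 4 - b ^ 5)
    (-1 / 2 * b + 9 / 8 * b ^ 2 + 33 / 16 * b ^ 3 - 349 / 128 * b ^ 4 - 65 / 16 * b ^ 5
      + 15 / 8 * b ^ 6 + 5 / 2 * b ^ 7) :=
  (taylorExp_dfFactor_div hb).sqrt tendsto_id_zero one_pos
    (by ring) (by ring) (by ring) (by ring) (by ring)

/-- The rotation number through third order; the coefficient of `m ^ 4` plays no role. -/
theorem taylorExp_dfNu {s : ℝ} (hs : s = 2 / Real.pi * (√((1 - b) / b) * b)) :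
    ∃ e, TaylorExp (𝓝 0) id (dfNu b) (1 / (2 * Real.pi) * Real.arccos (2 * b - 1))
      (s * (-1 / 8 - 1 / 4 * b)) (s * (-11 / 128 - 17 / 64 * b + 3 / 16 * b ^ 2 + 3 / 8 * b ^ 3))
      (s * (-35 / 512 - 217 / 768 * b + 19 / 48 * b ^ 2 + b ^ 3 - 5 / 12 * b ^ 4 - 5 / 6 * b ^ 5))
      e := by
  have h0 := tendsto_id_zero
  have hb1 : 0 < 1 - b := sub_pos.2 hb.2
  have hr := taylorExp_dfTan hb
  have he : TaylorExp (𝓝 0) id (fun m => (1 + b) * dfSinSq b m - 1) (b ^ 2 * -1)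
      (b ^ 2 * (-1 + b ^ 2)) (b ^ 2 * (-1 + 3 * b ^ 2 - 2 * b ^ 4))
      (b ^ 2 * (-1 + 6 * b ^ 2 - 10 * b ^ 4 + 5 * b ^ 6))
      (b ^ 2 * (-1 + 10 * b ^ 2 - 30 * b ^ 4 + 35 * b ^ 6 - 14 * b ^ 8)) :=
    (((taylorExp_dfSinSq hb).const_mul (1 + b)).sub (taylorExp_const 1)).congr_coeff
      (by ring) (by ring) (by ring) (by ring) (by ring)
  have hφ := TaylorExp.integrate (hasDerivAt_dfAmp hb)
    (((he.mul h0 hr).mul h0 (taylorExp_inv_octRoot (b ^ 2))).const_mul _)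
  have hsc := (((taylorExp_dfCosFactor hb).mul h0 hr).const_mul (√((1 - b) / b) * b)).congr'
    (sin_mul_cos_dfAmp hb)
  have hmem : ∀ᶠ m in 𝓝 0, dfAmp b m ∈ Icc 0 Real.pi := by
    refine .of_forall fun m => ⟨Real.arcsin_nonneg.2 (Real.sqrt_nonneg _), ?_⟩
    exact (Real.arcsin_le_pi_div_two _).trans (by linarith [Real.pi_pos])
  have hw := (taylorExp_dfSinSq hb).congr' (g := fun m => Real.sin (dfAmp b m) ^ 2) (by
    filter_upwards [dfSinSq_mem hb] with m ⟨_, hw, _⟩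
    have h0 := Real.sqrt_nonneg (dfSinSq b m)
    rw [dfAmp, Real.sin_arcsin (by linarith) (Real.sqrt_le_one.2 hw.2.le), Real.sq_sqrt hw.1.le])
  have hr := taylorExp_ellFm_ratio hmem hsc hw rfl rfl rfl rfl
  have main := (hr.add (hφ.const_mul (2 / Real.pi))).const_mul (1 / 2)
  refine ⟨_, (main.congr' (.of_forall fun m => ?_)).congr_coeff ?_ ?_ ?_ ?_ rfl⟩
  · rw [dfNu]; field_simp; ring
  · have hw0 : dfSinSq b 0 = 1 - b := by
      rw [dfSinSq_eq_mul hb, dfFactor, octRoot]; norm_num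
    have h1 : √(1 - b) ≤ 1 := Real.sqrt_le_one.2 (by linarith [hb.1])
    have h2 := Real.sqrt_nonneg (1 - b)
    have hc : 2 * b - 1 = Real.cos (2 * dfAmp b 0) := by
      rw [dfAmp, hw0, Real.cos_two_mul', Real.cos_sq', Real.sin_arcsin (by linarith) h1,
        Real.sq_sqrt hb1.le]
      ring
    have h3 : 0 ≤ dfAmp b 0 := Real.arcsin_nonneg.2 (Real.sqrt_nonneg _)
    have h4 : dfAmp b 0 ≤ Real.pi / 2 := Real.arcsin_le_pi_div_two _
    rw [hc, Real.arccos_cos (by linarith) (by linarith)]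
    field_simp
    ring
  all_goals rw [hs]; ring

end

/-! ### The action in the Duffing regime -/

theorem taylorExp_thirdCoeff_succ {w : ℝ → ℝ} {n : ℕ} {w₀ w₁ w₂ w₃ w₄ e₀ e₁ e₂ e₃ e₄ : ℝ}
    (hw : TaylorExp (𝓝 0) id w w₀ w₁ w₂ w₃ w₄)
    (he : TaylorExp (𝓝 0) id (fun m => thirdCoeff (w m) n) e₀ e₁ e₂ e₃ e₄) :
    TaylorExp (𝓝 0) id (fun m => thirdCoeff (w m) (n + 1)) (wallis (n + 1) + w₀ * e₀)
      (w₀ * e₁ + w₁ * e₀) (w₀ * e₂ + w₁ * e₁ + w₂ * e₀)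
      (w₀ * e₃ + w₁ * e₂ + w₂ * e₁ + w₃ * e₀)
      (w₀ * e₄ + w₁ * e₃ + w₂ * e₂ + w₃ * e₁ + w₄ * e₀) :=
  ((taylorExp_const (wallis (n + 1))).add (hw.mul tendsto_id_zero he)).congr_coeff rfl
    (by ring) (by ring) (by ring) (by ring)

/-- The coefficients of even index, to the orders that enter the expansion of the action. -/
theorem taylorExp_thirdCoeff_even {w : ℝ → ℝ} {w₀ w₁ w₂ w₃ w₄ : ℝ}
    (hw : TaylorExp (𝓝 0) id w w₀ w₁ w₂ w₃ w₄) :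
    (∃ e₃ e₄, TaylorExp (𝓝 0) id (fun m => thirdCoeff (w m) 2) (3 / 8 + w₀ / 2 + w₀ ^ 2)
      (w₁ / 2 + 2 * w₀ * w₁) (w₂ / 2 + 2 * w₀ * w₂ + w₁ ^ 2) e₃ e₄) ∧
    (∃ e₂ e₃ e₄, TaylorExp (𝓝 0) id (fun m => thirdCoeff (w m) 4)
      (35 / 128 + 5 / 16 * w₀ + 3 / 8 * w₀ ^ 2 + w₀ ^ 3 / 2 + w₀ ^ 4)
      ((5 / 16 + 3 / 4 * w₀ + 3 / 2 * w₀ ^ 2 + 4 * w₀ ^ 3) * w₁) e₂ e₃ e₄) ∧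
    (∃ e₁ e₂ e₃ e₄, TaylorExp (𝓝 0) id (fun m => thirdCoeff (w m) 6)
      (231 / 1024 + 63 / 256 * w₀ + 35 / 128 * w₀ ^ 2 + 5 / 16 * w₀ ^ 3 + 3 / 8 * w₀ ^ 4
        + w₀ ^ 5 / 2 + w₀ ^ 6) e₁ e₂ e₃ e₄) := by
  have h0 : TaylorExp (𝓝 0) id (fun m => thirdCoeff (w m) 0) 1 0 0 0 0 := taylorExp_const 1
  have h2 := taylorExp_thirdCoeff_succ hw (taylorExp_thirdCoeff_succ hw h0)
  have h4 := taylorExp_thirdCoeff_succ hw (taylorExp_thirdCoeff_succ hw h2)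
  have h6 := taylorExp_thirdCoeff_succ hw (taylorExp_thirdCoeff_succ hw h4)
  simp only [wallis] at h2 h4 h6
  refine ⟨⟨_, _, h2.congr_coeff ?_ ?_ ?_ rfl rfl⟩, ⟨_, _, _, h4.congr_coeff ?_ ?_ rfl rfl rfl⟩,
    ⟨_, _, _, _, h6.congr_coeff ?_ rfl rfl rfl rfl⟩⟩ <;> push_cast <;> ring

theorem integral_sin_sq_mul_neg_cos_pow (j : ℕ) :
    (∫ ψ in (0 : ℝ)..Real.pi, Real.sin ψ ^ 2 * (-Real.cos ψ) ^ (2 * j))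
      = Real.pi * (wallis j - wallis (j + 1)) ∧
    (∫ ψ in (0 : ℝ)..Real.pi, Real.sin ψ ^ 2 * (-Real.cos ψ) ^ (2 * j + 1)) = 0 := by
  have step : ∀ n : ℕ, ∫ ψ in (0 : ℝ)..Real.pi, Real.cos ψ ^ (n + 2)
      = (n + 1) / (n + 2) * ∫ ψ in (0 : ℝ)..Real.pi, Real.cos ψ ^ n := fun n => by
    rw [integral_cos_pow]; simp
  have even : ∀ j : ℕ, ∫ ψ in (0 : ℝ)..Real.pi, Real.cos ψ ^ (2 * j) = Real.pi * wallis j := by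
    intro j
    induction j with
    | zero => simp [wallis]
    | succ j ih =>
      rw [mul_add, mul_one, step, ih, wallis]
      push_cast
      field_simp
  have odd : ∀ j : ℕ, ∫ ψ in (0 : ℝ)..Real.pi, Real.cos ψ ^ (2 * j + 1) = 0 := by
    intro j
    induction j with
    | zero => simp
    | succ j ih => rw [show 2 * (j + 1) + 1 = 2 * j + 1 + 2 by ring, step, ih, mul_zero]
  have split : ∀ n : ℕ, ∫ ψ in (0 : ℝ)..Real.pi, Real.sin ψ ^ 2 * (-Real.cos ψ) ^ n
      = (-1) ^ n * ((∫ ψ in (0 : ℝ)..Real.pi, Real.cos ψ ^ n)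
        - ∫ ψ in (0 : ℝ)..Real.pi, Real.cos ψ ^ (n + 2)) := fun n => by
    rw [← intervalIntegral.integral_sub (by apply Continuous.intervalIntegrable; fun_prop)
      (by apply Continuous.intervalIntegrable; fun_prop), ← intervalIntegral.integral_const_mul]
    congr 1
    funext ψ
    rw [Real.sin_sq, neg_pow]
    ring
  constructor
  · rw [split, even, show 2 * j + 2 = 2 * (j + 1) by ring, even, pow_mul]
    norm_num
    ring
  · rw [split, odd, show 2 * j + 1 + 2 = 2 * (j + 1) + 1 by ring, odd, sub_zero, mul_zero]

/-- The square of the parameter `r = k ^ 2 / (2 - k ^ 2)` of `dfIntegral`, in terms of the parameter after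
Landen's transformation. -/
def dfLambda (m : ℝ) : ℝ := 4 * m / (1 + m) ^ 2

/-- The action integral in the half-angle variable `ψ = 2 θ`, as a function of `r` and of the
characteristic `g`. -/
def dfIntegral (r g : ℝ) : ℝ := ∫ ψ in (0 : ℝ)..Real.pi,
  Real.sin ψ ^ 2 * (1 / ((1 - g * (r * -Real.cos ψ)) * √(1 - r * -Real.cos ψ)))

/-- Expansion of the action integral in its modulus. The powers of `cos` of odd degree integrate to
zero, so only the coefficients of even index appear and the expansion is one in `t ^ 2`. -/
theorem isBigO_dfIntegral {g : ℝ → ℝ} (hg : ∀ᶠ t in 𝓝 0, g t ∈ Icc 0 1) :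
    (fun t => dfLambda (t ^ 2) / (2 * Real.pi) * dfIntegral (2 * t / (1 + t ^ 2)) (g t)
      - dfLambda (t ^ 2) / 2 * (1 / 2 + dfLambda (t ^ 2) * (1 / 8 * thirdCoeff (g t) 2
        + dfLambda (t ^ 2) * (1 / 16 * thirdCoeff (g t) 4
          + dfLambda (t ^ 2) * (5 / 128 * thirdCoeff (g t) 6))))) =O[𝓝 0] fun t => (t ^ 2) ^ 5 := by
  obtain ⟨C, r, hC, hr, hr2, H⟩ := exists_integral_expansion 7
  refine IsBigO.of_bound (C * 2 ^ 10) ?_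
  filter_upwards [hg, abs_le_eventually (by positivity : 0 < r / 2)] with t hgt ht
  have hρ : |2 * t / (1 + t ^ 2)| ≤ 2 * |t| := by
    rw [abs_div, abs_mul, abs_two, abs_of_pos (by positivity : 0 < 1 + t ^ 2)]
    exact div_le_self (by positivity) (by nlinarith [sq_nonneg t])
  have k := H (fun ψ => Real.sin ψ ^ 2) (fun ψ => -Real.cos ψ) (by fun_prop) (by fun_prop)
    (fun ψ => by rw [abs_of_nonneg (sq_nonneg _)]; exact Real.sin_sq_le_one ψ)
    (fun ψ => by rw [abs_neg]; exact Real.abs_cos_le_one ψ) (2 * t / (1 + t ^ 2))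
    (hρ.trans (by linarith)) (g t) hgt Real.pi Real.pi_pos.le
  have hlam : dfLambda (t ^ 2) = (2 * t / (1 + t ^ 2)) ^ 2 := by
    rw [dfLambda, div_pow]; ring
  rw [hlam]
  change |dfIntegral _ _ - _| ≤ _ at k
  generalize 2 * t / (1 + t ^ 2) = ρ at *
  have e : ∑ n ∈ Finset.range (7 + 1), thirdCoeff (g t) n * ρ ^ n
        * ∫ ψ in (0 : ℝ)..Real.pi, Real.sin ψ ^ 2 * (-Real.cos ψ) ^ n
      = Real.pi * (1 / 2 + ρ ^ 2 * (1 / 8 * thirdCoeff (g t) 2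
        + ρ ^ 2 * (1 / 16 * thirdCoeff (g t) 4 + ρ ^ 2 * (5 / 128 * thirdCoeff (g t) 6)))) := by
    obtain ⟨a0, b0⟩ := integral_sin_sq_mul_neg_cos_pow 0
    obtain ⟨a1, b1⟩ := integral_sin_sq_mul_neg_cos_pow 1
    obtain ⟨a2, b2⟩ := integral_sin_sq_mul_neg_cos_pow 2
    obtain ⟨a3, b3⟩ := integral_sin_sq_mul_neg_cos_pow 3
    simp only [Nat.reduceMul, Nat.reduceAdd] at a0 a1 a2 a3 b0 b1 b2 b3
    have t0 : thirdCoeff (g t) 0 = 1 := rfl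
    simp only [Finset.sum_range_succ, Finset.sum_range_zero, a0, a1, a2, a3, b0, b1, b2, b3, t0]
    simp only [wallis]
    push_cast
    ring
  rw [e] at k
  generalize 1 / 2 + ρ ^ 2 * (1 / 8 * thirdCoeff (g t) 2
        + ρ ^ 2 * (1 / 16 * thirdCoeff (g t) 4 + ρ ^ 2 * (5 / 128 * thirdCoeff (g t) 6))) = S at *
  have e2 : ρ ^ 2 / (2 * Real.pi) * dfIntegral ρ (g t) - ρ ^ 2 / 2 * S
      = ρ ^ 2 / (2 * Real.pi) * (dfIntegral ρ (g t) - Real.pi * S) := by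
    field_simp
  have hp := Real.pi_pos
  rw [e2, Real.norm_eq_abs, Real.norm_eq_abs, abs_mul, abs_div, abs_pow,
    abs_of_pos (by positivity : 0 < 2 * Real.pi), abs_of_nonneg (by positivity : 0 ≤ (t ^ 2) ^ 5)]
  calc |ρ| ^ 2 / (2 * Real.pi) * |dfIntegral ρ (g t) - Real.pi * S|
      ≤ |ρ| ^ 2 / (2 * Real.pi) * (C * |ρ| ^ (7 + 1) * Real.pi) := by gcongr
    _ = C * |ρ| ^ 10 / 2 := by field_simp; ring
    _ ≤ C * |ρ| ^ 10 := half_le_self (by positivity)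
    _ ≤ C * (2 * |t|) ^ 10 := by gcongr
    _ = C * 2 ^ 10 * (t ^ 2) ^ 5 := by
      rw [mul_pow, ← sq_abs t]; ring

/-- The characteristic of the action integral. -/
def dfChar (b m : ℝ) : ℝ := dfSinSq b m * (1 + m) / (1 + m * dfSinSq b m ^ 2)

/-- The action as a function of the modulus `t` after Landen's transformation. -/
def dfAct (b t : ℝ) : ℝ :=
  dfLambda (t ^ 2) / (2 * Real.pi) * (dfChar b (t ^ 2)
    * √(dfChar b (t ^ 2) / (1 - dfChar b (t ^ 2))))
    * dfIntegral (2 * t / (1 + t ^ 2)) (dfChar b (t ^ 2))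

/-- The square root of the absolute value of the invariant. -/
def dfAbs (b m : ℝ) : ℝ :=
  (1 - m) * dfSinSq b m / ((1 - dfSinSq b m) * (1 - m * dfSinSq b m))

/-- The distance of the invariant from its value `-((1 - b) / b) ^ 2` at the fixed points. -/
def dfLevel (b m : ℝ) : ℝ := ((1 - b) / b) ^ 2 - dfAbs b m ^ 2

theorem taylorExp_dfLambda : TaylorExp (𝓝 0) id dfLambda 0 4 (-8) 12 (-16) := by
  have h : TaylorExp (𝓝 0) id (fun m : ℝ => (1 + m) ^ 2) 1 2 1 0 0 :=
    .of_eq fun m => by simp only [id]; ring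
  have hi := h.inv tendsto_id_zero (d₀ := 1) (d₁ := -2) (d₂ := 3) (d₃ := -4) (d₄ := 5)
    (by norm_num) (by norm_num) (by norm_num) (by norm_num) (by norm_num)
  refine (((hi.const_mul 4).var_mul tendsto_id_zero).congr' (.of_forall fun m => by
    simp only [dfLambda, id]; ring)).congr_coeff ?_ ?_ ?_ ?_ ?_ <;> norm_num

section

variable {b : ℝ} (hb : b ∈ Ioo 0 1)
include hb

theorem taylorExp_inv_one_sub_dfSinSq : TaylorExp (𝓝 0) id (fun m => (1 - m * dfSinSq b m)⁻¹) 1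
    (1 - b) (1 - 2 * b + b ^ 3) (1 - 3 * b + 4 * b ^ 3 - 2 * b ^ 5)
    (1 - 4 * b + 10 * b ^ 3 - 12 * b ^ 5 + 5 * b ^ 7) :=
  ((taylorExp_const 1).sub ((taylorExp_dfSinSq hb).var_mul tendsto_id_zero)).inv tendsto_id_zero
    (by ring) (by ring) (by ring) (by ring) (by ring)

theorem taylorExp_dfChar : TaylorExp (𝓝 0) id (dfChar b) (1 - b) (2 * b - 4 * b ^ 2 + 2 * b ^ 3)
    (-2 * b + 8 * b ^ 2 - 16 * b ^ 3 + 16 * b ^ 4 - 6 * b ^ 5)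
    (2 * b - 12 * b ^ 2 + 34 * b ^ 3 - 64 * b ^ 4 + 84 * b ^ 5 - 64 * b ^ 6 + 20 * b ^ 7)
    (-2 * b + 16 * b ^ 2 - 64 * b ^ 3 + 160 * b ^ 4 - 280 * b ^ 5 + 384 * b ^ 6 - 400 * b ^ 7
      + 256 * b ^ 8 - 70 * b ^ 9) := by
  have h0 := tendsto_id_zero
  have hw := taylorExp_dfSinSq hb
  have hi := ((taylorExp_const 1).add ((hw.sq h0).var_mul h0)).inv h0 (d₀ := 1)
    (d₁ := -1 + 2 * b - b ^ 2) (d₂ := 1 - 4 * b + 8 * b ^ 2 - 8 * b ^ 3 + 3 * b ^ 4)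
    (d₃ := -1 + 6 * b - 17 * b ^ 2 + 32 * b ^ 3 - 42 * b ^ 4 + 32 * b ^ 5 - 10 * b ^ 6)
    (d₄ := 1 - 8 * b + 32 * b ^ 2 - 80 * b ^ 3 + 140 * b ^ 4 - 192 * b ^ 5 + 200 * b ^ 6
      - 128 * b ^ 7 + 35 * b ^ 8)
    (by ring) (by ring) (by ring) (by ring) (by ring)
  refine (((hw.mul h0 ((taylorExp_const 1).add taylorExp_var)).mul h0 hi).congr'
    (.of_forall fun m => by simp only [dfChar, id, div_eq_mul_inv])).congr_coeff ?_ ?_ ?_ ?_ ?_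
  all_goals ring

theorem taylorExp_dfLevel : TaylorExp (𝓝 0) id (dfLevel b) 0 (((1 - b) / b) ^ 2 * (4 * b))
    (((1 - b) / b) ^ 2 * (4 * b - 8 * b ^ 2 - 4 * b ^ 3))
    (((1 - b) / b) ^ 2 * (4 * b - 16 * b ^ 2 + 16 * b ^ 4 + 8 * b ^ 5))
    (((1 - b) / b) ^ 2 * (4 * b - 24 * b ^ 2 + 12 * b ^ 3 + 48 * b ^ 4 + 4 * b ^ 5 - 40 * b ^ 6
      - 20 * b ^ 7)) := by
  have h0 := tendsto_id_zero
  have hb0 := hb.1.ne'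
  have hq : TaylorExp (𝓝 0) id (fun m => dfFactor b m / dfCosFactor b m * (1 - m)
      * (1 - m * dfSinSq b m)⁻¹) 1 (-2 * b) (-2 * b + 2 * b ^ 2 + 2 * b ^ 3)
      (-2 * b + 4 * b ^ 2 + 4 * b ^ 3 - 4 * b ^ 4 - 4 * b ^ 5)
      (-2 * b + 6 * b ^ 2 + 6 * b ^ 3 - 14 * b ^ 4 - 14 * b ^ 5 + 10 * b ^ 6 + 10 * b ^ 7) := by
    refine (((taylorExp_dfFactor_div hb).mul h0 ((taylorExp_const 1).sub taylorExp_var)).mul h0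
      (taylorExp_inv_one_sub_dfSinSq hb)).congr_coeff ?_ ?_ ?_ ?_ ?_ <;> ring
  refine ((((taylorExp_const 1).sub (hq.sq h0)).const_mul (((1 - b) / b) ^ 2)).congr'
    (.of_forall fun m => ?_)).congr_coeff ?_ ?_ ?_ ?_ ?_
  · have e : dfAbs b m = (1 - b) / b * (dfFactor b m / dfCosFactor b m * (1 - m)
        * (1 - m * dfSinSq b m)⁻¹) := by
      have e1 : 1 - dfSinSq b m = b * dfCosFactor b m := by rw [dfCosFactor]; field_simp
      rw [dfAbs, e1, dfSinSq_eq_mul hb]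
      field_simp
    rw [dfLevel, e]
    ring
  all_goals ring

/-- The radical in the action, split into its value at `m = 0` and factors that are `1` there. -/
theorem dfChar_spec : ∀ᶠ m in 𝓝 0, 0 ≤ m → dfChar b m ∈ Ioo 0 1 ∧
    √(dfChar b m / (1 - dfChar b m)) = √((1 - b) / b) * (√(dfFactor b m / dfCosFactor b m)
      * √((1 + m) * (1 - m * dfSinSq b m)⁻¹)) := by
  filter_upwards [dfSinSq_mem hb, sqrt_dfSinSq_div hb] with m ⟨hm, hw, _⟩ hq hm0
  have hm1 : m < 1 := (le_abs_self m).trans_lt (hm.trans (by norm_num))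
  have hmw : 0 < 1 - m * dfSinSq b m := by nlinarith [hw.1, hw.2]
  have hD : 0 < 1 + m * dfSinSq b m ^ 2 := by positivity
  have e1 : 1 - dfChar b m = (1 - dfSinSq b m) * (1 - m * dfSinSq b m)
      / (1 + m * dfSinSq b m ^ 2) := by
    rw [dfChar]; field_simp; ring
  have hg0 : 0 < dfChar b m := div_pos (mul_pos hw.1 (by linarith)) hD
  refine ⟨⟨hg0, ?_⟩, ?_⟩
  · have : 0 < 1 - dfChar b m := by
      rw [e1]; exact div_pos (mul_pos (sub_pos.2 hw.2) hmw) hD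
    linarith
  · rw [← mul_assoc, ← hq, e1, dfChar, ← Real.sqrt_div hw.1.le,
      ← Real.sqrt_mul (div_nonneg hw.1.le (sub_pos.2 hw.2).le)]
    congr 1
    have := sub_pos.2 hw.2
    field_simp

/-- Expansion of the action in the square of the parameter `t`. -/
theorem taylorExp_dfAct {s : ℝ} (hs : s = √((1 - b) / b) * (1 - b)) :
    TaylorExp (𝓝 0) (fun t => t ^ 2) (dfAct b) 0 s (s * (7 / 8 - 3 / 2 * b - b ^ 2))
      (s * (51 / 64 - 11 / 4 * b - b ^ 2 + 3 * b ^ 3 + 2 * b ^ 4))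
      (s * (759 / 1024 - 987 / 256 * b - 29 / 128 * b ^ 2 + 149 / 16 * b ^ 3 + 33 / 8 * b ^ 4
        - 15 / 2 * b ^ 5 - 5 * b ^ 6)) := by
  have h0 := tendsto_id_zero
  have hT : Tendsto (fun t : ℝ => t ^ 2) (𝓝 0) (𝓝 0) := by
    simpa using (tendsto_id_zero).pow 2
  have hl := taylorExp_dfLambda
  have hg := taylorExp_dfChar hb
  obtain ⟨⟨_, _, e2⟩, ⟨_, _, _, e4⟩, ⟨_, _, _, _, e6⟩⟩ := taylorExp_thirdCoeff_even hg
  have hS := (taylorExp_const (1 / 2)).add (hl.mul h0 ((e2.const_mul (1 / 8)).add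
    (hl.mul h0 ((e4.const_mul (1 / 16)).add (hl.mul h0 (e6.const_mul (5 / 128)))))))
  have hS' := ((hl.const_mul (1 / 2)).mul h0 hS).congr_coeff
    (d₀ := 0) (d₁ := 1) (d₂ := -1 / 8 - 5 / 2 * b + b ^ 2)
    (d₃ := 27 / 64 + 15 / 8 * b - 9 / 4 * b ^ 2 + 4 * b ^ 3 - 2 * b ^ 4)
    (d₄ := -121 / 1024 - 935 / 256 * b + 167 / 128 * b ^ 2 + 35 / 16 * b ^ 3 + 19 / 8 * b ^ 4
      - 19 / 2 * b ^ 5 + 5 * b ^ 6) (by ring) (by ring) (by ring) (by ring) (by ring)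
  have hh := (((taylorExp_const 1).add taylorExp_var).mul h0
    (taylorExp_inv_one_sub_dfSinSq hb)).sqrt h0 one_pos (d₁ := 1 - 1 / 2 * b)
    (d₂ := 1 / 2 - b - 1 / 8 * b ^ 2 + 1 / 2 * b ^ 3)
    (d₃ := 1 / 2 - 5 / 4 * b - 3 / 8 * b ^ 2 + 31 / 16 * b ^ 3 + 1 / 4 * b ^ 4 - b ^ 5)
    (d₄ := 3 / 8 - 3 / 2 * b - 11 / 16 * b ^ 2 + 9 / 2 * b ^ 3 + 155 / 128 * b ^ 4
      - 93 / 16 * b ^ 5 - 5 / 8 * b ^ 6 + 5 / 2 * b ^ 7)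
    (by ring) (by ring) (by ring) (by ring) (by ring)
  have hp := (((hg.mul h0 ((taylorExp_dfTan hb).mul h0 hh)).congr_coeff
    (d₀ := 1 - b) (d₁ := 1 - 3 * b ^ 2 + 2 * b ^ 3)
    (d₂ := 1 / 2 - 5 / 2 * b + 9 / 2 * b ^ 2 - 19 / 2 * b ^ 3 + 13 * b ^ 4 - 6 * b ^ 5)
    (d₃ := 1 / 2 - 2 * b - 4 * b ^ 2 + 22 * b ^ 3 - 81 / 2 * b ^ 4 + 58 * b ^ 5 - 54 * b ^ 6
      + 20 * b ^ 7) (by ring) (by ring) (by ring) (by ring) rfl).const_mul √((1 - b) / b))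
  have hspec := dfChar_spec hb
  have hO := (isBigO_dfIntegral (g := fun t => dfChar b (t ^ 2)) ((hT.eventually hspec).mono
    fun t h => Ioo_subset_Icc_self (h (sq_nonneg t)).1)).mul
    (((hp.tendsto h0).comp hT).isBigO_one ℝ)
  simp only [mul_one] at hO
  refine (((hp.mul h0 hS').comp_tendsto hT).add_isBigO (hO.congr' ?_ .rfl)).congr_coeff
    ?_ ?_ ?_ ?_ ?_
  · filter_upwards [hT.eventually hspec] with t h
    simp only [dfAct, (h (sq_nonneg t)).2, Function.comp, id]
    ring
  all_goals try rw [hs]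
  all_goals ring

end

/-! ### Landen's transformation and the transfer to the Duffing regime -/

/-- The ascending Landen transformation of the first integral. -/
theorem ellFm_landen {t : ℝ} (ht : t ∈ Ico 0 1) {θ : ℝ} (hθ : θ ∈ Icc 0 (Real.pi / 2)) :
    ellFm (Real.arcsin ((1 + t) * Real.sin θ / (1 + t * Real.sin θ ^ 2))) (4 * t / (1 + t) ^ 2)
      = (1 + t) * ellFm θ (t ^ 2) := by
  have ht0 := ht.1
  have ht1 : 0 < 1 - t := sub_pos.2 ht.2
  have hm : t ^ 2 < 1 := by nlinarith
  have hM : 4 * t / (1 + t) ^ 2 < 1 := by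
    rw [div_lt_one (by positivity)]; nlinarith [mul_pos ht1 ht1]
  have hD : ∀ θ : ℝ, 0 < 1 + t * Real.sin θ ^ 2 := fun θ => by positivity
  have hE : ∀ θ : ℝ, 0 < 1 - t * Real.sin θ ^ 2 := fun θ => by
    nlinarith [Real.sin_sq_le_one θ, sq_nonneg (Real.sin θ)]
  have hder : ∀ θ ∈ Ioo 0 (Real.pi / 2), HasDerivAt (fun θ =>
      ellFm (Real.arcsin ((1 + t) * Real.sin θ / (1 + t * Real.sin θ ^ 2))) (4 * t / (1 + t) ^ 2)
        - (1 + t) * ellFm θ (t ^ 2)) 0 θ := by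
    intro θ hθ
    have hc := Real.cos_pos_of_mem_Ioo ⟨by linarith [hθ.1, Real.pi_pos], hθ.2⟩
    have hs := Real.sin_pos_of_mem_Ioo ⟨hθ.1, by linarith [hθ.2, Real.pi_pos]⟩
    have hΔ := one_sub_mul_sin_sq_pos hm θ
    have hq0 := Real.sqrt_pos.2 hΔ
    have hq2 := Real.sq_sqrt hΔ.le
    have hc2 := Real.cos_sq' θ
    have hDθ := hD θ
    have hEθ := hE θ
    have hx2 : 1 - ((1 + t) * Real.sin θ / (1 + t * Real.sin θ ^ 2)) ^ 2
        = (Real.cos θ * √(1 - t ^ 2 * Real.sin θ ^ 2) / (1 + t * Real.sin θ ^ 2)) ^ 2 := by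
      rw [div_pow, div_pow, mul_pow (Real.cos θ), hq2, hc2]
      field_simp
      ring
    have hpos : 0 < Real.cos θ * √(1 - t ^ 2 * Real.sin θ ^ 2) / (1 + t * Real.sin θ ^ 2) := by
      positivity
    have hx1 : |(1 + t) * Real.sin θ / (1 + t * Real.sin θ ^ 2)| < 1 := by
      rw [← sq_lt_one_iff_abs_lt_one]
      nlinarith
    obtain ⟨h1, h2⟩ := abs_lt.1 hx1
    have hX : HasDerivAt (fun θ => (1 + t) * Real.sin θ / (1 + t * Real.sin θ ^ 2)) _ θ :=
      ((Real.hasDerivAt_sin θ).const_mul (1 + t)).div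
        ((((Real.hasDerivAt_sin θ).pow 2).const_mul t).const_add 1) hDθ.ne'
    have harc : HasDerivAt (fun θ =>
        Real.arcsin ((1 + t) * Real.sin θ / (1 + t * Real.sin θ ^ 2))) _ θ :=
      HasDerivAt.comp (h := fun θ => (1 + t) * Real.sin θ / (1 + t * Real.sin θ ^ 2)) θ
        (Real.hasDerivAt_arcsin h1.ne' h2.ne) hX
    have hF := HasDerivAt.comp (h₂ := fun φ => ellFm φ (4 * t / (1 + t) ^ 2))
      (h := fun θ => Real.arcsin ((1 + t) * Real.sin θ / (1 + t * Real.sin θ ^ 2))) θ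
      (hasDerivAt_ellFm hM _) harc
    refine (hF.sub ((hasDerivAt_ellFm hm θ).const_mul (1 + t))).congr_deriv ?_
    rw [Real.sin_arcsin h1.le h2.le, hx2, Real.sqrt_sq hpos.le]
    have e1 : 1 - 4 * t / (1 + t) ^ 2 * ((1 + t) * Real.sin θ / (1 + t * Real.sin θ ^ 2)) ^ 2
        = ((1 - t * Real.sin θ ^ 2) / (1 + t * Real.sin θ ^ 2)) ^ 2 := by
      field_simp
      ring
    rw [e1, Real.sqrt_sq (by positivity)]
    generalize √(1 - t ^ 2 * Real.sin θ ^ 2) = q at *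
    field_simp
    push_cast
    ring
  have hcont : Continuous fun θ =>
      ellFm (Real.arcsin ((1 + t) * Real.sin θ / (1 + t * Real.sin θ ^ 2))) (4 * t / (1 + t) ^ 2)
        - (1 + t) * ellFm θ (t ^ 2) := by
    have hF : ∀ {m : ℝ}, m < 1 → Continuous fun φ => ellFm φ m := fun hm =>
      continuous_iff_continuousAt.2 fun φ => (hasDerivAt_ellFm hm φ).continuousAt
    exact ((hF hM).comp (Real.continuous_arcsin.comp (Continuous.div (by fun_prop) (by fun_prop)
      fun θ => (hD θ).ne'))).sub (continuous_const.mul (hF hm))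
  have hz : ellFm (Real.arcsin ((1 + t) * Real.sin 0 / (1 + t * Real.sin 0 ^ 2)))
      (4 * t / (1 + t) ^ 2) - (1 + t) * ellFm 0 (t ^ 2) = 0 := by
    simp [ellFm]
  rcases hθ.1.eq_or_lt with rfl | h0
  · exact sub_eq_zero.1 hz
  · obtain ⟨ξ, hξ, h⟩ := exists_hasDerivAt_eq_slope _ (fun _ => 0) h0 hcont.continuousOn
      fun x hx => hder x ⟨hx.1, hx.2.trans_le hθ.2⟩
    rw [hz, eq_comm, div_eq_zero_iff] at h
    rcases h with h | h <;> linarith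

/-- The modulus after the descending Landen transformation. -/
def landen (k : ℝ) : ℝ := (1 - compModulus k) / (1 + compModulus k)

theorem landen_spec {k : ℝ} (hk : k ∈ Ioo 0 1) : landen k ∈ Ioo 0 1 ∧
    compModulus k = (1 - landen k) / (1 + landen k) ∧
    k ^ 2 = 4 * landen k / (1 + landen k) ^ 2 := by
  obtain ⟨h1, h2, -⟩ := compModulus_spec hk
  have hk0 := hk.1
  have hk1 : compModulus k < 1 := by nlinarith
  have hp : 0 < 1 + compModulus k := by linarith
  have e : k ^ 2 = 1 - compModulus k ^ 2 := by linarith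
  rw [e, landen]
  refine ⟨⟨div_pos (by linarith) hp, by rw [div_lt_one hp]; linarith⟩, ?_, ?_⟩
  · field_simp; ring
  · field_simp; ring

section

variable {a c : ℝ} (ha : 2 < a) (hc : c ∈ Ioo (-(|a / 2| - 1) ^ 2) 0)
  (hw : dfSinSq (2 / a) (landen (modDf a c) ^ 2) ∈ Ioo 0 1)
  (hrel : (1 - (1 + 2 / a) * dfSinSq (2 / a) (landen (modDf a c) ^ 2))
    * (1 - landen (modDf a c) ^ 2 * ((1 + 2 / a) * dfSinSq (2 / a) (landen (modDf a c) ^ 2)))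
    = (2 / a) ^ 2)
include ha hc hw hrel

/-- Level and phase advance in terms of the transformed parameter. With `k'` fixed, both sides of the
first identity solve the quadratic equation `(1 + X k') (1 + X / k') = (a / 2) ^ 2`, which has a single
positive root; the value of `sn²` follows. -/
theorem phaseDf_landen : √|c| = dfAbs (2 / a) (landen (modDf a c) ^ 2) ∧
    jacSn (etaDf a c) (modDf a c) ^ 2 = (1 + landen (modDf a c)) ^ 2
      * dfSinSq (2 / a) (landen (modDf a c) ^ 2)
        / (1 + landen (modDf a c) * dfSinSq (2 / a) (landen (modDf a c) ^ 2)) ^ 2 ∧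
    0 < jacSn (etaDf a c) (modDf a c) ∧ 0 < jacCn (etaDf a c) (modDf a c) := by
  have ha0 : 0 < a := by linarith
  have habs : 2 < |a| := by rwa [abs_of_pos ha0]
  obtain ⟨hk, hA⟩ := modDf_spec habs hc
  obtain ⟨hη, -, hv⟩ := etaDf_spec habs hc
  obtain ⟨ht, hy, -⟩ := landen_spec hk
  have hk2 := sq_lt_one_of_mem hk
  have hs := jacSn_pos_of_mem hk2 (Ioo_subset_Ioc_self hη)
  have hcn := jacCn_nonneg_of_mem hk2 (Ioo_subset_Ioc_self hη)
  have hcn2 := jacCn_sq (k := modDf a c) (etaDf a c)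
  have hr := Real.sqrt_pos.2 (abs_pos.2 hc.2.ne)
  have ht0 := ht.1
  have ht1 : 0 < 1 - landen (modDf a c) := sub_pos.2 ht.2
  have hw0 := hw.1
  have hw1 := sub_pos.2 hw.2
  rw [dfAbs]
  rw [hy] at hA hv
  generalize dfSinSq (2 / a) (landen (modDf a c) ^ 2) = w at *
  generalize landen (modDf a c) = t at *
  generalize jacSn (etaDf a c) (modDf a c) = s at *
  generalize jacCn (etaDf a c) (modDf a c) = x at *
  generalize √|c| = r at *
  have hmw : 0 < 1 - t ^ 2 * w := by
    have : t ^ 2 * w < 1 := by nlinarith [mul_pos ht0 hw0, mul_pos ht0 ht1]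
    linarith
  -- the quadratic equation for `w`, with a common factor `a + 2` removed
  have hquad : 2 * (1 - t ^ 2 * w ^ 2) = a * ((1 - w) * (1 - t ^ 2 * w)) := by
    have h1 : (a + 2) * (2 * (1 - t ^ 2 * w ^ 2) - a * ((1 - w) * (1 - t ^ 2 * w))) = 0 := by
      field_simp at hrel
      linear_combination (-1 : ℝ) * hrel
    have := (mul_eq_zero.1 h1).resolve_left (by linarith)
    linarith
  have hR : r = (1 - t ^ 2) * w / ((1 - w) * (1 - t ^ 2 * w)) := by
    have hr0 : 0 < (1 - t ^ 2) * w / ((1 - w) * (1 - t ^ 2 * w)) := by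
      have : 0 < 1 - t ^ 2 := by nlinarith
      positivity
    have hA' : (1 + (1 - t ^ 2) * w / ((1 - w) * (1 - t ^ 2 * w)) * ((1 - t) / (1 + t)))
        * (1 + (1 - t ^ 2) * w / ((1 - w) * (1 - t ^ 2 * w)) / ((1 - t) / (1 + t)))
        = (a / 2) ^ 2 := by
      have e : a / 2 = (1 - t ^ 2 * w ^ 2) / ((1 - w) * (1 - t ^ 2 * w)) := by
        rw [div_eq_div_iff two_ne_zero (by positivity)]; linarith
      rw [e]
      field_simp
      ring
    generalize (1 - t ^ 2) * w / ((1 - w) * (1 - t ^ 2 * w)) = r' at *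
    have hy0 : 0 < (1 - t) / (1 + t) := by positivity
    generalize (1 - t) / (1 + t) = y at *
    have hA0 := hA.trans hA'.symm
    have h1 : (r - r') * (y + 1 / y + r + r') = 0 := by
      field_simp at hA0 ⊢
      linear_combination hA0
    have h2 : 0 < y + 1 / y + r + r' := by positivity
    linarith [(mul_eq_zero.1 h1).resolve_right h2.ne']
  have hsn : s ^ 2 = (1 + t) ^ 2 * w / (1 + t * w) ^ 2 := by
    rw [hcn2, hR] at hv
    rw [eq_div_iff (by positivity)]
    have hy0 : 0 < (1 - t) := ht1
    field_simp at hv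
    have h3 : (1 - t) * (s ^ 2 * (1 + t * w) ^ 2 - (1 + t) ^ 2 * w) = 0 := by
      linear_combination (-1 : ℝ) * hv
    have := (mul_eq_zero.1 h3).resolve_left ht1.ne'
    linarith
  refine ⟨hR, hsn, hs, hcn.lt_of_ne fun h => ?_⟩
  rw [← h] at hv
  have : 0 < (1 - t) / (1 + t) * s ^ 2 := by positivity
  rw [← hv] at this
  simp at this

/-- Both integrals are transformed by `ellFm_landen`, and the common factor `1 + t` cancels. -/
theorem rotationDf_eq_dfNu : rotationDf a c = dfNu (2 / a) (landen (modDf a c) ^ 2) := by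
  have ha0 : 0 < a := by linarith
  have habs : 2 < |a| := by rwa [abs_of_pos ha0]
  obtain ⟨-, hsn, hs, hx⟩ := phaseDf_landen ha hc hw hrel
  obtain ⟨hk, -⟩ := modDf_spec habs hc
  obtain ⟨hη, -⟩ := etaDf_spec habs hc
  obtain ⟨ht, -, hm⟩ := landen_spec hk
  have hk2 := sq_lt_one_of_mem hk
  have ht0 := ht.1
  have hw0 := hw.1
  have ham := jacAm_mem_Ioc hk2 (Ioo_subset_Ioc_self hη)
  have hsq := Real.sqrt_nonneg (dfSinSq (2 / a) (landen (modDf a c) ^ 2))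
  have hsin : Real.sin (dfAmp (2 / a) (landen (modDf a c) ^ 2))
      = √(dfSinSq (2 / a) (landen (modDf a c) ^ 2)) :=
    Real.sin_arcsin (by linarith) (Real.sqrt_le_one.2 hw.2.le)
  have hη2 : jacAm (etaDf a c) (modDf a c) = Real.arcsin ((1 + landen (modDf a c))
      * Real.sin (dfAmp (2 / a) (landen (modDf a c) ^ 2))
      / (1 + landen (modDf a c) * Real.sin (dfAmp (2 / a) (landen (modDf a c) ^ 2)) ^ 2)) := by
    rw [hsin, Real.sq_sqrt hw.1.le]
    have e : (1 + landen (modDf a c)) * √(dfSinSq (2 / a) (landen (modDf a c) ^ 2))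
        / (1 + landen (modDf a c) * dfSinSq (2 / a) (landen (modDf a c) ^ 2))
        = jacSn (etaDf a c) (modDf a c) := by
      refine (sq_eq_sq₀ (by positivity) hs.le).1 ?_
      rw [hsn, div_pow, mul_pow, Real.sq_sqrt hw.1.le]
    rw [e, jacSn, Real.arcsin_sin (by linarith [ham.1, Real.pi_pos]) ham.2]
  have h1 := ellFm_landen (Ioo_subset_Ico_self ht)
    (θ := dfAmp (2 / a) (landen (modDf a c) ^ 2))
    ⟨Real.arcsin_nonneg.2 (Real.sqrt_nonneg _), Real.arcsin_le_pi_div_two _⟩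
  have h2 := ellFm_landen (Ioo_subset_Ico_self ht) (θ := Real.pi / 2)
    ⟨by positivity, le_rfl⟩
  rw [Real.sin_pi_div_two, one_pow, mul_one, mul_one, div_self (by linarith), Real.arcsin_one,
    ← hm, ← ellF_eq_ellFm] at h2
  rw [← hη2, ← hm, ← ellF_eq_ellFm, ellF_jacAm hk2] at h1
  rw [rotationDf, dfNu, h1, ellK, h2]
  field_simp

/-- With `θ = ψ / 2` the modulus and the characteristic enter the area integral through `cos ψ`,
whose sign is reversed by `ψ ↦ π - ψ`; in this form the action is even in `t`. -/
theorem actionDf_eq_dfAct : actionDf a c = dfAct (2 / a) (landen (modDf a c)) := by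
  have ha0 : 0 < a := by linarith
  have habs : 2 < |a| := by rwa [abs_of_pos ha0]
  obtain ⟨hr, hsn, hs, hx⟩ := phaseDf_landen ha hc hw hrel
  obtain ⟨hk, -⟩ := modDf_spec habs hc
  obtain ⟨ht, hy, hm⟩ := landen_spec hk
  have hk2 := sq_lt_one_of_mem hk
  have hx2 := jacCn_sq (k := modDf a c) (etaDf a c)
  have ht0 := ht.1
  have ht1 : 0 < 1 - landen (modDf a c) := sub_pos.2 ht.2
  have hw0 := hw.1
  have hw1 := sub_pos.2 hw.2
  have hk4 : modDf a c ^ 4 = (modDf a c ^ 2) ^ 2 := by ring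
  rw [actionDf, areaDn_eq_integral hk2, dfAct, dfChar, dfLambda, hk4, hr, hy, hm, dfAbs, hsn]
  generalize dfSinSq (2 / a) (landen (modDf a c) ^ 2) = w at *
  generalize landen (modDf a c) = t at *
  generalize jacSn (etaDf a c) (modDf a c) = s at *
  generalize jacCn (etaDf a c) (modDf a c) = x at *
  have hmw : 0 < 1 - t ^ 2 * w := by
    have : t ^ 2 * w < 1 := by nlinarith [mul_pos ht0 hw0, mul_pos ht0 ht1]
    linarith
  have htw : 0 < 1 + t * w := by positivity
  have hp0 : 0 < 1 + t ^ 2 := by positivity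
  have hq0 := Real.sqrt_pos.2 hp0
  have hq2 := Real.sq_sqrt hp0.le
  have hn : 0 < 1 + t ^ 2 * w ^ 2 := by positivity
  -- the half-angle substitution in the integral
  have hint : (∫ θ in (0 : ℝ)..(Real.pi / 2), Real.sin θ ^ 2 * (1 - Real.sin θ ^ 2)
        * (1 - 4 * t / (1 + t) ^ 2 * ((1 + t) ^ 2 * w / (1 + t * w) ^ 2) * Real.sin θ ^ 2)⁻¹
        / √(1 - 4 * t / (1 + t) ^ 2 * Real.sin θ ^ 2))
      = (1 + t * w) ^ 2 * (1 + t) / (8 * (1 + t ^ 2 * w ^ 2) * √(1 + t ^ 2))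
        * dfIntegral (2 * t / (1 + t ^ 2)) (w * (1 + t ^ 2) / (1 + t ^ 2 * w ^ 2)) := by
    have h := intervalIntegral.integral_comp_div (a := 0) (b := Real.pi) (c := 2) (fun θ =>
      Real.sin θ ^ 2 * (1 - Real.sin θ ^ 2)
        * (1 - 4 * t / (1 + t) ^ 2 * ((1 + t) ^ 2 * w / (1 + t * w) ^ 2) * Real.sin θ ^ 2)⁻¹
        / √(1 - 4 * t / (1 + t) ^ 2 * Real.sin θ ^ 2)) two_ne_zero
    rw [zero_div, smul_eq_mul] at h
    rw [← mul_right_inj' (two_ne_zero (α := ℝ)), ← h, dfIntegral, ← mul_assoc,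
      ← intervalIntegral.integral_const_mul]
    congr 1
    funext ψ
    have hsin : Real.sin (ψ / 2) ^ 2 = (1 - Real.cos ψ) / 2 := by
      rw [Real.sin_sq_eq_half_sub, mul_div_cancel₀ _ two_ne_zero]; ring
    rw [hsin, Real.sin_sq ψ]
    have hc1 := Real.neg_one_le_cos ψ
    have hc2 := Real.cos_le_one ψ
    have e1 : 1 - 4 * t / (1 + t) ^ 2 * ((1 - Real.cos ψ) / 2)
        = (1 + t ^ 2) / (1 + t) ^ 2 * (1 - 2 * t / (1 + t ^ 2) * -Real.cos ψ) := by
      field_simp; ring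
    have e2 : 1 - 4 * t / (1 + t) ^ 2 * ((1 + t) ^ 2 * w / (1 + t * w) ^ 2)
          * ((1 - Real.cos ψ) / 2)
        = (1 + t ^ 2 * w ^ 2) / (1 + t * w) ^ 2 * (1 - w * (1 + t ^ 2) / (1 + t ^ 2 * w ^ 2)
          * (2 * t / (1 + t ^ 2) * -Real.cos ψ)) := by
      field_simp; ring
    rw [e1, e2, Real.sqrt_mul (by positivity), Real.sqrt_div hp0.le, Real.sqrt_sq (by linarith)]
    generalize √(1 - 2 * t / (1 + t ^ 2) * -Real.cos ψ) = q
    generalize 1 - w * (1 + t ^ 2) / (1 + t ^ 2 * w ^ 2)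
          * (2 * t / (1 + t ^ 2) * -Real.cos ψ) = d
    field_simp
    ring
  have hR : s / x = (1 + t) * √(w / ((1 - w) * (1 - t ^ 2 * w))) := by
    refine (sq_eq_sq₀ (by positivity) (by positivity)).1 ?_
    rw [div_pow, mul_pow, Real.sq_sqrt (by positivity), hx2, hsn]
    have e : 1 - (1 + t) ^ 2 * w / (1 + t * w) ^ 2
        = (1 - w) * (1 - t ^ 2 * w) / (1 + t * w) ^ 2 := by field_simp; ring
    rw [e]
    field_simp
  have hg : w * (1 + t ^ 2) / (1 + t ^ 2 * w ^ 2) / (1 - w * (1 + t ^ 2) / (1 + t ^ 2 * w ^ 2))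
      = (1 + t ^ 2) * (w / ((1 - w) * (1 - t ^ 2 * w))) := by
    have e : 1 - w * (1 + t ^ 2) / (1 + t ^ 2 * w ^ 2)
        = (1 - w) * (1 - t ^ 2 * w) / (1 + t ^ 2 * w ^ 2) := by field_simp; ring
    rw [e]
    field_simp
  rw [hint, hg, Real.sqrt_mul hp0.le]
  -- `x ^ 2 (s / x) = s x`, where `x ^ 2 = 1 - s ^ 2`
  have hsx : s * x = x ^ 2 * (s / x) := by field_simp
  have e : 1 - (1 + t) ^ 2 * w / (1 + t * w) ^ 2
      = (1 - w) * (1 - t ^ 2 * w) / (1 + t * w) ^ 2 := by field_simp; ring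
  rw [hsx, hR, hx2, hsn, e]
  generalize dfIntegral (2 * t / (1 + t ^ 2)) (w * (1 + t ^ 2) / (1 + t ^ 2 * w ^ 2)) = I
  generalize √(w / ((1 - w) * (1 - t ^ 2 * w))) = R
  generalize √(1 + t ^ 2) = q at *
  rw [show 1 - t ^ 2 = (1 - t) * (1 + t) by ring]
  field_simp
  rw [hq2]
  ring

end

/-! ### The series of the Duffing regime -/

theorem tendsto_sq_zero : Tendsto (fun t : ℝ => t ^ 2) (𝓝 0) (𝓝 0) := by
  simpa using (tendsto_id_zero).pow 2

/-- Conversion of an expansion in `t ^ 2` to one in `M = 4 t / (1 + t) ^ 2`, the square of the modulus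
before Landen's transformation. Evenness in `t` determines the coefficients of the odd powers of `M`
from those of the even ones: after normalization those of `M ^ 2` to `M ^ 5` are `1, 1, A, 2 A - 1`. -/
theorem isBigO_landen_series {f : ℝ → ℝ} {c₀ C A e₃ e₄ : ℝ}
    (h : TaylorExp (𝓝 0) (fun t => t ^ 2) f c₀ (16 * C) (C * (16 * (16 * A - 14))) e₃ e₄) :
    (fun t => f t - (c₀ + C * ((4 * t / (1 + t) ^ 2) ^ 2 + (4 * t / (1 + t) ^ 2) ^ 3
      + A * (4 * t / (1 + t) ^ 2) ^ 4 + (2 * A - 1) * (4 * t / (1 + t) ^ 2) ^ 5))) =O[𝓝 0]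
      fun t => t ^ 6 := by
  have h1 : TaylorExp (𝓝 0) (fun t : ℝ => t ^ 2) (fun t => f t - (c₀ + 16 * C * t ^ 2
      + C * (16 * (16 * A - 14)) * (t ^ 2) ^ 2)) 0 0 0 e₃ e₄ :=
    (h.sub (g := fun t => c₀ + 16 * C * t ^ 2 + C * (16 * (16 * A - 14)) * (t ^ 2) ^ 2)
      (d₀ := c₀) (d₁ := 16 * C) (d₂ := C * (16 * (16 * A - 14))) (d₃ := 0) (d₄ := 0)
      (.of_eq fun t => by ring)).congr_coeff (by ring) (by ring) (by ring) (by ring) (by ring)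
  have h2 : (fun t => f t - (c₀ + 16 * C * t ^ 2 + C * (16 * (16 * A - 14)) * (t ^ 2) ^ 2))
      =O[𝓝 0] fun t => t ^ 6 := (h1.isBigO_three tendsto_sq_zero).congr_right fun t => by ring
  -- `t ^ 6 * Q t` is the difference between the polynomial in `t ^ 2` and the one in `M`
  let Q : ℝ → ℝ := fun t => C * ((-7216 + 11264 * A) + (-23008 + 30720 * A) * t
    + (-43696 + 53760 * A) * t ^ 2 + (-54528 + 64512 * A) * t ^ 3 + (-46320 + 53760 * A) * t ^ 4
    + (-26720 + 30720 * A) * t ^ 5 + (-10064 + 11520 * A) * t ^ 6 + (-2240 + 2560 * A) * t ^ 7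
    + (-224 + 256 * A) * t ^ 8) / (1 + t) ^ 10
  have hQ : ContinuousAt Q 0 := by
    refine ContinuousAt.div (by fun_prop) (by fun_prop) (by norm_num)
  have h3 := (isBigO_refl (fun t : ℝ => t ^ 6) (𝓝 0)).mul (hQ.tendsto.isBigO_one ℝ)
  simp only [mul_one] at h3
  have hne : ∀ᶠ t : ℝ in 𝓝 0, 1 + t ≠ 0 := by
    have : ContinuousAt (fun t : ℝ => 1 + t) 0 := by fun_prop
    exact this.eventually_ne (by norm_num)
  refine (h2.add h3).congr' ?_ .rfl
  filter_upwards [hne] with t ht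
  simp only [Q]
  field_simp
  ring

section

variable {a b q : ℝ} (hb : b ∈ Ioo 0 1) (ha : a = 2 / b) (hq : q = √((1 - b) / b))
include hb ha hq

/-- The constants of the series in terms of `b = 2 / a` and `q = √((1 - b) / b)`. -/
theorem df_const_spec : 0 < q ∧ q ^ 2 = (1 - b) / b ∧ √(a - 2) = √2 * q ∧
    (2 : ℝ) ^ (-(3 : ℝ) / 2) / √(a - 2) = 1 / (4 * q) ∧
    (2 : ℝ) ^ (-(3 : ℝ) / 2) / (a * (a - 2) ^ ((3 : ℝ) / 2)) = b / (16 * q ^ 3) ∧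
    (2 : ℝ) ^ ((7 : ℝ) / 2) * (a - 2) ^ ((5 : ℝ) / 2) = 64 * q ^ 5 ∧
    (a - 2) ^ ((3 : ℝ) / 2) / (2 ^ 4 * √2 * a) = q ^ 3 * b / 16 ∧
    √(a - 2) / (2 ^ 4 * √2 * a ^ 2) = q * b ^ 2 / 64 := by
  have hb0 := hb.1
  have hb1 : 0 < 1 - b := sub_pos.2 hb.2
  have h0 : 0 < (1 - b) / b := by positivity
  have hq2 : q ^ 2 = (1 - b) / b := by rw [hq, Real.sq_sqrt h0.le]
  have hq0 : 0 < q := hq ▸ Real.sqrt_pos.2 h0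
  have ha2 : a - 2 = 2 * ((1 - b) / b) := by rw [ha]; field_simp
  have hs : √(a - 2) = √2 * q := by rw [ha2, Real.sqrt_mul zero_le_two, hq]
  have hp : 0 ≤ a - 2 := by rw [ha2]; positivity
  have h2 : √2 ^ 2 = (2 : ℝ) := Real.sq_sqrt zero_le_two
  have h20 : 0 < √(2 : ℝ) := Real.sqrt_pos.2 two_pos
  have e1 : (2 : ℝ) ^ (-(3 : ℝ) / 2) = (√2 ^ 3)⁻¹ := by
    rw [neg_div, Real.rpow_neg zero_le_two, rpow_three_halves zero_le_two]
  have e2 : (2 : ℝ) ^ ((7 : ℝ) / 2) = √2 ^ 7 := by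
    rw [Real.sqrt_eq_rpow, ← Real.rpow_natCast, ← Real.rpow_mul zero_le_two]; norm_num
  have p3 : √2 ^ 3 = 2 * √2 := by rw [pow_succ, h2]
  have p4 : √2 ^ 4 = (4 : ℝ) := by rw [show √2 ^ 4 = (√2 ^ 2) ^ 2 by ring, h2]; norm_num
  have p6 : √2 ^ 6 = (8 : ℝ) := by rw [show √2 ^ 6 = (√2 ^ 2) ^ 3 by ring, h2]; norm_num
  have p12 : √2 ^ 12 = (64 : ℝ) := by rw [show √2 ^ 12 = (√2 ^ 2) ^ 6 by ring, h2]; norm_num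
  refine ⟨hq0, hq2, hs, ?_, ?_, ?_, ?_, ?_⟩
  · rw [e1, hs, ← p4]; field_simp
  · rw [e1, rpow_three_halves hp, hs, ha, ← div_div, div_eq_div_iff (by positivity) (by positivity)]
    field_simp
    rw [p6]; norm_num
  · rw [e2, rpow_five_halves hp, hs, ← p12]; ring
  · rw [rpow_three_halves hp, hs, mul_pow, p3, ha]; field_simp; norm_num
  · rw [hs, ha]; field_simp; norm_num

omit hq in
theorem nuZeroDf_eq : nuZeroDf a = 1 / (2 * Real.pi) * Real.arccos (2 * b - 1) := by
  have hb0 := hb.1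
  rw [nuZeroDf, ha]
  congr 3
  field_simp
  norm_num

theorem taylorExp_dfNu_sq : ∃ e, TaylorExp (𝓝 0) (fun t => t ^ 2) (fun t => dfNu b (t ^ 2))
    (nuZeroDf a) (2 / Real.pi * (q * b) * (-1 / 8 - 1 / 4 * b))
    (2 / Real.pi * (q * b) * (-11 / 128 - 17 / 64 * b + 3 / 16 * b ^ 2 + 3 / 8 * b ^ 3))
    (2 / Real.pi * (q * b) * (-35 / 512 - 217 / 768 * b + 19 / 48 * b ^ 2 + b ^ 3 - 5 / 12 * b ^ 4
      - 5 / 6 * b ^ 5)) e := by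
  obtain ⟨e, h⟩ := taylorExp_dfNu hb rfl
  rw [nuZeroDf_eq hb ha, hq]
  exact ⟨e, h.comp_tendsto tendsto_sq_zero⟩

theorem dfAct_sub_modulus_series : (fun t => dfAct b t - (a - 2) ^ ((3 : ℝ) / 2) / (2 ^ 4 * √2 * a)
    * ((4 * t / (1 + t) ^ 2) ^ 2 + (4 * t / (1 + t) ^ 2) ^ 3
      + (119 / 8 - (4 + 3 * a) / a ^ 2) * ((4 * t / (1 + t) ^ 2) ^ 4 / 2 ^ 4)
      + (55 / 8 - (4 + 3 * a) / a ^ 2) * ((4 * t / (1 + t) ^ 2) ^ 5 / 2 ^ 3))) =O[𝓝 0]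
    fun t => t ^ 6 := by
  have hb0 := hb.1
  obtain ⟨hq0, hq2, -, -, -, -, hc, -⟩ := df_const_spec hb ha hq
  have hq3 : q ^ 3 = q * ((1 - b) / b) := by rw [← hq2]; ring
  have h := taylorExp_dfAct hb rfl
  rw [← hq] at h
  refine (isBigO_landen_series (c₀ := 0) (C := q ^ 3 * b / 16)
    (A := (119 / 8 - (4 + 3 * a) / a ^ 2) / 16)
    (h.congr_coeff rfl ?_ ?_ rfl rfl)).congr_left fun t => ?_
  · rw [hq3]; field_simp
  · rw [hq3, ha]; field_simp; ring
  · rw [hc]; ring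

theorem dfNu_sub_modulus_series : (fun t => dfNu b (t ^ 2)
    - (nuZeroDf a - 1 / (2 * Real.pi) * (√(a - 2) / (2 ^ 4 * √2 * a ^ 2))
    * ((4 + a) * ((4 * t / (1 + t) ^ 2) ^ 2 + (4 * t / (1 + t) ^ 2) ^ 3)
      - (384 + 96 * a - 964 * a ^ 2 - 235 * a ^ 3) / (2 ^ 8 * a ^ 2) * (4 * t / (1 + t) ^ 2) ^ 4
      - (384 + 96 * a - 452 * a ^ 2 - 107 * a ^ 3) / (2 ^ 7 * a ^ 2) * (4 * t / (1 + t) ^ 2) ^ 5)))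
    =O[𝓝 0] fun t => t ^ 6 := by
  have hb0 := hb.1
  obtain ⟨hq0, hq2, -, -, -, -, -, hc⟩ := df_const_spec hb ha hq
  obtain ⟨e, h⟩ := taylorExp_dfNu_sq hb ha hq
  have ha4 : 0 < 4 + a := by rw [ha]; positivity
  have ha0 : 0 < a := by rw [ha]; positivity
  refine (isBigO_landen_series (c₀ := nuZeroDf a)
    (C := -(1 / (2 * Real.pi)) * (q * b ^ 2 / 64) * (4 + a))
    (A := -((384 + 96 * a - 964 * a ^ 2 - 235 * a ^ 3) / (2 ^ 8 * a ^ 2 * (4 + a))))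
    (h.congr_coeff rfl ?_ ?_ rfl rfl)).congr_left fun t => ?_
  · rw [ha]; field_simp; ring
  · have e : (-(1 / (2 * Real.pi)) * (q * b ^ 2 / 64) * (4 + a)) * (16 * (16 *
        -((384 + 96 * a - 964 * a ^ 2 - 235 * a ^ 3) / (2 ^ 8 * a ^ 2 * (4 + a))) - 14))
        = (1 / (2 * Real.pi)) * (q * b ^ 2 / 64) * ((384 + 96 * a - 964 * a ^ 2 - 235 * a ^ 3)
          / a ^ 2 + 224 * (4 + a)) := by
      field_simp; ring
    rw [e, ha]; field_simp; ring
  · rw [hc]; field_simp; ring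

omit ha hq in
theorem taylorExp_dfLevel_sq : TaylorExp (𝓝 0) (fun t => t ^ 2) (fun t => dfLevel b (t ^ 2)) 0
    (((1 - b) / b) ^ 2 * (4 * b)) (((1 - b) / b) ^ 2 * (4 * b - 8 * b ^ 2 - 4 * b ^ 3))
    (((1 - b) / b) ^ 2 * (4 * b - 16 * b ^ 2 + 16 * b ^ 4 + 8 * b ^ 5))
    (((1 - b) / b) ^ 2 * (4 * b - 24 * b ^ 2 + 12 * b ^ 3 + 48 * b ^ 4 + 4 * b ^ 5 - 40 * b ^ 6
      - 20 * b ^ 7)) := (taylorExp_dfLevel hb).comp_tendsto tendsto_sq_zero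

omit ha hq in
theorem sq_isBigO_dfLevel : (fun t : ℝ => t ^ 2) =O[𝓝 0] fun t => dfLevel b (t ^ 2) :=
  (taylorExp_dfLevel_sq hb).var_isBigO tendsto_sq_zero (by
    have := hb.1
    have : 0 < 1 - b := sub_pos.2 hb.2
    positivity)

theorem dfAct_sub_invariant_series : (fun t => dfAct b t - serJDnInv a (dfLevel b (t ^ 2))) =O[𝓝 0]
    fun t => dfLevel b (t ^ 2) ^ 5 := by
  have hb0 := hb.1
  have hb1 : 0 < 1 - b := sub_pos.2 hb.2
  obtain ⟨hq0, hq2, -, hc, -⟩ := df_const_spec hb ha hq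
  refine IsBigO.trans ?_ ((sq_isBigO_dfLevel hb).pow 5)
  have hser : TaylorExp (𝓝 0) (fun t => dfLevel b (t ^ 2))
      (fun t => serJDnInv a (dfLevel b (t ^ 2))) 0 (1 / (4 * q))
      (1 / (4 * q) * ((8 - a) / (2 ^ 4 * (a - 2) ^ 2)))
      (1 / (4 * q) * ((192 - 32 * a + 3 * a ^ 2) / (2 ^ 8 * (a - 2) ^ 4)))
      (1 / (4 * q) * ((12800 - 5 * (480 - 72 * a + 5 * a ^ 2) * a) / (2 ^ 13 * (a - 2) ^ 6))) :=
    .of_eq fun m => by rw [serJDnInv, hc]; ring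
  have hs : q * (1 - b) = 1 / q * ((1 - b) ^ 2 / b) := by
    rw [one_div_mul_eq_div, eq_div_iff hq0.ne']
    linear_combination (1 - b) * hq2
  have ha2 : a - 2 = 2 * (1 - b) / b := by rw [ha]; field_simp
  refine (taylorExp_dfAct hb rfl).isBigO_sub
    (((taylorExp_dfLevel_sq hb).subst tendsto_sq_zero hser).congr_coeff rfl ?_ ?_ ?_ ?_)
  all_goals
    rw [← hq, hs]
    try rw [ha2, ha]
    field_simp
    try ring

theorem dfNu_sub_invariant_series :
    (fun t => dfNu b (t ^ 2) - serNuDnInv a (dfLevel b (t ^ 2))) =O[𝓝 0]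
    fun t => dfLevel b (t ^ 2) ^ 4 := by
  have hb0 := hb.1
  have hb1 : 0 < 1 - b := sub_pos.2 hb.2
  obtain ⟨hq0, hq2, -, -, hc, -⟩ := df_const_spec hb ha hq
  obtain ⟨e, h⟩ := taylorExp_dfNu_sq hb ha hq
  refine IsBigO.trans ?_ ((sq_isBigO_dfLevel hb).pow 4)
  have hser : TaylorExp (𝓝 0) (fun t => dfLevel b (t ^ 2))
      (fun t => serNuDnInv a (dfLevel b (t ^ 2))) (nuZeroDf a)
      (-(1 / (2 * Real.pi) * (b / (16 * q ^ 3))) * (4 + a))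
      (-(1 / (2 * Real.pi) * (b / (16 * q ^ 3)))
        * (-((128 - 224 * a - 68 * a ^ 2 + 5 * a ^ 3) / (2 ^ 5 * a * (a - 2) ^ 2))))
      (-(1 / (2 * Real.pi) * (b / (16 * q ^ 3)))
        * ((4096 - 11264 * a + 12672 * a ^ 2 + 4384 * a ^ 3 - 476 * a ^ 4 + 33 * a ^ 5)
          / (3 * 2 ^ 8 * a ^ 2 * (a - 2) ^ 4))) 0 :=
    .of_eq fun m => by rw [serNuDnInv, hc]; ring
  have hs : q * b = 1 / q ^ 3 * ((1 - b) ^ 2 / b) := by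
    rw [one_div_mul_eq_div, eq_div_iff (by positivity)]
    calc q * b * q ^ 3 = b * (q ^ 2) ^ 2 := by ring
      _ = _ := by rw [hq2]; field_simp
  have ha2 : a - 2 = 2 * (1 - b) / b := by rw [ha]; field_simp
  refine (h.sub ((taylorExp_dfLevel_sq hb).subst tendsto_sq_zero hser) |>.congr_coeff
    (sub_self _) ?_ ?_ ?_ rfl).isBigO_four tendsto_sq_zero
  all_goals
    rw [hs]
    try rw [ha2]
    rw [ha]
    field_simp
    try ring

theorem dfNu_sub_action_series : (fun t => dfNu b (t ^ 2) - serNuDnAct a (dfAct b t)) =O[𝓝 0]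
    fun t => dfAct b t ^ 3 := by
  have hb0 := hb.1
  have hb1 : 0 < 1 - b := sub_pos.2 hb.2
  obtain ⟨hq0, hq2, -, -, -, hc, -⟩ := df_const_spec hb ha hq
  obtain ⟨e, h⟩ := taylorExp_dfNu_sq hb ha hq
  have hJ := taylorExp_dfAct hb rfl
  rw [← hq] at hJ
  refine IsBigO.trans ?_ ((hJ.var_isBigO tendsto_sq_zero (by positivity)).pow 3)
  have hser : TaylorExp (𝓝 0) (dfAct b) (fun t => serNuDnAct a (dfAct b t)) (nuZeroDf a)
      (-(1 / (2 * Real.pi)) * (1 / a * ((4 + a) / (a - 2))))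
      (-(1 / (2 * Real.pi)) * (-(1 / a ^ 2 * ((128 - 160 * a - 60 * a ^ 2 + 3 * a ^ 3)
        / (64 * q ^ 5))))) 0 0 :=
    .of_eq fun m => by rw [serNuDnAct, hc]; ring
  have ha2 : a - 2 = 2 * q ^ 2 := by rw [hq2, ha]; field_simp
  have hb' : b = 1 / (1 + q ^ 2) := by rw [hq2]; field_simp; ring
  have ha' : a = 2 * (1 + q ^ 2) := by linarith
  refine (h.sub (hJ.subst tendsto_sq_zero hser) |>.congr_coeff
    (sub_self _) ?_ ?_ rfl rfl).isBigO_three tendsto_sq_zero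
  all_goals
    try rw [ha2]
    rw [ha', hb']
    field_simp
    try ring

end

/-- Along `c ↓ -(a / 2 - 1)²` the parameter `t = landen k` tends to zero and is of the order of
`k²`, so the expansions in `t` give those in the modulus, in the shifted invariant and in the
action. -/
theorem series_Df {a : ℝ} (ha : 2 < a) :
    (fun c => actionDf a c - serJDnMod a (modDf a c)) =O[𝓝[>] (-(a / 2 - 1) ^ 2)]
      (fun c => modDf a c ^ 12) ∧
    (fun c => actionDf a c - serJDnInv a (c + (a / 2 - 1) ^ 2)) =O[𝓝[>] (-(a / 2 - 1) ^ 2)]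
      (fun c => (c + (a / 2 - 1) ^ 2) ^ 5) ∧
    (fun c => rotationDf a c - serNuDnMod a (modDf a c)) =O[𝓝[>] (-(a / 2 - 1) ^ 2)]
      (fun c => modDf a c ^ 12) ∧
    (fun c => rotationDf a c - serNuDnInv a (c + (a / 2 - 1) ^ 2)) =O[𝓝[>] (-(a / 2 - 1) ^ 2)]
      (fun c => (c + (a / 2 - 1) ^ 2) ^ 4) ∧
    (fun c => rotationDf a c - serNuDnAct a (actionDf a c)) =O[𝓝[>] (-(a / 2 - 1) ^ 2)]
      (fun c => actionDf a c ^ 3) := by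
  have ha0 : 0 < a := by linarith
  have habs : 2 < |a| := by rwa [abs_of_pos ha0]
  have habs2 : |a / 2| = a / 2 := abs_of_pos (by positivity)
  have hb : 2 / a ∈ Ioo 0 1 := ⟨by positivity, (div_lt_one ha0).2 ha⟩
  have hab : a = 2 / (2 / a) := by field_simp
  have hT := modDf_tendsto habs
  have hev := eventually_mem_range_Df habs
  rw [habs2] at hT hev
  have hland : Tendsto landen (𝓝 0) (𝓝 0) := by
    have h1 : ContinuousAt landen 0 := by
      unfold landen compModulus
      exact ContinuousAt.div (by fun_prop) (by fun_prop) (by norm_num)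
    simpa [landen, compModulus] using h1.tendsto
  have T := hland.comp (hT.mono_right nhdsWithin_le_nhds)
  have hsp := (tendsto_sq_zero.comp T).eventually (dfSinSq_mem hb)
  have hrange : ∀ {c}, c ∈ Ioo (-(a / 2 - 1) ^ 2) 0 → c ∈ Ioo (-(|a / 2| - 1) ^ 2) 0 :=
    fun h => by rwa [habs2]
  have hJ : ∀ᶠ c in 𝓝[>] (-(a / 2 - 1) ^ 2), dfAct (2 / a) (landen (modDf a c)) = actionDf a c := by
    filter_upwards [hev, hsp] with c hc ⟨_, hw, hrel, _⟩
    exact (actionDf_eq_dfAct ha (hrange hc) hw hrel).symm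
  have hν : ∀ᶠ c in 𝓝[>] (-(a / 2 - 1) ^ 2),
      dfNu (2 / a) (landen (modDf a c) ^ 2) = rotationDf a c := by
    filter_upwards [hev, hsp] with c hc ⟨_, hw, hrel, _⟩
    exact (rotationDf_eq_dfNu ha (hrange hc) hw hrel).symm
  have hC : ∀ᶠ c in 𝓝[>] (-(a / 2 - 1) ^ 2),
      dfLevel (2 / a) (landen (modDf a c) ^ 2) = c + (a / 2 - 1) ^ 2 := by
    filter_upwards [hev, hsp] with c hc ⟨_, hw, hrel, _⟩
    rw [dfLevel, ← (phaseDf_landen ha (hrange hc) hw hrel).1, Real.sq_sqrt (abs_nonneg c),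
      abs_of_neg hc.2]
    field_simp
    ring
  have hM : ∀ᶠ c in 𝓝[>] (-(a / 2 - 1) ^ 2), 4 * landen (modDf a c)
      / (1 + landen (modDf a c)) ^ 2 = modDf a c ^ 2 := by
    filter_upwards [hev] with c hc
    exact (landen_spec (modDf_spec habs (hrange hc)).1).2.2.symm
  have hO : (fun c => landen (modDf a c) ^ 6) =O[𝓝[>] (-(a / 2 - 1) ^ 2)]
      fun c => modDf a c ^ 12 := by
    refine IsBigO.of_bound 1 ?_
    filter_upwards [hev] with c hc
    obtain ⟨⟨h0, h1⟩, -, h2⟩ := landen_spec (modDf_spec habs (hrange hc)).1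
    have h3 : landen (modDf a c) ≤ modDf a c ^ 2 := by
      have h4 : (1 + landen (modDf a c)) ^ 2 ≤ 2 ^ 2 := by gcongr; linarith
      rw [h2, le_div_iff₀ (by positivity)]
      nlinarith
    rw [one_mul, Real.norm_of_nonneg (by positivity), Real.norm_of_nonneg (by positivity),
      show modDf a c ^ 12 = (modDf a c ^ 2) ^ 6 by ring]
    gcongr
  refine ⟨?_, ?_, ?_, ?_, ?_⟩
  · refine IsBigO.trans (((dfAct_sub_modulus_series hb hab rfl).comp_tendsto T).congr' ?_ .rfl) hO
    filter_upwards [hJ, hM] with c h1 h2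
    simp only [Function.comp, h1, h2, serJDnMod]; ring
  · refine ((dfAct_sub_invariant_series hb hab rfl).comp_tendsto T).congr' ?_ ?_
    · filter_upwards [hJ, hC] with c h1 h2
      simp only [Function.comp, h1, h2]
    · filter_upwards [hC] with c h2
      simp only [Function.comp, h2]
  · refine IsBigO.trans (((dfNu_sub_modulus_series hb hab rfl).comp_tendsto T).congr' ?_ .rfl) hO
    filter_upwards [hν, hM] with c h1 h2
    simp only [Function.comp, h1, h2, serNuDnMod]; ring
  · refine ((dfNu_sub_invariant_series hb hab rfl).comp_tendsto T).congr' ?_ ?_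
    · filter_upwards [hν, hC] with c h1 h2
      simp only [Function.comp, h1, h2]
    · filter_upwards [hC] with c h2
      simp only [Function.comp, h2]
  · refine ((dfNu_sub_action_series hb hab rfl).comp_tendsto T).congr' ?_ ?_
    · filter_upwards [hν, hJ] with c h1 h2
      simp only [Function.comp, h1, h2]
    · filter_upwards [hJ] with c h2
      simp only [Function.comp, h2]

end

theorem mainTheorem5 :
    -- areas of the elliptic Lissajous curves
    (∀ k η : ℝ, 0 < k → k < 1 → jacSn η k ≠ 0 →
      areaSn k η = 4 / k ^ 2 *
        ((jacSd η k ^ 2 * ellE k - ellK k + jacCn η k ^ 2 * ellPi (k ^ 2 * jacSn η k ^ 2) k)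
          / (jacSn η k * jacSd η k ^ 2)) ∧
      areaCn k η = 4 / k ^ 2 *
        ((ellK k - jacSn η k ^ 2 * ellE k - jacCn η k ^ 2 * ellPi (k ^ 2 * jacSn η k ^ 2) k)
          / (jacSd η k * jacSn η k ^ 2)) ∧
      areaDn k η = 2 / (jacSc η k * jacSn η k ^ 2) *
        ((jacSn η k ^ 2 + jacDn η k ^ 2) * ellK k - jacSn η k ^ 2 * ellE k
          - jacDn η k ^ 2 * ellPi (k ^ 2 * jacSn η k ^ 2) k)) ∧
    -- defocusing octupole (DO), elliptic sine
    (∀ a : ℝ, |a| < 2 → ∃ J ν : ℝ → ℝ,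
      (∀ c ∈ Ioo 0 ((|a / 2| - 1) ^ 2), ∀ k ηp η : ℝ,
        k = modDO a c → ηp = etaDO a c → η = phase a k ηp →
        HasAction (-1) a (curveDO a c) (J c) ∧
        HasRotationNumber (-1) a (curveDO a c) (ν c) ∧
        k ∈ Ioo 0 1 ∧
        (ηp ∈ Ioc 0 (ellK k) ∧ jacNs ηp k = √k / c ^ ((1 : ℝ) / 4)) ∧
        curveDO a c = range (fun u =>
          (c ^ ((1 : ℝ) / 4) * √k * jacSn u k, c ^ ((1 : ℝ) / 4) * √k * jacSn (u + η) k)) ∧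
        J c = √|c| / (2 * Real.pi) * (k * areaSn k η) ∧
        J c = 2 / Real.pi *
          ((jacSd ηp k ^ 2 * ellE k - ellK k + jacCn ηp k ^ 2 * ellPi (k ^ 2 * jacSn ηp k ^ 2) k)
            / (jacSd ηp k * jacNd ηp k)) ∧
        ν c = η / (4 * ellK k)) ∧
      BijOn (modDO a) (Ioo 0 ((|a / 2| - 1) ^ 2)) (Ioo 0 1) ∧
      Tendsto (modDO a) (𝓝[>] 0) (𝓝[>] 0) ∧
      (fun c => J c - serJSnMod a (modDO a c)) =O[𝓝[>] 0] (fun c => modDO a c ^ 10) ∧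
      (fun c => J c - serJInv 1 a c) =O[𝓝[>] 0] (fun c => c ^ 5) ∧
      (fun c => ν c - serNuSnMod a (modDO a c)) =O[𝓝[>] 0] (fun c => modDO a c ^ 10) ∧
      (fun c => ν c - serNuInv 1 a c) =O[𝓝[>] 0] (fun c => c ^ 5) ∧
      (fun c => ν c - serNuAct 1 a (J c)) =O[𝓝[>] 0] (fun c => J c ^ 4)) ∧
    -- focusing octupole (FO), elliptic cosine
    (∀ a : ℝ, ∃ J ν : ℝ → ℝ,
      (∀ c ∈ Ioi (0 : ℝ), ∀ k ηp η : ℝ,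
        k = modFO a c → ηp = etaFO a c → η = phase a k ηp →
        HasAction 1 a (curveFO a c) (J c) ∧
        HasRotationNumber 1 a (curveFO a c) (ν c) ∧
        k ∈ Ioo 0 1 ∧
        (ηp ∈ Ioc 0 (ellK k) ∧
          jacDs ηp k = √(k * compModulus k) / c ^ ((1 : ℝ) / 4)) ∧
        curveFO a c = range (fun u =>
          (c ^ ((1 : ℝ) / 4) * √(k / compModulus k) * jacCn u k,
            c ^ ((1 : ℝ) / 4) * √(k / compModulus k) * jacCn (u + η) k)) ∧
        J c = √|c| / (2 * Real.pi) * (k / compModulus k * areaCn k η) ∧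
        J c = 2 / Real.pi *
          ((ellK k - jacSn ηp k ^ 2 * ellE k - jacCn ηp k ^ 2 * ellPi (k ^ 2 * jacSn ηp k ^ 2) k)
            / (jacSn ηp k * jacDn ηp k)) ∧
        ν c = η / (4 * ellK k)) ∧
      (|a| < 2 →
        BijOn (modFO a) (Ioi 0) (Ioo 0 1) ∧
        Tendsto (modFO a) (𝓝[>] 0) (𝓝[>] 0) ∧
        (fun c => J c - serJCnMod a (modFO a c)) =O[𝓝[>] 0] (fun c => modFO a c ^ 10) ∧
        (fun c => J c - serJInv (-1) a c) =O[𝓝[>] 0] (fun c => c ^ 5) ∧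
        (fun c => ν c - serNuCnMod a (modFO a c)) =O[𝓝[>] 0] (fun c => modFO a c ^ 10) ∧
        (fun c => ν c - serNuInv (-1) a c) =O[𝓝[>] 0] (fun c => c ^ 5) ∧
        (fun c => ν c - serNuAct (-1) a (J c)) =O[𝓝[>] 0] (fun c => J c ^ 4))) ∧
    -- Duffing regime (Df), delta amplitude
    (∀ a : ℝ, 2 < |a| → ∃ J ν : ℝ → ℝ,
      (∀ c ∈ Ioo (-(|a / 2| - 1) ^ 2) 0, ∀ k ηp : ℝ,
        k = modDf a c → ηp = etaDf a c →
        (∀ s : ℝ, s = 1 ∨ s = -1 →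
          HasAction 1 a (curveDf a s c) (J c) ∧
          (2 < a → HasRotationNumber 1 a (curveDf a s c) (ν c)) ∧
          curveDf a s c = range (fun u =>
            (s * (|c| ^ ((1 : ℝ) / 4) * √(1 / compModulus k) * jacDn u k),
              s * (a / |a|) *
                (|c| ^ ((1 : ℝ) / 4) * √(1 / compModulus k) * jacDn (u + ηp) k)))) ∧
        k ∈ Ioo 0 1 ∧
        (ηp ∈ Ioo 0 (ellK k) ∧ jacCs ηp k = √(compModulus k) / |c| ^ ((1 : ℝ) / 4)) ∧
        J c = √|c| / (2 * Real.pi) * (1 / compModulus k * areaDn k ηp) ∧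
        J c = 1 / Real.pi *
          (((jacSn ηp k ^ 2 + jacDn ηp k ^ 2) * ellK k - jacSn ηp k ^ 2 * ellE k
            - jacDn ηp k ^ 2 * ellPi (k ^ 2 * jacSn ηp k ^ 2) k)
            / (jacSn ηp k * jacCn ηp k)) ∧
        (2 < a → ν c = ηp / (2 * ellK k))) ∧
      BijOn (modDf a) (Ioo (-(|a / 2| - 1) ^ 2) 0) (Ioo 0 1) ∧
      Tendsto (modDf a) (𝓝[>] (-(|a / 2| - 1) ^ 2)) (𝓝[>] 0) ∧
      (2 < a →
        (fun c => J c - serJDnMod a (modDf a c)) =O[𝓝[>] (-(a / 2 - 1) ^ 2)]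
          (fun c => modDf a c ^ 12) ∧
        (fun c => J c - serJDnInv a (c + (a / 2 - 1) ^ 2)) =O[𝓝[>] (-(a / 2 - 1) ^ 2)]
          (fun c => (c + (a / 2 - 1) ^ 2) ^ 5) ∧
        (fun c => ν c - serNuDnMod a (modDf a c)) =O[𝓝[>] (-(a / 2 - 1) ^ 2)]
          (fun c => modDf a c ^ 12) ∧
        (fun c => ν c - serNuDnInv a (c + (a / 2 - 1) ^ 2)) =O[𝓝[>] (-(a / 2 - 1) ^ 2)]
          (fun c => (c + (a / 2 - 1) ^ 2) ^ 4) ∧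
        (fun c => ν c - serNuDnAct a (J c)) =O[𝓝[>] (-(a / 2 - 1) ^ 2)]
          (fun c => J c ^ 3))) := by
  refine ⟨fun k η hk0 hk1 hs => ?_, fun a ha => ⟨actionDO a, rotationDO a, ?_, modDO_bijOn ha,
    modDO_tendsto ha, series_DO ha⟩, fun a => ⟨actionFO a, rotationFO a, ?_, fun ha =>
    ⟨modFO_bijOn ha, modFO_tendsto ha, series_FO ha⟩⟩, fun a ha => ⟨actionDf a, rotationDf a, ?_,
    modDf_bijOn ha, modDf_tendsto ha, fun ha2 => series_Df ha2⟩⟩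
  · have hk2 := sq_lt_one_of_mem ⟨hk0, hk1⟩
    exact ⟨areaSn_formula hk0.ne' hk2 hs, areaCn_formula hk0.ne' hk2 hs,
      areaDn_formula hk0.ne' hk2 hs⟩
  · intro c hc k ηp η hk hηp hη
    obtain ⟨h1, h2, h3, h4⟩ := curve_DO ha hc hk hηp hη
    subst hk hηp hη
    exact ⟨h1, h2, (modDO_spec ha hc).1, ⟨(etaDO_spec ha hc).1, (etaDO_spec ha hc).2.1⟩, h3, rfl,
      h4, rfl⟩
  · intro c hc k ηp η hk hηp hη
    obtain ⟨h1, h2, h3, h4⟩ := curve_FO hc hk hηp hη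
    subst hk hηp hη
    exact ⟨h1, h2, (modFO_spec hc).1, ⟨(etaFO_spec hc).1, (etaFO_spec hc).2.1⟩, h3, rfl,
      h4, rfl⟩
  · intro c hc k ηp hk hηp
    obtain ⟨h1, h2⟩ := curve_Df ha hc hk hηp
    subst hk hηp
    exact ⟨h1, (modDf_spec ha hc).1, ⟨(etaDf_spec ha hc).1, (etaDf_spec ha hc).2.1⟩, rfl,
      h2, fun _ => rfl⟩
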